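/- **Theorem 1.** The *rotate model* is a word RAM (words of $w=\Theta(\lg n)$ bits, with $w\ge\kappa_0\lg n$ for a constant $\kappa_0$; arithmetic, bitwise and shift operations on words, memory access, output to a write-only tape and pointer operations take unit time) whose input, a graph $G$ on the vertices $0,\dots,n-1$ with $m$ edges, is given by read-only circular linked adjacency lists; the only change allowed to the input is the unit-cost *rotate* operation, which advances the head of the list of a vertex to the next node. An undirected graph is given by one list of neighbours per vertex, a directed graph by a list of out-neighbours and a list of in-neighbours per vertex. Space is the number of extra bits (registers, temporary pointers, work memory). Given adjacency orders and a source $s$, DFS starts at $s$, always goes on to the first unvisited vertex in the (out-)adjacency list of the current vertex, backtracks when there is none, and, when a tree is complete, restarts at the smallest unvisited vertex; the DFS order lists the vertices by first visit. It is the *lex-DFS order* if the adjacency orders are those of the input lists (read from their initial heads), and a *general-DFS order* if it is the DFS order for some ordering of the adjacency lists. Let $G$ be a simple undirected graph, or a directed graph without parallel arcs, with $n\ge 2$ vertices and $m$ edges, and let $s$ be a vertex of $G$. In the rotate model, the vertices of $G$ can be output, by one program for undirected and one for directed graphs in each case, in (a) the lex-DFS order from $s$, in $O(m+n)$ time using $n\lg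 3+O(\lg^2 n)$ bits; (b) a general-DFS order from $s$, in $O(m+n)$ time using $n+O(\lg n)$ bits; (c) if $s$ reaches all vertices, a general-DFS order from $s$, using $O(\lg n)$ bits, in $O(m^2/n+m\ell)$ time if $G$ is undirected and in $O(m(n+\ell^2))$ time if $G$ is directed, where $\ell$ is the maximum depth of a vertex in the DFS tree of that order. The constants in the time bounds are absolute; those in the space bounds depend only on an upper bound for $w/\lg n$. -/

import Mathlib

/-! ## Depth-first search with respect to given adjacency lists

Vertices are `0, …, n-1`, i.e. the elements of `Fin n`.  `adj v` lists the (out-)neighbours of `v`. -/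

/-- `l` is an ordering of the adjacency lists of the relation `r`: for each `v`, the list `l v`
contains every `u` with `r v u` exactly once, and nothing else. -/
def IsAdjacencyOrder {n : ℕ} (r : Fin n → Fin n → Prop) (l : Fin n → List (Fin n)) : Prop :=
  ∀ v, (l v).Nodup ∧ ∀ u, u ∈ l v ↔ r v u

/-- Recursive DFS.  `T` lists the vertices visited so far, in the order of their first visit, each
with its depth in its DFS tree.  If `v` is unvisited, it is visited at depth `d`, and then its
adjacency list is scanned from front to back, each unvisited vertex met being explored recursively
at depth `d + 1`.  The first argument bounds the depth of the recursion; since the vertices on the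
recursion path are distinct, the bound `n` used below is never felt. -/
def dfsVisit {n : ℕ} (adj : Fin n → List (Fin n)) :
    ℕ → ℕ → List (Fin n × ℕ) → Fin n → List (Fin n × ℕ)
  | 0, _, T, _ => T
  | fuel + 1, d, T, v =>
      if v ∈ T.map Prod.fst then T
      else (adj v).foldl (dfsVisit adj fuel (d + 1)) (T ++ [(v, d)])

/-- The full DFS from the source `s`; when a tree is complete and some vertices are still unvisited,
the search is restarted at the unvisited vertex with the smallest number. -/
def dfsTrace {n : ℕ} (adj : Fin n → List (Fin n)) (s : Fin n) : List (Fin n × ℕ) :=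
  (s :: List.finRange n).foldl (dfsVisit adj n 0) []

/-- The vertices in DFS order with respect to `adj`: the order of the first visits. -/
def dfsOrder {n : ℕ} (adj : Fin n → List (Fin n)) (s : Fin n) : List (Fin n) :=
  (dfsTrace adj s).map Prod.fst

/-- The maximum depth of a vertex in the DFS tree (forest) with respect to `adj`. -/
def dfsDepth {n : ℕ} (adj : Fin n → List (Fin n)) (s : Fin n) : ℕ :=
  ((dfsTrace adj s).map Prod.snd).foldr max 0

/-! ## The rotate model: a word RAM with circular adjacency lists whose heads may be advanced -/

namespace Rotate

/-- Arithmetic, bitwise and shift operations on words. -/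
inductive BinOp
  | add | sub | mul | div | mod | and | or | xor | shl | shr

/-- The value of an operation, before reduction to a `w`-bit word. -/
def BinOp.eval (w : ℕ) : BinOp → ℕ → ℕ → ℕ
  | add, a, b => a + b
  | sub, a, b => a + 2 ^ w - b
  | mul, a, b => a * b
  | div, a, b => a / b
  | mod, a, b => a % b
  | and, a, b => a &&& b
  | or, a, b => a ||| b
  | xor, a, b => a ^^^ b
  | shl, a, b => a <<< b
  | shr, a, b => a >>> b

/-- Instructions of a machine with `K` word registers and `k` cursors (temporary pointers to nodes
of adjacency lists), on an input with `h` families of circular adjacency lists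
(`h = 1` for undirected graphs; `h = 2`, out- and in-neighbour lists, for directed graphs). -/
inductive Instr (h K k : ℕ)
  /-- `r := c` -/
  | const (r : Fin K) (c : ℕ)
  /-- `r := a ∘ b` -/
  | op (o : BinOp) (r a b : Fin K)
  /-- `r := mem[a]` -/
  | load (r a : Fin K)
  /-- `mem[a] := r` -/
  | store (a r : Fin K)
  /-- go to line `l` -/
  | jump (l : ℕ)
  /-- go to line `l` if `a = b` -/
  | jumpEq (a b : Fin K) (l : ℕ)
  /-- go to line `l` if `a < b` -/
  | jumpLt (a b : Fin K) (l : ℕ)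
  /-- append the word `a` to the write-only output -/
  | output (a : Fin K)
  /-- let cursor `c` point to the front of list number `a` of family `i` (null if it is empty) -/
  | front (c : Fin k) (i : Fin h) (a : Fin K)
  /-- move cursor `c` to the next node of its circular list -/
  | next (c : Fin k)
  /-- `c := d` for cursors -/
  | copy (c d : Fin k)
  /-- `r :=` the vertex stored in the node cursor `c` points to -/
  | read (r : Fin K) (c : Fin k)
  /-- go to line `l` if cursor `c` is null -/
  | jumpNull (c : Fin k) (l : ℕ)
  /-- go to line `l` if the cursors `c` and `d` are equal -/
  | jumpSame (c d : Fin k) (l : ℕ)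
  /-- rotate: advance the head of list number `a` of family `i` to the next node -/
  | rotate (i : Fin h) (a : Fin K)
  | halt

/-- A program: finitely many registers, cursors and lines of code, independent of the input. -/
structure Program (h : ℕ) where
  K : ℕ
  k : ℕ
  code : List (Instr h K k)

/-- The adjacency lists of the input, each written out starting from its initial front.  They are
read-only. -/
abbrev Lists (h n : ℕ) := Fin h → Fin n → List (Fin n)

/-- A node of an adjacency list: family, vertex that owns the list, position in the list. -/
abbrev Node (h n : ℕ) := Fin h × Fin n × ℕ

/-- A configuration.  `heads i v` is the position of the node that the head of list `v` of family
`i` currently points to. -/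
structure Config (h n K k : ℕ) where
  pc : ℕ
  regs : Fin K → ℕ
  cursors : Fin k → Option (Node h n)
  mem : ℕ → ℕ
  heads : Fin h → Fin n → ℕ
  out : List ℕ

/-- The cyclic successor of position `p` in a circular list. -/
def succPos {α : Type} (l : List α) (p : ℕ) : ℕ := if p + 1 < l.length then p + 1 else 0

namespace Config

variable {h n K k : ℕ}

/-- Go to line `l`. -/
def goto (c : Config h n K k) (l : ℕ) : Config h n K k := { c with pc := l }

/-- Go to the next line. -/
def advance (c : Config h n K k) : Config h n K k := c.goto (c.pc + 1)

/-- Go to line `l` if `b` holds, to the next line otherwise. -/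
def branch (c : Config h n K k) (b : Bool) (l : ℕ) : Config h n K k :=
  if b then c.goto l else c.advance

/-- Write `x`, reduced to a `w`-bit word, into register `r`. -/
def setReg (c : Config h n K k) (w : ℕ) (r : Fin K) (x : ℕ) : Config h n K k :=
  { c with regs := Function.update c.regs r (x % 2 ^ w) }

def setCursor (c : Config h n K k) (i : Fin k) (p : Option (Node h n)) : Config h n K k :=
  { c with cursors := Function.update c.cursors i p }

def setMem (c : Config h n K k) (a x : ℕ) : Config h n K k :=
  { c with mem := Function.update c.mem a x }

def setHead (c : Config h n K k) (i : Fin h) (v : Fin n) (p : ℕ) : Config h n K k :=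
  { c with heads := Function.update c.heads i (Function.update (c.heads i) v p) }

end Config

/-- The effect of one instruction, on a machine with `w`-bit words and a work memory of `S` words.
Accessing memory outside the work memory, accessing the list of a non-vertex, reading through a null
cursor, and `halt` have no successor configuration. -/
def exec {h n K k : ℕ} (L : Lists h n) (w S : ℕ) (c : Config h n K k) :
    Instr h K k → Option (Config h n K k)
  | .const r x => some (c.setReg w r x).advance
  | .op o r a b => some (c.setReg w r (o.eval w (c.regs a) (c.regs b))).advance
  | .load r a => if c.regs a < S then some (c.setReg w r (c.mem (c.regs a))).advance else none
  | .store a r => if c.regs a < S then some (c.setMem (c.regs a) (c.regs r)).advance else none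
  | .jump l => some (c.goto l)
  | .jumpEq a b l => some (c.branch (c.regs a == c.regs b) l)
  | .jumpLt a b l => some (c.branch (decide (c.regs a < c.regs b)) l)
  | .output a => some { c.advance with out := c.out ++ [c.regs a] }
  | .front q i a =>
      if hv : c.regs a < n then
        let v : Fin n := ⟨c.regs a, hv⟩
        some (c.setCursor q (if L i v = [] then none else some (i, v, c.heads i v))).advance
      else none
  | .next q =>
      some (c.setCursor q
        ((c.cursors q).map fun x => (x.1, x.2.1, succPos (L x.1 x.2.1) x.2.2))).advance
  | .copy q q' => some (c.setCursor q (c.cursors q')).advance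
  | .read r q =>
      match c.cursors q with
      | none => none
      | some x => ((L x.1 x.2.1)[x.2.2]?).map fun u => (c.setReg w r u.val).advance
  | .jumpNull q l => some (c.branch (c.cursors q == none) l)
  | .jumpSame q q' l => some (c.branch (c.cursors q == c.cursors q') l)
  | .rotate i a =>
      if hv : c.regs a < n then
        let v : Fin n := ⟨c.regs a, hv⟩
        some (c.setHead i v (succPos (L i v) (c.heads i v))).advance
      else none
  | .halt => none

variable {h n : ℕ}

/-- One step: execute the instruction in the current line. -/
def step (P : Program h) (L : Lists h n) (w S : ℕ) (c : Config h n P.K P.k) :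
    Option (Config h n P.K P.k) :=
  (P.code[c.pc]?).bind (exec L w S c)

/-- `t` steps. -/
def stepN (P : Program h) (L : Lists h n) (w S : ℕ) :
    ℕ → Config h n P.K P.k → Option (Config h n P.K P.k)
  | 0, c => some c
  | t + 1, c => (step P L w S c).bind (stepN P L w S t)

/-- The initial configuration: every list head is at its front, registers 0, 1 and 2 hold the number
`n` of vertices, the source `s` and the word size `w`, and everything else is zero or null. -/
def init (P : Program h) (s : Fin n) (w : ℕ) : Config h n P.K P.k where
  pc := 0
  regs := fun r => (match r.val with
    | 0 => n
    | 1 => s.val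
    | 2 => w
    | _ => 0) % 2 ^ w
  cursors := fun _ => none
  mem := fun _ => 0
  heads := fun _ _ => 0
  out := []

/-- On the lists `L` and the source `s`, with `w`-bit words and a work memory of `S` words, the
program `P` halts after exactly `t` unit-cost steps, having output the sequence `o` of vertices. -/
def Outputs (P : Program h) (L : Lists h n) (s : Fin n) (w S t : ℕ) (o : List (Fin n)) : Prop :=
  ∃ c, stepN P L w S t (init P s w) = some c ∧ P.code[c.pc]? = some .halt ∧
    c.out = o.map Fin.val

/-- The number of extra bits used: `w` for each register and each word of the work memory, and for
each cursor enough bits to hold null or the address of one of the nodes of the lists. -/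
def extraBits (P : Program h) (L : Lists h n) (w S : ℕ) : ℕ :=
  P.K * w + P.k * Nat.size (∑ i, ∑ v, (L i v).length) + S * w

end Rotate

/-!
# Depth-first search in the rotate model

The state of a DFS is a stack of vertices, each with the part of its adjacency list that is still to
be scanned. The rotate model has no room for the stack, but the list heads can represent it: the
list of a vertex on the stack is kept rotated such that it starts with the unscanned part, whose
first entry is the next vertex on the stack (`LexCore`, `LinkCore`). Two questions remain: how to go
back to the parent when a vertex is completed, and how to recognize visited vertices.

In linear time, visited vertices are marked in a bit vector, which takes `n + O(lg n)` bits. Hence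
`n lg 3` bits are not needed for the lex-DFS order, and one program serves for this order and for
general-DFS orders alike.

* In a directed graph, when a vertex is visited, its in-list is rotated until the parent is at the
  head; completing the vertex then is reading that head (`lexSpec_directed`).
* In an undirected graph, a completed vertex `u` is at the head of the list of its parent `p`. The
  other neighbours with `u` at the head are leaves among the children of `u`: a completed inner
  vertex keeps its last child at the head, and a leaf is rotated, when it is completed, until its
  parent is at the head. Now `p`, unless it is the root, is at the head of the list of its own
  parent, whereas a leaf `y` is not at the head of the list of any neighbour except `u`
  (`LexCore.isParent`). This property is tested for two candidates in lockstep, so that the time is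
  bounded by the degree of the loser (`wp_duel`); the loser is a leaf, which is charged only once,
  since only its parent looks at it. So the time is linear (`lexSpec_undirected`).

With `O(lg n)` bits, the order in which the neighbours of a vertex are scanned may be chosen when
the vertex is visited: each list is cut at a place that can be recognized later (`Snapshot`,
`outputs_linkMain`). The stack is tested by walking from the source along the list heads (`climb`).
For the other vertices, the point is that every completed vertex is linked, by at most as many list
heads as the largest depth so far, to a vertex `g` on the stack, and that the last vertex of this
path has already been scanned in the list of `g` (`Gated`).

* In a directed graph, in-list heads point to parents, and an out-list is scanned with its least
  vertex last. If in-list heads lead from an unvisited vertex to a vertex `g` on the stack, then all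
  the vertices before `g` are unvisited, so that the last of them belongs to the unscanned part of
  the list of `g`. This tells completed from unvisited vertices (`Directed.check`), in time
  `O(n + ℓ ^ 2)`.
* In an undirected graph, the list of a vertex on the stack is scanned with its parent last, so that
  the parent is at the head when the vertex is completed. The list of an unvisited vertex is
  rotated, whenever the vertex at its head is visited, to an unvisited neighbour, if there is one
  (`Ready`); these rotations make at most two turns of each list. So list heads lead from an
  unvisited vertex either to the stack at once, or to unvisited vertices for ever. A completed
  neighbour of the current vertex `u` that has not been scanned yet is a descendant of a scanned
  child of `u`, and list heads lead from it to `u` in at least two steps (`Undirected.check`). Each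
  test takes time `O(ℓ)`, and `m ≥ n - 1` gives the bound.

The programs are written in a small structured language, whose compiled code takes as many steps as
its big-step semantics says (`Run.stepN`), and are verified by a calculus for total correctness with
running time (`wp`). Running times are bounded by potentials.
-/

/-! ### A structured language on top of the rotate model -/

namespace Rotate

/-- The programs below all use 32 registers; in comments, `r5` is register number 5. -/
abbrev Reg := Fin 32

/-- The programs below all use 8 cursors. -/
abbrev Cur := Fin 8

/-- A configuration without its program counter. -/
structure Store (h n : ℕ) where
  regs : Reg → ℕ
  cursors : Cur → Option (Node h n)
  mem : ℕ → ℕ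
  heads : Fin h → Fin n → ℕ
  out : List ℕ

variable {h n : ℕ}

namespace Store

/-- The configuration with store `σ` in line `pc`. -/
def toConfig (σ : Store h n) (pc : ℕ) : Config h n 32 8 :=
  ⟨pc, σ.regs, σ.cursors, σ.mem, σ.heads, σ.out⟩

def setReg (σ : Store h n) (w : ℕ) (r : Reg) (x : ℕ) : Store h n :=
  { σ with regs := Function.update σ.regs r (x % 2 ^ w) }

def setCursor (σ : Store h n) (q : Cur) (p : Option (Node h n)) : Store h n :=
  { σ with cursors := Function.update σ.cursors q p }

def setMem (σ : Store h n) (a x : ℕ) : Store h n :=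
  { σ with mem := Function.update σ.mem a x }

def push (σ : Store h n) (x : ℕ) : Store h n := { σ with out := σ.out ++ [x] }

/-- Advance the head of list `v` of family `i`. -/
def rot (σ : Store h n) (L : Lists h n) (i : Fin h) (v : Fin n) : Store h n :=
  { σ with
    heads := Function.update σ.heads i
      (Function.update (σ.heads i) v (succPos (L i v) (σ.heads i v))) }

end Store

/-- The effect of an instruction other than a jump on a store. -/
def execPrim (L : Lists h n) (w S : ℕ) (σ : Store h n) : Instr h 32 8 → Option (Store h n)
  | .const r x => some (σ.setReg w r x)
  | .op o r a b => some (σ.setReg w r (o.eval w (σ.regs a) (σ.regs b)))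
  | .load r a => if σ.regs a < S then some (σ.setReg w r (σ.mem (σ.regs a))) else none
  | .store a r => if σ.regs a < S then some (σ.setMem (σ.regs a) (σ.regs r)) else none
  | .output a => some (σ.push (σ.regs a))
  | .front q i a =>
      if hv : σ.regs a < n then
        some (σ.setCursor q (if L i ⟨σ.regs a, hv⟩ = [] then none
          else some (i, ⟨σ.regs a, hv⟩, σ.heads i ⟨σ.regs a, hv⟩)))
      else none
  | .next q =>
      some (σ.setCursor q
        ((σ.cursors q).map fun x => (x.1, x.2.1, succPos (L x.1 x.2.1) x.2.2)))
  | .copy q q' => some (σ.setCursor q (σ.cursors q'))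
  | .read r q =>
      match σ.cursors q with
      | none => none
      | some x => ((L x.1 x.2.1)[x.2.2]?).map fun u => σ.setReg w r u.val
  | .rotate i a => if hv : σ.regs a < n then some (σ.rot L i ⟨σ.regs a, hv⟩) else none
  | _ => none

theorem exec_of_execPrim {L : Lists h n} {w S : ℕ} {σ σ' : Store h n} {i : Instr h 32 8}
    (hi : execPrim L w S σ i = some σ') (pc : ℕ) :
    exec L w S (σ.toConfig pc) i = some (σ'.toConfig (pc + 1)) := by
  cases i <;> simp only [execPrim, exec, Store.toConfig, reduceCtorEq, Option.some.injEq] at hi ⊢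
  case read r q =>
    rcases hx : σ.cursors q with _ | x
    · simp [hx] at hi
    · rw [hx] at hi
      obtain ⟨u, hu, rfl⟩ := Option.map_eq_some_iff.1 hi
      exact Option.map_eq_some_iff.2 ⟨u, hu, rfl⟩
  all_goals first
    | (subst hi; rfl)
    | (split at hi <;> simp_all; subst hi; rfl)

/-- The conditions a program can branch on. -/
inductive Test
  | eq (a b : Reg)
  | lt (a b : Reg)
  | null (q : Cur)

/-- The condition holds in the store `σ`. -/
def Test.holds (σ : Store h n) : Test → Prop
  | eq a b => σ.regs a = σ.regs b
  | lt a b => σ.regs a < σ.regs b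
  | null q => σ.cursors q = none

/-- The instruction that goes to line `l` if the test succeeds. -/
def Test.instr (l : ℕ) : Test → Instr h 32 8
  | eq a b => .jumpEq a b l
  | lt a b => .jumpLt a b l
  | null q => .jumpNull q l

/-- Structured programs; `loop b c` repeats `c` until `b` holds, testing `b` first. -/
inductive Cmd (h : ℕ)
  | skip
  | prim (i : Instr h 32 8)
  | seq (c d : Cmd h)
  | ite (b : Test) (c d : Cmd h)
  | loop (b : Test) (c : Cmd h)

infixr:60 " ;; " => Cmd.seq

/-- Number of lines of the compiled code. -/
def Cmd.size : Cmd h → ℕ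
  | skip => 0
  | prim _ => 1
  | seq c d => c.size + d.size
  | ite _ c d => 1 + d.size + 1 + c.size
  | .loop _ c => 1 + c.size + 1

/-- Compilation; the code is placed from line `o` on. -/
def Cmd.compile (o : ℕ) : Cmd h → List (Instr h 32 8)
  | skip => []
  | prim i => [i]
  | seq c d => c.compile o ++ d.compile (o + c.size)
  | ite b c d => [b.instr (o + (1 + d.size + 1))] ++ d.compile (o + 1) ++
      [.jump (o + (1 + d.size + 1 + c.size))] ++ c.compile (o + (1 + d.size + 1))
  | .loop b c => [b.instr (o + (1 + c.size + 1))] ++ c.compile (o + 1) ++ [.jump o]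

theorem Cmd.length_compile (c : Cmd h) : ∀ o, (c.compile o).length = c.size := by
  induction c with
  | skip => simp [compile, size]
  | prim i => simp [compile, size]
  | seq c d hc hd => simp [compile, size, hc, hd]
  | ite b c d hc hd => intro o; simp [compile, size, hc, hd]; omega
  | loop b c hc => intro o; simp [compile, size, hc]; omega

/-- `Run L w S c σ t σ'`: started in the store `σ`, the command `c` takes `t` steps and ends in
the store `σ'`. -/
inductive Run (L : Lists h n) (w S : ℕ) : Cmd h → Store h n → ℕ → Store h n → Prop
  | skip (σ) : Run L w S .skip σ 0 σ
  | prim {σ i σ'} : execPrim L w S σ i = some σ' → Run L w S (.prim i) σ 1 σ'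
  | seq {c d σ t σ₁ t' σ'} : Run L w S c σ t σ₁ → Run L w S d σ₁ t' σ' →
      Run L w S (c ;; d) σ (t + t') σ'
  | iteT {b c d σ t σ'} : b.holds σ → Run L w S c σ t σ' → Run L w S (.ite b c d) σ (1 + t) σ'
  | iteF {b c d σ t σ'} : ¬ b.holds σ → Run L w S d σ t σ' →
      Run L w S (.ite b c d) σ (1 + t + 1) σ'
  | loopT {b c σ} : b.holds σ → Run L w S (.loop b c) σ 1 σ
  | loopF {b c σ t σ₁ t' σ'} : ¬ b.holds σ → Run L w S c σ t σ₁ →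
      Run L w S (.loop b c) σ₁ t' σ' → Run L w S (.loop b c) σ (1 + t + 1 + t') σ'

theorem stepN_add {P : Program h} {L : Lists h n} {w S : ℕ} (a b : ℕ) (c : Config h n P.K P.k) :
    stepN P L w S (a + b) c = (stepN P L w S a c).bind (stepN P L w S b) := by
  induction a generalizing c with
  | zero => simp [stepN]
  | succ a ih =>
    rw [Nat.add_right_comm]
    simp only [stepN]
    cases step P L w S c with
    | none => rfl
    | some c' => simpa using ih c'

theorem getElem?_of_eq_append {α : Type*} {code pre post : List α} {i : α} {o : ℕ}
    (hc : code = pre ++ i :: post) (ho : pre.length = o) : code[o]? = some i := by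
  subst hc ho
  simp

section step

variable {L : Lists h n} {w S o l : ℕ} {code : List (Instr h 32 8)} {σ : Store h n}

theorem step_prim {i : Instr h 32 8} {σ' : Store h n} (hc : code[o]? = some i)
    (he : execPrim L w S σ i = some σ') :
    stepN ⟨32, 8, code⟩ L w S 1 (σ.toConfig o) = some (σ'.toConfig (o + 1)) := by
  have h1 := exec_of_execPrim he o
  have h2 : step ⟨32, 8, code⟩ L w S (σ.toConfig o) = some (σ'.toConfig (o + 1)) := by
    rw [← h1]
    exact congrArg (fun x => Option.bind x (exec L w S (σ.toConfig o))) hc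
  exact congrArg (fun x => Option.bind x (stepN ⟨32, 8, code⟩ L w S 0)) h2

theorem step_jump (hc : code[o]? = some (.jump l)) :
    stepN ⟨32, 8, code⟩ L w S 1 (σ.toConfig o) = some (σ.toConfig l) := by
  have h2 : step ⟨32, 8, code⟩ L w S (σ.toConfig o) = some (σ.toConfig l) :=
    congrArg (fun x => Option.bind x (exec L w S (σ.toConfig o))) hc
  exact congrArg (fun x => Option.bind x (stepN ⟨32, 8, code⟩ L w S 0)) h2

theorem step_test {b : Test} (hc : code[o]? = some (b.instr l)) :
    (b.holds σ → stepN ⟨32, 8, code⟩ L w S 1 (σ.toConfig o) = some (σ.toConfig l)) ∧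
    (¬ b.holds σ → stepN ⟨32, 8, code⟩ L w S 1 (σ.toConfig o) = some (σ.toConfig (o + 1))) := by
  have h1 : (b.holds σ → exec L w S (σ.toConfig o) (b.instr l) = some (σ.toConfig l)) ∧
      (¬ b.holds σ → exec L w S (σ.toConfig o) (b.instr l) = some (σ.toConfig (o + 1))) := by
    have ht : ∀ (c : Config h n 32 8) (β : Bool), β = true → c.branch β l = c.goto l := by
      rintro c _ rfl; rfl
    have hf : ∀ (c : Config h n 32 8) (β : Bool), β = false → c.branch β l = c.advance := by
      rintro c _ rfl; rfl
    cases b with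
    | eq a a' =>
      exact ⟨fun hb => congrArg some (ht _ _ (beq_iff_eq.2 hb)),
        fun hb => congrArg some (hf _ _ (beq_eq_false_iff_ne.2 hb))⟩
    | lt a a' =>
      exact ⟨fun hb => congrArg some (ht _ _ (decide_eq_true hb)),
        fun hb => congrArg some (hf _ _ (decide_eq_false hb))⟩
    | null q =>
      exact ⟨fun hb => congrArg some (ht _ _ (beq_iff_eq.2 hb)),
        fun hb => congrArg some (hf _ _ (beq_eq_false_iff_ne.2 hb))⟩
  have h2 : step ⟨32, 8, code⟩ L w S (σ.toConfig o) = exec L w S (σ.toConfig o) (b.instr l) :=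
    congrArg (fun x => Option.bind x (exec L w S (σ.toConfig o))) hc
  exact ⟨fun hb => congrArg (fun x => Option.bind x (stepN ⟨32, 8, code⟩ L w S 0))
      (h2.trans (h1.1 hb)),
    fun hb => congrArg (fun x => Option.bind x (stepN ⟨32, 8, code⟩ L w S 0))
      (h2.trans (h1.2 hb))⟩

end step

/-- Compiled code does what the structured program says, in the same number of steps. -/
theorem Run.stepN {L : Lists h n} {w S : ℕ} {c : Cmd h} {σ σ' : Store h n} {t : ℕ}
    (hr : Run L w S c σ t σ') : ∀ (code pre post : List (Instr h 32 8)) (o : ℕ),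
      code = pre ++ c.compile o ++ post → pre.length = o →
      Rotate.stepN ⟨32, 8, code⟩ L w S t (σ.toConfig o) = some (σ'.toConfig (o + c.size)) := by
  induction hr with
  | skip σ => intro code pre post o _ _; rfl
  | prim hi =>
    intro code pre post o hc ho
    exact step_prim (getElem?_of_eq_append (by rw [hc, Cmd.compile]; simp; rfl) ho) hi
  | @seq c d σ t σ₁ t' σ' _ _ ih ih' =>
    intro code pre post o hc ho
    rw [stepN_add, ih code pre (d.compile (o + c.size) ++ post) o (by simp [hc, Cmd.compile]) ho]
    refine (ih' code (pre ++ c.compile o) post _ (by simp [hc, Cmd.compile])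
      (by simp [ho, Cmd.length_compile])).trans ?_
    simp [Cmd.size, Nat.add_assoc]
  | @iteT b c d σ t σ' hb _ ih =>
    intro code pre post o hc ho
    have h1 : code[o]? = some (b.instr (o + (1 + d.size + 1))) :=
      getElem?_of_eq_append (by rw [hc, Cmd.compile]; simp; rfl) ho
    rw [stepN_add, (step_test h1).1 hb]
    refine (ih code (pre ++ ([b.instr (o + (1 + d.size + 1))] ++ d.compile (o + 1) ++
      [.jump (o + (1 + d.size + 1 + c.size))])) post _ (by simp [hc, Cmd.compile])
      (by simp [ho, Cmd.length_compile]; omega)).trans ?_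
    simp [Cmd.size, Nat.add_assoc]
  | @iteF b c d σ t σ' hb _ ih =>
    intro code pre post o hc ho
    have h1 : code[o]? = some (b.instr (o + (1 + d.size + 1))) :=
      getElem?_of_eq_append (by rw [hc, Cmd.compile]; simp; rfl) ho
    have h2 : code[o + 1 + d.size]? = some (.jump (o + (1 + d.size + 1 + c.size))) :=
      getElem?_of_eq_append (pre := pre ++ [b.instr (o + (1 + d.size + 1))] ++ d.compile (o + 1))
        (by rw [hc, Cmd.compile]; simp; rfl) (by simp [ho, Cmd.length_compile]; omega)
    have h3 := ih code (pre ++ [b.instr (o + (1 + d.size + 1))])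
      ([.jump (o + (1 + d.size + 1 + c.size))] ++ c.compile (o + (1 + d.size + 1)) ++ post) (o + 1)
      (by simp [hc, Cmd.compile]) (by simp [ho])
    rw [stepN_add, stepN_add, (step_test h1).2 hb]
    refine (congrArg (fun x => Option.bind x _) h3).trans ?_
    exact step_jump h2
  | @loopT b c σ hb =>
    intro code pre post o hc ho
    have h1 : code[o]? = some (b.instr (o + (1 + c.size + 1))) :=
      getElem?_of_eq_append (by rw [hc, Cmd.compile]; simp; rfl) ho
    exact (step_test h1).1 hb
  | @loopF b c σ t σ₁ t' σ' hb _ _ ih ih' =>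
    intro code pre post o hc ho
    have h1 : code[o]? = some (b.instr (o + (1 + c.size + 1))) :=
      getElem?_of_eq_append (by rw [hc, Cmd.compile]; simp; rfl) ho
    have h2 : code[o + 1 + c.size]? = some (.jump o) :=
      getElem?_of_eq_append
        (pre := pre ++ [b.instr (o + (1 + c.size + 1))] ++ c.compile (o + 1))
        (by rw [hc, Cmd.compile]; simp; rfl) (by simp [ho, Cmd.length_compile]; omega)
    have h3 := ih code (pre ++ [b.instr (o + (1 + c.size + 1))])
      ([.jump o] ++ post) (o + 1) (by simp [hc, Cmd.compile]) (by simp [ho])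
    rw [stepN_add, stepN_add, stepN_add, (step_test h1).2 hb]
    refine (congrArg (fun x => Option.bind (Option.bind x _) _) h3).trans ?_
    refine (congrArg (fun x => Option.bind x _) (step_jump h2)).trans ?_
    exact ih' code pre post o hc ho

/-- The program obtained from a command.  Program size, registers and cursors do not depend on the
input. -/
def Cmd.program (c : Cmd h) : Program h := ⟨32, 8, c.compile 0 ++ [.halt]⟩

/-- The initial store. -/
def initStore (h : ℕ) (s : Fin n) (w : ℕ) : Store h n where
  regs := fun r => (match r.val with
    | 0 => n
    | 1 => s.val
    | 2 => w
    | _ => 0) % 2 ^ w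
  cursors := fun _ => none
  mem := fun _ => 0
  heads := fun _ _ => 0
  out := []

theorem Run.outputs {L : Lists h n} {w S t : ℕ} {c : Cmd h} {s : Fin n} {σ : Store h n}
    {o : List (Fin n)} (hr : Run L w S c (initStore h s w) t σ) (ho : σ.out = o.map Fin.val) :
    Outputs c.program L s w S t o := by
  refine ⟨σ.toConfig c.size, ?_, ?_, ho⟩
  · have := hr.stepN (c.compile 0 ++ [.halt]) [] [.halt] 0 (by simp) rfl
    rw [Nat.zero_add] at this
    exact this
  · exact getElem?_of_eq_append (code := c.compile 0 ++ [.halt]) rfl (Cmd.length_compile c 0)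

/-- Total correctness with running time: `c` terminates when started in `σ`, and `Q` holds of the
number of steps and of the final store. -/
def wp (L : Lists h n) (w S : ℕ) (c : Cmd h) (σ : Store h n) (Q : ℕ → Store h n → Prop) : Prop :=
  ∃ t σ', Run L w S c σ t σ' ∧ Q t σ'

section wp

variable {L : Lists h n} {w S : ℕ} {c d : Cmd h} {σ : Store h n} {Q Q' : ℕ → Store h n → Prop}

theorem wp.mono (H : wp L w S c σ Q) (hQ : ∀ t σ', Q t σ' → Q' t σ') : wp L w S c σ Q' := by
  obtain ⟨t, σ', hr, hq⟩ := H
  exact ⟨t, σ', hr, hQ _ _ hq⟩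

theorem wp_skip : wp L w S .skip σ Q ↔ Q 0 σ := by
  constructor
  · rintro ⟨t, σ', hr, hq⟩
    cases hr
    exact hq
  · intro hq
    exact ⟨_, _, .skip σ, hq⟩

theorem wp_seq : wp L w S (c ;; d) σ Q ↔
    wp L w S c σ fun t σ' => wp L w S d σ' fun t' σ'' => Q (t + t') σ'' := by
  constructor
  · rintro ⟨t, σ', hr, hq⟩
    cases hr with
    | seq h1 h2 => exact ⟨_, _, h1, _, _, h2, hq⟩
  · rintro ⟨t, σ', h1, t', σ'', h2, hq⟩
    exact ⟨_, _, .seq h1 h2, hq⟩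

theorem wp.seq (H : wp L w S c σ Q')
    (hQ : ∀ t σ', Q' t σ' → wp L w S d σ' fun t' σ'' => Q (t + t') σ'') :
    wp L w S (c ;; d) σ Q :=
  wp_seq.2 (H.mono hQ)

theorem wp_prim {i : Instr h 32 8} :
    wp L w S (.prim i) σ Q ↔ ∃ σ', execPrim L w S σ i = some σ' ∧ Q 1 σ' := by
  constructor
  · rintro ⟨t, σ', hr, hq⟩
    cases hr with
    | prim h1 => exact ⟨_, h1, hq⟩
  · rintro ⟨σ', h1, hq⟩
    exact ⟨_, _, .prim h1, hq⟩

theorem wp_const {r : Reg} {x : ℕ} : wp L w S (.prim (.const r x)) σ Q ↔ Q 1 (σ.setReg w r x) := by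
  simp [wp_prim, execPrim]

theorem wp_op {o : BinOp} {r a b : Reg} : wp L w S (.prim (.op o r a b)) σ Q ↔
    Q 1 (σ.setReg w r (o.eval w (σ.regs a) (σ.regs b))) := by
  simp [wp_prim, execPrim]

theorem wp_output {a : Reg} : wp L w S (.prim (.output a)) σ Q ↔ Q 1 (σ.push (σ.regs a)) := by
  simp [wp_prim, execPrim]

theorem wp_load {r a : Reg} (ha : σ.regs a < S) :
    wp L w S (.prim (.load r a)) σ Q ↔ Q 1 (σ.setReg w r (σ.mem (σ.regs a))) := by
  simp [wp_prim, execPrim, ha]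

theorem wp_store {r a : Reg} (ha : σ.regs a < S) :
    wp L w S (.prim (.store a r)) σ Q ↔ Q 1 (σ.setMem (σ.regs a) (σ.regs r)) := by
  simp [wp_prim, execPrim, ha]

theorem wp_rotate {i : Fin h} {a : Reg} {v : Fin n} (ha : σ.regs a = v.val) :
    wp L w S (.prim (.rotate i a)) σ Q ↔ Q 1 (σ.rot L i v) := by
  simp [wp_prim, execPrim, ha]

theorem wp_ite {b : Test} : wp L w S (.ite b c d) σ Q ↔
    (b.holds σ → wp L w S c σ fun t => Q (1 + t)) ∧
    (¬ b.holds σ → wp L w S d σ fun t => Q (1 + t + 1)) := by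
  constructor
  · rintro ⟨t, σ', hr, hq⟩
    cases hr with
    | iteT hb h1 => exact ⟨fun _ => ⟨_, _, h1, hq⟩, fun hb' => absurd hb hb'⟩
    | iteF hb h1 => exact ⟨fun hb' => absurd hb' hb, fun _ => ⟨_, _, h1, hq⟩⟩
  · rintro ⟨h1, h2⟩
    by_cases hb : b.holds σ
    · obtain ⟨t, σ', hr, hq⟩ := h1 hb
      exact ⟨_, _, .iteT hb hr, hq⟩
    · obtain ⟨t, σ', hr, hq⟩ := h2 hb
      exact ⟨_, _, .iteF hb hr, hq⟩

theorem wp_loop_aux {b : Test} (I : ℕ → ℕ → Store h n → Prop) {m t₀ : ℕ} (h0 : I m t₀ σ)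
    (hstep : ∀ m t σ, I m t σ → ¬ b.holds σ →
      wp L w S c σ fun t' σ' => ∃ m' < m, I m' (t + (1 + t' + 1)) σ')
    (hexit : ∀ m t σ, I m t σ → b.holds σ → Q (t + 1) σ) :
    wp L w S (.loop b c) σ fun t σ' => Q (t₀ + t) σ' := by
  induction m using Nat.strong_induction_on generalizing t₀ σ with
  | _ m ih =>
    by_cases hb : b.holds σ
    · exact ⟨_, _, .loopT hb, hexit m t₀ σ h0 hb⟩
    · obtain ⟨t', σ', hr, m', hm, hI⟩ := hstep m t₀ σ h0 hb
      obtain ⟨t'', σ'', hr', hq⟩ := ih m' hm hI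
      exact ⟨_, _, .loopF hb hr hr', by convert hq using 1; omega⟩

/-- Rule for loops: `I m t σ` is the invariant, with a measure `m` that decreases and the time `t`
spent so far. -/
theorem wp_loop {b : Test} (I : ℕ → ℕ → Store h n → Prop) (m : ℕ) (h0 : I m 0 σ)
    (hstep : ∀ m t σ, I m t σ → ¬ b.holds σ →
      wp L w S c σ fun t' σ' => ∃ m' < m, I m' (t + (1 + t' + 1)) σ')
    (hexit : ∀ m t σ, I m t σ → b.holds σ → Q (t + 1) σ) : wp L w S (.loop b c) σ Q :=
  (wp_loop_aux I h0 hstep hexit).mono fun t σ' hq => by rwa [Nat.zero_add] at hq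

end wp

end Rotate

/-! ### Depth-first search with an explicit stack -/

namespace Dfs

variable {n : ℕ}

/-- A stack frame: a vertex and the part of its adjacency list that is still to be scanned. -/
abbrev Frame (n : ℕ) := Fin n × List (Fin n)

/-- The vertices visited in a trace. -/
abbrev visited (T : List (Fin n × ℕ)) : List (Fin n) := T.map Prod.fst

theorem mem_visited_append {T : List (Fin n × ℕ)} {v x : Fin n} {d : ℕ} :
    v ∈ visited (T ++ [(x, d)]) ↔ v ∈ visited T ∨ v = x := by
  simp [visited]

/-- The vertices on the stack. -/
abbrev verts (F : List (Frame n)) : List (Fin n) := F.map Prod.fst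

/-- The trace that results when the frames of the stack (top first) are completed one by one. -/
def unwind (R : Fin n → List (Fin n)) : List (Fin n × ℕ) → List (Frame n) → List (Fin n × ℕ)
  | T, [] => T
  | T, f :: F => unwind R (f.2.foldl (dfsVisit R (n - (F.length + 1)) (F.length + 1)) T) F

theorem dfsVisit_of_mem {R : Fin n → List (Fin n)} {k d : ℕ} {T : List (Fin n × ℕ)} {v : Fin n}
    (hv : v ∈ visited T) : dfsVisit R k d T v = T := by
  cases k with
  | zero => rfl
  | succ k => rw [dfsVisit, if_pos hv]

theorem foldl_dfsVisit_of_subset {R : Fin n → List (Fin n)} {k d : ℕ} {T : List (Fin n × ℕ)}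
    {l : List (Fin n)} (hl : ∀ v ∈ l, v ∈ visited T) : l.foldl (dfsVisit R k d) T = T := by
  induction l with
  | nil => rfl
  | cons x l ih =>
    rw [List.foldl_cons, dfsVisit_of_mem (hl x (by simp))]
    exact ih fun v hv => hl v (by simp [hv])

theorem foldl_append_prefix {α β : Type*} {f : List α → β → List α} (hf : ∀ T v, T <+: f T v)
    (l : List β) (T : List α) : T <+: l.foldl f T := by
  induction l generalizing T with
  | nil => exact List.prefix_rfl
  | cons x l ih => exact (hf T x).trans (ih _)

theorem prefix_dfsVisit (R : Fin n → List (Fin n)) (k d : ℕ) (T : List (Fin n × ℕ)) (v : Fin n) :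
    T <+: dfsVisit R k d T v := by
  induction k generalizing d T v with
  | zero => exact List.prefix_rfl
  | succ k ih =>
    rw [dfsVisit]
    split
    · exact List.prefix_rfl
    · exact (List.prefix_append T _).trans (foldl_append_prefix (ih (d + 1)) _ _)

theorem unwind_skip {R : Fin n → List (Fin n)} {T : List (Fin n × ℕ)} {u x : Fin n}
    {l : List (Fin n)} {F : List (Frame n)} (hx : x ∈ visited T) :
    unwind R T ((u, x :: l) :: F) = unwind R T ((u, l) :: F) := by
  simp only [unwind, List.foldl_cons, dfsVisit_of_mem hx]

theorem unwind_skip_append {R : Fin n → List (Fin n)} {T : List (Fin n × ℕ)} {u : Fin n}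
    {l l' : List (Fin n)} {F : List (Frame n)} (hl : ∀ v ∈ l, v ∈ visited T) :
    unwind R T ((u, l ++ l') :: F) = unwind R T ((u, l') :: F) := by
  simp only [unwind, List.foldl_append, foldl_dfsVisit_of_subset hl]

theorem length_le_of_nodup {l : List (Fin n)} (hl : l.Nodup) : l.length ≤ n := by
  simpa using hl.length_le_card

theorem dfsVisit_succ {R : Fin n → List (Fin n)} {k d : ℕ} {T : List (Fin n × ℕ)} {x : Fin n}
    (hx : x ∉ visited T) (hk : d < n) (hkd : k = n - d) :
    dfsVisit R k d T x =
      (R x).foldl (dfsVisit R (n - (d + 1)) (d + 1)) (T ++ [(x, d)]) := by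
  obtain ⟨j, hj⟩ : ∃ j, n - d = j + 1 := ⟨n - d - 1, by omega⟩
  rw [hkd, hj, dfsVisit, if_neg hx]
  congr 2
  omega

/-- Descending to an unvisited vertex does not change the final trace.  The current child stays in
the frame of its parent; being visited, it is skipped there later. -/
theorem unwind_push {R : Fin n → List (Fin n)} {T : List (Fin n × ℕ)} {u x : Fin n}
    {l : List (Fin n)} {F : List (Frame n)} (hx : x ∉ visited T)
    (hF : (x :: u :: verts F).Nodup) :
    unwind R (T ++ [(x, F.length + 1)]) ((x, R x) :: (u, x :: l) :: F) =
      unwind R T ((u, x :: l) :: F) := by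
  have hn : F.length + 1 < n := by simpa using length_le_of_nodup hF
  simp only [unwind, List.foldl_cons, List.length_cons]
  rw [dfsVisit_succ hx (by omega) rfl]
  congr 2
  apply dfsVisit_of_mem
  have := (foldl_append_prefix (prefix_dfsVisit R (n - (F.length + 1 + 1)) (F.length + 1 + 1)) (R x)
    (T ++ [(x, F.length + 1)])).subset
  exact List.mem_map.2 ⟨(x, F.length + 1), this (by simp), rfl⟩

/-- Starting a new tree at an unvisited vertex amounts to pushing a frame on the empty stack. -/
theorem unwind_root {R : Fin n → List (Fin n)} {T : List (Fin n × ℕ)} {x : Fin n}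
    (hx : x ∉ visited T) : unwind R (T ++ [(x, 0)]) [(x, R x)] = dfsVisit R n 0 T x := by
  have hn : 0 < n := x.pos
  rw [dfsVisit_succ hx hn (by simp)]
  simp [unwind]

/-- The state of a DFS of the relation `r`: `T` is the trace so far, `F` the stack, `ρ v` the
order in which the neighbours of a visited vertex `v` are scanned. -/
structure Snapshot (r : Fin n → Fin n → Prop) (ρ : Fin n → List (Fin n)) (T : List (Fin n × ℕ))
    (F : List (Frame n)) : Prop where
  order : IsAdjacencyOrder r ρ
  nodup : (visited T).Nodup
  nodup_stack : (verts F).Nodup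
  stack_subset : ∀ v ∈ verts F, v ∈ visited T
  scanned : ∀ f ∈ F, ∃ pre, ρ f.1 = pre ++ f.2 ∧ ∀ x ∈ pre, x ∈ visited T
  /-- the unscanned part of a frame below the top starts with the vertex of the frame above -/
  chain : F.IsChain fun c p => ∃ l, p.2 = c.1 :: l
  /-- the neighbours of a completed vertex are visited -/
  closed : ∀ v ∈ visited T, v ∉ verts F → ∀ u, r v u → u ∈ visited T

namespace Snapshot

variable {r : Fin n → Fin n → Prop} {ρ : Fin n → List (Fin n)} {T : List (Fin n × ℕ)}
  {F : List (Frame n)} {u x : Fin n} {l l' : List (Fin n)}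

theorem mem_iff (hs : Snapshot r ρ T F) {u v : Fin n} : u ∈ ρ v ↔ r v u := (hs.order v).2 u

theorem skip_append (hs : Snapshot r ρ T ((u, l ++ l') :: F)) (hl : ∀ v ∈ l, v ∈ visited T)
    : Snapshot r ρ T ((u, l') :: F) where
  order := hs.order
  nodup := hs.nodup
  nodup_stack := hs.nodup_stack
  stack_subset := hs.stack_subset
  scanned := by
    intro f hf
    rcases List.mem_cons.1 hf with rfl | hf
    · obtain ⟨pre, h1, h2⟩ := hs.scanned _ (List.mem_cons_self)
      refine ⟨pre ++ l, by simpa using h1, fun y hy => ?_⟩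
      rcases List.mem_append.1 hy with hy | hy
      · exact h2 y hy
      · exact hl y hy
    · exact hs.scanned f (List.mem_cons_of_mem _ hf)
  chain := by
    have := hs.chain
    cases F with
    | nil => simp
    | cons f F => simpa [List.isChain_cons_cons] using this
  closed := hs.closed

theorem skip (hs : Snapshot r ρ T ((u, x :: l) :: F)) (hx : x ∈ visited T) :
    Snapshot r ρ T ((u, l) :: F) :=
  skip_append (l := [x]) hs (by simpa using hx)

theorem not_mem_stack (hs : Snapshot r ρ T F) (hx : x ∉ visited T) : x ∉ verts F :=
  fun h => hx (hs.stack_subset x h)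

/-- Descending to `x`; the order in which the neighbours of `x` are scanned may be chosen now. -/
theorem push (hs : Snapshot r ρ T ((u, x :: l) :: F)) (hx : x ∉ visited T) {lx : List (Fin n)}
    (hlx : lx.Nodup ∧ ∀ y, y ∈ lx ↔ r x y) (d : ℕ) :
    Snapshot r (Function.update ρ x lx) (T ++ [(x, d)]) ((x, lx) :: (u, x :: l) :: F) where
  order := by
    intro v
    by_cases hv : v = x
    · subst hv; simpa using hlx
    · simpa [hv] using hs.order v
  nodup := by
    simp only [List.map_append, List.map_cons, List.map_nil]
    rw [List.nodup_append]
    exact ⟨hs.nodup, by simp, fun a ha b hb => by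
      simp only [List.mem_singleton] at hb
      subst hb
      rintro rfl
      exact hx ha⟩
  nodup_stack := List.nodup_cons.2 ⟨hs.not_mem_stack hx, hs.nodup_stack⟩
  stack_subset := by
    intro v hv
    rcases List.mem_cons.1 hv with rfl | hv
    · simp
    · simpa using Or.inl (by simpa using hs.stack_subset v hv)
  scanned := by
    intro f hf
    rcases List.mem_cons.1 hf with rfl | hf
    · exact ⟨[], by simp, by simp⟩
    · obtain ⟨pre, h1, h2⟩ := hs.scanned f hf
      have hne : f.1 ≠ x := fun h => hs.not_mem_stack hx (by
        have := List.mem_map_of_mem (f := Prod.fst) hf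
        rwa [h] at this)
      refine ⟨pre, by simpa [hne] using h1, fun y hy => ?_⟩
      have := h2 y hy
      simp only [List.map_append, List.mem_append]
      exact Or.inl this
  chain := by
    rw [List.isChain_cons_cons]
    exact ⟨⟨l, rfl⟩, hs.chain⟩
  closed := by
    intro v hv hvF y hy
    have h1 : v ≠ x := fun h => hvF (by simp [h])
    have h2 : v ∈ visited T := by
      simp only [List.map_append, List.mem_append, List.map_cons, List.map_nil,
        List.mem_singleton] at hv
      exact hv.resolve_right h1
    have := hs.closed v h2 (fun h => hvF (List.mem_cons_of_mem _ h)) y hy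
    simp only [List.map_append, List.mem_append]
    exact Or.inl this

/-- Starting a new tree. -/
theorem root (hs : Snapshot r ρ T []) (hx : x ∉ visited T) {lx : List (Fin n)}
    (hlx : lx.Nodup ∧ ∀ y, y ∈ lx ↔ r x y) (d : ℕ) :
    Snapshot r (Function.update ρ x lx) (T ++ [(x, d)]) [(x, lx)] where
  order := by
    intro v
    by_cases hv : v = x
    · subst hv; simpa using hlx
    · simpa [hv] using hs.order v
  nodup := by
    simp only [List.map_append, List.map_cons, List.map_nil]
    rw [List.nodup_append]
    exact ⟨hs.nodup, by simp, fun a ha b hb => by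
      simp only [List.mem_singleton] at hb
      subst hb
      rintro rfl
      exact hx ha⟩
  nodup_stack := by simp
  stack_subset := by simp
  scanned := by
    intro f hf
    obtain rfl := List.mem_singleton.1 hf
    exact ⟨[], by simp, by simp⟩
  chain := by simp
  closed := by
    intro v hv hvF y hy
    have h1 : v ≠ x := fun h => hvF (by simp [h])
    have h2 : v ∈ visited T := by
      simp only [List.map_append, List.mem_append, List.map_cons, List.map_nil,
        List.mem_singleton] at hv
      exact hv.resolve_right h1
    have := hs.closed v h2 (by simp) y hy
    simp only [List.map_append, List.mem_append]
    exact Or.inl this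

/-- Completing the top vertex. -/
theorem pop (hs : Snapshot r ρ T ((u, []) :: F)) : Snapshot r ρ T F where
  order := hs.order
  nodup := hs.nodup
  nodup_stack := (List.nodup_cons.1 hs.nodup_stack).2
  stack_subset := fun v hv => hs.stack_subset v (List.mem_cons_of_mem _ hv)
  scanned := fun f hf => hs.scanned f (List.mem_cons_of_mem _ hf)
  chain := hs.chain.tail
  closed := by
    intro v hv hvF y hy
    by_cases h : v = u
    · subst h
      obtain ⟨pre, h1, h2⟩ := hs.scanned _ (List.mem_cons_self)
      refine h2 y ?_
      have := hs.mem_iff.2 hy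
      rw [h1] at this
      simpa using this
    · exact hs.closed v hv (by simpa [h] using hvF) y hy

/-- At the beginning, nothing is visited. -/
theorem nil (hr : IsAdjacencyOrder r ρ) : Snapshot r ρ [] [] where
  order := hr
  nodup := by simp
  nodup_stack := by simp
  stack_subset := by simp
  scanned := by simp
  chain := by simp
  closed := by simp

end Snapshot

end Dfs

/-! ### Circular lists, seen from their heads and from cursors -/

namespace Rotate

variable {h n : ℕ}

theorem rotate_succPos {α : Type} (l : List α) {p : ℕ} (hp : p = 0 ∨ p < l.length) :
    l.rotate (succPos l p) = (l.rotate p).rotate 1 := by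
  rw [List.rotate_rotate, succPos]
  split
  · rfl
  · rcases l with _ | ⟨a, l⟩
    · simp
    · have : p + 1 = (a :: l).length := by
        rcases hp with rfl | hp
        · simp_all
        · omega
      rw [this, List.rotate_length, List.rotate_zero]

theorem succPos_ok {α : Type} (l : List α) (p : ℕ) : succPos l p = 0 ∨ succPos l p < l.length := by
  rw [succPos]
  split
  · right; assumption
  · left; rfl

namespace Store

/-- The heads point to nodes. -/
def HeadsOk (L : Lists h n) (σ : Store h n) : Prop :=
  ∀ i v, σ.heads i v = 0 ∨ σ.heads i v < (L i v).length

/-- List `v` of family `i`, written out from its current head. -/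
def view (L : Lists h n) (σ : Store h n) (i : Fin h) (v : Fin n) : List (Fin n) :=
  (L i v).rotate (σ.heads i v)

/-- Cursor `q` points into list `v` of family `i`, which reads `l` from there. -/
def At (L : Lists h n) (σ : Store h n) (q : Cur) (i : Fin h) (v : Fin n) (l : List (Fin n)) : Prop :=
  ∃ p, σ.cursors q = some (i, v, p) ∧ p < (L i v).length ∧ (L i v).rotate p = l

section simps

variable (σ : Store h n) (L : Lists h n) (w x : ℕ) (r r' : Reg) (q q' : Cur) (p : Option (Node h n))
  (i : Fin h) (v : Fin n)

@[simp] theorem regs_setReg : (σ.setReg w r x).regs r' = if r' = r then x % 2 ^ w else σ.regs r' := by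
  simp [setReg, Function.update_apply]

@[simp] theorem cursors_setReg : (σ.setReg w r x).cursors = σ.cursors := rfl
@[simp] theorem mem_setReg : (σ.setReg w r x).mem = σ.mem := rfl
@[simp] theorem heads_setReg : (σ.setReg w r x).heads = σ.heads := rfl
@[simp] theorem out_setReg : (σ.setReg w r x).out = σ.out := rfl
@[simp] theorem regs_setCursor : (σ.setCursor q p).regs = σ.regs := rfl
@[simp] theorem cursors_setCursor :
    (σ.setCursor q p).cursors q' = if q' = q then p else σ.cursors q' := by
  simp [setCursor, Function.update_apply]
@[simp] theorem mem_setCursor : (σ.setCursor q p).mem = σ.mem := rfl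
@[simp] theorem heads_setCursor : (σ.setCursor q p).heads = σ.heads := rfl
@[simp] theorem out_setCursor : (σ.setCursor q p).out = σ.out := rfl
@[simp] theorem regs_push : (σ.push x).regs = σ.regs := rfl
@[simp] theorem out_push : (σ.push x).out = σ.out ++ [x] := rfl
@[simp] theorem regs_setMem (a : ℕ) : (σ.setMem a x).regs = σ.regs := rfl
@[simp] theorem mem_setMem (a : ℕ) : (σ.setMem a x).mem = Function.update σ.mem a x := rfl
@[simp] theorem regs_rot : (σ.rot L i v).regs = σ.regs := rfl
@[simp] theorem out_rot : (σ.rot L i v).out = σ.out := rfl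

@[simp] theorem view_setReg : (σ.setReg w r x).view L = σ.view L := rfl
@[simp] theorem view_setCursor : (σ.setCursor q p).view L = σ.view L := rfl
@[simp] theorem view_push : (σ.push x).view L = σ.view L := rfl

theorem heads_rot : (σ.rot L i v).heads = Function.update σ.heads i
    (Function.update (σ.heads i) v (succPos (L i v) (σ.heads i v))) := rfl

end simps

variable {σ σ' : Store h n} {L : Lists h n} {i : Fin h} {u v : Fin n} {q : Cur} {l : List (Fin n)}

theorem HeadsOk.rot (hσ : σ.HeadsOk L) : (σ.rot L i v).HeadsOk L := by
  intro j u
  rw [heads_rot]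
  by_cases hj : j = i
  · subst hj
    by_cases hu : u = v
    · subst hu; simpa using succPos_ok _ _
    · simpa [hu] using hσ j u
  · simpa [hj] using hσ j u

theorem view_rot (hσ : σ.HeadsOk L) (j : Fin h) (u : Fin n) :
    (σ.rot L i v).view L j u = if j = i ∧ u = v then (σ.view L i v).rotate 1 else σ.view L j u := by
  rw [view, heads_rot]
  by_cases hj : j = i
  · subst hj
    by_cases hu : u = v
    · subst hu; simpa [view] using rotate_succPos _ (hσ j u)
    · simp [hu, view]
  · simp [hj, view]

theorem view_eq_nil : σ.view L i v = [] ↔ L i v = [] := List.rotate_eq_nil_iff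

theorem mem_view : u ∈ σ.view L i v ↔ u ∈ L i v := List.mem_rotate

theorem nodup_view : (σ.view L i v).Nodup ↔ (L i v).Nodup := List.nodup_rotate

theorem length_view : (σ.view L i v).length = (L i v).length := List.length_rotate _ _

/-- The memory, the output, the first `b` registers and the first `c` cursors are the same in `σ`
and in `σ'`. -/
structure Keeps (b c : ℕ) (σ σ' : Store h n) : Prop where
  regs : ∀ r : Reg, r.val < b → σ'.regs r = σ.regs r
  cursors : ∀ q : Cur, q.val < c → σ'.cursors q = σ.cursors q
  mem : σ'.mem = σ.mem
  out : σ'.out = σ.out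

/-- In addition, all list heads are the same. -/
structure Pure (b c : ℕ) (σ σ' : Store h n) : Prop extends Keeps b c σ σ' where
  heads : σ'.heads = σ.heads

section keeps

variable {b c b' c' : ℕ} {σ₁ σ₂ σ₃ : Store h n} {w x : ℕ} {r : Reg} {p : Option (Node h n)}

theorem Keeps.refl (b c : ℕ) (σ : Store h n) : Keeps b c σ σ := ⟨by simp, by simp, rfl, rfl⟩

theorem Pure.refl (b c : ℕ) (σ : Store h n) : Pure b c σ σ := ⟨Keeps.refl b c σ, rfl⟩

theorem Keeps.trans (h1 : Keeps b c σ₁ σ₂) (h2 : Keeps b' c' σ₂ σ₃)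
    (hb : b ≤ b' := by decide) (hc : c ≤ c' := by decide) : Keeps b c σ₁ σ₃ where
  regs r hr := (h2.regs r (hr.trans_le hb)).trans (h1.regs r hr)
  cursors r hr := (h2.cursors r (hr.trans_le hc)).trans (h1.cursors r hr)
  mem := h2.mem.trans h1.mem
  out := h2.out.trans h1.out

theorem Pure.trans (h1 : Pure b c σ₁ σ₂) (h2 : Pure b' c' σ₂ σ₃)
    (hb : b ≤ b' := by decide) (hc : c ≤ c' := by decide) : Pure b c σ₁ σ₃ :=
  ⟨h1.toKeeps.trans h2.toKeeps hb hc, h2.heads.trans h1.heads⟩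

theorem Keeps.mono (h1 : Keeps b' c' σ₁ σ₂) (hb : b ≤ b' := by decide) (hc : c ≤ c' := by decide) :
    Keeps b c σ₁ σ₂ :=
  ⟨fun r hr => h1.regs r (hr.trans_le hb), fun r hr => h1.cursors r (hr.trans_le hc), h1.mem, h1.out⟩

theorem Pure.mono (h1 : Pure b' c' σ₁ σ₂) (hb : b ≤ b' := by decide) (hc : c ≤ c' := by decide) :
    Pure b c σ₁ σ₂ := ⟨h1.toKeeps.mono hb hc, h1.heads⟩

theorem Keeps.setReg (h1 : Keeps b c σ₁ σ₂) (hr : b ≤ r.val := by decide) :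
    Keeps b c σ₁ (σ₂.setReg w r x) where
  regs r' hr' := by
    rw [regs_setReg, if_neg, h1.regs r' hr']
    rintro rfl; omega
  cursors := h1.cursors
  mem := h1.mem
  out := h1.out

theorem Pure.setReg (h1 : Pure b c σ₁ σ₂) (hr : b ≤ r.val := by decide) :
    Pure b c σ₁ (σ₂.setReg w r x) := ⟨h1.toKeeps.setReg hr, h1.heads⟩

theorem Keeps.setCursor (h1 : Keeps b c σ₁ σ₂) (hq : c ≤ q.val := by decide) :
    Keeps b c σ₁ (σ₂.setCursor q p) where
  regs := h1.regs
  cursors r' hr' := by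
    rw [cursors_setCursor, if_neg, h1.cursors r' hr']
    rintro rfl; omega
  mem := h1.mem
  out := h1.out

theorem Pure.setCursor (h1 : Pure b c σ₁ σ₂) (hq : c ≤ q.val := by decide) :
    Pure b c σ₁ (σ₂.setCursor q p) := ⟨h1.toKeeps.setCursor hq, h1.heads⟩

theorem Keeps.rot (h1 : Keeps b c σ₁ σ₂) : Keeps b c σ₁ (σ₂.rot L i v) :=
  ⟨h1.regs, h1.cursors, h1.mem, h1.out⟩

theorem Pure.view (h1 : Pure b c σ₁ σ₂) : σ₂.view L = σ₁.view L := by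
  funext i v; simp [Store.view, h1.heads]

theorem Pure.headsOk (h1 : Pure b c σ₁ σ₂) (hσ : σ₁.HeadsOk L) : σ₂.HeadsOk L := by
  intro i v; rw [h1.heads]; exact hσ i v

end keeps

theorem view_congr (hh : σ'.heads = σ.heads) : σ'.view L = σ.view L := by
  funext i v; simp [Store.view, hh]

theorem HeadsOk.congr (hσ : σ.HeadsOk L) (hh : σ'.heads = σ.heads) : σ'.HeadsOk L := by
  intro i v; rw [hh]; exact hσ i v

theorem At.congr {l : List (Fin n)} (hσ : σ.At L q i v l) (hh : σ'.cursors q = σ.cursors q) :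
    σ'.At L q i v l := by
  obtain ⟨p, h1, h2⟩ := hσ
  exact ⟨p, hh.trans h1, h2⟩

end Store

open Store

section wp

variable {L : Lists h n} {w S : ℕ} {σ : Store h n} {Q : ℕ → Store h n → Prop} {i : Fin h}
  {u v x : Fin n} {q : Cur} {l : List (Fin n)} {a r : Reg}

theorem wp_front_nil (ha : σ.regs a = v.val) (hv : σ.view L i v = []) :
    wp L w S (.prim (.front q i a)) σ Q ↔ Q 1 (σ.setCursor q none) := by
  simp [wp_prim, execPrim, ha, view_eq_nil.1 hv]

theorem wp_front (ha : σ.regs a = v.val) (hσ : σ.HeadsOk L) (hv : σ.view L i v ≠ [])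
    (H : ∀ p, (p < (L i v).length ∧ (L i v).rotate p = σ.view L i v) →
      Q 1 (σ.setCursor q (some (i, v, p)))) :
    wp L w S (.prim (.front q i a)) σ Q := by
  have h0 : L i v ≠ [] := fun h => hv (view_eq_nil.2 h)
  simp only [wp_prim, execPrim, ha, Fin.is_lt, dite_true, h0, if_false, Option.some.injEq,
    exists_eq_left', Fin.eta]
  refine H _ ⟨?_, rfl⟩
  rcases hσ i v with h1 | h1
  · rw [h1]; exact List.length_pos_of_ne_nil h0
  · exact h1

theorem wp_read (hq : σ.At L q i v (x :: l)) :
    wp L w S (.prim (.read r q)) σ Q ↔ Q 1 (σ.setReg w r x.val) := by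
  obtain ⟨p, h1, h2, h3⟩ := hq
  have h4 : (L i v)[p]? = some x := by
    rw [← List.head?_rotate h2, h3]; rfl
  simp [wp_prim, execPrim, h1, h4]

theorem wp_next (hq : σ.At L q i v l)
    (H : ∀ p, (p < (L i v).length ∧ (L i v).rotate p = l.rotate 1) →
      Q 1 (σ.setCursor q (some (i, v, p)))) :
    wp L w S (.prim (.next q)) σ Q := by
  obtain ⟨p, h1, h2, h3⟩ := hq
  simp only [wp_prim, execPrim, h1, Option.map_some, Option.some.injEq, exists_eq_left']
  refine H _ ⟨?_, ?_⟩
  · rcases succPos_ok (L i v) p with h4 | h4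
    · rw [h4]; omega
    · exact h4
  · rw [rotate_succPos _ (Or.inr h2), h3]

/-- `r :=` the vertex at the head of list number `a` of family `i`, which must not be empty. -/
def headOf (i : Fin h) (r a : Reg) (q : Cur) : Cmd h := .prim (.front q i a) ;; .prim (.read r q)

theorem wp_headOf (ha : σ.regs a = v.val) (hσ : σ.HeadsOk L) (hv : σ.view L i v = x :: l)
    (H : ∀ p, Q 2 ((σ.setCursor q p).setReg w r x.val)) :
    wp L w S (headOf i r a q) σ Q := by
  refine wp_seq.2 (wp_front ha hσ (by simp [hv]) fun p hp => ?_)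
  rw [wp_read (i := i) (v := v) (x := x) (l := l) ⟨p, by simp, hp.1, by rw [hp.2, hv]⟩]
  exact H _

end wp

end Rotate

/-! ### Common subroutines -/

namespace Rotate

open Store Dfs

variable {h n : ℕ}

/-- The first registers keep the input `n`, `s`, `w` and the constants `0` and `1`. -/
structure Base (s : Fin n) (w : ℕ) (σ : Store h n) : Prop where
  r0 : σ.regs 0 = n
  r1 : σ.regs 1 = s
  r2 : σ.regs 2 = w
  r3 : σ.regs 3 = 0
  r4 : σ.regs 4 = 1

theorem Store.Keeps.base {b c : ℕ} {s : Fin n} {w : ℕ} {σ σ' : Store h n} (hk : Keeps b c σ σ')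
    (hσ : Base s w σ) (hb : 5 ≤ b := by decide) : Base s w σ' := by
  obtain ⟨h0, h1, h2, h3, h4⟩ := hσ
  constructor
  · rw [hk.regs 0 (by exact (show 0 < 5 by decide).trans_le hb), h0]
  · rw [hk.regs 1 (by exact (show 1 < 5 by decide).trans_le hb), h1]
  · rw [hk.regs 2 (by exact (show 2 < 5 by decide).trans_le hb), h2]
  · rw [hk.regs 3 (by exact (show 3 < 5 by decide).trans_le hb), h3]
  · rw [hk.regs 4 (by exact (show 4 < 5 by decide).trans_le hb), h4]

theorem val_mod {w : ℕ} (hw : n < 2 ^ w) (v : Fin n) : v.val % 2 ^ w = v.val :=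
  Nat.mod_eq_of_lt (v.is_lt.trans hw)

/-- `r := a`. -/
def mov (r a : Reg) : Cmd h := .prim (.op .or r a a)

theorem wp_mov {L : Lists h n} {w S : ℕ} {σ : Store h n} {Q : ℕ → Store h n → Prop} {r a : Reg} :
    wp L w S (mov r a) σ Q ↔ Q 1 (σ.setReg w r (σ.regs a)) := by
  simp [mov, wp_op, BinOp.eval]

/-! ### The bit vector of visited vertices -/

/-- The memory holds the characteristic vector of `T`, `w` vertices per word. -/
def Bits (w : ℕ) (m : ℕ → ℕ) (T : List (Fin n)) : Prop :=
  (∀ v : Fin n, (m (v.val / w)).testBit (v.val % w) = decide (v ∈ T)) ∧ ∀ a, m a < 2 ^ w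

/-- `r := 1` if vertex `a` is visited, `r := 0` otherwise. -/
def testBit (r a : Reg) : Cmd h :=
  .prim (.op .div 30 a 2) ;; .prim (.load 30 30) ;; .prim (.op .mod 31 a 2) ;;
  .prim (.op .shr 30 30 31) ;; .prim (.op .and r 30 4)

/-- Mark vertex `a` as visited. -/
def setBit (a : Reg) : Cmd h :=
  .prim (.op .div 30 a 2) ;; .prim (.op .mod 31 a 2) ;; .prim (.op .shl 31 4 31) ;;
  .prim (.load 29 30) ;; .prim (.op .or 29 29 31) ;; .prim (.store 30 29)

section

variable {L : Lists h n} {w S : ℕ} {σ : Store h n} {Q : ℕ → Store h n → Prop} {s : Fin n}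
  {v x : Fin n} {T : List (Fin n)} {a r : Reg} {i : Fin h}

theorem wp_testBit (hw : n < 2 ^ w) (hS : n / w < S) (hw0 : 0 < w) (hb : Base s w σ)
    (hT : Bits w σ.mem T) (ha : σ.regs a = v.val) (ha30 : a ≠ 30) (hr : r.val < 29) :
    wp L w S (testBit r a) σ fun t σ' => t = 5 ∧ σ'.regs r = (if v ∈ T then 1 else 0) ∧
      (∀ r' : Reg, r' ≠ r → r'.val < 29 → σ'.regs r' = σ.regs r') ∧
      σ'.cursors = σ.cursors ∧ σ'.mem = σ.mem ∧ σ'.heads = σ.heads ∧ σ'.out = σ.out := by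
  have hv : v.val / w ≤ n / w := Nat.div_le_div_right v.is_lt.le
  have hvw : v.val / w < 2 ^ w := (Nat.div_le_self _ _).trans_lt (v.is_lt.trans hw)
  have hmw : v.val % w < 2 ^ w := (Nat.mod_lt _ hw0).trans Nat.lt_two_pow_self
  have hmm : ∀ x, σ.mem x % 2 ^ w = σ.mem x := fun x => Nat.mod_eq_of_lt (hT.2 x)
  have hsh : ∀ y, (σ.mem (v.val / w) >>> y) % 2 ^ w = σ.mem (v.val / w) >>> y := fun y =>
    Nat.mod_eq_of_lt ((Nat.shiftRight_le _ _).trans_lt (hT.2 _))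
  simp only [testBit, wp_seq, wp_op]
  rw [wp_load (by simpa [ha, hb.r2, BinOp.eval, Nat.mod_eq_of_lt hvw] using hv.trans_lt hS)]
  have h30 : r ≠ 30 := by rintro rfl; revert hr; decide
  have h31 : r ≠ 31 := by rintro rfl; revert hr; decide
  simp only [BinOp.eval, regs_setReg, mem_setReg, cursors_setReg, heads_setReg, out_setReg, if_true,
    ha, hb.r2, hb.r4, ha30, if_false, Nat.mod_eq_of_lt hvw, Nat.mod_eq_of_lt hmw, hmm, hsh,
    show ((2 : Reg) = 30) = False by decide, show ((4 : Reg) = 30) = False by decide,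
    show ((4 : Reg) = 31) = False by decide, show ((30 : Reg) = 31) = False by decide]
  refine ⟨trivial, ?_, ?_, trivial, trivial, trivial, trivial⟩
  · have h2 := hT.1 v
    rw [Nat.testBit, Nat.and_comm] at h2
    rw [Nat.and_one_is_mod] at h2 ⊢
    rw [Nat.mod_eq_of_lt (b := 2 ^ w) ((Nat.mod_lt _ two_pos).trans_le
      (Nat.pow_le_pow_right two_pos hw0))]
    have h3 := Nat.mod_two_eq_zero_or_one (σ.mem (v.val / w) >>> (v.val % w))
    by_cases hvT : v ∈ T
    · simp only [hvT, decide_true, bne_iff_ne] at h2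
      simp only [hvT, if_true]
      omega
    · simp only [hvT, decide_false, bne_eq_false_iff_eq] at h2
      simp only [hvT, if_false]
      omega
  · intro r' hr' hr29
    have h30 : r' ≠ 30 := by rintro rfl; revert hr29; decide
    have h31 : r' ≠ 31 := by rintro rfl; revert hr29; decide
    simp [hr', h30, h31]

theorem wp_setBit (hw : n < 2 ^ w) (hS : n / w < S) (hw0 : 0 < w) (hb : Base s w σ)
    (hT : Bits w σ.mem T) (ha : σ.regs a = v.val) (ha30 : a ≠ 30) :
    wp L w S (setBit a) σ fun t σ' => t = 6 ∧ Bits w σ'.mem (T ++ [v]) ∧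
      (∀ r' : Reg, r'.val < 29 → σ'.regs r' = σ.regs r') ∧
      σ'.cursors = σ.cursors ∧ σ'.heads = σ.heads ∧ σ'.out = σ.out := by
  have hv : v.val / w ≤ n / w := Nat.div_le_div_right v.is_lt.le
  have hvw : v.val / w < 2 ^ w := (Nat.div_le_self _ _).trans_lt (v.is_lt.trans hw)
  have hmw : v.val % w < 2 ^ w := (Nat.mod_lt _ hw0).trans Nat.lt_two_pow_self
  have hsl : (1 <<< (v.val % w)) < 2 ^ w := by
    rw [Nat.one_shiftLeft]
    exact Nat.pow_lt_pow_right (by norm_num) (Nat.mod_lt _ hw0)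
  have hmm : ∀ x, σ.mem x % 2 ^ w = σ.mem x := fun x => Nat.mod_eq_of_lt (hT.2 x)
  have hor : (σ.mem (v.val / w) ||| 1 <<< (v.val % w)) < 2 ^ w := Nat.or_lt_two_pow (hT.2 _) hsl
  simp only [setBit, wp_seq, wp_op]
  rw [wp_load (by simpa [ha, hb.r2, BinOp.eval, Nat.mod_eq_of_lt hvw] using hv.trans_lt hS)]
  rw [wp_store (by simpa [ha, hb.r2, BinOp.eval, Nat.mod_eq_of_lt hvw] using hv.trans_lt hS)]
  simp only [BinOp.eval, regs_setReg, mem_setReg, if_true,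
    ha, hb.r2, hb.r4, ha30, if_false, Nat.mod_eq_of_lt hvw, Nat.mod_eq_of_lt hmw, hmm,
    Nat.mod_eq_of_lt hsl, Nat.mod_eq_of_lt hor, mem_setMem, regs_setMem,
    show ((2 : Reg) = 30) = False by decide, show ((4 : Reg) = 30) = False by decide,
    show ((4 : Reg) = 31) = False by decide, show ((30 : Reg) = 31) = False by decide,
    show ((30 : Reg) = 29) = False by decide, show ((31 : Reg) = 29) = False by decide]
  refine ⟨trivial, ⟨?_, ?_⟩, ?_, rfl, rfl, rfl⟩
  · intro u
    rw [Function.update_apply]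
    split
    · rename_i huv
      rw [Nat.testBit_or, Nat.one_shiftLeft, Nat.testBit_two_pow, ← huv, hT.1 u]
      have : v.val % w = u.val % w ↔ u = v := by
        constructor
        · intro hm
          ext
          rw [← Nat.div_add_mod u.val w, ← Nat.div_add_mod v.val w, huv, hm]
        · rintro rfl; rfl
      simp [this, Bool.decide_or]
    · rename_i huv
      have : u ≠ v := by rintro rfl; exact huv rfl
      simp [hT.1 u, this]
  · intro b
    rw [Function.update_apply]
    split
    · exact hor
    · exact hT.2 b
  · intro r' hr29
    have h29 : r' ≠ 29 := by rintro rfl; revert hr29; decide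
    have h30 : r' ≠ 30 := by rintro rfl; revert hr29; decide
    have h31 : r' ≠ 31 := by rintro rfl; revert hr29; decide
    simp [h29, h30, h31]

/-! ### Rotating a list until a given vertex is at its head -/

/-- Rotate list number `a` of family `i` until the vertex `t` is at its head. -/
def rotateUntil (i : Fin h) (a t : Reg) : Cmd h :=
  headOf i 28 a 7 ;; .loop (.eq 28 t) (.prim (.rotate i a) ;; headOf i 28 a 7)

/-- The time is proportional to the length of the list, and the order of the entries is kept. -/
theorem wp_rotateUntil {l₁ l₂ : List (Fin n)} (hw : n < 2 ^ w) (hσ : σ.HeadsOk L)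
    (ha : σ.regs a = v.val) (hr : σ.regs r = x.val) (ha28 : a.val < 28) (hr28 : r.val < 28)
    (hv : σ.view L i v = l₁ ++ x :: l₂) (hx : x ∉ l₁) :
    wp L w S (rotateUntil i a r) σ fun t σ' => t ≤ 5 * l₁.length + 3 ∧ Keeps 28 7 σ σ' ∧
      σ'.HeadsOk L ∧ σ'.view L i v = x :: l₂ ++ l₁ ∧
      ∀ j u, ¬ (j = i ∧ u = v) → σ'.view L j u = σ.view L j u := by
  obtain ⟨y, l, hyl⟩ : ∃ y l, l₁ ++ x :: l₂ = y :: l := by cases l₁ <;> simp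
  refine wp_seq.2 (wp_headOf ha hσ (hv.trans hyl) fun p => ?_)
  refine wp_loop (fun m t σ' => ∃ d e y, l₁ = d ++ e ∧ m = e.length ∧
    t ≤ 5 * d.length ∧ Keeps 28 7 σ σ' ∧ σ'.HeadsOk L ∧ (∃ l, e ++ x :: l₂ = y :: l) ∧
    σ'.view L i v = e ++ x :: l₂ ++ d ∧ σ'.regs 28 = y.val ∧
    ∀ j u, ¬ (j = i ∧ u = v) → σ'.view L j u = σ.view L j u) l₁.length ?_ ?_ ?_
  · exact ⟨[], l₁, y, rfl, rfl, le_rfl, ((Keeps.refl 28 7 σ).setCursor).setReg,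
      hσ, ⟨l, hyl⟩, by simpa using hv, by simp [val_mod hw], fun _ _ _ => rfl⟩
  · rintro m t σ' ⟨d, e, y, rfl, rfl, ht, hk, hok, ⟨l, hl⟩, hvw, h28, hoth⟩ hne
    have hxr : σ'.regs r = x.val := (hk.regs r hr28).trans hr
    have hva : σ'.regs a = v.val := (hk.regs a ha28).trans ha
    have hyx : y ≠ x := by
      rintro rfl
      exact hne (h28.trans hxr.symm)
    obtain ⟨e, rfl⟩ : ∃ e', e = y :: e' := by
      cases e with
      | nil => simp at hl; exact absurd hl.1.symm hyx
      | cons z e => simp at hl; exact ⟨e, by rw [hl.1]⟩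
    have hvw' : (σ'.rot L i v).view L i v = e ++ x :: l₂ ++ (d ++ [y]) := by
      rw [view_rot hok]
      simp [hvw]
    obtain ⟨z, l', hzl⟩ : ∃ y l, e ++ x :: l₂ = y :: l := by cases e <;> simp
    refine wp_seq.2 ((wp_rotate hva).2 (wp_headOf (l := l' ++ (d ++ [y])) (by simpa using hva)
      hok.rot (by rw [hvw', hzl]; rfl) fun p => ?_))
    refine ⟨e.length, by simp, d ++ [y], e, z, by simp, rfl, ?_, ((hk.rot).setCursor).setReg,
      hok.rot, ⟨l', hzl⟩, hvw', by simp [val_mod hw], fun j u hju => ?_⟩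
    · simp; omega
    · rw [← hoth j u hju]
      exact (view_rot hok j u).trans (if_neg hju)
  · rintro m t σ' ⟨d, e, y, rfl, rfl, ht, hk, hok, ⟨l, hl⟩, hvw, h28, hoth⟩ heq
    have hxr : σ'.regs r = x.val := (hk.regs r hr28).trans hr
    have hyx : y = x := Fin.ext (by rw [← h28, ← hxr]; exact heq)
    subst hyx
    have he : e = [] := by
      cases e with
      | nil => rfl
      | cons z e => simp at hl; simp [hl.1] at hx
    subst he
    refine ⟨?_, hk, hok, by simpa using hvw, hoth⟩
    simp; omega

end

end Rotate

/-! ### Scanning an adjacency list for an unvisited vertex -/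

namespace Rotate

open Store Dfs

variable {h n : ℕ}

/-- Rotate list number `r5` of family `i` until an unvisited vertex is at its head; this vertex is
stored in `r10`.  If there is none, the list makes a full turn.  The answer is given in `r11`. -/
def scan (i : Fin h) : Cmd h :=
  .prim (.const 11 0) ;; .prim (.front 0 i 5) ;;
  .ite (.null 0) .skip
    (.prim (.read 12 0) ;; mov 10 12 ;; .prim (.const 13 1) ;;
      .loop (.eq 13 3)
        (testBit 14 10 ;;
          .ite (.eq 14 3) (.prim (.const 11 1) ;; .prim (.const 13 0))
            (.prim (.rotate i 5) ;; headOf i 10 5 0 ;;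
              .ite (.eq 10 12) (.prim (.const 13 0)) .skip)))

variable {L : Lists h n} {w S : ℕ} {σ : Store h n} {s u : Fin n} {T : List (Fin n)} {i : Fin h}

/-- The two possible outcomes of `scan`, with the time they take. -/
inductive ScanPost (L : Lists h n) (σ σ' : Store h n) (i : Fin h) (u : Fin n) (T : List (Fin n))
    (t : ℕ) : Prop
  | found (l₁ l₂ : List (Fin n)) (x : Fin n) (hv : σ.view L i u = l₁ ++ x :: l₂)
      (h₁ : ∀ y ∈ l₁, y ∈ T) (hx : x ∉ T) (hv' : σ'.view L i u = x :: l₂ ++ l₁)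
      (ht : t ≤ 16 * l₁.length + 20) (h11 : σ'.regs 11 = 1) (h10 : σ'.regs 10 = x)
  | none (h₁ : ∀ y ∈ σ.view L i u, y ∈ T) (hv' : σ'.view L i u = σ.view L i u)
      (ht : t ≤ 16 * (σ.view L i u).length + 20) (h11 : σ'.regs 11 = 0)

theorem wp_scan (hw : n < 2 ^ w) (hS : n / w < S) (hw0 : 0 < w) (hb : Base s w σ)
    (hT : Bits w σ.mem T) (hσ : σ.HeadsOk L) (h5 : σ.regs 5 = u.val) (hnd : (L i u).Nodup) :
    wp L w S (scan i) σ fun t σ' => Keeps 10 0 σ σ' ∧ σ'.HeadsOk L ∧ ScanPost L σ σ' i u T t ∧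
      ∀ j v, ¬ (j = i ∧ v = u) → σ'.view L j v = σ.view L j v := by
  have h1w : 1 % 2 ^ w = 1 := Nat.mod_eq_of_lt (Nat.one_lt_two_pow hw0.ne')
  rcases hvu : σ.view L i u with _ | ⟨x₀, l⟩
  · simp only [scan, wp_seq, wp_const]
    refine (wp_front_nil (v := u) (by simpa using h5) (by simpa using hvu)).2 ?_
    simp only [wp_ite, Test.holds, wp_skip, cursors_setCursor, if_true, true_imp_iff,
      not_true_eq_false, false_imp_iff, and_true]
    refine ⟨((Keeps.refl 10 0 σ).setReg).setCursor, hσ, .none (by simp [hvu]) (by simp) (by simp)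
      (by simp), fun _ _ _ => rfl⟩
  simp only [scan, wp_seq, wp_const]
  refine wp_front (v := u) (by simpa using h5) hσ (by simp [hvu]) fun p hp => ?_
  simp only [wp_ite, Test.holds, cursors_setCursor, if_true, reduceCtorEq, false_imp_iff, true_and,
    not_false_eq_true, true_imp_iff, wp_seq]
  rw [wp_read (i := i) (v := u) (x := x₀) (l := l) ⟨p, by simp, hp.1, by rw [hp.2]; simpa using hvu⟩]
  simp only [wp_mov, wp_const]
  refine wp_loop (fun m t σ' => Keeps 10 0 σ σ' ∧ σ'.HeadsOk L ∧
    (∀ j v, ¬ (j = i ∧ v = u) → σ'.view L j v = σ.view L j v) ∧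
    ((σ'.regs 13 = 1 ∧ ∃ d y e, σ.view L i u = d ++ y :: e ∧ σ'.view L i u = y :: e ++ d ∧
      (∀ z ∈ d, z ∈ T) ∧ σ'.regs 10 = y.val ∧ σ'.regs 12 = x₀.val ∧ σ'.regs 11 = 0 ∧
      m = e.length + 1 ∧ t ≤ 16 * d.length) ∨
      (σ'.regs 13 = 0 ∧ m = 0 ∧ ScanPost L σ σ' i u T (t + 8)))) (l.length + 1) ?_ ?_ ?_
  · refine ⟨by repeat (first | exact Keeps.refl 10 0 σ | refine Keeps.setReg ?_ |
      refine Keeps.setCursor ?_),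
      hσ, fun _ _ _ => rfl, Or.inl ⟨?_, [], x₀, l, ?_⟩⟩
    · simp [h1w]
    · simp [hvu, val_mod hw]
  · rintro m t σ' ⟨hk, hok, hoth, ⟨h13, d, y, e, hd, hv', hdT, h10, h12, h11, rfl, ht⟩ |
      ⟨h13, rfl, hp⟩⟩ hne
    swap
    · exact absurd (h13.trans (hk.base hb).r3.symm) hne
    refine (wp_testBit hw hS hw0 (hk.base hb) (T := T) (by rw [hk.mem]; exact hT) h10 (by decide)
      (by decide)).seq ?_
    rintro _ σ₁ ⟨rfl, h14, hr, hc, hm, hh, ho⟩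
    have hk1 : Keeps 10 0 σ σ₁ := ⟨fun r hr' => by
      rw [hr r (by rintro rfl; revert hr'; decide) (hr'.trans (by decide)), hk.regs r hr'],
      by simp, hm.trans hk.mem, ho.trans hk.out⟩
    have hok1 : σ₁.HeadsOk L := hok.congr hh
    have hvv : σ₁.view L = σ'.view L := view_congr hh
    have h10' : σ₁.regs 10 = y.val := by rw [hr 10 (by decide) (by decide), h10]
    have h12' : σ₁.regs 12 = x₀.val := by rw [hr 12 (by decide) (by decide), h12]
    have h11' : σ₁.regs 11 = 0 := by rw [hr 11 (by decide) (by decide), h11]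
    have h13' : σ₁.regs 13 = 1 := by rw [hr 13 (by decide) (by decide), h13]
    simp only [wp_ite, Test.holds, h14, (hk1.base hb).r3]
    refine ⟨fun h0 => ?_, fun h0 => ?_⟩
    · have hyT : y ∉ T := by
        intro hyT
        simp [hyT] at h0
      simp only [wp_seq, wp_const]
      refine ⟨0, by simp, ?_, hok1, fun j v hjv => by rw [← hoth j v hjv, ← hvv]; rfl,
        Or.inr ⟨by simp, rfl, ?_⟩⟩
      · repeat (first | exact hk1 | refine Keeps.setReg ?_)
      · refine .found d e y hd hdT hyT ?_ ?_ ?_ ?_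
        · simpa [hvv] using hv'
        · omega
        · simp [h1w]
        · simpa using h10'
    · have hyT : y ∈ T := by
        by_contra hyT
        simp [hyT] at h0
      refine wp_seq.2 ((wp_rotate (v := u) (by rw [hk1.regs 5 (by decide), h5])).2 ?_)
      have hvr : (σ₁.rot L i u).view L i u = e ++ (d ++ [y]) := by
        rw [view_rot hok1, hvv, hv']
        simp
      have hor : ∀ j v, ¬ (j = i ∧ v = u) → (σ₁.rot L i u).view L j v = σ.view L j v := by
        intro j v hjv
        rw [← hoth j v hjv, view_rot hok1, if_neg hjv, hvv]
      have hkr : Keeps 10 0 σ (σ₁.rot L i u) := hk1.rot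
      have hdyT : ∀ z ∈ d ++ [y], z ∈ T := by
        intro z hz
        rcases List.mem_append.1 hz with hz | hz
        · exact hdT z hz
        · rw [List.mem_singleton.1 hz]; exact hyT
      rcases e with _ | ⟨z, e⟩
      · -- the list has made a full turn
        obtain ⟨l', hl'⟩ : ∃ l', d ++ [y] = x₀ :: l' := ⟨l, by rw [← hd, hvu]⟩
        refine wp_seq.2 (wp_headOf (v := u) (x := x₀) (l := l') ?_ hok1.rot ?_ fun p => ?_)
        · simp [hk1.regs 5 (by decide), h5]
        · rw [hvr, hl']; rfl
        simp only [wp_ite, Test.holds, regs_setReg, if_true, regs_setCursor, regs_rot, h12', val_mod hw,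
          show ((12 : Reg) = 10) = False by decide, if_false, true_imp_iff, not_true_eq_false,
          false_imp_iff, and_true, wp_const]
        refine ⟨0, by simp, ?_, hok1.rot, hor, Or.inr ⟨by simp, rfl, ?_⟩⟩
        · repeat (first | exact hkr | refine Keeps.setReg ?_ | refine Keeps.setCursor ?_)
        · refine .none ?_ ?_ ?_ ?_
          · rw [hd]; exact hdyT
          · rw [hd]; exact hvr
          · rw [hd]; simp; omega
          · simpa using h11'
      · refine wp_seq.2 (wp_headOf (v := u) (x := z) (l := e ++ (d ++ [y])) ?_ hok1.rot ?_ fun p => ?_)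
        · simp [hk1.regs 5 (by decide), h5]
        · rw [hvr]; rfl
        have hzx : z.val ≠ x₀.val := by
          intro hzx
          have hnd' := (nodup_view (σ := σ)).2 hnd
          rw [hd] at hnd'
          rw [hd] at hvu
          rcases d with _ | ⟨d₀, d⟩
          · simp at hvu hnd'
            exact hnd'.1.1 (by rw [hvu.1]; exact (Fin.ext hzx).symm)
          · simp at hvu hnd'
            exact hnd'.1.2.2.1 (by rw [hvu.1]; exact (Fin.ext hzx.symm))
        simp only [wp_ite, Test.holds, regs_setReg, if_true, regs_setCursor, regs_rot, h12', val_mod hw,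
          show ((12 : Reg) = 10) = False by decide, if_false, hzx, false_imp_iff, true_and,
          not_false_eq_true, true_imp_iff, wp_skip]
        refine ⟨e.length + 1, by simp, ?_, hok1.rot, hor, Or.inl ⟨by simpa using h13',
          d ++ [y], z, e, by simpa using hd, hvr, hdyT, rfl, by simpa using h11', rfl, ?_⟩⟩
        · repeat (first | exact hkr | refine Keeps.setReg ?_ | refine Keeps.setCursor ?_)
        · simp; omega
  · rintro m t σ' ⟨hk, hok, hoth, ⟨h13, d, y, e, hd, hv', hdT, h10, h12, h11, rfl, ht⟩ |
      ⟨h13, rfl, hp⟩⟩ heq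
    · have : σ'.regs 13 = σ'.regs 3 := heq
      rw [h13, (hk.base hb).r3] at this
      exact absurd this one_ne_zero
    · refine ⟨hk, hok, ?_, hoth⟩
      cases hp with
      | found l₁ l₂ x hv h₁ hx hv' ht h11 h10 =>
        exact .found l₁ l₂ x hv h₁ hx hv' (by omega) h11 h10
      | none h₁ hv' ht h11 => exact .none h₁ hv' (by omega) h11

end Rotate

/-! ### Lexicographic DFS with a bit vector, up to the treatment of tree edges -/

namespace Rotate

open Store Dfs

variable {h n : ℕ}

/-- Output vertex `a` and mark it as visited. -/
def visit (a : Reg) : Cmd h := .prim (.output a) ;; setBit a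

/-- Search the tree with root `r6`, with current vertex `r5`.  The command `enter` is executed when
the unvisited neighbour `r10` of `r5` has been visited; it has to make `r10` the current vertex.  The
command `leave` is executed when all neighbours of `r5` are visited; it has to go back to the parent
of `r5`.  The flag `r8` says whether the tree is incomplete, and `r9` is 1 at the beginning. -/
def lexTree (i : Fin h) (enter leave : Cmd h) : Cmd h :=
  visit 6 ;; mov 5 6 ;; .prim (.const 8 1) ;; .prim (.const 9 1) ;;
  .loop (.eq 8 3)
    (scan i ;;
      .ite (.eq 11 4) (visit 10 ;; enter) (.ite (.eq 5 6) (.prim (.const 8 0)) leave))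

/-- Search the tree of the source, and then, for all unvisited vertices `r7`, the tree of `r7`. -/
def lexMain (i : Fin h) (enter leave : Cmd h) : Cmd h :=
  .prim (.const 4 1) ;; mov 6 1 ;; lexTree i enter leave ;; .prim (.const 7 0) ;;
  .loop (.eq 7 0)
    (testBit 14 7 ;; .ite (.eq 14 3) (mov 6 7 ;; lexTree i enter leave) .skip ;;
      .prim (.op .add 7 7 4))

/-- The part of the invariant that is common to directed and undirected graphs.  The list of a vertex
on the stack has been rotated so that it starts with the unscanned part, and the list of an unvisited
vertex has not been rotated.  There are no conditions on completed vertices. -/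
structure LexCore (L : Lists h n) (i : Fin h) (r : Fin n → Fin n → Prop) (s : Fin n) (w : ℕ)
    (root : Fin n) (σ : Store h n) (T : List (Fin n × ℕ)) (F : List (Frame n)) : Prop where
  base : Base s w σ
  ok : σ.HeadsOk L
  bits : Bits w σ.mem (visited T)
  out : σ.out = (visited T).map Fin.val
  snap : Snapshot r (L i) T F
  r6 : F ≠ [] → σ.regs 6 = root.val
  last : ∀ v ∈ (verts F).getLast?, v = root
  frames : ∀ f ∈ F, ∃ pre, L i f.1 = pre ++ f.2 ∧ σ.view L i f.1 = f.2 ++ pre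
  white : ∀ v, v ∉ visited T → σ.view L i v = L i v

/-- What the commands `enter` and `leave` have to guarantee.  `X` is an invariant that depends on the
lists as seen from their heads, on `r9`, the trace and the stack; `P` is a potential that pays for the
running time, including that of `scan`. -/
structure LexSpec (L : Lists h n) (i : Fin h) (r : Fin n → Fin n → Prop) (s : Fin n) (w S : ℕ)
    (enter leave : Cmd h)
    (X : (Fin h → Fin n → List (Fin n)) → ℕ → List (Fin n × ℕ) → List (Frame n) → Prop)
    (P : (Fin h → Fin n → List (Fin n)) → List (Fin n × ℕ) → List (Frame n) → ℕ) : Prop where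
  enter : ∀ root σ₀ T u l₁ x l₂ F σ, LexCore L i r s w root σ₀ T ((u, l₁ ++ x :: l₂) :: F) →
    X (σ₀.view L) (σ₀.regs 9) T ((u, l₁ ++ x :: l₂) :: F) → (∀ y ∈ l₁, y ∈ visited T) →
    x ∉ visited T →
    LexCore L i r s w root σ (T ++ [(x, F.length + 1)]) ((x, L i x) :: (u, x :: l₂) :: F) →
    σ.regs 5 = u.val → σ.regs 10 = x.val → σ.regs 8 = 1 → σ.regs 9 = σ₀.regs 9 →
    (∀ j v, ¬ (j = i ∧ v = u) → σ.view L j v = σ₀.view L j v) →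
    wp L w S enter σ fun t σ' =>
      LexCore L i r s w root σ' (T ++ [(x, F.length + 1)]) ((x, L i x) :: (u, x :: l₂) :: F) ∧
      X (σ'.view L) (σ'.regs 9) (T ++ [(x, F.length + 1)]) ((x, L i x) :: (u, x :: l₂) :: F) ∧
      σ'.regs 5 = x.val ∧ σ'.regs 8 = 1 ∧ σ'.regs 7 = σ.regs 7 ∧
      t + 16 * l₁.length + 60 +
        P (σ'.view L) (T ++ [(x, F.length + 1)]) ((x, L i x) :: (u, x :: l₂) :: F) ≤
      P (σ₀.view L) T ((u, l₁ ++ x :: l₂) :: F)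
  leave : ∀ root T u l f F σ, LexCore L i r s w root σ T ((u, l) :: f :: F) →
    X (σ.view L) (σ.regs 9) T ((u, l) :: f :: F) → (∀ y ∈ L i u, y ∈ visited T) →
    σ.regs 5 = u.val → σ.regs 8 = 1 →
    wp L w S leave σ fun t σ' =>
      LexCore L i r s w root σ' T (f :: F) ∧ X (σ'.view L) (σ'.regs 9) T (f :: F) ∧
      σ'.regs 5 = f.1.val ∧ σ'.regs 8 = 1 ∧ σ'.regs 7 = σ.regs 7 ∧
      t + 16 * (L i u).length + 60 + P (σ'.view L) T (f :: F) ≤ P (σ.view L) T ((u, l) :: f :: F)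
  finish : ∀ root T u l σ, LexCore L i r s w root σ T [(u, l)] →
    X (σ.view L) (σ.regs 9) T [(u, l)] → (∀ y ∈ L i u, y ∈ visited T) →
    X (σ.view L) (σ.regs 9) T [] ∧
      16 * (L i u).length + 60 + P (σ.view L) T [] ≤ P (σ.view L) T [(u, l)]
  start : ∀ root₀ T x σ, LexCore L i r s w root₀ σ T [] → X (σ.view L) (σ.regs 9) T [] →
    x ∉ visited T → X (σ.view L) 1 (T ++ [(x, 0)]) [(x, L i x)] ∧
      60 + P (σ.view L) (T ++ [(x, 0)]) [(x, L i x)] ≤ P (σ.view L) T []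

variable {L : Lists h n} {i : Fin h} {r : Fin n → Fin n → Prop} {s : Fin n} {w S : ℕ}
  {enter leave : Cmd h}
  {X : (Fin h → Fin n → List (Fin n)) → ℕ → List (Fin n × ℕ) → List (Frame n) → Prop}
  {P : (Fin h → Fin n → List (Fin n)) → List (Fin n × ℕ) → List (Frame n) → ℕ}
  {σ σ' : Store h n} {T : List (Fin n × ℕ)} {F : List (Frame n)} {root root' x u : Fin n} {a : Reg}
  {l l₁ l₂ : List (Fin n)}

theorem wp_visit (hw : n < 2 ^ w) (hS : n / w < S) (hw0 : 0 < w) (hb : Base s w σ)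
    (hT : Bits w σ.mem (visited T)) (ho : σ.out = (visited T).map Fin.val) (ha : σ.regs a = x.val)
    (ha30 : a ≠ 30) (d : ℕ) :
    wp L w S (visit a) σ fun t σ' => t = 7 ∧ Bits w σ'.mem (visited (T ++ [(x, d)])) ∧
      (∀ r' : Reg, r'.val < 29 → σ'.regs r' = σ.regs r') ∧ σ'.heads = σ.heads ∧
      σ'.out = (visited (T ++ [(x, d)])).map Fin.val := by
  simp only [visit, wp_seq, wp_output]
  refine (wp_setBit (σ := σ.push (σ.regs a)) (T := visited T) hw hS hw0 ⟨hb.1, hb.2, hb.3, hb.4, hb.5⟩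
    hT ha ha30).mono ?_
  rintro _ σ' ⟨rfl, hT', hr, -, hh, ho'⟩
  refine ⟨rfl, by simpa using hT', hr, hh, ?_⟩
  rw [ho', out_push, ho, ha]
  simp

theorem Base.congr {σ σ' : Store h n} (hσ : Base s w σ) {b : ℕ}
    (hk : ∀ r : Reg, r.val < b → σ'.regs r = σ.regs r) (hb : 5 ≤ b := by decide) : Base s w σ' := by
  obtain ⟨h0, h1, h2, h3, h4⟩ := hσ
  constructor
  · rw [hk 0 (by exact (show 0 < 5 by decide).trans_le hb), h0]
  · rw [hk 1 (by exact (show 1 < 5 by decide).trans_le hb), h1]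
  · rw [hk 2 (by exact (show 2 < 5 by decide).trans_le hb), h2]
  · rw [hk 3 (by exact (show 3 < 5 by decide).trans_le hb), h3]
  · rw [hk 4 (by exact (show 4 < 5 by decide).trans_le hb), h4]

namespace LexCore

/-- The parts of the invariant that do not mention the registers. -/
theorem congr (hc : LexCore L i r s w root σ T F) (hb : Base s w σ') (hok : σ'.HeadsOk L)
    (hm : σ'.mem = σ.mem) (ho : σ'.out = σ.out) (h6 : σ'.regs 6 = σ.regs 6)
    (hv : ∀ v, σ'.view L i v = σ.view L i v) : LexCore L i r s w root σ' T F where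
  base := hb
  ok := hok
  bits := hm ▸ hc.bits
  out := ho ▸ hc.out
  snap := hc.snap
  r6 := fun hF => h6.trans (hc.r6 hF)
  last := hc.last
  frames := fun f hf => by rw [hv]; exact hc.frames f hf
  white := fun v hv' => by rw [hv]; exact hc.white v hv'

theorem frame (hc : LexCore L i r s w root σ T ((u, l) :: F)) :
    ∃ pre, L i u = pre ++ l ∧ σ.view L i u = l ++ pre ∧ ∀ y ∈ pre, y ∈ visited T := by
  obtain ⟨pre, h1, h2⟩ := hc.frames _ List.mem_cons_self
  obtain ⟨pre', h1', h2'⟩ := hc.snap.scanned _ List.mem_cons_self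
  have : pre = pre' := List.append_cancel_right (h1.symm.trans h1')
  exact ⟨pre, h1, h2, this ▸ h2'⟩

theorem nodup (hc : LexCore L i r s w root σ T F) (v : Fin n) : (L i v).Nodup := (hc.snap.order v).1

theorem pop (hc : LexCore L i r s w root σ T ((u, l) :: F)) (hu : ∀ y ∈ L i u, y ∈ visited T) :
    LexCore L i r s w root σ T F where
  base := hc.base
  ok := hc.ok
  bits := hc.bits
  out := hc.out
  snap := by
    obtain ⟨pre, h1, h2, h3⟩ := hc.frame
    have := hc.snap
    rw [← List.append_nil l] at this
    exact (this.skip_append fun y hy => hu y (by rw [h1]; simp [hy])).pop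
  r6 := fun _ => hc.r6 (by simp)
  last := by
    cases F with
    | nil => simp
    | cons f F =>
      have := hc.last
      simp only [verts, List.map_cons, List.getLast?_cons_cons] at this ⊢
      exact this
  frames := fun f hf => hc.frames f (List.mem_cons_of_mem _ hf)
  white := hc.white

end LexCore

/-- The loop of `lexTree`. -/
theorem wp_lexTree_loop (hw : n < 2 ^ w) (hS : n / w < S) (hw0 : 0 < w)
    (hL : LexSpec L i r s w S enter leave X P) (hc : LexCore L i r s w root σ T F)
    (hX : X (σ.view L) (σ.regs 9) T F) (hF : ∃ f F', F = f :: F' ∧ σ.regs 5 = f.1.val)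
    (h8 : σ.regs 8 = 1) :
    wp L w S (.loop (.eq 8 3)
      (scan i ;;
        .ite (.eq 11 4) (visit 10 ;; enter) (.ite (.eq 5 6) (.prim (.const 8 0)) leave))) σ
      fun t σ' => LexCore L i r s w root σ' (unwind (L i) T F) [] ∧
        X (σ'.view L) (σ'.regs 9) (unwind (L i) T F) [] ∧ σ'.regs 7 = σ.regs 7 ∧
        t + P (σ'.view L) (unwind (L i) T F) [] ≤ P (σ.view L) T F + 1 := by
  refine wp_loop (fun m t σ' => ∃ T' F', m = P (σ'.view L) T' F' ∧
    unwind (L i) T' F' = unwind (L i) T F ∧ LexCore L i r s w root σ' T' F' ∧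
    X (σ'.view L) (σ'.regs 9) T' F' ∧ σ'.regs 7 = σ.regs 7 ∧
    t + P (σ'.view L) T' F' ≤ P (σ.view L) T F ∧
    ((∃ f F'', F' = f :: F'' ∧ σ'.regs 5 = f.1.val ∧ σ'.regs 8 = 1) ∨ (F' = [] ∧ σ'.regs 8 = 0)))
    (P (σ.view L) T F) ?_ ?_ ?_
  · obtain ⟨f, F', h1, h2⟩ := hF
    exact ⟨T, F, rfl, rfl, hc, hX, rfl, by simp, Or.inl ⟨f, F', h1, h2, h8⟩⟩
  · rintro m t σ' ⟨T', F', rfl, hun, hc', hX', h7, ht, ⟨⟨u, l⟩, F'', rfl, h5, h8'⟩ | ⟨rfl, h8'⟩⟩ hne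
    swap
    · exact absurd (h8'.trans hc'.base.r3.symm) hne
    refine (wp_scan (u := u) (i := i) hw hS hw0 hc'.base hc'.bits hc'.ok h5 (hc'.nodup u)).seq ?_
    rintro t₁ σ₁ ⟨hk, hok, hpost, hoth⟩
    have hb₁ : Base s w σ₁ := hk.base hc'.base
    obtain ⟨pre, hpre, hvw, hpreT⟩ := hc'.frame
    have h51 : σ₁.regs 5 = u.val := (hk.regs 5 (by decide)).trans h5
    have h61 : σ₁.regs 6 = root.val := (hk.regs 6 (by decide)).trans (hc'.r6 (by simp))
    have h71 : σ₁.regs 7 = σ'.regs 7 := hk.regs 7 (by decide)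
    have h81 : σ₁.regs 8 = 1 := (hk.regs 8 (by decide)).trans h8'
    have h91 : σ₁.regs 9 = σ'.regs 9 := hk.regs 9 (by decide)
    cases hpost with
    | found l₁ l₂' x hv h₁ hx hv' ht₁ h11 h10 =>
      simp only [wp_ite, Test.holds, h11, hb₁.r4, true_imp_iff, not_true_eq_false, false_imp_iff,
        and_true]
      -- the unvisited vertex belongs to the unscanned part `l`
      obtain ⟨l₂, rfl, hl₂⟩ : ∃ l₂, l = l₁ ++ x :: l₂ ∧ l₂' = l₂ ++ pre := by
        rw [hvw] at hv
        rcases List.append_eq_append_iff.1 hv with ⟨a, ha, ha'⟩ | ⟨a, ha, ha'⟩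
        · exfalso
          apply hx
          apply hpreT
          rw [ha']; simp
        · cases a with
          | nil =>
            exfalso
            apply hx
            apply hpreT
            rw [← List.nil_append pre, ← ha']; simp
          | cons y a =>
            simp only [List.cons_append, List.cons.injEq] at ha'
            obtain ⟨rfl, rfl⟩ := ha'
            exact ⟨a, ha, rfl⟩
      subst hl₂
      refine (wp_visit (x := x) (a := 10) (d := F''.length + 1) (T := T') hw hS hw0 hb₁
        (by rw [hk.mem]; exact hc'.bits) (by rw [hk.out]; exact hc'.out) h10 (by decide)).seq ?_
      rintro _ σ₂ ⟨rfl, hbits, hregs, hh, hout⟩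
      have hvv : σ₂.view L = σ₁.view L := view_congr hh
      have hxu : x ≠ u := fun hxu => hx (hxu ▸ hc'.snap.stack_subset u (by simp))
      have hsnap := hc'.snap.skip_append h₁
      have hnd : (x :: u :: verts F'').Nodup :=
        List.nodup_cons.2 ⟨hsnap.not_mem_stack hx, hsnap.nodup_stack⟩
      have hc₂ : LexCore L i r s w root σ₂ (T' ++ [(x, F''.length + 1)])
          ((x, L i x) :: (u, x :: l₂) :: F'') := by
        constructor
        · exact hb₁.congr hregs
        · exact hok.congr hh
        · exact hbits
        · exact hout
        · have := hsnap.push hx (hc'.snap.order x) (F''.length + 1)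
          rwa [Function.update_eq_self] at this
        · intro _; rw [hregs 6 (by decide), h61]
        · have := hc'.last
          simp only [verts, List.map_cons, List.getLast?_cons_cons] at this ⊢
          exact this
        · intro f hf
          rw [hvv]
          rcases List.mem_cons.1 hf with rfl | hf
          · exact ⟨[], by simp, by
              rw [hoth i x (by simp [hxu]), hc'.white x hx]; simp⟩
          rcases List.mem_cons.1 hf with rfl | hf
          · exact ⟨pre ++ l₁, by simpa using hpre, by rw [hv']; simp⟩
          · have : f.1 ≠ u := by
              intro hfu
              exact (List.nodup_cons.1 hsnap.nodup_stack).1 (by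
                have := List.mem_map_of_mem (f := Prod.fst) hf
                rwa [hfu] at this)
            rw [hoth i f.1 (by simp [this])]
            exact hc'.frames f (List.mem_cons_of_mem _ hf)
        · intro v hv
          have h1 : v ∉ visited T' := fun h => hv (by
            simp only [List.map_append, List.mem_append]; exact Or.inl h)
          have : v ≠ u := by
            rintro rfl
            exact h1 (hc'.snap.stack_subset v (by simp))
          rw [hvv, hoth i v (by simp [this]), hc'.white v h1]
      refine (hL.enter root σ' T' u l₁ x l₂ F'' σ₂ hc' hX' h₁ hx hc₂
        ((hregs 5 (by decide)).trans h51) ((hregs 10 (by decide)).trans h10)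
        ((hregs 8 (by decide)).trans h81) ((hregs 9 (by decide)).trans h91)
        (fun j v hjv => by rw [hvv, hoth j v hjv])).mono ?_
      rintro t₂ σ₃ ⟨hc₃, hX₃, h53, h83, h73, hP⟩
      refine ⟨_, ?_, _, _, rfl, ?_, hc₃, hX₃, ?_, ?_, Or.inl ⟨_, _, rfl, h53, h83⟩⟩
      · omega
      · rw [unwind_push hx hnd, ← hun, unwind_skip_append h₁]
      · rw [h73, hregs 7 (by decide), h71, h7]
      · omega
    | none h₁ hv' ht₁ h11 =>
      have hview : σ₁.view L = σ'.view L := by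
        funext j v
        by_cases hjv : j = i ∧ v = u
        · rw [hjv.1, hjv.2, hv']
        · exact hoth j v hjv
      have hall : ∀ y ∈ L i u, y ∈ visited T' := fun y hy => h₁ y (mem_view.2 hy)
      have hc₁ : LexCore L i r s w root σ₁ T' ((u, l) :: F'') :=
        hc'.congr hb₁ hok hk.mem hk.out (hk.regs 6 (by decide)) (fun v => by rw [hview])
      have hX₁ : X (σ₁.view L) (σ₁.regs 9) T' ((u, l) :: F'') := by rw [hview, h91]; exact hX'
      have hun' : unwind (L i) T' F'' = unwind (L i) T F := by
        rw [← hun, ← List.append_nil l, unwind_skip_append]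
        · rfl
        · intro y hy
          exact hall y (by rw [hpre]; simp [hy])
      rw [length_view] at ht₁
      simp only [wp_ite, Test.holds, h11, hb₁.r4, zero_ne_one, false_imp_iff, true_and,
        not_false_eq_true, true_imp_iff, h51, h61]
      cases F'' with
      | nil =>
        have hur : u = root := hc'.last u (by simp)
        subst hur
        obtain ⟨hX₂, hP⟩ := hL.finish u T' u l σ₁ hc₁ hX₁ hall
        simp only [true_imp_iff, not_true_eq_false, false_imp_iff, and_true, wp_const]
        have hc₂ := (hc₁.pop hall).congr (σ' := σ₁.setReg w 8 0)
          (hb₁.congr (b := 5) (fun r' hr' => by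
            rw [regs_setReg, if_neg]; rintro rfl; revert hr'; decide)) hok rfl rfl (by simp)
            (fun v => rfl)
        refine ⟨_, ?_, T', [], rfl, hun', hc₂, by simpa using hX₂, by simp [h71, h7], ?_,
          Or.inr ⟨rfl, by simp⟩⟩
        · rw [view_setReg, ← hview]; omega
        · rw [view_setReg]; rw [← hview] at ht; omega
      | cons f F'' =>
        have hur : u.val ≠ root.val := by
          intro hur
          have h2 := hc'.last _ (List.getLast?_eq_some_getLast (by simp))
          have h3 := (List.nodup_cons.1 hc'.snap.nodup_stack).1
          have h4 : u = root := Fin.ext hur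
          apply h3
          rw [h4, ← h2]
          simp only [verts, List.map_cons, List.getLast_cons_cons]
          exact List.getLast_mem _
        simp only [hur, false_imp_iff, true_and, not_false_eq_true, true_imp_iff]
        refine (hL.leave root T' u l f F'' σ₁ hc₁ hX₁ hall h51 h81).mono ?_
        rintro t₂ σ₂ ⟨hc₂, hX₂, h52, h82, h72, hP⟩
        rw [hview] at hP
        refine ⟨_, ?_, T', f :: F'', rfl, hun', hc₂, hX₂, by rw [h72, h71, h7], ?_,
          Or.inl ⟨f, F'', rfl, h52, h82⟩⟩
        · omega
        · omega
  · rintro m t σ' ⟨T', F', rfl, hun, hc', hX', h7, ht, ⟨f, F'', rfl, h5, h8'⟩ | ⟨rfl, h8'⟩⟩ heq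
    · have : σ'.regs 8 = σ'.regs 3 := heq
      rw [h8', hc'.base.r3] at this
      exact absurd this one_ne_zero
    · rw [← hun]
      exact ⟨hc', hX', h7, by simp only [unwind]; omega⟩

theorem LexCore.of_nil (hc : LexCore L i r s w root σ T []) (root' : Fin n) :
    LexCore L i r s w root' σ T [] :=
  ⟨hc.base, hc.ok, hc.bits, hc.out, hc.snap, by simp, by simp, by simp, hc.white⟩

theorem wp_lexTree (hw : n < 2 ^ w) (hS : n / w < S) (hw0 : 0 < w)
    (hL : LexSpec L i r s w S enter leave X P) (hc : LexCore L i r s w root σ T [])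
    (hX : X (σ.view L) (σ.regs 9) T []) (hx : x ∉ visited T) (h6 : σ.regs 6 = x.val) :
    wp L w S (lexTree i enter leave) σ fun t σ' =>
      LexCore L i r s w root σ' (dfsVisit (L i) n 0 T x) [] ∧
        X (σ'.view L) (σ'.regs 9) (dfsVisit (L i) n 0 T x) [] ∧ σ'.regs 7 = σ.regs 7 ∧
        t + P (σ'.view L) (dfsVisit (L i) n 0 T x) [] ≤ P (σ.view L) T [] := by
  have h1w : 1 % 2 ^ w = 1 := Nat.mod_eq_of_lt (Nat.one_lt_two_pow hw0.ne')
  obtain ⟨hX', hP⟩ := hL.start root T x σ hc hX hx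
  refine (wp_visit (x := x) (a := 6) (d := 0) (T := T) hw hS hw0 hc.base hc.bits hc.out h6
    (by decide)).seq ?_
  rintro _ σ₁ ⟨rfl, hbits, hregs, hh, hout⟩
  have hvv : σ₁.view L = σ.view L := view_congr hh
  have h61 : σ₁.regs 6 = x.val := (hregs 6 (by decide)).trans h6
  simp only [wp_seq, wp_mov, wp_const]
  set σ₂ := ((σ₁.setReg w 5 (σ₁.regs 6)).setReg w 8 1).setReg w 9 1 with hσ₂
  have hc₂ : LexCore L i r s w x σ₂ (T ++ [(x, 0)]) [(x, L i x)] := by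
    constructor
    · refine (hc.base.congr (b := 5) fun r' hr' => ?_)
      rw [hσ₂]
      have h5 : r' ≠ 5 := by rintro rfl; revert hr'; decide
      have h8 : r' ≠ 8 := by rintro rfl; revert hr'; decide
      have h9 : r' ≠ 9 := by rintro rfl; revert hr'; decide
      simp only [regs_setReg, h5, h8, h9, if_false]
      exact hregs r' (hr'.trans (by decide))
    · exact hc.ok.congr hh
    · exact hbits
    · exact hout
    · have := hc.snap.root hx (hc.snap.order x) 0
      rwa [Function.update_eq_self] at this
    · intro _; simpa [hσ₂] using h61
    · simp
    · intro f hf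
      obtain rfl := List.mem_singleton.1 hf
      exact ⟨[], by simp, by simpa [hσ₂, hvv] using hc.white x hx⟩
    · intro v hv
      have h1 : v ∉ visited T := fun h => hv (by
        simp only [List.map_append, List.mem_append]; exact Or.inl h)
      simpa [hσ₂, hvv] using hc.white v h1
  have hv₂ : σ₂.view L = σ.view L := by rw [hσ₂]; simpa using hvv
  have h92 : σ₂.regs 9 = 1 := by simp [hσ₂, h1w]
  refine (wp_lexTree_loop hw hS hw0 hL hc₂ (by rw [hv₂, h92]; exact hX') ⟨_, _, rfl, ?_⟩ ?_).mono ?_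
  · simp [hσ₂, h61, val_mod hw]
  · simp [hσ₂, h1w]
  · rintro t σ₃ ⟨hc₃, hX₃, h73, hP₃⟩
    rw [unwind_root hx] at hc₃ hX₃ hP₃
    refine ⟨hc₃.of_nil root, hX₃, ?_, ?_⟩
    · rw [h73]; simpa [hσ₂] using hregs 7 (by decide)
    · rw [hv₂] at hP₃; omega

theorem wp_lexMain (hw : n < 2 ^ w) (hS : n / w < S) (hw0 : 0 < w) (hadj : IsAdjacencyOrder r (L i))
    (hL : LexSpec L i r s w S enter leave X P) (hX : ∀ f, X L f [] []) :
    wp L w S (lexMain i enter leave) (initStore h s w) fun t σ' =>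
      σ'.out = (dfsOrder (L i) s).map Fin.val ∧ t ≤ P L [] [] + 15 * n + 10 := by
  have h1w : 1 % 2 ^ w = 1 := Nat.mod_eq_of_lt (Nat.one_lt_two_pow hw0.ne')
  have hnw : n % 2 ^ w = n := Nat.mod_eq_of_lt hw
  have hww : w % 2 ^ w = w := Nat.mod_eq_of_lt Nat.lt_two_pow_self
  simp only [lexMain, wp_seq, wp_mov, wp_const]
  set σ₁ : Store h n := ((initStore h s w).setReg w 4 1).setReg w 6
    (((initStore h s w).setReg w 4 1).regs 1) with hσ₁
  have hview : σ₁.view L = L := by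
    funext j v
    simp [hσ₁, view, initStore]
  have hc₁ : LexCore L i r s w s σ₁ [] [] := by
    constructor
    · constructor <;> simp [hσ₁, initStore, hnw, hww, h1w, val_mod hw]
    · intro j v; left; simp [hσ₁, initStore]
    · constructor <;> simp [hσ₁, initStore]
    · simp [hσ₁, initStore]
    · exact Snapshot.nil hadj
    · simp
    · simp
    · simp
    · intro v _; rw [hview]
  refine (wp_lexTree (x := s) hw hS hw0 hL hc₁ (by rw [hview]; exact hX _) (by simp) ?_).mono ?_
  · simp [hσ₁, initStore, val_mod hw]
  rintro t₂ σ₂ ⟨hc₂, hX₂, -, hP₂⟩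
  rw [hview] at hP₂
  refine wp_loop (fun m t σ' => ∃ k T, m = n - k ∧ k ≤ n ∧
    T = ((List.finRange n).take k).foldl (dfsVisit (L i) n 0) (dfsVisit (L i) n 0 [] s) ∧
    LexCore L i r s w s σ' T [] ∧ X (σ'.view L) (σ'.regs 9) T [] ∧ σ'.regs 7 = k ∧
    t + t₂ + P (σ'.view L) T [] ≤ P L [] [] + 15 * k) n ?_ ?_ ?_
  · refine ⟨0, _, by simp, by simp, rfl, hc₂.congr (hc₂.base.congr (b := 5) fun r' hr' => ?_)
      hc₂.ok rfl rfl (by simp) (fun v => rfl), by simpa using hX₂, by simp, ?_⟩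
    · rw [regs_setReg, if_neg]; rintro rfl; revert hr'; decide
    · simpa using hP₂
  · rintro m t σ₃ ⟨k, T, rfl, hk, hT, hc₃, hX₃, h7, hP₃⟩ hne
    have hkn : k < n := by
      rcases hk.lt_or_eq with h | h
      · exact h
      · exact absurd (h7.trans (h.trans hc₃.base.r0.symm)) hne
    have hT' : ∀ T', dfsVisit (L i) n 0 T ⟨k, hkn⟩ = T' →
        T' = ((List.finRange n).take (k + 1)).foldl (dfsVisit (L i) n 0)
          (dfsVisit (L i) n 0 [] s) := by
      rintro _ rfl
      rw [List.take_add_one, List.foldl_append, ← hT]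
      simp [hkn]
    have h7v : σ₃.regs 7 = (⟨k, hkn⟩ : Fin n).val := h7
    refine (wp_testBit (T := visited T) (v := ⟨k, hkn⟩) hw hS hw0 hc₃.base hc₃.bits h7 (by decide)
      (by decide)).seq ?_
    rintro _ σ₄ ⟨rfl, h14, hr, hcu, hm, hh, ho⟩
    have hregs : ∀ r' : Reg, r'.val < 14 → σ₄.regs r' = σ₃.regs r' := fun r' hr' =>
      hr r' (by rintro rfl; revert hr'; decide) (hr'.trans (by decide))
    have hvv : σ₄.view L = σ₃.view L := view_congr hh
    have hc₄ : LexCore L i r s w s σ₄ T [] := hc₃.congr (hc₃.base.congr hregs) (hc₃.ok.congr hh)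
      hm ho (hregs 6 (by decide)) (fun v => by rw [hvv])
    have hX₄ : X (σ₄.view L) (σ₄.regs 9) T [] := by
      rw [hvv, hregs 9 (by decide)]; exact hX₃
    have key : ∀ (T' : List (Fin n × ℕ)) (t' : ℕ) (σ₅ : Store h n),
        dfsVisit (L i) n 0 T ⟨k, hkn⟩ = T' → LexCore L i r s w s σ₅ T' [] →
        X (σ₅.view L) (σ₅.regs 9) T' [] → σ₅.regs 7 = k →
        t' + P (σ₅.view L) T' [] ≤ P (σ₃.view L) T [] + 11 →
        wp L w S (.prim (.op .add 7 7 4)) σ₅ fun t'' σ₆ => ∃ m' < n - k, ∃ k' T',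
          m' = n - k' ∧ k' ≤ n ∧
          T' = ((List.finRange n).take k').foldl (dfsVisit (L i) n 0) (dfsVisit (L i) n 0 [] s) ∧
          LexCore L i r s w s σ₆ T' [] ∧ X (σ₆.view L) (σ₆.regs 9) T' [] ∧ σ₆.regs 7 = k' ∧
          t + (1 + (t' + t'') + 1) + t₂ + P (σ₆.view L) T' [] ≤ P L [] [] + 15 * k' := by
      intro T' t' σ₅ hTT hc₅ hX₅ h75 hP₅
      rw [wp_op]
      refine ⟨n - (k + 1), by omega, k + 1, T', rfl, hkn, hT' T' hTT,
        hc₅.congr (hc₅.base.congr (b := 5) fun r' hr' => ?_) hc₅.ok rfl rfl (by simp)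
          (fun v => rfl), by simpa using hX₅, ?_, ?_⟩
      · rw [regs_setReg, if_neg]; rintro rfl; revert hr'; decide
      · simp [BinOp.eval, h75, hc₅.base.r4, Nat.mod_eq_of_lt (show k + 1 < 2 ^ w by omega)]
      · simp only [view_setReg]; omega
    simp only [wp_ite, Test.holds, h14, hc₄.base.r3, wp_seq]
    refine ⟨fun h0 => ?_, fun h0 => ?_⟩
    · have hkT : ⟨k, hkn⟩ ∉ visited T := by
        intro hkT
        simp [hkT] at h0
      have hvk : σ₄.regs 7 = (⟨k, hkn⟩ : Fin n).val := (hregs 7 (by decide)).trans h7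
      rw [wp_mov]
      have hc₅ : LexCore L i r s w s (σ₄.setReg w 6 (σ₄.regs 7)) T [] := by
        have hb : Base s w (σ₄.setReg w 6 (σ₄.regs 7)) := hc₄.base.congr (b := 5) fun r' hr' => by
          rw [regs_setReg, if_neg]; rintro rfl; revert hr'; decide
        exact ⟨hb, hc₄.ok, hc₄.bits, hc₄.out, hc₄.snap, by simp, by simp, by simp, hc₄.white⟩
      refine (wp_lexTree (x := ⟨k, hkn⟩) hw hS hw0 hL hc₅ (by simpa using hX₄) hkT ?_).mono ?_
      · simp [hvk, Nat.mod_eq_of_lt (hkn.trans hw)]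
      · rintro t₆ σ₆ ⟨hc₆, hX₆, h76, hP₆⟩
        refine (key _ (5 + (1 + (1 + t₆))) σ₆ rfl hc₆ hX₆ ?_ ?_).mono ?_
        · rw [h76]; simpa using hvk
        · simp only [view_setReg, hvv] at hP₆; omega
        · rintro t₇ σ₇ H
          convert H using 12
          omega
    · have hkT : ⟨k, hkn⟩ ∈ visited T := by
        by_contra hkT
        simp [hkT] at h0
      rw [wp_skip]
      refine (key T (5 + (1 + 0 + 1)) σ₄ (dfsVisit_of_mem hkT) hc₄ hX₄
        ((hregs 7 (by decide)).trans h7) ?_).mono ?_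
      · rw [hvv]; omega
      · rintro t₇ σ₇ H
        convert H using 12
        omega
  · rintro m t σ₃ ⟨k, T, rfl, hk, hT, hc₃, hX₃, h7, hP₃⟩ heq
    have hkn : k = n := h7.symm.trans (heq.trans hc₃.base.r0)
    subst hkn
    rw [List.take_of_length_le (by simp)] at hT
    refine ⟨?_, by omega⟩
    rw [hc₃.out, hT]
    rfl

end Rotate

/-! ### Lexicographic DFS of directed graphs -/

namespace Rotate

open Store Dfs

variable {h n : ℕ}

/-- Visiting a vertex releases its share of a potential. -/
theorem sum_unvisited_push (g : Fin n → ℕ) {T : List (Fin n × ℕ)} {x : Fin n}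
    (hx : x ∉ visited T) (d : ℕ) :
    (∑ v, if v ∈ visited (T ++ [(x, d)]) then 0 else g v) + g x =
      ∑ v, if v ∈ visited T then 0 else g v := by
  have h1 : g x = ∑ v, if v = x then g v else 0 := by simp
  rw [h1, ← Finset.sum_add_distrib]
  refine Finset.sum_congr rfl fun v _ => ?_
  by_cases hv : v = x
  · subst hv
    simp [hx]
  · have : v ∈ visited (T ++ [(x, d)]) ↔ v ∈ visited T := by
      rw [mem_visited_append]; simp [hv]
    simp only [hv, if_false, add_zero, this]

/-- In a directed graph, the head of the list of in-neighbours of a vertex is made to point to its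
parent in the DFS tree. -/
def enterDirected : Cmd 2 := rotateUntil 1 10 5 ;; mov 5 10

/-- Go back to the parent. -/
def leaveDirected : Cmd 2 := headOf 1 10 5 0 ;; mov 5 10

/-- The in-list of each vertex on the stack starts with the vertex below it. -/
def ParentHeads (V : Fin 2 → Fin n → List (Fin n)) (F : List (Frame n)) : Prop :=
  F.IsChain fun c p => (V 1 c.1).head? = some p.1

/-- The potential that pays for the running time.  The coefficients bound the numbers of steps that
the commands take per list entry and per vertex. -/
def directedPotential (L : Lists 2 n) (T : List (Fin n × ℕ)) (F : List (Frame n)) : ℕ :=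
  (∑ v, if v ∈ visited T then 0 else 32 * (L 0 v).length + 5 * (L 1 v).length + 140) +
    (F.map fun f => 16 * f.2.length + 16 * (L 0 f.1).length + 70).sum

theorem ParentHeads.congr {V V' : Fin 2 → Fin n → List (Fin n)} {F : List (Frame n)}
    (hF : ParentHeads V F) (hV : ∀ v ∈ verts F, (V' 1 v).head? = (V 1 v).head?) :
    ParentHeads V' F := by
  induction F with
  | nil => simp [ParentHeads]
  | cons f F ih =>
    cases F with
    | nil => simp [ParentHeads]
    | cons g F =>
      rw [ParentHeads, List.isChain_cons_cons] at hF ⊢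
      exact ⟨by rw [hV f.1 (by simp)]; exact hF.1, ih hF.2 fun v hv => hV v (List.mem_cons_of_mem _ hv)⟩

/-- The list of remaining vertices in the top frame is irrelevant. -/
theorem ParentHeads.top {V : Fin 2 → Fin n → List (Fin n)} {F : List (Frame n)} {u : Fin n}
    {l l' : List (Fin n)} (hF : ParentHeads V ((u, l) :: F)) : ParentHeads V ((u, l') :: F) := by
  cases F with
  | nil => simp [ParentHeads]
  | cons g F =>
    rw [ParentHeads, List.isChain_cons_cons] at hF ⊢
    exact hF

theorem lexSpec_directed {L : Lists 2 n} {r : Fin n → Fin n → Prop} (s : Fin n) {w : ℕ} (S : ℕ)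
    (hw : n < 2 ^ w) (hadj : IsAdjacencyOrder (fun v u => r u v) (L 1)) :
    LexSpec L 0 r s w S enterDirected leaveDirected (fun V _ _ F => ParentHeads V F)
      (fun _ T F => directedPotential L T F) where
  enter := by
    intro root σ₀ T u l₁ x l₂ F σ hc₀ hX h₁ hx hc h5 h10 h8 h9 hoth
    have hux : u ∈ L 1 x := by
      refine ((hadj x).2 u).2 (hc.snap.mem_iff.1 ?_)
      obtain ⟨pre, h1, -⟩ := hc₀.frames _ List.mem_cons_self
      simp only at h1
      rw [h1]; simp
    obtain ⟨a, b, hab⟩ := List.append_of_mem (mem_view (σ := σ).2 hux)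
    have hnd : (σ.view L 1 x).Nodup := nodup_view.2 (hadj x).1
    rw [hab] at hnd
    have hua : u ∉ a := fun hua => (List.nodup_append.1 hnd).2.2 u hua u (by simp) rfl
    have hlen : a.length ≤ (L 1 x).length := by
      rw [← length_view (σ := σ) (L := L), hab]; simp
    refine (wp_rotateUntil (i := 1) (a := 10) (r := 5) hw hc.ok h10 h5 (by decide) (by decide)
      hab hua).seq ?_
    rintro t σ' ⟨ht, hk, hok, hv, hoth'⟩
    rw [wp_mov]
    have hv0 : ∀ v, σ'.view L 0 v = σ.view L 0 v := fun v => hoth' 0 v (by simp)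
    have hbase : Base s w (σ'.setReg w 5 (σ'.regs 10)) := by
      refine (hk.base hc.base).congr (b := 5) fun r' hr' => ?_
      rw [regs_setReg, if_neg]; rintro rfl; revert hr'; decide
    refine ⟨hc.congr hbase hok hk.mem hk.out (by simpa using hk.regs 6 (by decide)) hv0, ?_, ?_, ?_,
      ?_, ?_⟩
    · rw [ParentHeads, List.isChain_cons_cons]
      refine ⟨by simp [hv], ?_⟩
      refine ParentHeads.congr (V := σ₀.view L) (hX.top) fun v hv' => ?_
      have hvx : v ≠ x := by
        rintro rfl
        exact (List.nodup_cons.1 hc.snap.nodup_stack).1 hv'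
      rw [view_setReg, hoth' 1 v (by simp [hvx]), hoth 1 v (by simp)]
    · simp [hk.regs 10 (by decide), h10, val_mod hw]
    · simpa [h8] using hk.regs 8 (by decide)
    · simpa using hk.regs 7 (by decide)
    · have := sum_unvisited_push (fun v => 32 * (L 0 v).length + 5 * (L 1 v).length + 140) hx
        (F.length + 1)
      simp only [directedPotential, List.map_cons, List.sum_cons, List.length_append,
        List.length_cons]
      omega
  leave := by
    intro root T u l f F σ hc hX hall h5 h8
    rw [ParentHeads, List.isChain_cons_cons] at hX
    obtain ⟨l', hl'⟩ : ∃ l', σ.view L 1 u = f.1 :: l' := by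
      have := hX.1
      rcases hvu : σ.view L 1 u with _ | ⟨y, l'⟩
      · simp [hvu] at this
      · simp [hvu] at this; exact ⟨l', by rw [this]⟩
    refine wp_seq.2 (wp_headOf h5 hc.ok hl' fun p => ?_)
    rw [wp_mov]
    refine ⟨(hc.pop hall).congr ?_ hc.ok rfl rfl (by simp) fun v => rfl, hX.2, ?_, ?_,
      ?_, ?_⟩
    · refine hc.base.congr (b := 5) fun r' hr' => ?_
      have h5 : r' ≠ 5 := by rintro rfl; revert hr'; decide
      have h10 : r' ≠ 10 := by rintro rfl; revert hr'; decide
      simp [h5, h10]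
    · simp [val_mod hw]
    · simpa using h8
    · simp
    · simp only [directedPotential, List.map_cons, List.sum_cons]
      omega
  finish := by
    intro root T u l σ hc hX hall
    refine ⟨by simp [ParentHeads], ?_⟩
    simp only [directedPotential, List.map_cons, List.sum_cons]
    omega
  start := by
    intro root₀ T x σ hc hX hx
    refine ⟨by simp [ParentHeads], ?_⟩
    have := sum_unvisited_push (fun v => 32 * (L 0 v).length + 5 * (L 1 v).length + 140) hx 0
    simp only [directedPotential, List.map_cons, List.sum_cons, List.map_nil, List.sum_nil]
    omega

theorem outputs_lex_directed {L : Lists 2 n} {r : Fin n → Fin n → Prop} (s : Fin n) {w : ℕ}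
    (hw : n < 2 ^ w) (hw0 : 0 < w) (hadj : IsAdjacencyOrder r (L 0))
    (hadj' : IsAdjacencyOrder (fun v u => r u v) (L 1)) :
    ∃ t, Outputs (lexMain 0 enterDirected leaveDirected).program L s w (n / w + 1) t
        (dfsOrder (L 0) s) ∧
      t ≤ 32 * (∑ v, (L 0 v).length) + 5 * (∑ v, (L 1 v).length) + 155 * n + 10 := by
  obtain ⟨t, σ, hr, ho, ht⟩ := wp_lexMain (S := n / w + 1) hw (Nat.lt_succ_self _) hw0 hadj
    (lexSpec_directed s _ hw hadj') (fun f => by simp [ParentHeads])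
  refine ⟨t, hr.outputs ho, ht.trans ?_⟩
  simp only [directedPotential, List.map_nil, List.not_mem_nil, if_false, List.sum_nil,
    Finset.sum_add_distrib, ← Finset.mul_sum, Finset.sum_const, Finset.card_univ, Fintype.card_fin,
    smul_eq_mul]
  omega

end Rotate

/-! ### Finding the parent of a completed vertex in an undirected graph -/

namespace Rotate

open Store Dfs

variable {h n : ℕ}

/-- Some neighbour of `y` other than `u` has `y` at the head of its list. -/
def Witness (A : Fin n → List (Fin n)) (u y : Fin n) : Prop :=
  ∃ x ∈ A y, x ≠ u ∧ (A x).head? = some y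

/-- Test whether the vertex under cursor `q`, in the list of vertex `a`, shows that `a` has a witness
with respect to `r5`.  The answer is given in `r20`. -/
def look (q : Cur) (a : Reg) : Cmd 1 :=
  .prim (.const 20 0) ;; .prim (.read 22 q) ;;
  .ite (.eq 22 5) .skip (headOf 0 23 22 7 ;; .ite (.eq 23 a) (.prim (.const 20 1)) .skip)

/-- Move cursor `q`, and say in `r21` whether it has come to the vertex `b`. -/
def advance (q : Cur) (b : Reg) : Cmd h :=
  .prim (.const 21 0) ;; .prim (.next q) ;; .prim (.read 22 q) ;;
  .ite (.eq 22 b) (.prim (.const 21 1)) .skip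

/-- Test for a witness, and move the cursor. -/
def probe (q : Cur) (a b : Reg) : Cmd 1 := look q a ;; advance q b

/-- Look for witnesses of the vertices `r10` and `r12` in lockstep, and store in `r10` the vertex that
has a witness, or else the one with the longer list. -/
def duel : Cmd 1 :=
  headOf 0 17 10 2 ;; headOf 0 18 12 3 ;; .prim (.const 19 1) ;;
  .loop (.eq 19 3)
    (probe 2 10 17 ;;
      .ite (.eq 20 4) (.prim (.const 19 0))
        (.ite (.eq 21 4) (mov 10 12 ;; .prim (.const 19 0))
          (probe 3 12 18 ;;
            .ite (.eq 20 4) (mov 10 12 ;; .prim (.const 19 0))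
              (.ite (.eq 21 4) (.prim (.const 19 0)) .skip))))

/-- Let the neighbour `r12` of `r5` compete for being the parent of `r5`.  If `r11` is 1, then `r10`
is the best one so far.  The flag `r13` is cleared if `r12` is certainly the parent. -/
def consider : Cmd 1 :=
  headOf 0 16 12 7 ;;
  .ite (.eq 16 5)
    (.ite (.eq 12 6) (mov 10 12 ;; .prim (.const 13 0))
      (.ite (.eq 11 3) (mov 10 12 ;; .prim (.const 11 1)) duel)) .skip

/-- Store in `r10` the parent of the completed vertex `r5` in the tree with root `r6`. -/
def findParent : Cmd 1 :=
  headOf 0 15 5 1 ;; .prim (.const 11 0) ;; .prim (.const 13 1) ;;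
  .loop (.eq 13 3)
    (.prim (.read 12 1) ;; consider ;;
      .ite (.eq 13 4) (advance 1 15 ;; .ite (.eq 21 4) (.prim (.const 13 0)) .skip) .skip)

variable {L : Lists 1 n} {w S : ℕ} {σ : Store 1 n} {s u x y c p root : Fin n} {q : Cur} {a b : Reg}
  {l : List (Fin n)}

theorem wp_look (hw : n < 2 ^ w) (hw0 : 0 < w) (hσ : σ.HeadsOk L) (h5 : σ.regs 5 = u.val)
    (ha : σ.regs a = c.val) (ha20 : a.val < 20) (hq : σ.At L q 0 c (x :: l))
    (hx : σ.view L 0 x ≠ []) :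
    wp L w S (look q a) σ fun t σ' => t ≤ 10 ∧ Pure 20 7 σ σ' ∧
      (open Classical in σ'.regs 20 = if x ≠ u ∧ (σ.view L 0 x).head? = some c then 1 else 0) := by
  have h1w : 1 % 2 ^ w = 1 := Nat.mod_eq_of_lt (Nat.one_lt_two_pow hw0.ne')
  obtain ⟨z, lz, hz⟩ := List.exists_cons_of_ne_nil hx
  have hq' : (σ.setReg w 20 0).At L q 0 c (x :: l) := hq.congr rfl
  have hpu : Pure 20 7 σ ((σ.setReg w 20 0).setReg w 22 ↑x) := ((Pure.refl 20 7 σ).setReg).setReg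
  have h22 : ((σ.setReg w 20 0).setReg w 22 ↑x).regs 22 = x.val := by simp [val_mod hw]
  have h20 : ((σ.setReg w 20 0).setReg w 22 ↑x).regs 20 = 0 := by simp
  simp only [look, wp_seq, wp_const]
  rw [wp_read hq', wp_ite]
  simp only [Test.holds, wp_skip]
  rw [h22, hpu.regs 5 (by decide), h5]
  refine ⟨fun he => ⟨by omega, hpu, ?_⟩, fun he => wp_seq.2 (wp_headOf (v := x) h22 hσ hz fun p => ?_)⟩
  · rw [h20]; simp [Fin.ext he]
  have hxu : x ≠ u := fun hxu => he (by rw [hxu])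
  have hpu' : Pure 20 7 σ ((((σ.setReg w 20 0).setReg w 22 ↑x).setCursor 7 p).setReg w 23 ↑z) :=
    (hpu.setCursor).setReg
  simp only [wp_ite, Test.holds, wp_skip, wp_const]
  rw [hpu'.regs a ha20, ha]
  refine ⟨fun hz' => ⟨by omega, hpu'.setReg, ?_⟩, fun hz' => ⟨by omega, hpu', ?_⟩⟩
  · have hzc : z = c := by simpa [val_mod hw, Fin.ext_iff] using hz'
    simp [hxu, hz, hzc, h1w]
  · have hzc : z ≠ c := by simpa [val_mod hw, Fin.ext_iff] using hz'
    simp [hz, hzc]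

theorem wp_advance {L : Lists h n} {σ : Store h n} {i : Fin h} (hw : n < 2 ^ w) (hw0 : 0 < w)
    (hb : σ.regs b = y.val) (hb20 : b.val < 20)
    (hq : σ.At L q i c (x :: l)) :
    wp L w S (advance q b) σ fun t σ' => t ≤ 6 ∧ Pure 21 0 σ σ' ∧
      (∀ q' : Cur, q' ≠ q → σ'.cursors q' = σ.cursors q') ∧
      (σ'.regs 21 = if (l ++ [x]).head? = some y then 1 else 0) ∧ σ'.At L q i c (l ++ [x]) := by
  have h1w : 1 % 2 ^ w = 1 := Nat.mod_eq_of_lt (Nat.one_lt_two_pow hw0.ne')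
  have hq' : (σ.setReg w 21 0).At L q i c (x :: l) := hq.congr rfl
  simp only [advance, wp_seq, wp_const]
  refine wp_next hq' fun p hp => ?_
  have hat : ((σ.setReg w 21 0).setCursor q (some (i, c, p))).At L q i c (l ++ [x]) :=
    ⟨p, by simp, hp.1, by rw [hp.2]; simp⟩
  obtain ⟨z', l', hl'⟩ : ∃ z' l', l ++ [x] = z' :: l' := by cases l <;> simp
  rw [hl'] at hat ⊢
  rw [wp_read hat]
  have hpu : Pure 21 0 σ (((σ.setReg w 21 0).setCursor q (some (i, c, p))).setReg w 22 ↑z') :=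
    (((Pure.refl 21 0 σ).setReg).setCursor (Nat.zero_le _)).setReg
  have hcu : ∀ q' : Cur, q' ≠ q →
      (((σ.setReg w 21 0).setCursor q (some (i, c, p))).setReg w 22 ↑z').cursors q'
        = σ.cursors q' := fun q' h2 => by simp [h2]
  simp only [wp_ite, wp_const, wp_skip, Test.holds]
  rw [hpu.regs b (by omega), hb]
  refine ⟨fun he => ⟨by omega, hpu.setReg, hcu, ?_, hat.congr rfl⟩,
    fun he => ⟨by omega, hpu, hcu, ?_, hat.congr rfl⟩⟩
  · have : z' = y := by simpa [val_mod hw, Fin.ext_iff] using he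
    simp [this, h1w]
  · have : z' ≠ y := by simpa [val_mod hw, Fin.ext_iff] using he
    simp [this]

theorem head?_rotated_eq_iff {d e : List (Fin n)} {b : Fin n} (hd : (d ++ x :: e).Nodup)
    (hb : (d ++ x :: e).head? = some b) : (e ++ d ++ [x]).head? = some b ↔ e = [] := by
  cases e with
  | nil => simpa using hb
  | cons z e =>
    simp only [List.cons_append, List.head?_cons, Option.some.injEq, reduceCtorEq, iff_false]
    rintro rfl
    cases d with
    | nil => simp only [List.nil_append, List.head?_cons, Option.some.injEq] at hb; subst hb; simp at hd
    | cons y d =>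
      simp only [List.cons_append, List.head?_cons, Option.some.injEq] at hb
      subst hb
      simp at hd

/-- Cursor `q` runs through the list of `c`, the rest of which is `e`, and none of the `k` neighbours
met so far is a witness. -/
def Probing (L : Lists 1 n) (σ : Store 1 n) (q : Cur) (u c : Fin n) (k : ℕ) : Prop :=
  ∃ d e, σ.view L 0 c = d ++ e ∧ e ≠ [] ∧ σ.At L q 0 c (e ++ d) ∧ d.length = k ∧
    ∀ x ∈ d, ¬ (x ≠ u ∧ (σ.view L 0 x).head? = some c)

theorem Probing.length_lt {k : ℕ} (hp : Probing L σ q u c k) : k < (L 0 c).length := by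
  obtain ⟨d, e, h1, h2, -, rfl, -⟩ := hp
  have := List.length_pos_of_ne_nil h2
  rw [← length_view (σ := σ), h1, List.length_append]
  omega

theorem Probing.congr {σ' : Store 1 n} {k : ℕ} (hp : Probing L σ q u c k) (hh : σ'.heads = σ.heads)
    (hc : σ'.cursors q = σ.cursors q) : Probing L σ' q u c k := by
  obtain ⟨d, e, h1, h2, h3, h4, h5⟩ := hp
  have := view_congr (L := L) hh
  exact ⟨d, e, by rw [this, h1], h2, h3.congr hc, h4, by rwa [this]⟩

theorem wp_probe_step {k : ℕ} (hw : n < 2 ^ w) (hw0 : 0 < w) (hσ : σ.HeadsOk L)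
    (hnd : (L 0 c).Nodup) (h5 : σ.regs 5 = u.val)
    (ha : σ.regs a = c.val) (hb : σ.regs b = y.val) (ha20 : a.val < 20) (hb20 : b.val < 20)
    (hq7 : q.val < 7) (hq : Probing L σ q u c k) (hy : (σ.view L 0 c).head? = some y)
    (hx : ∀ x ∈ L 0 c, σ.view L 0 x ≠ []) :
    wp L w S (probe q a b) σ fun t σ' => t ≤ 17 ∧ Pure 20 0 σ σ' ∧
      (∀ q' : Cur, q'.val < 7 → q' ≠ q → σ'.cursors q' = σ.cursors q') ∧
      ((σ'.regs 20 = 1 ∧ Witness (σ.view L 0) u c) ∨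
        (σ'.regs 20 = 0 ∧ σ'.regs 21 = 1 ∧ ¬ Witness (σ.view L 0) u c) ∨
        (σ'.regs 20 = 0 ∧ σ'.regs 21 = 0 ∧ Probing L σ' q u c (k + 1))) := by
  obtain ⟨d, e, hv, he, hat, rfl, hd⟩ := hq
  obtain ⟨x, e, rfl⟩ := List.exists_cons_of_ne_nil he
  have hxc : x ∈ L 0 c := mem_view.1 (by rw [hv]; simp)
  refine (wp_look hw hw0 hσ h5 ha ha20 hat (hx x hxc)).seq ?_
  rintro t₁ σ₁ ⟨ht₁, hk₁, h20⟩
  refine (wp_advance (y := y) hw hw0 ((hk₁.regs b hb20).trans hb) hb20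
    (hat.congr (hk₁.cursors q hq7))).mono ?_
  rintro t₂ σ' ⟨ht₂, hk₂, hcu, h21, hat'⟩
  have hk : Pure 20 0 σ σ' := (hk₁.mono (b := 20) (c := 0)).trans hk₂
  refine ⟨by omega, hk, fun q' h1 h2 => (hcu q' h2).trans (hk₁.cursors q' h1), ?_⟩
  rw [← hk₂.regs 20 (by decide)] at h20
  have hnd' : (d ++ x :: e).Nodup := by rw [← hv, nodup_view]; exact hnd
  have hiff := head?_rotated_eq_iff hnd' (by rw [← hv]; exact hy)
  replace h21 : σ'.regs 21 = if e = [] then 1 else 0 := by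
    rw [h21]; exact if_congr hiff rfl rfl
  by_cases hwit : x ≠ u ∧ (σ.view L 0 x).head? = some c
  · rw [if_pos hwit] at h20
    exact Or.inl ⟨h20, x, by rw [hv]; simp, hwit⟩
  rw [if_neg hwit] at h20
  have hd' : ∀ z ∈ d ++ [x], ¬ (z ≠ u ∧ (σ.view L 0 z).head? = some c) := by
    intro z hz
    rcases List.mem_append.1 hz with hz | hz
    · exact hd z hz
    · obtain rfl := List.mem_singleton.1 hz
      exact hwit
  by_cases hen : e = []
  · rw [if_pos hen] at h21
    subst hen
    refine Or.inr (Or.inl ⟨h20, h21, ?_⟩)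
    rintro ⟨z, hz, hz'⟩
    rw [hv] at hz
    exact hd' z hz hz'
  · rw [if_neg hen] at h21
    refine Or.inr (Or.inr ⟨h20, h21, d ++ [x], e, by rw [hk.view, hv]; simp, hen, ?_, by simp, ?_⟩)
    · simpa using hat'
    · rw [hk.view]; exact hd'

theorem wp_headOf_probing (hσ : σ.HeadsOk L) (ha : σ.regs a = c.val) (hc : σ.view L 0 c ≠ [])
    {Q : ℕ → Store 1 n → Prop}
    (H : ∀ p x l, σ.view L 0 c = x :: l → Probing L (σ.setCursor q p) q u c 0 →
      Q 2 ((σ.setCursor q p).setReg w b x.val)) :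
    wp L w S (headOf 0 b a q) σ Q := by
  obtain ⟨x, l, hx⟩ := List.exists_cons_of_ne_nil hc
  refine wp_seq.2 (wp_front ha hσ hc fun p hp => ?_)
  have hat : (σ.setCursor q (some (0, c, p))).At L q 0 c (x :: l) :=
    ⟨p, by simp, hp.1, by rw [hp.2, hx]⟩
  rw [wp_read hat]
  exact H _ x l hx ⟨[], x :: l, by simpa using hx, by simp, by simpa using hat, rfl, by simp⟩

theorem setReg_eq_self {r : Reg} {v : ℕ} (hr : σ.regs r = v) (hv : v < 2 ^ w) : σ.setReg w r v = σ := by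
  cases σ
  subst hr
  simp only [setReg, Nat.mod_eq_of_lt hv, Function.update_eq_self]

/-- At most one of the two candidates has a witness. As their lists are searched alternately, the
time is bounded by the length of the list of the loser, whichever of them it is. -/
theorem wp_duel (hw : n < 2 ^ w) (hw0 : 0 < w) (hσ : σ.HeadsOk L) (hnd : ∀ v, (L 0 v).Nodup)
    (hbase : Base s w σ) (h5 : σ.regs 5 = u.val) (h10 : σ.regs 10 = c.val) (h12 : σ.regs 12 = y.val)
    (hc : σ.view L 0 c ≠ []) (hy : σ.view L 0 y ≠ []) (hne' : ∀ v, ∀ x ∈ L 0 v, σ.view L 0 x ≠ [])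
    (hcy : ¬ (Witness (σ.view L 0) u c ∧ Witness (σ.view L 0) u y)) :
    wp L w S duel σ fun t σ' => Pure 10 2 σ σ' ∧
      (∀ r : Reg, 10 < r.val → r.val < 17 → σ'.regs r = σ.regs r) ∧
      ((σ'.regs 10 = c.val ∧ ¬ Witness (σ.view L 0) u y ∧ t ≤ 60 * (L 0 y).length) ∨
        (σ'.regs 10 = y.val ∧ ¬ Witness (σ.view L 0) u c ∧ t ≤ 60 * (L 0 c).length)) := by
  have h1w : 1 % 2 ^ w = 1 := Nat.mod_eq_of_lt (Nat.one_lt_two_pow hw0.ne')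
  simp only [duel, wp_seq, wp_const]
  refine wp_headOf_probing (u := u) hσ h10 hc fun p₁ x₁ l₁ hx₁ hp₁ => ?_
  refine wp_headOf_probing (σ := (σ.setCursor 2 p₁).setReg w 17 ↑x₁) (u := u) hσ
    (by simpa using h12) hy fun p₂ x₂ l₂ hx₂ hp₂ => ?_
  refine wp_loop (fun m t σ' => Pure 10 2 σ σ' ∧
    (∀ r : Reg, 10 < r.val → r.val < 17 → σ'.regs r = σ.regs r) ∧
    ((∃ k, m = (L 0 c).length + 1 - k ∧ t ≤ 50 * k ∧ Pure 17 2 σ σ' ∧ σ'.regs 17 = x₁.val ∧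
        σ'.regs 18 = x₂.val ∧ σ'.regs 19 = 1 ∧ Probing L σ' 2 u c k ∧ Probing L σ' 3 u y k) ∨
      (m = 0 ∧ σ'.regs 19 = 0 ∧
        ((σ'.regs 10 = c.val ∧ ¬ Witness (σ.view L 0) u y ∧ t ≤ 50 * (L 0 y).length) ∨
        (σ'.regs 10 = y.val ∧ ¬ Witness (σ.view L 0) u c ∧ t ≤ 50 * (L 0 c).length)))))
    ((L 0 c).length + 1) ?_ ?_ ?_
  · have hpu : Pure 17 2 σ (((((σ.setCursor 2 p₁).setReg w 17 ↑x₁).setCursor 3 p₂).setReg w 18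
        ↑x₂).setReg w 19 1) := (((((Pure.refl 17 2 σ).setCursor).setReg).setCursor).setReg).setReg
    refine ⟨hpu.mono, fun r _ hr => hpu.regs r hr, Or.inl ⟨0, rfl, by omega, hpu, ?_, ?_, ?_, ?_, ?_⟩⟩
    · simp [val_mod hw]
    · simp [val_mod hw]
    · simp [h1w]
    · exact hp₁.congr rfl rfl
    · exact hp₂.congr rfl rfl
  · rintro m t σ' ⟨hk, -, ⟨k, rfl, ht, hpu, h17, h18, h19, hpc, hpy⟩ | ⟨-, h19, -⟩⟩ hne
    swap
    · exact absurd (h19.trans (hk.base hbase).r3.symm) hne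
    have hkc := hpc.length_lt
    have hky := hpy.length_lt
    have hview := hpu.view (L := L)
    have h5' : σ'.regs 5 = u.val := (hpu.regs 5 (by decide)).trans h5
    have h10' : σ'.regs 10 = c.val := (hpu.regs 10 (by decide)).trans h10
    have h12' : σ'.regs 12 = y.val := (hpu.regs 12 (by decide)).trans h12
    have round : wp L w S (probe 2 10 17 ;;
      .ite (.eq 20 4) (.prim (.const 19 0))
        (.ite (.eq 21 4) (mov 10 12 ;; .prim (.const 19 0))
          (probe 3 12 18 ;;
            .ite (.eq 20 4) (mov 10 12 ;; .prim (.const 19 0))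
              (.ite (.eq 21 4) (.prim (.const 19 0)) .skip)))) σ' fun t σ₂ => t ≤ 48 ∧
          ((Pure 17 2 σ' σ₂ ∧ σ₂.regs 17 = x₁.val ∧ σ₂.regs 18 = x₂.val ∧ σ₂.regs 19 = 1 ∧
              Probing L σ₂ 2 u c (k + 1) ∧ Probing L σ₂ 3 u y (k + 1)) ∨
            ((∃ σ₁, Pure 17 2 σ' σ₁ ∧ ∃ x : Fin n, σ₂ = (σ₁.setReg w 10 x.val).setReg w 19 0 ∧
              (x = c ∧ ¬ Witness (σ.view L 0) u y ∨ x = y ∧ ¬ Witness (σ.view L 0) u c)))) := by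
      have hv : ∀ v : Fin n, v.val < 2 ^ w := fun v => v.is_lt.trans hw
      refine (wp_probe_step (y := x₁) hw hw0 (hpu.headsOk hσ) (hnd c) h5' h10' h17 (by decide)
        (by decide) (by decide) hpc (by rw [hview, hx₁]; rfl)
        (by rw [hview]; exact hne' c)).seq ?_
      rintro t₁ σ₁ ⟨ht₁, hk₁, hcu₁, H₁⟩
      have hp1 : Pure 17 2 σ' σ₁ := ⟨⟨fun r hr => hk₁.regs r (by omega), fun q hq => hcu₁ q (by omega)
        (by rintro rfl; revert hq; decide), hk₁.mem, hk₁.out⟩, hk₁.heads⟩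
      have hb1 : Base s w σ₁ := (hp1.toKeeps).base (hk.base hbase)
      have h10₁ : σ₁.regs 10 = c.val := (hp1.regs 10 (by decide)).trans h10'
      have h12₁ : σ₁.regs 12 = y.val := (hp1.regs 12 (by decide)).trans h12'
      rw [hview] at H₁
      simp only [wp_ite, wp_skip, wp_const, Test.holds, wp_seq, wp_mov, hb1.r4]
      rcases H₁ with ⟨h20, hW⟩ | ⟨h20, h21, hW⟩ | ⟨h20, h21, hpc₁⟩
      · refine ⟨fun _ => ⟨by omega, Or.inr ⟨σ₁, hp1, c, ?_, Or.inl ⟨rfl, fun h => hcy ⟨hW, h⟩⟩⟩⟩,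
          fun h => absurd h20 h⟩
        rw [setReg_eq_self h10₁ (hv c)]
      · refine ⟨fun h => by omega, fun _ => ⟨fun _ => ⟨by omega, Or.inr ⟨σ₁, hp1, y, ?_,
          Or.inr ⟨rfl, hW⟩⟩⟩, fun h => absurd h21 h⟩⟩
        rw [h12₁]
      refine ⟨fun h => by omega, fun _ => ⟨fun h => by omega, fun _ => ?_⟩⟩
      have hpy₁ : Probing L σ₁ 3 u y k := hpy.congr hp1.heads (hcu₁ 3 (by decide) (by decide))
      have hview₁ : σ₁.view L = σ.view L := hp1.view.trans hview
      refine (wp_probe_step (y := x₂) hw hw0 (hp1.headsOk (hpu.headsOk hσ)) (hnd y)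
        ((hp1.regs 5 (by decide)).trans h5') h12₁ ((hk₁.regs 18 (by decide)).trans h18) (by decide)
        (by decide) (by decide) hpy₁ (by rw [hview₁]; exact congrArg List.head? hx₂)
        (by rw [hview₁]; exact hne' y)).mono ?_
      rintro t₂ σ₂ ⟨ht₂, hk₂, hcu₂, H₂⟩
      have hp2 : Pure 17 2 σ₁ σ₂ := ⟨⟨fun r hr => hk₂.regs r (by omega), fun q hq => hcu₂ q (by omega)
        (by rintro rfl; revert hq; decide), hk₂.mem, hk₂.out⟩, hk₂.heads⟩
      have hp12 : Pure 17 2 σ' σ₂ := hp1.trans hp2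
      have hb2 : Base s w σ₂ := (hp2.toKeeps).base hb1
      rw [hview₁] at H₂
      simp only [hb2.r4]
      rcases H₂ with ⟨h20, hW⟩ | ⟨h20, h21, hW⟩ | ⟨h20, h21, hpy₂⟩
      · refine ⟨fun _ => ⟨by omega, Or.inr ⟨σ₂, hp12, y, ?_, Or.inr ⟨rfl, fun h => hcy ⟨h, hW⟩⟩⟩⟩,
          fun h => absurd h20 h⟩
        rw [hp2.regs 12 (by decide), h12₁]
      · refine ⟨fun h => by omega, fun _ => ⟨fun _ => ⟨by omega, Or.inr ⟨σ₂, hp12, c, ?_,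
          Or.inl ⟨rfl, hW⟩⟩⟩, fun h => absurd h21 h⟩⟩
        rw [setReg_eq_self ((hp2.regs 10 (by decide)).trans h10₁) (hv c)]
      · refine ⟨fun h => by omega, fun _ => ⟨fun h => by omega, fun _ => ⟨by omega, Or.inl ⟨hp12,
          ?_, ?_, ?_, ?_, hpy₂⟩⟩⟩⟩
        · rw [hk₂.regs 17 (by decide), hk₁.regs 17 (by decide), h17]
        · rw [hk₂.regs 18 (by decide), hk₁.regs 18 (by decide), h18]
        · rw [hk₂.regs 19 (by decide), hk₁.regs 19 (by decide), h19]
        · exact hpc₁.congr hk₂.heads (hcu₂ 2 (by decide) (by decide))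
    refine round.mono ?_
    rintro t' σ₂ ⟨ht', ⟨hpu₂, h17₂, h18₂, h19₂, hpc₂, hpy₂⟩ | ⟨σ₁, hpu₁, x, rfl, hx⟩⟩
    · have hpu' := hpu.trans hpu₂
      exact ⟨_, by omega, hpu'.mono, fun r _ hr => hpu'.regs r hr,
        Or.inl ⟨k + 1, rfl, by omega, hpu', h17₂, h18₂, h19₂, hpc₂, hpy₂⟩⟩
    · have hpu' := hpu.trans hpu₁
      refine ⟨0, by omega, (hpu'.mono (b := 10).setReg).setReg, fun r h1 h2 => ?_,
        Or.inr ⟨rfl, by simp, ?_⟩⟩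
      · rw [regs_setReg, if_neg (by rintro rfl; revert h2; decide), regs_setReg,
          if_neg (by rintro rfl; revert h1; decide), hpu'.regs r h2]
      · rcases hx with ⟨rfl, hx⟩ | ⟨rfl, hx⟩
        · exact Or.inl ⟨by simp [val_mod hw], hx, by omega⟩
        · exact Or.inr ⟨by simp [val_mod hw], hx, by omega⟩
  · rintro m t σ' ⟨hk, hr, ⟨k, rfl, ht, hpu, h17, h18, h19, hpc, hpy⟩ | ⟨-, h19, hfin⟩⟩ heq
    · exact absurd (h19.symm.trans (heq.trans (hk.base hbase).r3)) one_ne_zero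
    · have h1 := List.length_pos_of_ne_nil hc
      have h2 := List.length_pos_of_ne_nil hy
      rw [length_view] at h1 h2
      refine ⟨hk, hr, ?_⟩
      rcases hfin with ⟨h3, h4, h5⟩ | ⟨h3, h4, h5⟩
      · exact Or.inl ⟨h3, h4, by omega⟩
      · exact Or.inr ⟨h3, h4, by omega⟩

/-- What is known about the parent `p` of `u` when the neighbours in `d` have been considered: in terms
of the registers `r11` and `r10`, and with the number `b` of list entries that a later comparison may
have to pay for. -/
def Champion (L : Lists 1 n) (A : Fin n → List (Fin n)) (u p root : Fin n) (d : List (Fin n))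
    (σ : Store 1 n) (b : ℕ) : Prop :=
  (σ.regs 11 = 0 ∧ (∀ y ∈ d, (A y).head? ≠ some u) ∧ b = 0) ∨
  (σ.regs 11 = 1 ∧ ∃ c ∈ d, σ.regs 10 = c.val ∧ (A c).head? = some u ∧ c ≠ root ∧ (p ∈ d → c = p) ∧
    b = if c = p then 0 else (L 0 c).length)

/-- The conditions under which `findParent` finds the parent `p` of `u`. -/
structure IsParent (A : Fin n → List (Fin n)) (root u p : Fin n) : Prop where
  mem : p ∈ A u
  head : (A p).head? = some u
  witness : p ≠ root → Witness A u p
  other : ∀ y ∈ A u, (A y).head? = some u → y ≠ p → ¬ Witness A u y ∧ y ≠ root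

open Classical in
/-- The price for comparing the neighbour `y` of `u` with the parent `p`. -/
noncomputable def price (L : Lists 1 n) (A : Fin n → List (Fin n)) (u p y : Fin n) : ℕ :=
  if (A y).head? = some u ∧ y ≠ p then (L 0 y).length else 0

/-- The loser of a comparison is not the parent, and the length of its list pays for the time; it
does not compete again. -/
theorem wp_consider {d : List (Fin n)} {k : ℕ} (hw : n < 2 ^ w) (hw0 : 0 < w) (hσ : σ.HeadsOk L)
    (hnd : ∀ v, (L 0 v).Nodup) (hbase : Base s w σ) (h5 : σ.regs 5 = u.val)
    (h6 : σ.regs 6 = root.val) (h12 : σ.regs 12 = y.val) (h13 : σ.regs 13 = 1)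
    (hne : ∀ v, ∀ x ∈ L 0 v, σ.view L 0 x ≠ []) (hp : IsParent (σ.view L 0) root u p)
    (hd : ∀ x ∈ d, x ∈ L 0 u) (hy : y ∈ L 0 u) (hyd : y ∉ d)
    (hch : Champion L (σ.view L 0) u p root d σ k) :
    wp L w S consider σ fun t σ' => Pure 10 2 σ σ' ∧ σ'.regs 15 = σ.regs 15 ∧
      ((σ'.regs 13 = 0 ∧ σ'.regs 10 = p.val ∧ t ≤ 10) ∨
        (σ'.regs 13 = 1 ∧ ∃ k', Champion L (σ.view L 0) u p root (d ++ [y]) σ' k' ∧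
          t + 60 * k' ≤ 10 + 60 * k + 60 * price L (σ.view L 0) u p y)) := by
  have h1w : 1 % 2 ^ w = 1 := Nat.mod_eq_of_lt (Nat.one_lt_two_pow hw0.ne')
  have hyne := hne u y hy
  obtain ⟨z, lz, hz⟩ := List.exists_cons_of_ne_nil hyne
  refine wp_seq.2 (wp_headOf h12 hσ hz fun p₁ => ?_)
  set σ₁ := (σ.setCursor 7 p₁).setReg w 16 z.val with hσ₁
  have hk₁ : Pure 16 7 σ σ₁ := ((Pure.refl 16 7 σ).setCursor).setReg
  have h16 : σ₁.regs 16 = z.val := by simp [hσ₁, val_mod hw]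
  have hr : ∀ r : Reg, r.val < 16 → σ₁.regs r = σ.regs r := hk₁.regs
  simp only [wp_ite, wp_skip, wp_const, Test.holds, wp_seq, wp_mov, h16, hr 5 (by decide), h5,
    hr 12 (by decide), h12, hr 6 (by decide), h6, hr 11 (by decide), hr 3 (by decide), hbase.r3,
    Fin.val_inj]
  have hprice : price L (σ.view L 0) u p y = if z = u ∧ y ≠ p then (L 0 y).length else 0 := by
    simp [price, hz]
  refine ⟨fun hzu => ⟨fun hyr => ?_, fun hyr => ⟨fun h11 => ?_, fun h11 => ?_⟩⟩, fun hzu => ?_⟩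
  · -- the root is on the stack, and it is not another candidate
    have hyp : y = p := by
      by_contra hyp
      exact (hp.other y (mem_view.2 hy) (by rw [hz, hzu]; rfl) hyp).2 hyr
    refine ⟨((hk₁.mono (b := 10) (c := 2)).setReg).setReg, by simpa using hr 15 (by decide),
      Or.inl ⟨by simp, by simp [hyp, val_mod hw], by omega⟩⟩
  · rcases hch with ⟨-, hd', rfl⟩ | ⟨h, -⟩
    swap
    · omega
    refine ⟨((hk₁.mono (b := 10) (c := 2)).setReg).setReg, by simpa using hr 15 (by decide),
      Or.inr ⟨by simpa using (hr 13 (by decide)).trans h13, _, Or.inr ⟨by simp [h1w], y, by simp,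
        by simp [val_mod hw], by rw [hz, hzu]; rfl, hyr, fun hpd => ?_, rfl⟩, ?_⟩⟩
    · rcases List.mem_append.1 hpd with hpd | hpd
      · exact absurd hp.head (hd' p hpd)
      · exact (List.mem_singleton.1 hpd).symm
    · rw [hprice]
      by_cases hyp : y = p
      · simp [hyp]
      · simp [hyp, hzu]
  · rcases hch with ⟨h, -⟩ | ⟨h11e, c, hcd, h10, hc, hcr, hpc, rfl⟩
    · exact absurd h h11
    have hyc : y ≠ c := by rintro rfl; exact hyd hcd
    have hycand : (σ.view L 0 y).head? = some u := by rw [hz, hzu]; rfl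
    have hnot : ∀ x ∈ L 0 u, (σ.view L 0 x).head? = some u → x ≠ p → ¬ Witness (σ.view L 0) u x :=
      fun x hx hx' hxp => (hp.other x (mem_view.2 hx) hx' hxp).1
    have hcy : ¬ (Witness (σ.view L 0) u c ∧ Witness (σ.view L 0) u y) := by
      rintro ⟨h1, h2⟩
      by_cases hyp : y = p
      · exact hnot c (hd c hcd) hc (fun hcp => hyc (hyp.trans hcp.symm)) h1
      · exact hnot y hy hycand hyp h2
    have hv₁ : σ₁.view L = σ.view L := hk₁.view
    refine (wp_duel (u := u) (c := c) (y := y) hw hw0 (hk₁.headsOk hσ) hnd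
      ((hk₁.toKeeps).base hbase) ((hr 5 (by decide)).trans h5) ((hr 10 (by decide)).trans h10)
      ((hr 12 (by decide)).trans h12) (by rw [hv₁]; exact hne u c (hd c hcd))
      (by rw [hv₁]; exact hyne) (by rw [hv₁]; exact hne) (by rw [hv₁]; exact hcy)).mono ?_
    rw [hv₁]
    rintro t σ₂ ⟨hk₂, hr₂, hres⟩
    refine ⟨(hk₁.mono (b := 10) (c := 2)).trans hk₂,
      (hr₂ 15 (by decide) (by decide)).trans (hr 15 (by decide)),
      Or.inr ⟨((hr₂ 13 (by decide) (by decide)).trans (hr 13 (by decide))).trans h13, ?_⟩⟩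
    have h11' : σ₂.regs 11 = 1 := by
      rw [hr₂ 11 (by decide) (by decide), hr 11 (by decide), h11e]
    rw [hprice]
    rcases hres with ⟨h10', hW, ht⟩ | ⟨h10', hW, ht⟩
    · -- `y` has lost
      have hyp : y ≠ p := by
        rintro rfl
        exact hW (hp.witness hyr)
      refine ⟨_, Or.inr ⟨h11', c, by simp [hcd], h10', hc, hcr, fun hpd => ?_, rfl⟩, ?_⟩
      · rcases List.mem_append.1 hpd with hpd | hpd
        · exact hpc hpd
        · exact absurd (List.mem_singleton.1 hpd).symm hyp
      · rw [if_pos (show z = u ∧ y ≠ p from ⟨hzu, hyp⟩)]; omega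
    · -- the previous champion has lost
      have hcp : c ≠ p := by
        rintro rfl
        exact hW (hp.witness hcr)
      refine ⟨_, Or.inr ⟨h11', y, by simp, h10', hycand, hyr, fun hpd => ?_, rfl⟩, ?_⟩
      · rcases List.mem_append.1 hpd with hpd | hpd
        · exact absurd (hpc hpd) hcp
        · exact (List.mem_singleton.1 hpd).symm
      · rw [if_neg hcp]
        by_cases hyp : y = p
        · simp [hyp]; omega
        · simp [hyp, hzu]; omega
  · refine ⟨hk₁.mono, hr 15 (by decide), Or.inr ⟨(hr 13 (by decide)).trans h13, k, ?_, ?_⟩⟩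
    · rcases hch with ⟨h11, hd', hk⟩ | ⟨h11, c, hcd, h10, hc, hcr, hpc, hk⟩
      · refine Or.inl ⟨(hr 11 (by decide)).trans h11, fun x hx => ?_, hk⟩
        rcases List.mem_append.1 hx with hx | hx
        · exact hd' x hx
        · obtain rfl := List.mem_singleton.1 hx
          rw [hz]; simpa using hzu
      · refine Or.inr ⟨(hr 11 (by decide)).trans h11, c, by simp [hcd], (hr 10 (by decide)).trans h10,
          hc, hcr, fun hpd => ?_, hk⟩
        rcases List.mem_append.1 hpd with hpd | hpd
        · exact hpc hpd
        · obtain rfl := List.mem_singleton.1 hpd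
          have := hp.head
          rw [hz] at this
          exact absurd (by simpa using this) hzu
    · omega

/-- The last champion is the parent, since the parent cannot lose: only it has a witness, unless it
is the root, which is recognized by its number. -/
theorem wp_findParent (hw : n < 2 ^ w) (hw0 : 0 < w) (hσ : σ.HeadsOk L)
    (hnd : ∀ v, (L 0 v).Nodup) (hbase : Base s w σ) (h5 : σ.regs 5 = u.val)
    (h6 : σ.regs 6 = root.val)
    (hne' : ∀ v, ∀ x ∈ L 0 v, σ.view L 0 x ≠ []) (hp : IsParent (σ.view L 0) root u p) :
    wp L w S findParent σ fun t σ' => Pure 10 1 σ σ' ∧ σ'.regs 10 = p.val ∧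
      t ≤ 40 * (L 0 u).length + 60 * ((σ.view L 0 u).map (price L (σ.view L 0) u p)).sum := by
  have h1w : 1 % 2 ^ w = 1 := Nat.mod_eq_of_lt (Nat.one_lt_two_pow hw0.ne')
  obtain ⟨x₀, l₀, hx₀⟩ := List.exists_cons_of_ne_nil (List.ne_nil_of_mem hp.mem)
  simp only [findParent, wp_seq, wp_const]
  refine wp_headOf_probing (u := u) hσ h5 (List.ne_nil_of_mem hp.mem) fun p₁ x₁ l₁ hx₁ hp₁ => ?_
  set f := price L (σ.view L 0) u p with hf
  refine wp_loop (fun m t σ' => Pure 10 1 σ σ' ∧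
    ((∃ d e k, σ.view L 0 u = d ++ e ∧ e ≠ [] ∧ m = e.length ∧ σ'.regs 15 = x₁.val ∧
        σ'.regs 13 = 1 ∧ σ'.At L 1 0 u (e ++ d) ∧ Champion L (σ.view L 0) u p root d σ' k ∧
        t + 60 * k ≤ 30 * d.length + 60 * (d.map f).sum) ∨
      (m = 0 ∧ σ'.regs 13 = 0 ∧ σ'.regs 10 = p.val ∧
        t ≤ 30 * (L 0 u).length + 60 * ((σ.view L 0 u).map f).sum))) (L 0 u).length ?_ ?_ ?_
  · obtain ⟨d, e, h1, h2, h3, h4, h5⟩ := hp₁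
    obtain rfl := List.length_eq_zero_iff.1 h4
    refine ⟨((((Pure.refl 10 1 σ).setCursor).setReg).setReg).setReg, Or.inl ⟨[], e, 0, h1, h2, ?_,
      by simp [val_mod hw], by simp [h1w], h3.congr rfl, Or.inl ⟨by simp, by simp, rfl⟩, by simp⟩⟩
    have := congrArg List.length h1
    rw [view_setCursor, length_view] at this
    simpa using this
  · rintro m t σ' ⟨hk, ⟨d, e, k, hv, he, rfl, h15, h13, hat, hch, ht⟩ | ⟨-, h13, -⟩⟩ hne
    swap
    · exact absurd (h13.trans (hk.base hbase).r3.symm) hne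
    obtain ⟨y, e, rfl⟩ := List.exists_cons_of_ne_nil he
    have hyu : y ∈ L 0 u := mem_view.1 (by rw [hv]; simp)
    have hndv : (d ++ y :: e).Nodup := by rw [← hv, nodup_view]; exact hnd u
    have hyd : y ∉ d := fun hyd => by simp [List.nodup_append] at hndv; exact hndv.2.2 y hyd |>.1 rfl
    have hk₁ : Pure 10 1 σ (σ'.setReg w 12 y.val) := hk.setReg
    have hv₁ : (σ'.setReg w 12 y.val).view L = σ.view L := hk₁.view
    rw [wp_seq, wp_read hat, wp_seq]
    refine (wp_consider (y := y) (u := u) (p := p) (root := root) (d := d) (k := k) hw hw0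
      (hk₁.headsOk hσ) hnd ((hk₁.toKeeps).base hbase) ((hk₁.regs 5 (by decide)).trans h5)
      ((hk₁.regs 6 (by decide)).trans h6) (by simp [val_mod hw]) (by simpa using h13)
      (by rw [hv₁]; exact hne') (by rw [hv₁]; exact hp)
      (fun x hx => mem_view.1 (by rw [hv]; simp [hx])) hyu hyd ?_).mono ?_
    · rw [hv₁]
      unfold Champion at hch ⊢
      simpa using hch
    rw [hv₁, ← hf]
    rintro t₁ σ₂ ⟨hk₂, h15₂, hres⟩
    have hk₂' : Pure 10 1 σ σ₂ := hk₁.trans hk₂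
    have hb₂ : Base s w σ₂ := (hk₂'.toKeeps).base hbase
    have hsum : d.length + 1 ≤ (L 0 u).length ∧
        (d.map f).sum + f y + (e.map f).sum = ((σ.view L 0 u).map f).sum := by
      constructor
      · rw [← length_view (σ := σ), hv]; simp
      · rw [hv]; simp; ring
    simp only [wp_ite, wp_skip, Test.holds, wp_seq, hb₂.r4]
    rcases hres with ⟨h13₂, h10₂, ht₁⟩ | ⟨h13₂, k', hch', ht₁⟩
    · refine ⟨fun h => by omega, fun _ => ⟨0, by simp, hk₂', Or.inr ⟨rfl, h13₂, h10₂, by omega⟩⟩⟩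
    refine ⟨fun _ => ?_, fun h => absurd h13₂ h⟩
    have hat₂ : σ₂.At L 1 0 u (y :: (e ++ d)) := hat.congr (hk₂.cursors 1 (by decide))
    refine (wp_advance (y := x₁) hw hw0 (h15₂.trans (by simpa using h15)) (by decide) hat₂).mono ?_
    rintro t₂ σ₃ ⟨ht₂, hk₃, hcu, h21, hat₃⟩
    have hk₃' : Pure 10 1 σ σ₃ := ⟨⟨fun r hr => (hk₃.regs r (by omega)).trans (hk₂'.regs r hr),
      fun q hq => (hcu q (by rintro rfl; revert hq; decide)).trans (hk₂'.cursors q hq),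
      hk₃.mem.trans hk₂'.mem, hk₃.out.trans hk₂'.out⟩, hk₃.heads.trans hk₂'.heads⟩
    have hiff := head?_rotated_eq_iff hndv (b := x₁) (by rw [← hv]; exact congrArg List.head? hx₁)
    replace h21 : σ₃.regs 21 = if e = [] then 1 else 0 := by
      rw [h21]; exact if_congr hiff rfl rfl
    have hb₃ : Base s w σ₃ := (hk₃'.toKeeps).base hbase
    have hch₃ : Champion L (σ.view L 0) u p root (d ++ [y]) σ₃ k' := by
      unfold Champion at hch' ⊢
      rw [hk₃.regs 10 (by decide), hk₃.regs 11 (by decide)]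
      exact hch'
    simp only [wp_const, hb₃.r4, h21]
    refine ⟨fun h => ?_, fun h => ?_⟩
    · have he' : e = [] := by by_contra he'; simp [he'] at h
      subst he'
      refine ⟨0, by simp, hk₃'.setReg, Or.inr ⟨rfl, by simp, ?_, ?_⟩⟩
      · rcases hch₃ with ⟨-, hno, -⟩ | ⟨-, c, -, h10, -, -, hpc, -⟩
        · exact absurd hp.head (hno p (by rw [← hv]; exact hp.mem))
        · have := hpc (by rw [← hv]; exact hp.mem)
          subst this
          simpa using h10
      · simp at hsum; omega
    · have he' : e ≠ [] := fun he' => by simp [he'] at h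
      refine ⟨e.length, by simp, hk₃', Or.inl ⟨d ++ [y], e, k', by rw [hv]; simp, he', rfl, ?_, ?_,
        by simpa using hat₃, hch₃, ?_⟩⟩
      · rw [hk₃.regs 15 (by decide), h15₂]; simpa using h15
      · rw [hk₃.regs 13 (by decide), h13₂]
      · simp; omega
  · rintro m t σ' ⟨hk, ⟨d, e, k, hv, he, rfl, h15, h13, hat, hch, ht⟩ | ⟨-, h13, h10, ht⟩⟩ heq
    · exact absurd (h13.symm.trans (heq.trans (hk.base hbase).r3)) one_ne_zero
    · have h1 := List.length_pos_of_mem hp.mem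
      rw [length_view] at h1
      exact ⟨hk, h10, by omega⟩

end Rotate

/-! ### Lexicographic DFS of undirected graphs -/

namespace Rotate

open Store Dfs

variable {n : ℕ}

/-- Go to the unvisited neighbour `r10`; the flag `r9` says that its list has not been touched. -/
def enterUndirected : Cmd 1 := mov 5 10 ;; .prim (.const 9 1)

/-- Go back to the parent.  A leaf of the DFS tree is left with its parent at the head of its list. -/
def leaveUndirected : Cmd 1 :=
  findParent ;; .ite (.eq 9 4) (rotateUntil 0 5 10) .skip ;; mov 5 10 ;; .prim (.const 9 0)

/-- The invariant on the list heads of completed vertices and of the top of the stack. -/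
structure LeafHeads (A : Fin n → List (Fin n)) (flag : ℕ) (T : List (Fin n × ℕ))
    (F : List (Frame n)) : Prop where
  /-- A completed vertex with a vertex `q` of the stack at its head is a leaf of the DFS tree: all its
  neighbours are on the stack, and none of them is above `q`. -/
  black : ∀ y ∈ visited T, y ∉ verts F → ∀ q, (A y).head? = some q → q ∈ verts F →
    ∃ π₁ π₂, verts F = π₁ ++ q :: π₂ ∧ ∀ x ∈ A y, x ∈ q :: π₂
  /-- The top vertex has no child so far. -/
  fresh : flag = 1 → ∀ u ∈ (verts F).head?, ∀ x ∈ A u, x ∈ visited T → x ∈ verts F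
  /-- The last child of the top vertex is at the head of its list. -/
  used : flag ≠ 1 → ∀ u ∈ (verts F).head?, ∀ q, (A u).head? = some q → q ∉ verts F

open Classical in
/-- The share of vertex `v` in the potential: the cost of visiting it, or the cost of comparing it
with another vertex when its parent is completed. -/
noncomputable def undirectedShare (L : Lists 1 n) (A : Fin n → List (Fin n)) (T : List (Fin n × ℕ))
    (F : List (Frame n)) (v : Fin n) : ℕ :=
  if v ∈ visited T then
    if v ∉ verts F ∧ ∃ q, (A v).head? = some q ∧ q ∈ verts F then 60 * (L 0 v).length else 0
  else 141 * (L 0 v).length + 150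

/-- The potential that pays for the running time. -/
noncomputable def undirectedPotential (L : Lists 1 n) (A : Fin n → List (Fin n))
    (T : List (Fin n × ℕ)) (F : List (Frame n)) : ℕ :=
  (∑ v, undirectedShare L A T F v) + (F.map fun f => 16 * f.2.length + 125 * (L 0 f.1).length + 80).sum

variable {L : Lists 1 n} {r : Fin n → Fin n → Prop} {s u p root : Fin n} {w S : ℕ} {σ : Store 1 n}
  {T : List (Fin n × ℕ)} {F : List (Frame n)} {l : List (Fin n)} {f : Frame n}

/-- The vertex above a vertex on the stack is at the head of its list. -/
theorem stack_head {A : Fin n → List (Fin n)} {F : List (Frame n)} {u v : Fin n} {l : List (Fin n)}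
    (hch : ((u, l) :: F).IsChain fun c p => ∃ l, p.2 = c.1 :: l)
    (hA : ∀ f ∈ F, ∃ pre, A f.1 = f.2 ++ pre) (hv : v ∈ verts F) :
    ∃ π₁ c π₂, u :: verts F = π₁ ++ c :: v :: π₂ ∧ (A v).head? = some c := by
  induction F generalizing u l with
  | nil => simp at hv
  | cons f F ih =>
    rw [List.isChain_cons_cons] at hch
    by_cases hvf : v = f.1
    · obtain ⟨l', hl'⟩ := hch.1
      obtain ⟨pre, hpre⟩ := hA f (by simp)
      exact ⟨[], u, verts F, by simp [hvf], by rw [hvf, hpre, hl']; rfl⟩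
    · have hv' : v ∈ verts F := by
        simp only [verts, List.map_cons, List.mem_cons] at hv
        exact hv.resolve_left hvf
      obtain ⟨π₁, c, π₂, h1, h2⟩ := ih (u := f.1) (l := f.2) hch.2
        (fun g hg => hA g (List.mem_cons_of_mem _ hg)) hv'
      exact ⟨u :: π₁, c, π₂, by simp only [verts, List.map_cons, List.cons_append] at h1 ⊢; rw [h1], h2⟩

theorem LexCore.stack_head (hc : LexCore L 0 r s w root σ T ((u, l) :: F)) {v : Fin n}
    (hv : v ∈ verts F) :
    ∃ π₁ c π₂, u :: verts F = π₁ ++ c :: v :: π₂ ∧ (σ.view L 0 v).head? = some c := by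
  refine Rotate.stack_head hc.snap.chain (fun f hf => ?_) hv
  obtain ⟨pre, -, h⟩ := hc.frames f (List.mem_cons_of_mem _ hf)
  exact ⟨pre, h⟩

theorem LexCore.eq_parent (hc : LexCore L 0 r s w root σ T ((u, l) :: f :: F)) {v : Fin n}
    (hv : v ∈ verts (f :: F)) (hu : (σ.view L 0 v).head? = some u) : v = f.1 := by
  obtain ⟨π₁, c, π₂, h1, h2⟩ := hc.stack_head hv
  obtain rfl : u = c := by simpa [hu] using h2
  have hnd := hc.snap.nodup_stack
  cases π₁ with
  | nil => simp at h1; exact h1.1.symm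
  | cons a π₁ =>
    simp only [List.cons_append, List.cons.injEq] at h1
    obtain ⟨rfl, h1⟩ := h1
    exfalso
    apply (List.nodup_cons.1 hnd).1
    change u ∈ verts (f :: F)
    rw [h1]; simp

/-- The parent of the top vertex has a witness, namely its own parent. Any other neighbour with the
top vertex at its head is a leaf; its neighbours are on the stack, and so have vertices of the stack
at their heads. -/
theorem LexCore.isParent (hc : LexCore L 0 r s w root σ T ((u, l) :: f :: F)) (hsymm : ∀ u v, r u v → r v u)
    (hirr : ∀ v, ¬ r v v) (hX : LeafHeads (σ.view L 0) (σ.regs 9) T ((u, l) :: f :: F))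
    (hall : ∀ y ∈ L 0 u, y ∈ visited T) : IsParent (σ.view L 0) root u f.1 where
  mem := by
    obtain ⟨l', hl'⟩ := (List.isChain_cons_cons.1 hc.snap.chain).1
    obtain ⟨pre, h1, h2⟩ := hc.frames f (by simp)
    refine mem_view.2 (hc.snap.mem_iff.2 (hsymm _ _ (hc.snap.mem_iff.1 ?_)))
    rw [h1, hl']; simp
  head := by
    obtain ⟨l', hl'⟩ := (List.isChain_cons_cons.1 hc.snap.chain).1
    obtain ⟨pre, h1, h2⟩ := hc.frames f (by simp)
    rw [h2, hl']; rfl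
  witness := by
    intro hne
    cases F with
    | nil => exact absurd (hc.last f.1 (by simp)) hne
    | cons g F =>
      have hch := (List.isChain_cons_cons.1 (List.isChain_cons_cons.1 hc.snap.chain).2).1
      obtain ⟨l', hl'⟩ := hch
      obtain ⟨pre, h1, h2⟩ := hc.frames g (by simp)
      refine ⟨g.1, mem_view.2 (hc.snap.mem_iff.2 (hsymm _ _ (hc.snap.mem_iff.1 ?_))), ?_, ?_⟩
      · rw [h1, hl']; simp
      · rintro hgu
        have := hc.snap.nodup_stack
        simp [verts, hgu] at this
      · rw [h2, hl']; rfl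
  other := by
    intro y hy hyu hyp
    have hyT := hall y (mem_view.1 hy)
    have hru : r u y := hc.snap.mem_iff.1 (mem_view.1 hy)
    have hyF : y ∉ verts ((u, l) :: f :: F) := by
      intro hyF
      simp only [verts, List.map_cons, List.mem_cons] at hyF
      rcases hyF with rfl | hyF
      · exact hirr _ hru
      · exact hyp (hc.eq_parent (by simpa using hyF) hyu)
    obtain ⟨π₁, π₂, h1, h2⟩ := hX.black y hyT hyF u hyu (by simp)
    have hsub : ∀ x ∈ σ.view L 0 y, x ∈ verts ((u, l) :: f :: F) := fun x hx => by
      rw [h1]; exact List.mem_append_right _ (h2 x hx)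
    refine ⟨?_, ?_⟩
    · rintro ⟨x, hx, hxu, hxy⟩
      have hxF := hsub x hx
      simp only [verts, List.map_cons, List.mem_cons] at hxF
      have hxF' : x ∈ verts (f :: F) := by simpa using hxF.resolve_left hxu
      obtain ⟨π₁, c, π₂, h3, h4⟩ := hc.stack_head hxF'
      obtain rfl : y = c := by simpa [hxy] using h4
      apply hyF
      change y ∈ u :: verts (f :: F)
      rw [h3]; simp
    · rintro rfl
      apply hyF
      have := hc.last _ (List.getLast?_eq_some_getLast (by simp))
      rw [← this]
      exact List.getLast_mem _

/-- Completing a vertex releases enough potential to find its parent. -/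
theorem undirectedShare_leave (hc : LexCore L 0 r s w root σ T ((u, l) :: f :: F))
    (hirr : ∀ v, ¬ r v v) (hall : ∀ y ∈ L 0 u, y ∈ visited T) {A : Fin n → List (Fin n)}
    (hA : ∀ v ≠ u, A v = σ.view L 0 v) :
    (∑ v, undirectedShare L A T (f :: F) v) +
        60 * ((σ.view L 0 u).map (price L (σ.view L 0) u f.1)).sum ≤
      (∑ v, undirectedShare L (σ.view L 0) T ((u, l) :: f :: F) v) + 60 * (L 0 u).length := by
  classical
  have hnd : (σ.view L 0 u).Nodup := nodup_view.2 (hc.nodup u)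
  have hsum : ((σ.view L 0 u).map (price L (σ.view L 0) u f.1)).sum =
      ∑ v, if v ∈ L 0 u then price L (σ.view L 0) u f.1 v else 0 := by
    rw [← List.sum_toFinset _ hnd, ← Finset.sum_filter]
    refine Finset.sum_congr ?_ fun _ _ => rfl
    ext v
    simp [mem_view]
  have hu : 60 * (L 0 u).length = ∑ v, if v = u then 60 * (L 0 u).length else 0 := by simp
  rw [hsum, hu, Finset.mul_sum, ← Finset.sum_add_distrib, ← Finset.sum_add_distrib]
  refine Finset.sum_le_sum fun v _ => ?_
  have huT : u ∈ visited T := hc.snap.stack_subset u (by simp)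
  by_cases hvu : v = u
  · subst hvu
    have h1 : v ∉ L 0 v := fun h => hirr v (hc.snap.mem_iff.1 h)
    simp only [undirectedShare, h1, huT, if_true, if_false]
    split_ifs <;> omega
  simp only [undirectedShare, hA v hvu, hvu, if_false]
  by_cases hvT : v ∈ visited T
  swap
  · have h1 : v ∉ L 0 u := fun h => hvT (hall v h)
    simp [hvT, h1]
  simp only [hvT, if_true]
  have hmem : v ∈ verts ((u, l) :: f :: F) ↔ v ∈ verts (f :: F) := by simp [hvu]
  by_cases hvF : v ∈ verts (f :: F)
  · have h1 : price L (σ.view L 0) u f.1 v = 0 := by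
      rw [price, if_neg]
      rintro ⟨h1, h2⟩
      exact h2 (hc.eq_parent hvF h1)
    rw [if_neg (fun h => h.1 hvF), h1]
    simp
  have huF : u ∉ verts (f :: F) := (List.nodup_cons.1 hc.snap.nodup_stack).1
  by_cases hhu : (σ.view L 0 v).head? = some u
  · have h1 : ¬ (v ∉ verts (f :: F) ∧ ∃ q, (σ.view L 0 v).head? = some q ∧ q ∈ verts (f :: F)) := by
      rintro ⟨-, q, h1, h2⟩
      obtain rfl : u = q := by simpa [hhu] using h1
      exact huF h2
    have h2 : v ∉ verts ((u, l) :: f :: F) ∧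
        ∃ q, (σ.view L 0 v).head? = some q ∧ q ∈ verts ((u, l) :: f :: F) :=
      ⟨by rwa [hmem], u, hhu, by simp⟩
    rw [if_neg h1, if_pos h2]
    split_ifs
    · rw [price]; split_ifs <;> omega
    · omega
  · have h1 : price L (σ.view L 0) u f.1 v = 0 := by
      rw [price, if_neg]
      rintro ⟨h1, -⟩
      exact hhu h1
    simp only [h1, ite_self, mul_zero, add_zero]
    split_ifs with h2 h3
    · exact le_rfl
    · exfalso
      obtain ⟨h2, q, h4, h5⟩ := h2
      exact h3 ⟨by rwa [hmem], q, h4, List.mem_cons_of_mem _ h5⟩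
    · omega
    · omega

/-- A new vertex on the stack is not at the head of the list of a completed vertex, as it is not
adjacent to any. -/
theorem undirectedShare_push {A A' : Fin n → List (Fin n)} {x : Fin n} {d : ℕ}
    {F F' : List (Frame n)} (hx : x ∉ visited T) (hA : ∀ v ∉ verts F, A' v = A v)
    (hF : ∀ v, v ∈ verts F' ↔ v = x ∨ v ∈ verts F)
    (hq : ∀ v ∈ visited T, v ∉ verts F → (A v).head? ≠ some x) :
    (∑ v, undirectedShare L A' (T ++ [(x, d)]) F' v) + (141 * (L 0 x).length + 150) ≤
      ∑ v, undirectedShare L A T F v := by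
  have hu : 141 * (L 0 x).length + 150 = ∑ v, if v = x then 141 * (L 0 x).length + 150 else 0 := by
    simp
  rw [hu, ← Finset.sum_add_distrib]
  refine Finset.sum_le_sum fun v _ => ?_
  have hmem : v ∈ visited (T ++ [(x, d)]) ↔ v ∈ visited T ∨ v = x := mem_visited_append
  by_cases hvx : v = x
  · subst hvx
    have : v ∈ visited (T ++ [(v, d)]) := hmem.2 (Or.inr rfl)
    simp only [undirectedShare, hF, hx, this, if_true, if_false]
    simp
  simp only [undirectedShare, hvx, if_false, hmem, or_false, add_zero]
  by_cases hvT : v ∈ visited T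
  swap
  · simp [hvT]
  simp only [hvT, if_true]
  split_ifs with h2 h3
  · exact le_rfl
  · exfalso
    obtain ⟨h2, q, h4, h5⟩ := h2
    have hvF : v ∉ verts F := fun h => h2 ((hF v).2 (Or.inr h))
    rw [hA v hvF] at h4
    rcases (hF q).1 h5 with rfl | h5
    · exact hq v hvT hvF h4
    · exact h3 ⟨hvF, q, h4, h5⟩
  · omega
  · omega

theorem lexSpec_undirected (s : Fin n) (S : ℕ) (hw : n < 2 ^ w) (hw0 : 0 < w)
    (hsymm : ∀ u v, r u v → r v u) (hirr : ∀ v, ¬ r v v) :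
    LexSpec L 0 r s w S enterUndirected leaveUndirected (fun V => LeafHeads (V 0))
      (fun V => undirectedPotential L (V 0)) where
  enter := by
    intro root σ₀ T u l₁ x l₂ F σ hc₀ hX h₁ hx hc h5 h10 h8 h9 hoth
    have h1w : 1 % 2 ^ w = 1 := Nat.mod_eq_of_lt (Nat.one_lt_two_pow hw0.ne')
    simp only [enterUndirected, wp_seq, wp_mov, wp_const]
    have hblack : ∀ y ∈ visited T, y ∉ verts ((u, l₁ ++ x :: l₂) :: F) → x ∉ L 0 y :=
      fun y hy hyF hxy => hx (hc₀.snap.closed y hy hyF x (hc₀.snap.mem_iff.1 hxy))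
    refine ⟨hc.congr ?_ hc.ok rfl rfl (by simp) (fun v => rfl), ?_, ?_, ?_, ?_, ?_⟩
    · refine hc.base.congr (b := 5) fun r' hr' => ?_
      rw [regs_setReg, if_neg (by rintro rfl; revert hr'; decide), regs_setReg,
        if_neg (by rintro rfl; revert hr'; decide)]
    · refine ⟨fun y hy hyF q hyq hqF => ?_, fun _ u' hu' y hy hyT => ?_, fun h => ?_⟩
      · have hyx : y ≠ x := by rintro rfl; simp at hyF
        have hyT : y ∈ visited T := (mem_visited_append.1 hy).resolve_right hyx
        have hyF' : y ∉ verts ((u, l₁ ++ x :: l₂) :: F) := fun h => hyF (List.mem_cons_of_mem _ h)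
        have hyu : y ≠ u := by rintro rfl; simp at hyF
        simp only [view_setReg] at hyq ⊢
        have hv : σ.view L 0 y = σ₀.view L 0 y := hoth 0 y (by simp [hyu])
        rw [hv] at hyq ⊢
        have hqx : q ≠ x := by
          rintro rfl
          exact hblack y hyT hyF' (mem_view.1 (List.mem_of_head? hyq))
        obtain ⟨π₁, π₂, h1, h2⟩ := hX.black y hyT hyF' q hyq (List.mem_of_ne_of_mem hqx hqF)
        exact ⟨x :: π₁, π₂, by simp only [verts, List.map_cons, List.cons_append] at h1 ⊢; rw [h1], h2⟩
      · obtain rfl : x = u' := by simpa using hu'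
        by_contra hyF
        have hyx : y ≠ x := by rintro rfl; simp at hyF
        have hyT' : y ∈ visited T := (mem_visited_append.1 hyT).resolve_right hyx
        exact hblack y hyT' (fun h => hyF (List.mem_cons_of_mem _ h))
          (hc.snap.mem_iff.2 (hsymm _ _ (hc.snap.mem_iff.1 (mem_view.1 hy))))
      · simp [h1w] at h
    · simp [h10, val_mod hw]
    · simpa using h8
    · simp
    · have := undirectedShare_push (L := L) (A := σ₀.view L 0) (A' := σ.view L 0)
        (d := F.length + 1)
        (F := (u, l₁ ++ x :: l₂) :: F) (F' := (x, L 0 x) :: (u, x :: l₂) :: F) hx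
        (fun v hv => hoth 0 v (by
          rintro ⟨-, rfl⟩
          exact hv (by simp))) (fun v => by simp) (fun v hv hvF hvx =>
            hblack v hv hvF (mem_view.1 (List.mem_of_head? hvx)))
      simp only [undirectedPotential, view_setReg, List.map_cons, List.sum_cons, List.length_append,
        List.length_cons]
      omega
  leave := by
    intro root T u l f F σ hc hX hall h5 h8
    have hp := hc.isParent hsymm hirr hX hall
    have hne : ∀ v, ∀ x ∈ L 0 v, σ.view L 0 x ≠ [] := fun v x hx =>
      List.ne_nil_of_mem (mem_view.2 (hc.snap.mem_iff.2 (hsymm _ _ (hc.snap.mem_iff.1 hx))))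
    refine (wp_findParent hw hw0 hc.ok hc.nodup hc.base h5 (hc.r6 (by simp)) hne hp).seq ?_
    rintro t₁ σ₁ ⟨hk₁, h10₁, ht₁⟩
    have hb₁ : Base s w σ₁ := (hk₁.toKeeps).base hc.base
    have hv₁ : σ₁.view L = σ.view L := hk₁.view
    have h9₁ : σ₁.regs 9 = σ.regs 9 := hk₁.regs 9 (by decide)
    have hnd := hc.snap.nodup_stack
    have huF : u ∉ verts (f :: F) := (List.nodup_cons.1 hnd).1
    -- the end of the command, when the list of `u` has been treated
    have key : ∀ (σ₂ : Store 1 n) t₂, Keeps 10 1 σ₁ σ₂ → σ₂.regs 10 = f.1.val → σ₂.HeadsOk L →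
        (∀ v ≠ u, σ₂.view L 0 v = σ.view L 0 v) → t₂ ≤ 5 * (L 0 u).length + 5 →
        (∀ q, (σ₂.view L 0 u).head? = some q → q ∈ verts (f :: F) →
          ∃ π₁ π₂, verts (f :: F) = π₁ ++ q :: π₂ ∧ ∀ x ∈ σ₂.view L 0 u, x ∈ q :: π₂) →
        wp L w S (mov 5 10 ;; .prim (.const 9 0)) σ₂ fun t σ' =>
          LexCore L 0 r s w root σ' T (f :: F) ∧ LeafHeads (σ'.view L 0) (σ'.regs 9) T (f :: F) ∧
          σ'.regs 5 = f.1.val ∧ σ'.regs 8 = 1 ∧ σ'.regs 7 = σ.regs 7 ∧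
          t₁ + (t₂ + t) + 16 * (L 0 u).length + 60 + undirectedPotential L (σ'.view L 0) T (f :: F) ≤
            undirectedPotential L (σ.view L 0) T ((u, l) :: f :: F) := by
      intro σ₂ t₂ hk₂ h10₂ hok₂ hv₂ ht₂ hleaf
      have hk : Keeps 10 1 σ σ₂ := (hk₁.toKeeps).trans hk₂
      simp only [wp_seq, wp_mov, wp_const]
      refine ⟨⟨?_, hok₂, ?_, ?_, (hc.pop hall).snap, fun _ => ?_, (hc.pop hall).last, ?_, ?_⟩,
        ⟨?_, fun h => ?_, fun _ u' hu' q hq hqF => ?_⟩, ?_, ?_, ?_, ?_⟩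
      · refine (hk.base hc.base).congr (b := 5) fun r' hr' => ?_
        rw [regs_setReg, if_neg (by rintro rfl; revert hr'; decide), regs_setReg,
          if_neg (by rintro rfl; revert hr'; decide)]
      · rw [mem_setReg, mem_setReg, hk.mem]; exact hc.bits
      · rw [out_setReg, out_setReg, hk.out]; exact hc.out
      · simpa using (hk.regs 6 (by decide)).trans (hc.r6 (by simp))
      · intro g hg
        have hgu : g.1 ≠ u := fun h => huF (h ▸ List.mem_map_of_mem hg)
        simp only [view_setReg, hv₂ g.1 hgu]
        exact hc.frames g (List.mem_cons_of_mem _ hg)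
      · intro v hv
        have hvu : v ≠ u := by rintro rfl; exact hv (hc.snap.stack_subset v (by simp))
        simp only [view_setReg, hv₂ v hvu]
        exact hc.white v hv
      · intro y hy hyF q hyq hqF
        simp only [view_setReg] at hyq ⊢
        by_cases hyu : y = u
        · subst hyu
          exact hleaf q hyq hqF
        · rw [hv₂ y hyu] at hyq ⊢
          obtain ⟨π₁, π₂, h1, h2⟩ := hX.black y hy (by
            intro h
            simp only [verts, List.map_cons, List.mem_cons] at h hyF
            exact hyF (h.resolve_left hyu)) q hyq (List.mem_cons_of_mem _ hqF)
          cases π₁ with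
          | nil =>
            simp only [verts, List.map_cons, List.nil_append, List.cons.injEq] at h1
            exact absurd (h1.1 ▸ hqF) huF
          | cons a π₁ =>
            simp only [verts, List.map_cons, List.cons_append, List.cons.injEq] at h1
            exact ⟨π₁, π₂, by simpa using h1.2, h2⟩
      · simp at h
      · obtain rfl : f.1 = u' := by simpa using hu'
        have hfu : f.1 ≠ u := fun h => huF (by rw [← h]; simp)
        simp only [view_setReg, hv₂ f.1 hfu, hp.head, Option.some.injEq] at hq
        exact huF (hq ▸ hqF)
      · simp [h10₂, val_mod hw]
      · simpa using (hk.regs 8 (by decide)).trans h8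
      · simpa using hk.regs 7 (by decide)
      · have := undirectedShare_leave hc hirr hall hv₂
        simp only [undirectedPotential, view_setReg, List.map_cons, List.sum_cons] at this ⊢
        omega
    simp only [wp_seq, wp_ite, wp_skip, Test.holds, hb₁.r4, h9₁]
    refine ⟨fun h9 => ?_, fun h9 => ?_⟩
    · obtain ⟨a, b, hab⟩ := List.append_of_mem hp.mem
      have hnu : (σ.view L 0 u).Nodup := nodup_view.2 (hc.nodup u)
      have hfa : f.1 ∉ a := by
        rw [hab] at hnu
        exact fun hfa => (List.nodup_append.1 hnu).2.2 _ hfa f.1 (by simp) rfl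
      have hlen : a.length ≤ (L 0 u).length := by
        rw [← length_view (σ := σ) (L := L), hab]; simp
      refine (wp_rotateUntil (i := 0) (a := 5) (r := 10) (v := u) (x := f.1) (l₁ := a) (l₂ := b) hw
        (hk₁.headsOk hc.ok) ((hk₁.regs 5 (by decide)).trans h5) h10₁ (by decide) (by decide)
        (by rw [hv₁, hab]) hfa).mono ?_
      rintro t₂ σ₂ ⟨ht₂, hk₂, hok₂, hvu, hvo⟩
      refine (wp_seq.1 (key σ₂ (1 + t₂) (hk₂.mono) ((hk₂.regs 10 (by decide)).trans h10₁) hok₂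
        (fun v hv => (hvo 0 v (by simp [hv])).trans (by rw [hv₁])) (by omega) ?_))
      intro q hq hqF
      obtain rfl : f.1 = q := by simpa [hvu] using hq
      refine ⟨[], verts F, by simp, fun x hx => ?_⟩
      have hx' : x ∈ σ.view L 0 u := by rw [hab]; rw [hvu] at hx; simp at hx ⊢; tauto
      have hxF := hX.fresh h9 u (by simp) x hx' (hall x (mem_view.1 hx'))
      simp only [verts, List.map_cons, List.mem_cons] at hxF ⊢
      refine hxF.resolve_left ?_
      rintro rfl
      exact hirr _ (hc.snap.mem_iff.1 (mem_view.1 hx'))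
    · refine (wp_seq.1 (key σ₁ (1 + 0 + 1) (Keeps.refl _ _ _) h10₁ (hk₁.headsOk hc.ok)
        (fun v hv => by rw [hv₁]) (by omega) ?_))
      intro q hq hqF
      rw [hv₁] at hq
      exact absurd (List.mem_cons_of_mem _ hqF) (hX.used h9 u (by simp) q hq)
  finish := by
    intro root T u l σ hc hX hall
    refine ⟨⟨by simp, by simp, by simp⟩, ?_⟩
    have : (∑ v, undirectedShare L (σ.view L 0) T [] v) ≤
        ∑ v, undirectedShare L (σ.view L 0) T [(u, l)] v := by
      refine Finset.sum_le_sum fun v _ => ?_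
      simp only [undirectedShare]
      split_ifs <;> simp_all
    simp only [undirectedPotential, List.map_cons, List.sum_cons, List.map_nil, List.sum_nil]
    omega
  start := by
    intro root₀ T x σ hc hX hx
    have hblack : ∀ y ∈ visited T, x ∉ L 0 y :=
      fun y hy hxy => hx (hc.snap.closed y hy (by simp) x (hc.snap.mem_iff.1 hxy))
    have hq : ∀ v ∈ visited T, v ∉ verts ([] : List (Frame n)) → (σ.view L 0 v).head? ≠ some x :=
      fun v hv _ hvx => hblack v hv (mem_view.1 (List.mem_of_head? hvx))
    refine ⟨⟨fun y hy hyF q hyq hqF => ?_, fun _ u' hu' y hy hyT => ?_, fun h => absurd rfl h⟩, ?_⟩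
    · have hyx : y ≠ x := by rintro rfl; simp at hyF
      have hqx : q = x := by simpa using hqF
      exact absurd (hqx ▸ hyq) (hq y ((mem_visited_append.1 hy).resolve_right hyx) (by simp))
    · obtain rfl : x = u' := by simpa using hu'
      by_contra hyF
      have hyx : y ≠ x := by rintro rfl; simp at hyF
      exact hblack y ((mem_visited_append.1 hyT).resolve_right hyx)
        (hc.snap.mem_iff.2 (hsymm _ _ (hc.snap.mem_iff.1 (mem_view.1 hy))))
    · have := undirectedShare_push (L := L) (A := σ.view L 0) (A' := σ.view L 0)
        (d := 0) (F := []) (F' := [(x, L 0 x)]) hx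
        (fun v hv => rfl) (fun v => by simp) hq
      simp only [undirectedPotential, List.map_cons, List.sum_cons, List.map_nil, List.sum_nil]
      omega

theorem outputs_lex_undirected (s : Fin n) (hw : n < 2 ^ w) (hw0 : 0 < w)
    (hadj : IsAdjacencyOrder r (L 0)) (hsymm : ∀ u v, r u v → r v u) (hirr : ∀ v, ¬ r v v) :
    ∃ t, Outputs (lexMain 0 enterUndirected leaveUndirected).program L s w (n / w + 1) t
        (dfsOrder (L 0) s) ∧ t ≤ 141 * (∑ v, (L 0 v).length) + 165 * n + 10 := by
  obtain ⟨t, σ, hr, ho, ht⟩ := wp_lexMain (S := n / w + 1) hw (Nat.lt_succ_self _) hw0 hadj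
    (lexSpec_undirected s _ hw hw0 hsymm hirr) (fun f => ⟨by simp, by simp, by simp⟩)
  refine ⟨t, hr.outputs ho, ht.trans ?_⟩
  simp only [undirectedPotential, undirectedShare, List.map_nil, List.not_mem_nil, if_false,
    List.sum_nil, Finset.sum_add_distrib, ← Finset.mul_sum, Finset.sum_const, Finset.card_univ,
    Fintype.card_fin, smul_eq_mul]
  omega

end Rotate

/-! ### DFS without a bit vector, up to the recognition of visited vertices -/

namespace Dfs

variable {n : ℕ}

/-- The largest depth in a trace. -/
def maxDepth (T : List (Fin n × ℕ)) : ℕ := (T.map Prod.snd).foldr max 0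

theorem maxDepth_append (T : List (Fin n × ℕ)) (x : Fin n) (d : ℕ) :
    maxDepth (T ++ [(x, d)]) = max (maxDepth T) d := by
  induction T with
  | nil => simp [maxDepth]
  | cons a T ih =>
    simp only [maxDepth, List.cons_append, List.map_cons, List.foldr_cons] at ih ⊢
    rw [ih, max_assoc]

/-- If all vertices are reachable from `s`, then there is only one tree. -/
theorem Snapshot.dfsTrace_eq {r : Fin n → Fin n → Prop} {ρ : Fin n → List (Fin n)}
    {T : List (Fin n × ℕ)} {s : Fin n} (hs : Snapshot r ρ T []) (hT : dfsVisit ρ n 0 [] s = T)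
    (hsT : s ∈ visited T) (hr : ∀ v, Relation.ReflTransGen r s v) : dfsTrace ρ s = T := by
  have hall : ∀ v, v ∈ visited T := fun v => by
    induction hr v with
    | refl => exact hsT
    | tail _ hab ih => exact hs.closed _ ih (by simp) _ hab
  rw [dfsTrace, List.foldl_cons, hT]
  exact foldl_dfsVisit_of_subset fun v _ => hall v

end Dfs

namespace Rotate

open Store Dfs

variable {h n : ℕ}

/-- Go back to the parent, or stop in the source.  The command `leave` has to make the parent the
current vertex. -/
def goBack (leave : Cmd h) : Cmd h :=
  .ite (.eq 5 1) (.prim (.const 8 0)) (leave ;; .prim (.op .sub 6 6 4) ;; .prim (.const 9 1))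

/-- Visit `r11`, the vertex at the head of the list of the current vertex.  The command `enter` has to
make it the current vertex. -/
def descend (enter : Cmd h) : Cmd h :=
  enter ;; .prim (.output 11) ;; .prim (.op .add 6 6 4) ;; .ite (.lt 7 6) (mov 7 6) .skip

/-- Search the graph from the source.  The current vertex is `r5`, its depth is `r6`, the largest depth
so far is `r7`, and `r8` is cleared at the end.  The flag `r9` says that the vertex at the head of the
list of `r5` has been scanned.  The commands `check` and `last` give their answer in `r12`: `check`
whether `r11` is unvisited, and `last` whether `r11` is the last vertex in the list of `r5`. -/
def linkMain (i : Fin h) (start check last enter leave : Cmd h) : Cmd h :=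
  .prim (.const 4 1) ;; mov 5 1 ;; .prim (.const 8 1) ;; start ;; .prim (.output 5) ;;
  .loop (.eq 8 3)
    (.prim (.front 0 i 5) ;;
      .ite (.null 0) (goBack leave)
        (.prim (.read 11 0) ;;
          .ite (.eq 9 4)
            (last ;; .ite (.eq 12 4) (goBack leave) (.prim (.rotate i 5) ;; .prim (.const 9 0)))
            (check ;; .ite (.eq 12 4) (descend enter) (.prim (.const 9 1)))))

/-- The part of the invariant that is common to directed and undirected graphs, when `(u, l)` is the
top of the stack and `F` the rest.  The order `ρ` in which the neighbours of a vertex are scanned is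
fixed when the vertex is visited. -/
structure LinkCore (L : Lists h n) (i : Fin h) (r : Fin n → Fin n → Prop) (s : Fin n) (w : ℕ)
    (σ : Store h n) (ρ : Fin n → List (Fin n)) (T : List (Fin n × ℕ)) (u : Fin n)
    (l : List (Fin n)) (F : List (Frame n)) : Prop where
  base : Base s w σ
  r5 : σ.regs 5 = u.val
  r6 : σ.regs 6 = F.length
  r7 : σ.regs 7 = maxDepth T
  r8 : σ.regs 8 = 1
  depth_le : F.length ≤ maxDepth T
  ok : σ.HeadsOk L
  out : σ.out = (visited T).map Fin.val
  snap : Snapshot r ρ T ((u, l) :: F)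
  /-- the final trace is determined, up to the order of the lists of unvisited vertices -/
  sound : ∀ R : Fin n → List (Fin n), (∀ v ∈ visited T, R v = ρ v) →
    unwind R T ((u, l) :: F) = dfsVisit R n 0 [] s
  root : ∀ v ∈ (u :: verts F).getLast?, v = s
  below : ∀ f ∈ F, ∃ pre, ρ f.1 = pre ++ f.2 ∧ σ.view L i f.1 = f.2 ++ pre
  top : σ.regs 9 = 0 ∧ (∃ pre, ρ u = pre ++ l ∧ σ.view L i u = l ++ pre ∧ (l = [] → pre = [])) ∨
    σ.regs 9 = 1 ∧ (∃ pre c, c ∈ visited T ∧ ρ u = pre ++ c :: l ∧ σ.view L i u = c :: l ++ pre)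

/-- A potential to which every unvisited vertex contributes. -/
def whitePotential (e : Fin n → (Fin h → ℕ) → List (Fin n) → ℕ) (H : Fin h → Fin n → ℕ)
    (T : List (Fin n × ℕ)) : ℕ :=
  ∑ v, if v ∈ visited T then 0 else e v (fun j => H j v) (visited T)

/-- What the commands have to guarantee.  `X` is an invariant that depends on the list heads, the
largest depth so far, the register `r10`, and the state of the DFS.  In terms of the largest depth so
far, `K` bounds the time for a single operation, and the white potential given by `e` bounds the
number of these operations in `start` and `enter`. -/
structure LinkSpec (L : Lists h n) (i : Fin h) (r : Fin n → Fin n → Prop) (s : Fin n) (w S : ℕ)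
    (start check last enter leave : Cmd h)
    (X : (Fin h → Fin n → ℕ) → ℕ → ℕ → (Fin n → List (Fin n)) → List (Fin n × ℕ) →
      List (Frame n) → Prop) (K : ℕ → ℕ) (e : Fin n → (Fin h → ℕ) → List (Fin n) → ℕ) : Prop where
  mono : Monotone K
  le : ∀ D, 20 ≤ K D
  rotate : ∀ H H' D m ρ T u l F, X H D m ρ T ((u, l) :: F) →
    (∀ j v, ¬ (j = i ∧ v = u) → H' j v = H j v) → X H' D m ρ T ((u, l) :: F)
  skip : ∀ H D m ρ T u x l F, X H D m ρ T ((u, x :: l) :: F) → X H D m ρ T ((u, l) :: F)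
  check : ∀ σ ρ T u x l F, LinkCore L i r s w σ ρ T u (x :: l) F →
    X σ.heads (maxDepth T) (σ.regs 10) ρ T ((u, x :: l) :: F) → σ.regs 11 = x.val → σ.regs 9 = 0 →
    wp L w S check σ fun t σ' => t ≤ K (maxDepth T) ∧ Pure 12 0 σ σ' ∧
      σ'.regs 12 = if x ∈ visited T then 0 else 1
  last : ∀ σ ρ T u pre c l F, LinkCore L i r s w σ ρ T u l F →
    X σ.heads (maxDepth T) (σ.regs 10) ρ T ((u, l) :: F) → ρ u = pre ++ c :: l →
    σ.view L i u = c :: l ++ pre → σ.regs 11 = c.val →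
    wp L w S last σ fun t σ' => t ≤ K (maxDepth T) ∧ Pure 12 0 σ σ' ∧
      σ'.regs 12 = if l = [] then 1 else 0
  enter : ∀ σ ρ T u x l F, LinkCore L i r s w σ ρ T u (x :: l) F →
    X σ.heads (maxDepth T) (σ.regs 10) ρ T ((u, x :: l) :: F) → σ.regs 11 = x.val →
    σ.regs 9 = 0 → x ∉ visited T →
    wp L w S enter σ fun t σ' => (∀ r : Reg, r.val < 12 → r ≠ 5 → σ'.regs r = σ.regs r) ∧
      σ'.regs 5 = x.val ∧ σ'.out = σ.out ∧ σ'.HeadsOk L ∧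
      (∀ v ∈ u :: verts F, σ'.view L i v = σ.view L i v) ∧
      X σ'.heads (max (maxDepth T) (F.length + 1)) (σ.regs 10)
        (Function.update ρ x (σ'.view L i x)) (T ++ [(x, F.length + 1)])
        ((x, σ'.view L i x) :: (u, x :: l) :: F) ∧
      ∃ b, t ≤ K (max (maxDepth T) (F.length + 1)) * b ∧
        b + whitePotential e σ'.heads (T ++ [(x, F.length + 1)]) ≤ whitePotential e σ.heads T
  leave : ∀ σ ρ T u p l F, LinkCore L i r s w σ ρ T u [] ((p, u :: l) :: F) →
    X σ.heads (maxDepth T) (σ.regs 10) ρ T ((u, []) :: (p, u :: l) :: F) →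
    (σ.view L i u = [] ∨ ∃ c, c ∈ (ρ u).getLast? ∧ σ.regs 11 = c.val) →
    wp L w S leave σ fun t σ' => t ≤ K (maxDepth T) ∧
      (∀ r : Reg, r.val < 12 → r ≠ 5 → σ'.regs r = σ.regs r) ∧
      σ'.regs 5 = p.val ∧ σ'.out = σ.out ∧ σ'.heads = σ.heads ∧
      X σ.heads (maxDepth T) (σ.regs 10) ρ T ((p, l) :: F)
  start : ∀ σ : Store h n, Base s w σ → σ.regs 5 = s.val → σ.view L = L → σ.HeadsOk L →
    wp L w S start σ fun t σ' => (∀ r : Reg, r.val < 10 → σ'.regs r = σ.regs r) ∧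
      σ'.out = σ.out ∧ σ'.HeadsOk L ∧
      X σ'.heads 0 (σ'.regs 10) (Function.update (L i) s (σ'.view L i s)) [(s, 0)]
        [(s, σ'.view L i s)] ∧
      ∃ b, t ≤ K 0 * b ∧ b + whitePotential e σ'.heads [(s, 0)] ≤ whitePotential e σ.heads []

end Rotate

/-! ### Correctness and running time of DFS without a bit vector -/

namespace Rotate

open Store Dfs

variable {h n : ℕ} {L : Lists h n} {i : Fin h} {r : Fin n → Fin n → Prop} {s u x : Fin n} {w S : ℕ}
  {start check last enter leave : Cmd h}
  {X : (Fin h → Fin n → ℕ) → ℕ → ℕ → (Fin n → List (Fin n)) → List (Fin n × ℕ) →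
    List (Frame n) → Prop} {K : ℕ → ℕ} {e : Fin n → (Fin h → ℕ) → List (Fin n) → ℕ} {σ σ' : Store h n}
  {ρ : Fin n → List (Fin n)} {T : List (Fin n × ℕ)} {F : List (Frame n)} {l : List (Fin n)}

theorem base_setReg {v x : ℕ} {a : Reg} (ha : 5 ≤ a.val := by decide) :
    Base s v (σ.setReg w a x) ↔ Base s v σ := by
  have : ∀ r' : Reg, r'.val < 5 → (σ.setReg w a x).regs r' = σ.regs r' := fun r' hr' => by
    rw [regs_setReg, if_neg]; rintro rfl; omega
  exact ⟨fun h => h.congr (b := 5) fun r' hr' => (this r' hr').symm, fun h => h.congr (b := 5) this⟩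

namespace LinkCore

theorem congr (hc : LinkCore L i r s w σ ρ T u l F)
    (hr : ∀ r : Reg, r.val < 10 → σ'.regs r = σ.regs r) (ho : σ'.out = σ.out)
    (hh : σ'.heads = σ.heads) : LinkCore L i r s w σ' ρ T u l F := by
  obtain ⟨base, r5, r6, r7, r8, dle, ok, out, snap, sound, root, below, top⟩ := hc
  have hv : σ'.view L = σ.view L := view_congr hh
  refine ⟨base.congr hr, ?_, ?_, ?_, ?_, dle, ok.congr hh, ho ▸ out, snap, sound, root, ?_, ?_⟩
  · rw [hr 5 (by decide), r5]
  · rw [hr 6 (by decide), r6]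
  · rw [hr 7 (by decide), r7]
  · rw [hr 8 (by decide), r8]
  · rwa [hv]
  · rwa [hv, hr 9 (by decide)]

theorem of_pure (hc : LinkCore L i r s w σ ρ T u l F) (hk : Pure 12 0 σ σ') :
    LinkCore L i r s w σ' ρ T u l F :=
  hc.congr (fun r hr => hk.regs r (by omega)) hk.out hk.heads

theorem nodup (hc : LinkCore L i r s w σ ρ T u l F) : (u :: verts F).Nodup := hc.snap.nodup_stack

theorem mem (hc : LinkCore L i r s w σ ρ T u l F) : u ∈ visited T :=
  hc.snap.stack_subset u (by simp)

theorem source_mem (hc : LinkCore L i r s w σ ρ T u l F) : s ∈ visited T := by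
  have := hc.root _ (List.getLast?_eq_some_getLast (by simp))
  rw [← this]
  exact hc.snap.stack_subset _ (List.getLast_mem (l := u :: verts F) (by simp))

theorem length_lt (hc : LinkCore L i r s w σ ρ T u l F) : F.length < n := by
  simpa using length_le_of_nodup hc.nodup

end LinkCore

theorem wp_goBack (hw : n < 2 ^ w)
    (hL : LinkSpec L i r s w S start check last enter leave X K e)
    (hc : LinkCore L i r s w σ ρ T u [] F)
    (hX : X σ.heads (maxDepth T) (σ.regs 10) ρ T ((u, []) :: F))
    (hv : σ.view L i u = [] ∨ ∃ c, c ∈ (ρ u).getLast? ∧ σ.regs 11 = c.val) :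
    wp L w S (goBack leave) σ fun t σ' => t ≤ K (maxDepth T) + 5 ∧ σ'.heads = σ.heads ∧
      ((∃ p l F', F = (p, u :: l) :: F' ∧ LinkCore L i r s w σ' ρ T p l F' ∧
        X σ'.heads (maxDepth T) (σ'.regs 10) ρ T ((p, l) :: F') ∧ σ'.regs 9 = 1) ∨
      (F = [] ∧ σ'.regs 8 = 0 ∧ Base s w σ' ∧ σ'.out = σ.out)) := by
  have hb := hc.base
  simp only [goBack, wp_ite, wp_const, wp_seq, wp_op, Test.holds, hc.r5, hb.r1, Fin.val_inj]
  have hlast := hc.root _ (List.getLast?_eq_some_getLast (by simp))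
  refine ⟨fun hus => ⟨by omega, rfl, Or.inr ⟨?_, by simp, (base_setReg (by decide)).2 hb, rfl⟩⟩,
    fun hus => ?_⟩
  · cases F with
    | nil => rfl
    | cons f F =>
      exfalso
      apply (List.nodup_cons.1 hc.nodup).1
      rw [hus, ← hlast]
      simp only [verts, List.map_cons, List.getLast_cons_cons]
      exact List.getLast_mem _
  · cases F with
    | nil => exact absurd hlast hus
    | cons f F =>
      obtain ⟨p, l'⟩ := f
      obtain ⟨⟨l, hl⟩, hch⟩ := List.isChain_cons_cons.1 hc.snap.chain
      simp only at hl
      subst hl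
      refine (hL.leave σ ρ T u p l F hc hX hv).mono ?_
      rintro t σ₁ ⟨ht, hr, h5, ho, hh, hX₁⟩
      have h1w : 1 % 2 ^ w = 1 := Nat.mod_eq_of_lt (by have := u.is_lt; omega)
      have hlen := hc.length_lt
      simp only [List.length_cons] at hlen
      have h6 : (BinOp.sub.eval w (σ₁.regs 6) (σ₁.regs 4)) % 2 ^ w = F.length := by
        rw [hr 6 (by decide) (by decide), hr 4 (by decide) (by decide), hc.r6, hb.r4]
        simp only [BinOp.eval, List.length_cons]
        rw [show F.length + 1 + 2 ^ w - 1 = F.length + 2 ^ w by omega, Nat.add_mod_right,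
          Nat.mod_eq_of_lt (by omega)]
      refine ⟨by omega, hh, Or.inl ⟨p, l, F, rfl, ?_, ?_, by simp [h1w]⟩⟩
      · have hv₁ : σ₁.view L = σ.view L := view_congr hh
        constructor
        · refine hb.congr (b := 5) fun r' hr' => ?_
          rw [regs_setReg, if_neg (by rintro rfl; revert hr'; decide), regs_setReg,
            if_neg (by rintro rfl; revert hr'; decide)]
          exact hr r' (by omega) (by rintro rfl; revert hr'; decide)
        · simpa using h5
        · simpa using h6
        · simpa using (hr 7 (by decide) (by decide)).trans hc.r7
        · simpa using (hr 8 (by decide) (by decide)).trans hc.r8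
        · have := hc.depth_le
          simp only [List.length_cons] at this
          omega
        · exact hc.ok.congr hh
        · exact ho.trans hc.out
        · exact hc.snap.pop.skip hc.mem
        · intro R hR
          rw [← hc.sound R hR]
          exact (unwind_skip hc.mem).symm
        · intro v hv
          exact hc.root v (by simpa using hv)
        · intro f hf
          simpa [hv₁] using hc.below f (List.mem_cons_of_mem _ hf)
        · obtain ⟨pre, h1, h2⟩ := hc.below _ List.mem_cons_self
          exact Or.inr ⟨by simp [h1w], pre, u, hc.mem, h1, by simpa [hv₁] using h2⟩
      · simpa [hh, hr 10 (by decide) (by decide)] using hX₁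

theorem wp_descend (hw : n < 2 ^ w) (hadj : IsAdjacencyOrder r (L i))
    (hL : LinkSpec L i r s w S start check last enter leave X K e)
    (hc : LinkCore L i r s w σ ρ T u (x :: l) F)
    (hX : X σ.heads (maxDepth T) (σ.regs 10) ρ T ((u, x :: l) :: F))
    (h9 : σ.regs 9 = 0) (h11 : σ.regs 11 = x.val) (hx : x ∉ visited T) :
    wp L w S (descend enter) σ fun t σ' => ∃ ρ' T' lx, lx.length = (L i x).length ∧
      T' = T ++ [(x, F.length + 1)] ∧ LinkCore L i r s w σ' ρ' T' x lx ((u, x :: l) :: F) ∧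
      X σ'.heads (maxDepth T') (σ'.regs 10) ρ' T' ((x, lx) :: (u, x :: l) :: F) ∧
      σ'.regs 9 = 0 ∧ maxDepth T ≤ maxDepth T' ∧
      ∃ b, t ≤ K (maxDepth T') * b + 6 ∧
        b + whitePotential e σ'.heads T' ≤ whitePotential e σ.heads T := by
  simp only [descend, wp_seq, wp_op, wp_output]
  refine (hL.enter σ ρ T u x l F hc hX h11 h9 hx).mono ?_
  rintro t σ₁ ⟨hr, h5, ho, hok, hvw, hX₁, b, hb, hb'⟩
  set d := F.length + 1 with hd
  set lx := σ₁.view L i x with hlx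
  have hmd : maxDepth (T ++ [(x, d)]) = max (maxDepth T) d := maxDepth_append T x d
  have hnd : (x :: u :: verts F).Nodup :=
    List.nodup_cons.2 ⟨hc.snap.not_mem_stack hx, hc.snap.nodup_stack⟩
  have hdn : d < n := by
    have := length_le_of_nodup hnd
    simp at this
    omega
  have hlx' : lx.Nodup ∧ ∀ y, y ∈ lx ↔ r x y :=
    ⟨nodup_view.2 (hadj x).1, fun y => mem_view.trans ((hadj x).2 y)⟩
  have h6 : (BinOp.add.eval w (σ₁.regs 6) (σ₁.regs 4)) % 2 ^ w = d := by
    rw [hr 6 (by decide) (by decide), hr 4 (by decide) (by decide), hc.r6, hc.base.r4]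
    exact Nat.mod_eq_of_lt (by simp only [BinOp.eval]; omega)
  -- the state up to the update of the maximal depth
  have key : ∀ σ₂ : Store h n, (∀ r : Reg, r.val < 11 → r ≠ 6 → r ≠ 7 → σ₂.regs r = σ₁.regs r) →
      σ₂.regs 6 = d → σ₂.regs 7 = max (maxDepth T) d → σ₂.out = σ.out ++ [x.val] →
      σ₂.heads = σ₁.heads → ∀ t', t' ≤ t + 6 →
      ∃ ρ' T' lx, lx.length = (L i x).length ∧
      T' = T ++ [(x, d)] ∧ LinkCore L i r s w σ₂ ρ' T' x lx ((u, x :: l) :: F) ∧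
      X σ₂.heads (maxDepth T') (σ₂.regs 10) ρ' T' ((x, lx) :: (u, x :: l) :: F) ∧
      σ₂.regs 9 = 0 ∧ maxDepth T ≤ maxDepth T' ∧
      ∃ b, t' ≤ K (maxDepth T') * b + 6 ∧
        b + whitePotential e σ₂.heads T' ≤ whitePotential e σ.heads T := by
    intro σ₂ hr₂ h6₂ h7₂ ho₂ hh₂ t' ht'
    have hv₂ : σ₂.view L = σ₁.view L := view_congr hh₂
    refine ⟨Function.update ρ x lx, T ++ [(x, d)], lx, length_view, rfl, ?_, ?_, ?_, ?_, b, ?_, ?_⟩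
    · constructor
      · refine hc.base.congr (b := 5) fun r' hr' => ?_
        rw [hr₂ r' (by omega) (by rintro rfl; revert hr'; decide) (by rintro rfl; revert hr'; decide)]
        exact hr r' (by omega) (by rintro rfl; revert hr'; decide)
      · rw [hr₂ 5 (by decide) (by decide) (by decide), h5]
      · rw [h6₂]; rfl
      · rw [h7₂, hmd]
      · rw [hr₂ 8 (by decide) (by decide) (by decide), hr 8 (by decide) (by decide), hc.r8]
      · rw [hmd]; exact le_max_right _ _
      · exact hok.congr hh₂
      · rw [ho₂, hc.out]; simp
      · exact hc.snap.push hx hlx' d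
      · intro R hR
        have hRx : R x = lx := by simpa using hR x (mem_visited_append.2 (Or.inr rfl))
        rw [← hRx, unwind_push hx hnd]
        refine hc.sound R fun v hv => ?_
        have hvx : v ≠ x := fun h => hx (h ▸ hv)
        simpa [hvx] using hR v (mem_visited_append.2 (Or.inl hv))
      · intro v hv
        exact hc.root v (by simpa using hv)
      · intro f hf
        rw [hv₂]
        have hfx : f.1 ∈ u :: verts F := by
          rcases List.mem_cons.1 hf with rfl | hf
          · simp
          · exact List.mem_cons_of_mem _ (List.mem_map_of_mem hf)
        have hne : f.1 ≠ x := fun h => (List.nodup_cons.1 hnd).1 (h ▸ hfx)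
        rw [hvw _ hfx, Function.update_of_ne hne]
        rcases List.mem_cons.1 hf with rfl | hf
        · rcases hc.top with ⟨-, pre, h1, h2, -⟩ | ⟨h1, -⟩
          · exact ⟨pre, h1, h2⟩
          · omega
        · exact hc.below f hf
      · refine Or.inl ⟨?_, [], by simp, by simp [hv₂, ← hlx], by simp⟩
        rw [hr₂ 9 (by decide) (by decide) (by decide), hr 9 (by decide) (by decide), h9]
    · rw [hh₂, hmd, hr₂ 10 (by decide) (by decide) (by decide), hr 10 (by decide) (by decide)]
      exact hX₁
    · rw [hr₂ 9 (by decide) (by decide) (by decide), hr 9 (by decide) (by decide), h9]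
    · rw [hmd]; exact le_max_left _ _
    · rw [hmd]; omega
    · rw [hh₂]; exact hb'
  set σ₂ := ((σ₁.push (σ₁.regs 11)).setReg w 6
    (BinOp.add.eval w ((σ₁.push (σ₁.regs 11)).regs 6) ((σ₁.push (σ₁.regs 11)).regs 4))) with hσ₂
  have h62 : σ₂.regs 6 = d := by rw [hσ₂]; simpa using h6
  have h72 : σ₂.regs 7 = maxDepth T := by
    rw [hσ₂]; simpa using (hr 7 (by decide) (by decide)).trans hc.r7
  have hr2 : ∀ r : Reg, r.val < 11 → r ≠ 6 → σ₂.regs r = σ₁.regs r := fun r' _ hr6 => by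
    rw [hσ₂]; simp [hr6]
  have ho2 : σ₂.out = σ.out ++ [x.val] := by
    rw [hσ₂]; simp [ho, hr 11 (by decide) (by decide), h11]
  simp only [wp_ite, wp_mov, wp_skip, Test.holds, h62, h72]
  refine ⟨fun hlt => ?_, fun hlt => ?_⟩
  · refine key (σ₂.setReg w 7 d) (fun r' hr' h6 h7 => ?_) (by simpa using h62) ?_
      (by simpa using ho2) rfl _ (by omega)
    · rw [regs_setReg, if_neg h7]; exact hr2 r' hr' h6
    · rw [regs_setReg, if_pos rfl, Nat.mod_eq_of_lt (by omega)]; omega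
  · refine key σ₂ (fun r' hr' h6 h7 => hr2 r' hr' h6) h62 ?_ ho2 rfl _ (by omega)
    rw [h72]; omega

/-- The number of steps of the search that remain: twice the number of unscanned list entries, and one
or two for each vertex. -/
def linkPotential (L : Lists h n) (i : Fin h) (T : List (Fin n × ℕ)) (F : List (Frame n)) : ℕ :=
  (∑ v, if v ∈ visited T then 0 else 2 * (L i v).length + 3) +
    (F.map fun f => 2 * f.2.length + 2).sum

variable (L i r s w X K e) in
/-- What one step of the search, from a state with the given stack to the store `σ'` in time `t`, has to
achieve. -/
def LinkProgress (σ : Store h n) (T : List (Fin n × ℕ)) (u : Fin n) (l : List (Fin n))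
    (F : List (Frame n)) (t : ℕ) (σ' : Store h n) : Prop :=
  ∃ ρ' T', maxDepth T ≤ maxDepth T' ∧ ∃ b, 2 + t ≤ K (maxDepth T') * b ∧
    ((∃ u' l' F', LinkCore L i r s w σ' ρ' T' u' l' F' ∧
      X σ'.heads (maxDepth T') (σ'.regs 10) ρ' T' ((u', l') :: F') ∧
      linkPotential L i T' ((u', l') :: F') + σ'.regs 9 <
        linkPotential L i T ((u, l) :: F) + σ.regs 9 ∧
      b + 3 * (linkPotential L i T' ((u', l') :: F') + σ'.regs 9) + whitePotential e σ'.heads T' ≤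
        3 * (linkPotential L i T ((u, l) :: F) + σ.regs 9) + whitePotential e σ.heads T) ∨
    (σ'.regs 8 = 0 ∧ Base s w σ' ∧ σ'.out = (visited T').map Fin.val ∧ Snapshot r ρ' T' [] ∧
      dfsVisit ρ' n 0 [] s = T' ∧ s ∈ visited T' ∧
      b ≤ 3 * (linkPotential L i T ((u, l) :: F) + σ.regs 9)))

/-- The white potential does not depend on the lists of visited vertices. -/
theorem whitePotential_congr {H H' : Fin h → Fin n → ℕ}
    (hH : ∀ v, v ∉ visited T → ∀ j, H' j v = H j v) :
    whitePotential e H' T = whitePotential e H T := by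
  refine Finset.sum_congr rfl fun v _ => ?_
  by_cases hv : v ∈ visited T
  · simp [hv]
  · simp [hv, hH v hv]

theorem wp_linkStep (hw : n < 2 ^ w) (hw0 : 0 < w) (hadj : IsAdjacencyOrder r (L i))
    (hL : LinkSpec L i r s w S start check last enter leave X K e)
    (hc : LinkCore L i r s w σ ρ T u l F)
    (hX : X σ.heads (maxDepth T) (σ.regs 10) ρ T ((u, l) :: F)) :
    wp L w S (.prim (.front 0 i 5) ;;
      .ite (.null 0) (goBack leave)
        (.prim (.read 11 0) ;;
          .ite (.eq 9 4)
            (last ;; .ite (.eq 12 4) (goBack leave) (.prim (.rotate i 5) ;; .prim (.const 9 0)))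
            (check ;; .ite (.eq 12 4) (descend enter) (.prim (.const 9 1))))) σ
      (LinkProgress L i r s w X K e σ T u l F) := by
  have h1w : 1 % 2 ^ w = 1 := Nat.mod_eq_of_lt (Nat.one_lt_two_pow hw0.ne')
  have hK := hL.le (maxDepth T)
  have back : ∀ (σ₁ : Store h n) (t₁ : ℕ), LinkCore L i r s w σ₁ ρ T u l F → σ₁.heads = σ.heads →
      σ₁.regs 10 = σ.regs 10 → l = [] → t₁ ≤ K (maxDepth T) + 10 →
      (σ.view L i u = [] ∨ ∃ c, c ∈ (ρ u).getLast? ∧ σ₁.regs 11 = c.val) →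
      wp L w S (goBack leave) σ₁ fun t => LinkProgress L i r s w X K e σ T u l F (t₁ + t) := by
    rintro σ₁ t₁ hc₁ hh₁ h10 rfl ht₁ hv
    have hv₁ : σ₁.view L = σ.view L := view_congr hh₁
    refine (wp_goBack hw hL hc₁ (by rwa [hh₁, h10]) (by rwa [hv₁])).mono ?_
    rintro t σ₂ ⟨ht, hh₂, ⟨p, l, F', rfl, hc₂, hX₂, h9⟩ | ⟨rfl, h8, hb₂, ho⟩⟩
    · refine ⟨ρ, T, le_rfl, 3, by omega, Or.inl ⟨p, l, F', hc₂, hX₂, ?_, ?_⟩⟩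
      · simp only [linkPotential, List.map_cons, List.sum_cons, List.length_cons, List.length_nil]
        omega
      · have : whitePotential e σ₂.heads T = whitePotential e σ.heads T := by rw [hh₂, hh₁]
        simp only [linkPotential, List.map_cons, List.sum_cons, List.length_cons, List.length_nil]
        omega
    · refine ⟨ρ, T, le_rfl, 3, by omega, Or.inr ⟨h8, hb₂, ho.trans hc₁.out, hc.snap.pop,
        (hc.sound ρ fun _ _ => rfl).symm, hc.source_mem, ?_⟩⟩
      simp only [linkPotential, List.map_cons, List.sum_cons]
      omega
  rcases hvu : σ.view L i u with _ | ⟨c, v'⟩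
  · have hl : l = [] := by
      rcases hc.top with ⟨-, pre, -, h2, -⟩ | ⟨-, pre, c, -, -, h2⟩
      · rw [hvu] at h2; simp at h2; exact h2.1
      · rw [hvu] at h2; simp at h2
    rw [wp_seq, wp_front_nil hc.r5 hvu, wp_ite]
    refine ⟨fun _ => ?_, fun h => absurd (by simp [Test.holds]) h⟩
    refine (back _ 2 (hc.of_pure ((Pure.refl 12 0 σ).setCursor)) rfl rfl hl (by omega)
      (Or.inl hvu)).mono fun t σ' H => ?_
    rwa [show 1 + (1 + t) = 2 + t by ring]
  refine wp_seq.2 (wp_front hc.r5 hc.ok (by simp [hvu]) fun p hp => ?_)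
  have hat : (σ.setCursor 0 (some (i, u, p))).At L 0 i u (c :: v') :=
    ⟨p, by simp, hp.1, by rw [hp.2, hvu]⟩
  rw [wp_ite]
  refine ⟨fun h => by simp [Test.holds] at h, fun _ => ?_⟩
  rw [wp_seq, wp_read hat]
  set σ₁ := (σ.setCursor 0 (some (i, u, p))).setReg w 11 c.val with hσ₁
  have hk₁ : Pure 11 0 σ σ₁ := ((Pure.refl 11 0 σ).setCursor).setReg
  have hc₁ : LinkCore L i r s w σ₁ ρ T u l F :=
    hc.congr (fun r' hr' => hk₁.regs r' (by omega)) hk₁.out hk₁.heads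
  have h11 : σ₁.regs 11 = c.val := by simp [hσ₁, val_mod hw]
  have hv₁ : σ₁.view L = σ.view L := hk₁.view
  have h10 : σ₁.regs 10 = σ.regs 10 := hk₁.regs 10 (by decide)
  have h9 : σ₁.regs 9 = σ.regs 9 := hk₁.regs 9 (by decide)
  have hX₁ : X σ₁.heads (maxDepth T) (σ₁.regs 10) ρ T ((u, l) :: F) := by rwa [hk₁.heads, h10]
  rw [wp_ite]
  simp only [Test.holds, h9, hc₁.base.r4]
  refine ⟨fun h91 => ?_, fun h91 => ?_⟩
  · -- the front has been scanned
    obtain ⟨pre, c', hcT, hρ, hvw⟩ : ∃ pre c, c ∈ visited T ∧ ρ u = pre ++ c :: l ∧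
        σ.view L i u = c :: l ++ pre := by
      rcases hc.top with ⟨h90, -⟩ | ⟨-, h⟩
      · omega
      · exact h
    obtain rfl : c = c' := by rw [hvu] at hvw; simp at hvw; exact hvw.1
    refine (hL.last σ₁ ρ T u pre c l F hc₁ hX₁ hρ (by rw [hv₁, hvw]) h11).seq ?_
    rintro t₂ σ₂ ⟨ht₂, hk₂, h12⟩
    have hc₂ := hc₁.of_pure hk₂
    simp only [wp_ite, Test.holds, h12, hc₂.base.r4]
    refine ⟨fun h => ?_, fun h => ?_⟩
    · have hl : l = [] := by by_contra hl; simp [hl] at h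
      refine (back σ₂ (1 + (1 + (1 + (1 + (t₂ + 1))) + 1)) hc₂ (hk₂.heads.trans hk₁.heads)
        ((hk₂.regs 10 (by decide)).trans h10) hl (by omega) (Or.inr ⟨c, by simp [hρ, hl],
          (hk₂.regs 11 (by decide)).trans h11⟩)).mono fun t σ' H => ?_
      convert H using 1
      omega
    · have hl : l ≠ [] := fun hl => by simp [hl] at h
      rw [wp_seq, wp_rotate hc₂.r5, wp_const]
      set σ₃ := (σ₂.rot L i u).setReg w 9 0 with hσ₃
      have hv₂ : σ₂.view L = σ.view L := hk₂.view.trans hv₁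
      have hvu₃ : σ₃.view L i u = l ++ (pre ++ [c]) := by
        have := view_rot (σ := σ₂) (i := i) (v := u) hc₂.ok i u
        rw [if_pos ⟨rfl, rfl⟩, hv₂, hvw] at this
        rw [hσ₃, view_setReg, this]
        simp
      have hvo₃ : ∀ j v, ¬ (j = i ∧ v = u) → σ₃.view L j v = σ.view L j v := fun j v hjv => by
        have := view_rot (σ := σ₂) (i := i) (v := u) hc₂.ok j v
        rw [if_neg hjv, hv₂] at this
        rw [hσ₃, view_setReg, this]
      have hho₃ : ∀ j v, ¬ (j = i ∧ v = u) → σ₃.heads j v = σ.heads j v := fun j v hjv => by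
        rw [hσ₃, heads_setReg, heads_rot, hk₂.heads, hk₁.heads]
        by_cases hj : j = i
        · subst hj
          have hne : v ≠ u := fun hne => hjv ⟨rfl, hne⟩
          simp [hne]
        · simp [hj]
      have hr₃ : ∀ r' : Reg, r'.val < 9 → σ₃.regs r' = σ₂.regs r' := fun r' hr' => by
        rw [hσ₃, regs_setReg, if_neg (by rintro rfl; revert hr'; decide)]; rfl
      have hc₃ : LinkCore L i r s w σ₃ ρ T u l F := by
        constructor
        · exact hc₂.base.congr hr₃
        · rw [hr₃ 5 (by decide), hc₂.r5]
        · rw [hr₃ 6 (by decide), hc₂.r6]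
        · rw [hr₃ 7 (by decide), hc₂.r7]
        · rw [hr₃ 8 (by decide), hc₂.r8]
        · exact hc₂.depth_le
        · exact hc₂.ok.rot
        · exact hc₂.out
        · exact hc₂.snap
        · exact hc₂.sound
        · exact hc₂.root
        · intro f hf
          have hfu : f.1 ≠ u := fun hfu =>
            (List.nodup_cons.1 hc.nodup).1 (hfu ▸ List.mem_map_of_mem hf)
          rw [hvo₃ i f.1 (by simp [hfu])]
          exact hc.below f hf
        · exact Or.inl ⟨by simp [hσ₃], pre ++ [c], by simp [hρ], hvu₃, fun h => absurd h hl⟩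
      have h93 : σ₃.regs 9 = 0 := by simp [hσ₃]
      refine ⟨ρ, T, le_rfl, 2, by omega, Or.inl ⟨u, l, F, hc₃, ?_, by omega, ?_⟩⟩
      · have h103 : σ₃.regs 10 = σ.regs 10 := by
          rw [← h10, ← hk₂.regs 10 (by decide), hσ₃]; simp
        rw [h103]
        exact hL.rotate _ _ _ _ _ _ _ _ _ hX hho₃
      · have : whitePotential e σ₃.heads T = whitePotential e σ.heads T := by
          refine whitePotential_congr fun v hv j => ?_
          exact hho₃ j v (by rintro ⟨-, rfl⟩; exact hv hc.mem)
        omega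
  · -- the front has to be scanned
    obtain ⟨h90, pre, hρ, hvw, hpre⟩ : σ.regs 9 = 0 ∧ ∃ pre, ρ u = pre ++ l ∧
        σ.view L i u = l ++ pre ∧ (l = [] → pre = []) := by
      rcases hc.top with ⟨h90, h⟩ | ⟨h91', -⟩
      · exact ⟨h90, h⟩
      · exact absurd h91' h91
    obtain ⟨l, rfl⟩ : ∃ l', l = c :: l' := by
      cases l with
      | nil => rw [hvu, hpre rfl] at hvw; simp at hvw
      | cons a l =>
        rw [hvu] at hvw
        simp at hvw
        exact ⟨l, by rw [hvw.1]⟩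
    refine (hL.check σ₁ ρ T u c l F hc₁ hX₁ h11 (h9.trans h90)).seq ?_
    rintro t₂ σ₂ ⟨ht₂, hk₂, h12⟩
    have hc₂ := hc₁.of_pure hk₂
    have hv₂ : σ₂.view L = σ.view L := hk₂.view.trans hv₁
    have h10₂ : σ₂.regs 10 = σ.regs 10 := (hk₂.regs 10 (by decide)).trans h10
    have h9₂ : σ₂.regs 9 = 0 := (hk₂.regs 9 (by decide)).trans (h9.trans h90)
    have hh₂ : σ₂.heads = σ.heads := hk₂.heads.trans hk₁.heads
    have hX₂ : X σ₂.heads (maxDepth T) (σ₂.regs 10) ρ T ((u, c :: l) :: F) := by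
      rwa [hh₂, h10₂]
    simp only [wp_ite, Test.holds, h12, hc₂.base.r4]
    refine ⟨fun h => ?_, fun h => ?_⟩
    · have hcT : c ∉ visited T := by intro hcT; simp [hcT] at h
      refine (wp_descend hw hadj hL hc₂ hX₂ h9₂
        ((hk₂.regs 11 (by decide)).trans h11) hcT).mono ?_
      rintro t₃ σ₃ ⟨ρ', T', lx, hlx, hT', hc₃, hX₃, h93, hmd, b, hb, hE⟩
      have hKm := hL.mono hmd
      refine ⟨ρ', T', hmd, b + 2, ?_, Or.inl ⟨c, lx, _, hc₃, hX₃, ?_, ?_⟩⟩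
      · rw [Nat.mul_add]; omega
      · have := sum_unvisited_push (fun v => 2 * (L i v).length + 3) hcT (F.length + 1)
        rw [← hT'] at this
        simp only [linkPotential, List.map_cons, List.sum_cons, hlx]
        omega
      · have := sum_unvisited_push (fun v => 2 * (L i v).length + 3) hcT (F.length + 1)
        rw [← hT'] at this
        rw [hh₂] at hE
        simp only [linkPotential, List.map_cons, List.sum_cons, hlx]
        omega
    · have hcT : c ∈ visited T := by by_contra hcT; simp [hcT] at h
      rw [wp_const]
      have hr₃ : ∀ r' : Reg, r'.val < 9 → (σ₂.setReg w 9 1).regs r' = σ₂.regs r' := fun r' hr' => by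
        rw [regs_setReg, if_neg (by rintro rfl; revert hr'; decide)]
      have hc₃ : LinkCore L i r s w (σ₂.setReg w 9 1) ρ T u l F := by
        constructor
        · exact hc₂.base.congr hr₃
        · rw [hr₃ 5 (by decide), hc₂.r5]
        · rw [hr₃ 6 (by decide), hc₂.r6]
        · rw [hr₃ 7 (by decide), hc₂.r7]
        · rw [hr₃ 8 (by decide), hc₂.r8]
        · exact hc₂.depth_le
        · exact hc₂.ok
        · exact hc₂.out
        · exact hc₂.snap.skip hcT
        · intro R hR
          rw [← hc₂.sound R hR, unwind_skip hcT]
        · exact hc₂.root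
        · exact hc₂.below
        · exact Or.inr ⟨by simp [h1w], pre, c, hcT, hρ, by rw [view_setReg, hv₂, hvw]⟩
      have h93 : (σ₂.setReg w 9 1).regs 9 = 1 := by simp [h1w]
      refine ⟨ρ, T, le_rfl, 2, by omega, Or.inl ⟨u, l, F, hc₃, ?_, ?_, ?_⟩⟩
      · rw [heads_setReg, regs_setReg, if_neg (by decide)]
        exact hL.skip _ _ _ _ _ _ _ _ _ hX₂
      · simp only [linkPotential, List.map_cons, List.sum_cons, List.length_cons]
        omega
      · rw [heads_setReg, hh₂]
        simp only [linkPotential, List.map_cons, List.sum_cons, List.length_cons]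
        omega

/-- The output is a DFS order for lists that are chosen during the search. -/
theorem outputs_linkMain (hw : n < 2 ^ w) (hw0 : 0 < w) (hadj : IsAdjacencyOrder r (L i))
    (hreach : ∀ v, Relation.ReflTransGen r s v)
    (hL : LinkSpec L i r s w S start check last enter leave X K e) :
    ∃ R t, IsAdjacencyOrder r R ∧
      Outputs (linkMain i start check last enter leave).program L s w S t (dfsOrder R s) ∧
      t ≤ K (dfsDepth R s) * (6 * (∑ v, (L i v).length) + 9 * n + (∑ v, e v (fun _ => 0) []) + 1) := by
  have h1w : 1 % 2 ^ w = 1 := Nat.mod_eq_of_lt (Nat.one_lt_two_pow hw0.ne')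
  have hnw : n % 2 ^ w = n := Nat.mod_eq_of_lt hw
  have hww : w % 2 ^ w = w := Nat.mod_eq_of_lt Nat.lt_two_pow_self
  have main : wp L w S (linkMain i start check last enter leave) (initStore h s w) fun t σ' =>
      ∃ R T, IsAdjacencyOrder r R ∧ σ'.out = (visited T).map Fin.val ∧ dfsTrace R s = T ∧
        t ≤ K (maxDepth T) * (6 * (∑ v, (L i v).length) + 9 * n + (∑ v, e v (fun _ => 0) []) + 1) := by
    simp only [linkMain, wp_seq, wp_const, wp_mov, wp_output]
    set σ₀ : Store h n := (((initStore h s w).setReg w 4 1).setReg w 5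
      (((initStore h s w).setReg w 4 1).regs 1)).setReg w 8 1 with hσ₀
    have hb₀ : Base s w σ₀ := by constructor <;> simp [hσ₀, initStore, hnw, hww, h1w, val_mod hw]
    have hv₀ : σ₀.view L = L := by funext j v; simp [hσ₀, view, initStore]
    refine (hL.start σ₀ hb₀ (by simp [hσ₀, initStore, val_mod hw]) hv₀
      (fun j v => Or.inl (by simp [hσ₀, initStore]))).mono ?_
    rintro t₁ σ₁ ⟨hr₁, ho₁, hok₁, hX₁, b₁, ht₁, hb₁⟩
    set lx := σ₁.view L i s with hlx
    set ρ₁ := Function.update (L i) s lx with hρ₁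
    set σ₂ := σ₁.push (σ₁.regs 5) with hσ₂
    have hlx' : lx.Nodup ∧ ∀ y, y ∈ lx ↔ r s y :=
      ⟨nodup_view.2 (hadj s).1, fun y => mem_view.trans ((hadj s).2 y)⟩
    have hlen : lx.length = (L i s).length := length_view
    have hsnap : Snapshot r ρ₁ [(s, 0)] [(s, lx)] := (Snapshot.nil hadj).root (by simp) hlx' 0
    have hc₂ : LinkCore L i r s w σ₂ ρ₁ [(s, 0)] s lx [] := by
      constructor
      · exact hb₀.congr (b := 10) hr₁
      · exact (hr₁ 5 (by decide)).trans (by simp [hσ₀, initStore, val_mod hw])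
      · exact (hr₁ 6 (by decide)).trans (by simp [hσ₀, initStore])
      · exact (hr₁ 7 (by decide)).trans (by simp [hσ₀, initStore, maxDepth])
      · exact (hr₁ 8 (by decide)).trans (by simp [hσ₀, h1w])
      · simp
      · exact hok₁
      · rw [hσ₂, out_push, ho₁, hr₁ 5 (by decide)]
        simp [hσ₀, initStore, val_mod hw]
      · exact hsnap
      · intro R hR
        have hRs : R s = lx := by simpa [hρ₁] using hR s (by simp)
        rw [← hRs]
        exact unwind_root (T := []) (by simp)
      · simp
      · simp
      · exact Or.inl ⟨(hr₁ 9 (by decide)).trans (by simp [hσ₀, initStore]), [], by simp [hρ₁],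
          by simp [hσ₂, hlx], by simp⟩
    have hE₀ : whitePotential e σ₀.heads [] = ∑ v, e v (fun _ => 0) [] := by
      simp [whitePotential, hσ₀, initStore]
    have hP : linkPotential L i [(s, 0)] [(s, lx)] ≤ 2 * (∑ v, (L i v).length) + 3 * n := by
      have := sum_unvisited_push (T := []) (fun v => 2 * (L i v).length + 3) (x := s) (by simp) 0
      simp only [List.map_cons, List.map_nil, List.not_mem_nil, if_false, Finset.sum_add_distrib,
        ← Finset.mul_sum,
        Finset.sum_const, Finset.card_univ, Fintype.card_fin, smul_eq_mul, List.nil_append] at this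
      simp only [linkPotential, List.map_cons, List.map_nil, List.sum_cons, List.sum_nil, hlen]
      omega
    set B := 3 * linkPotential L i [(s, 0)] [(s, lx)] + whitePotential e σ₀.heads [] with hB
    refine wp_loop (fun m t σ' => ∃ ρ T a, t₁ + t ≤ K (maxDepth T) * a ∧
      ((∃ u l F, LinkCore L i r s w σ' ρ T u l F ∧
        X σ'.heads (maxDepth T) (σ'.regs 10) ρ T ((u, l) :: F) ∧
        m = linkPotential L i T ((u, l) :: F) + σ'.regs 9 + 1 ∧
        a + 3 * (linkPotential L i T ((u, l) :: F) + σ'.regs 9) + whitePotential e σ'.heads T ≤ B) ∨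
      (m = 0 ∧ σ'.regs 8 = 0 ∧ Base s w σ' ∧ σ'.out = (visited T).map Fin.val ∧ Snapshot r ρ T [] ∧
        dfsVisit ρ n 0 [] s = T ∧ s ∈ visited T ∧ a ≤ B)))
      (linkPotential L i [(s, 0)] [(s, lx)] + 1) ?_ ?_ ?_
    · have h9 : σ₂.regs 9 = 0 := (hr₁ 9 (by decide)).trans (by simp [hσ₀, initStore])
      refine ⟨ρ₁, [(s, 0)], b₁, ht₁, Or.inl ⟨s, lx, [], hc₂, hX₁, by rw [h9], ?_⟩⟩
      rw [h9, hB, ← (show whitePotential e σ₀.heads [] = _ from rfl)]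
      have : σ₂.heads = σ₁.heads := rfl
      rw [this]
      omega
    · rintro m t σ' ⟨ρ, T, a, ht, ⟨u, l, F, hc, hX, rfl, ha⟩ | ⟨-, h8, hb', -⟩⟩ hne
      swap
      · exact absurd (h8.trans hb'.r3.symm) hne
      refine (wp_linkStep hw hw0 hadj hL hc hX).mono ?_
      rintro t' σ'' ⟨ρ', T', hmd, b, hb, hres⟩
      have hKm := Nat.mul_le_mul_right a (hL.mono hmd)
      have htime : t₁ + (t + (1 + t' + 1)) ≤ K (maxDepth T') * (a + b) := by
        rw [Nat.mul_add]; omega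
      rcases hres with ⟨u', l', F', hc', hX', hlt, hle⟩ | ⟨h8, hb', ho, hs, hv, hsT, hle⟩
      · exact ⟨_, Nat.succ_lt_succ hlt, ρ', T', a + b, htime,
          Or.inl ⟨u', l', F', hc', hX', rfl, by omega⟩⟩
      · exact ⟨0, by omega, ρ', T', a + b, htime,
          Or.inr ⟨rfl, h8, hb', ho, hs, hv, hsT, by omega⟩⟩
    · rintro m t σ' ⟨ρ, T, a, ht, ⟨u, l, F, hc, hX, rfl, ha⟩ | ⟨-, h8, hb', ho, hs, hv, hsT, ha⟩⟩ heq
      · exact absurd (hc.r8.symm.trans (heq.trans hc.base.r3)) one_ne_zero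
      · refine ⟨ρ, T, hs.order, ho, hs.dfsTrace_eq hv hsT hreach, ?_⟩
        have hK := hL.le (maxDepth T)
        have : K (maxDepth T) * a ≤ K (maxDepth T) *
            (6 * (∑ v, (L i v).length) + 9 * n + ∑ v, e v (fun _ => 0) []) :=
          Nat.mul_le_mul_left _ (by omega)
        rw [Nat.mul_add _ _ 1, mul_one]
        omega
  obtain ⟨t, σ, hr, R, T, hR, ho, hT, ht⟩ := main
  refine ⟨R, t, hR, hr.outputs (by rw [ho, dfsOrder, hT]), ?_⟩
  have : dfsDepth R s = maxDepth T := by rw [dfsDepth, hT]; rfl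
  rwa [this]

end Rotate

/-! ### Recognizing the vertices on the stack -/

namespace Rotate

open Store Dfs

variable {h n : ℕ}

/-- Walk along the list heads from the source to the current vertex `r5`.  The flag `r22` says whether
vertex `a` has been met, and `r21` is the predecessor of `r5`, or `r10` if `r5` is the source. -/
def climb (i : Fin h) (a : Reg) : Cmd h :=
  mov 20 1 ;; mov 21 10 ;; .prim (.const 22 0) ;;
  .loop (.eq 20 5)
    (.ite (.eq 20 a) (.prim (.const 22 1)) .skip ;; mov 21 20 ;; headOf i 20 20 6) ;;
  .ite (.eq 20 a) (.prim (.const 22 1)) .skip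

/-- `P` leads from its last element `s` upwards along the list heads. -/
structure Path (A : Fin n → List (Fin n)) (s : Fin n) (P : List (Fin n)) : Prop where
  chain : P.IsChain fun c p => (A p).head? = some c
  last : ∀ v ∈ P.getLast?, v = s
  nodup : P.Nodup

variable {L : Lists h n} {i : Fin h} {r : Fin n → Fin n → Prop} {s u y : Fin n} {w S : ℕ}
  {σ σ' : Store h n} {ρ : Fin n → List (Fin n)} {T : List (Fin n × ℕ)} {F : List (Frame n)}
  {P l : List (Fin n)} {a : Reg}

theorem LinkCore.path (hc : LinkCore L i r s w σ ρ T u l F) :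
    Path (σ.view L i) s (u :: verts F) where
  chain := by
    have hch := hc.snap.chain
    have hb := hc.below
    clear hc
    induction F generalizing u l with
    | nil => simp
    | cons f F ih =>
      obtain ⟨⟨l', hl'⟩, hch⟩ := List.isChain_cons_cons.1 hch
      obtain ⟨pre, -, h2⟩ := hb f (by simp)
      simp only [verts, List.map_cons, List.isChain_cons_cons]
      exact ⟨by rw [h2, hl']; rfl, ih hch fun g hg => hb g (List.mem_cons_of_mem _ hg)⟩
  last := hc.root
  nodup := hc.nodup

theorem wp_climb (hw : n < 2 ^ w) (hw0 : 0 < w) (hσ : σ.HeadsOk L) (h1 : σ.regs 1 = s.val)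
    (h5 : σ.regs 5 = u.val) (h10 : σ.regs 10 < 2 ^ w) (ha : σ.regs a = y.val) (ha20 : a.val < 20)
    (hP : Path (σ.view L i) s (u :: P)) :
    wp L w S (climb i a) σ fun t σ' => t ≤ 10 * P.length + 10 ∧ Pure 20 6 σ σ' ∧
      σ'.regs 22 = (if y ∈ u :: P then 1 else 0) ∧
      σ'.regs 21 = (P.head?.map Fin.val).getD (σ.regs 10) := by
  have h1w : 1 % 2 ^ w = 1 := Nat.mod_eq_of_lt (Nat.one_lt_two_pow hw0.ne')
  have hlast : (u :: P).getLast? = some s := by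
    rw [List.getLast?_eq_some_getLast (by simp), ← hP.last _ (List.getLast?_eq_some_getLast (by simp))]
  simp only [climb, wp_seq, wp_mov, wp_const]
  refine wp_loop (fun m t σ' => ∃ π₁ z π₂, u :: P = π₁ ++ z :: π₂ ∧ m = π₁.length ∧
    t ≤ 10 * π₂.length ∧ Pure 20 6 σ σ' ∧ σ'.regs 20 = z.val ∧
    σ'.regs 22 = (if y ∈ π₂ then 1 else 0) ∧
    σ'.regs 21 = (π₂.head?.map Fin.val).getD (σ.regs 10)) P.length ?_ ?_ ?_
  · obtain ⟨π₁, hπ⟩ : ∃ π₁, u :: P = π₁ ++ [s] := List.getLast?_eq_some_iff.1 hlast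
    refine ⟨π₁, s, [], hπ, ?_, by simp, (((Pure.refl 20 6 σ).setReg).setReg).setReg,
      by simp [h1, val_mod hw], by simp, ?_⟩
    · have := congrArg List.length hπ
      simp at this
      exact this
    · simp [Nat.mod_eq_of_lt h10]
  · rintro m t σ₁ ⟨π₁, z, π₂, hπ, rfl, ht, hk, h20, h22, h21⟩ hne
    have hzu : z ≠ u := by
      rintro rfl
      exact hne (h20.trans ((hk.regs 5 (by decide)).trans h5).symm)
    obtain ⟨π₁, c, rfl⟩ : ∃ π c, π₁ = π ++ [c] := by
      rcases List.eq_nil_or_concat π₁ with rfl | ⟨π, c, rfl⟩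
      · simp at hπ; exact absurd hπ.1.symm hzu
      · exact ⟨π, c, by simp⟩
    have hzc : (σ.view L i z).head? = some c := by
      have := hP.chain
      rw [hπ, List.append_assoc, List.singleton_append, List.isChain_append] at this
      exact (List.isChain_cons_cons.1 this.2.1).1
    obtain ⟨lz, hlz⟩ := List.head?_eq_some_iff.1 hzc
    have hya : σ₁.regs a = y.val := (hk.regs a ha20).trans ha
    -- the step to `c`, after the comparison
    have step : ∀ (σ₂ : Store h n) t₂, Pure 20 6 σ σ₂ → σ₂.regs 20 = z.val → t₂ ≤ 3 →
        σ₂.regs 22 = (if y ∈ z :: π₂ then 1 else 0) →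
        wp L w S (mov 21 20 ;; headOf i 20 20 6) σ₂ fun t' σ' =>
          ∃ m' < (π₁ ++ [c]).length, ∃ π₁ z π₂, u :: P = π₁ ++ z :: π₂ ∧ m' = π₁.length ∧
            t + (1 + (t₂ + t') + 1) ≤ 10 * π₂.length ∧ Pure 20 6 σ σ' ∧ σ'.regs 20 = z.val ∧
            σ'.regs 22 = (if y ∈ π₂ then 1 else 0) ∧
            σ'.regs 21 = (π₂.head?.map Fin.val).getD (σ.regs 10) := by
      intro σ₂ t₂ hk₂ h20₂ ht₂ h22₂
      rw [wp_seq, wp_mov]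
      refine wp_headOf (v := z) (x := c) (l := lz) (by simpa using h20₂)
        (hk₂.headsOk hσ) (by rw [view_setReg, hk₂.view, hlz]) fun p => ?_
      refine ⟨π₁.length, by simp, π₁, c, z :: π₂, by rw [hπ]; simp, rfl, by simp; omega,
        ((hk₂.setReg).setCursor).setReg, by simp [val_mod hw], by simpa using h22₂, ?_⟩
      simp [h20₂, val_mod hw]
    simp only [wp_seq, wp_ite, wp_const, wp_skip, Test.holds, h20, hya, Fin.val_inj]
    refine ⟨fun hzy => ?_, fun hzy => ?_⟩
    · exact wp_seq.1 (step (σ₁.setReg w 22 1) (1 + 1) hk.setReg (by simpa using h20) (by omega)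
        (by simp [h1w, hzy]))
    · have hyz : y ≠ z := fun h => hzy h.symm
      exact wp_seq.1 (step σ₁ (1 + 0 + 1) hk h20 (by omega) (by simpa [hyz] using h22))
  · rintro m t σ₁ ⟨π₁, z, π₂, hπ, rfl, ht, hk, h20, h22, h21⟩ heq
    have hzu : z = u := Fin.ext (h20.symm.trans (heq.trans ((hk.regs 5 (by decide)).trans h5)))
    subst hzu
    have hπ₁ : π₁ = [] := by
      cases π₁ with
      | nil => rfl
      | cons b π₁ =>
        simp only [List.cons_append, List.cons.injEq] at hπ
        have hnd := hP.nodup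
        rw [hπ.2] at hnd
        simp at hnd
    subst hπ₁
    obtain rfl : P = π₂ := by simpa using hπ
    have hya : σ₁.regs a = y.val := (hk.regs a ha20).trans ha
    simp only [wp_ite, wp_const, wp_skip, Test.holds, h20, hya, Fin.val_inj]
    refine ⟨fun hzy => ⟨by omega, hk.setReg, by simp [h1w, hzy], by simpa using h21⟩,
      fun hzy => ⟨by omega, hk, ?_, h21⟩⟩
    have hyz : y ≠ z := fun h => hzy h.symm
    simpa [hyz] using h22

/-! ### Completed vertices are linked to the stack -/

/-- The list heads lead from the completed vertex `x` in `k` steps through completed vertices to the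
vertex `g` on the stack, and the vertex before `g` has been scanned in the list of `g`. -/
inductive Gate (A : Fin n → List (Fin n)) (T : List (Fin n × ℕ)) (F : List (Frame n)) :
    ℕ → Fin n → Fin n → Prop
  | base {x g : Fin n} {l : List (Fin n)} (hx : (A x).head? = some g) (hg : (g, l) ∈ F)
      (hl : x ∉ l) : Gate A T F 1 x g
  | step {k : ℕ} {x p g : Fin n} (hx : (A x).head? = some p) (hpT : p ∈ visited T)
      (hpF : p ∉ verts F) (hp : Gate A T F k p g) : Gate A T F (k + 1) x g

/-- Every completed vertex is linked to the stack, by a path whose length together with the depth of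
its end `g` is at most `D`.  The vertices on the stack to which it is related by `q` are not above `g`.
-/
def Gated (A : Fin n → List (Fin n)) (q : Fin n → Fin n → Prop) (D : ℕ) (T : List (Fin n × ℕ))
    (F : List (Frame n)) : Prop :=
  ∀ x ∈ visited T, x ∉ verts F → ∃ k g π₁ π₂, Gate A T F k x g ∧ verts F = π₁ ++ g :: π₂ ∧
    k + π₂.length ≤ D ∧ ∀ z ∈ verts F, q x z → z ∈ g :: π₂

section gate

variable {A A' : Fin n → List (Fin n)} {T' : List (Fin n × ℕ)} {F' : List (Frame n)} {D D' k : ℕ}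
  {x g p : Fin n} {q : Fin n → Fin n → Prop}

/-- Links depend only on the lists of completed vertices; these stay completed, and what has been
scanned stays scanned. -/
theorem Gate.transfer (hg : Gate A T F k x g) (hxT : x ∈ visited T) (hxF : x ∉ verts F)
    (hA : ∀ v ∈ visited T, v ∉ verts F → A' v = A v) (hT : ∀ v ∈ visited T, v ∈ visited T')
    (hF : ∀ v ∈ visited T, v ∉ verts F → v ∉ verts F')
    (hF' : ∀ l, (g, l) ∈ F → ∃ l', (g, l') ∈ F' ∧ ∀ v ∈ visited T, v ∉ verts F → v ∉ l → v ∉ l') :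
    Gate A' T' F' k x g := by
  induction hg with
  | base hx hg hl =>
    obtain ⟨l', h1, h2⟩ := hF' _ hg
    exact .base (by rwa [hA _ hxT hxF]) h1 (h2 _ hxT hxF hl)
  | step hx hpT hpF _ ih =>
    exact .step (by rwa [hA _ hxT hxF]) (hT _ hpT) (hF _ hpT hpF) (ih hpT hpF hF')

theorem Gated.skip (hg : Gated A q D T ((u, y :: l) :: F)) : Gated A q D T ((u, l) :: F) := by
  intro x hxT hxF
  obtain ⟨k, g, π₁, π₂, h1, h2, h3, h4⟩ := hg x hxT hxF
  refine ⟨k, g, π₁, π₂, h1.transfer hxT hxF (fun _ _ _ => rfl) (fun _ h => h) (fun _ _ h => h)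
    fun l' hl' => ?_, h2, h3, h4⟩
  rcases List.mem_cons.1 hl' with h | h
  · obtain ⟨rfl, rfl⟩ := Prod.mk.inj h
    exact ⟨l, by simp, fun v _ _ hv hvl => hv (List.mem_cons_of_mem _ hvl)⟩
  · exact ⟨l', List.mem_cons_of_mem _ h, fun v _ _ hv => hv⟩

theorem Gated.congr (hg : Gated A q D T F) (hA : ∀ v ∈ visited T, v ∉ verts F → A' v = A v) :
    Gated A' q D T F := by
  intro x hxT hxF
  obtain ⟨k, g, π₁, π₂, h1, h2, h3, h4⟩ := hg x hxT hxF
  exact ⟨k, g, π₁, π₂, h1.transfer hxT hxF hA (fun _ h => h) (fun _ _ h => h)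
    fun l' hl' => ⟨l', hl', fun v _ _ hv => hv⟩, h2, h3, h4⟩

/-- A new vertex on the stack leaves the links as they are. -/
theorem Gated.push {d : ℕ} (hg : Gated A q D T F) (hx : x ∉ visited T) (hD : D ≤ D')
    (hq : ∀ z ∈ visited T, z ∉ verts F → ¬ q z x)
    (hA : ∀ v ∈ visited T, v ∉ verts F → A' v = A v) :
    Gated A' q D' (T ++ [(x, d)]) ((x, l) :: F) := by
  intro z hzT hzF
  have hzx : z ≠ x := by rintro rfl; simp at hzF
  have hzT' : z ∈ visited T := (mem_visited_append.1 hzT).resolve_right hzx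
  have hzF' : z ∉ verts F := fun h => hzF (List.mem_cons_of_mem _ h)
  obtain ⟨k, g, π₁, π₂, h1, h2, h3, h4⟩ := hg z hzT' hzF'
  refine ⟨k, g, x :: π₁, π₂, h1.transfer hzT' hzF' hA
    (fun v hv => mem_visited_append.2 (Or.inl hv)) (fun v hv hvF h => ?_)
    fun l' hl' => ⟨l', List.mem_cons_of_mem _ hl', fun v _ _ hv => hv⟩,
    by simp only [verts, List.map_cons, List.cons_append] at h2 ⊢; rw [h2], by omega,
    fun v hv hqv => h4 v ((List.mem_cons.1 hv).resolve_left ?_) hqv⟩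
  · simp only [verts, List.map_cons, List.mem_cons] at h
    rcases h with rfl | h
    · exact hx hv
    · exact hvF h
  · rintro rfl; exact hq z hzT' hzF' hqv

/-- When `u` is completed, it is linked to its parent, and the links that have ended in `u` become
longer by one, while their ends move one level down. -/
theorem Gated.pop (hg : Gated A q D T ((u, []) :: (p, u :: l) :: F)) (hu : u ∈ visited T)
    (hnd : (u :: p :: verts F).Nodup) (hul : u ∉ l) (hup : (A u).head? = some p)
    (hD : F.length + 1 ≤ D) : Gated A q D T ((p, l) :: F) := by
  have huF : u ∉ verts ((p, l) :: F) := (List.nodup_cons.1 hnd).1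
  have hgu : Gate A T ((p, l) :: F) 1 u p := .base hup (by simp) hul
  have ext : ∀ k x g, Gate A T ((u, []) :: (p, u :: l) :: F) k x g → g = u →
      x ∉ verts ((u, []) :: (p, u :: l) :: F) → Gate A T ((p, l) :: F) (k + 1) x p := by
    intro k x g hk hgu' hxF
    induction hk with
    | base hx _ _ => subst hgu'; exact .step hx hu huF hgu
    | step hx hpT hpF _ ih =>
      exact .step hx hpT (fun h => hpF (List.mem_cons_of_mem _ h)) (ih hgu' hpF)
  intro x hxT hxF
  by_cases hxu : x = u
  · subst hxu
    exact ⟨1, p, [], verts F, hgu, by simp, by simp; omega, fun z hz _ => hz⟩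
  have hxF' : x ∉ verts ((u, []) :: (p, u :: l) :: F) := by
    simp only [verts, List.map_cons, List.mem_cons] at hxF ⊢
    rintro (h | h)
    · exact hxu h
    · exact hxF h
  obtain ⟨k, g, π₁, π₂, h1, h2, h3, h4⟩ := hg x hxT hxF'
  cases π₁ with
  | nil =>
    -- the link has ended in `u`
    simp only [verts, List.map_cons, List.nil_append, List.cons.injEq] at h2
    obtain ⟨rfl, rfl⟩ := h2
    refine ⟨k + 1, p, [], verts F, ext k x u h1 rfl hxF', by simp, ?_, fun z hz _ => hz⟩
    simp only [List.length_cons] at h3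
    simp only [verts]
    omega
  | cons a π₁ =>
    simp only [verts, List.map_cons, List.cons_append, List.cons.injEq] at h2
    obtain ⟨rfl, h2⟩ := h2
    refine ⟨k, g, π₁, π₂, h1.transfer hxT hxF' (fun _ _ _ => rfl) (fun _ h => h)
      (fun v _ hv h => hv (List.mem_cons_of_mem _ h)) fun l' hl' => ?_, by simpa using h2, h3,
      fun z hz => h4 z (List.mem_cons_of_mem _ hz)⟩
    have hgu : g ≠ u := by
      rintro rfl
      apply (List.nodup_cons.1 hnd).1
      rw [h2]; simp
    rcases List.mem_cons.1 hl' with h | h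
    · exact absurd (Prod.mk.inj h).1 hgu
    rcases List.mem_cons.1 h with h | h
    · obtain ⟨rfl, rfl⟩ := Prod.mk.inj h
      exact ⟨l, by simp, fun v _ _ hv hvl => hv (List.mem_cons_of_mem _ hvl)⟩
    · exact ⟨l', List.mem_cons_of_mem _ h, fun v _ _ hv => hv⟩

end gate

end Rotate

/-! ### The least vertex of a list as an end marker -/

namespace Rotate

open Store Dfs

variable {h n : ℕ}

/-- Store in `r17` the least vertex in list number `a` of family `i`, which must not be empty. -/
def minOf (i : Fin h) (a : Reg) : Cmd h :=
  headOf i 19 a 5 ;; mov 17 19 ;; .prim (.const 21 0) ;;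
  .loop (.eq 21 4)
    (advance 5 19 ;; .prim (.read 18 5) ;; .ite (.lt 18 17) (mov 17 18) .skip)

/-- Rotate list number `r5` of family `i` until its least vertex is the last one. -/
def leastToEnd (i : Fin h) : Cmd h :=
  .prim (.front 5 i 5) ;;
  .ite (.null 5) .skip (minOf i 5 ;; rotateUntil i 5 17 ;; .prim (.rotate i 5))

/-- Say in `r12` whether vertex `r13` is met in list number `r16` of family `i`, from its head to its
least vertex.  For a vertex on the stack, this is the part that has not been scanned completely. -/
def find (i : Fin h) : Cmd h :=
  minOf i 16 ;; headOf i 18 16 5 ;; .prim (.const 12 0) ;; .prim (.const 19 0) ;;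
  .loop (.eq 19 4)
    (.ite (.eq 18 13) (.prim (.const 12 1) ;; .prim (.const 19 1))
      (.ite (.eq 18 17) (.prim (.const 19 1)) (.prim (.next 5) ;; .prim (.read 18 5))))

variable {L : Lists h n} {i : Fin h} {s v y c : Fin n} {w S : ℕ} {σ : Store h n} {a : Reg}
  {l pre : List (Fin n)}

theorem getLast?_append_cons_iff {c' : Fin n} (hnd : (c :: l).Nodup)
    (hlast : (pre ++ c :: l).getLast? = some c') : c = c' ↔ l = [] := by
  rw [List.getLast?_append] at hlast
  cases l with
  | nil => simpa using hlast
  | cons a l =>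
    simp only [reduceCtorEq, iff_false]
    rintro rfl
    rw [List.getLast?_cons_cons, List.getLast?_eq_some_getLast (by simp)] at hlast
    simp only [Option.some_or, Option.some.injEq] at hlast
    exact (List.nodup_cons.1 hnd).1 (hlast ▸ List.getLast_mem _)

theorem wp_minOf (hw : n < 2 ^ w) (hw0 : 0 < w) (hb : Base s w σ) (hσ : σ.HeadsOk L)
    (ha : σ.regs a = v.val) (hnd : (L i v).Nodup) (hne : L i v ≠ []) :
    wp L w S (minOf i a) σ fun t σ' => t ≤ 13 * (L i v).length + 8 ∧ Pure 17 0 σ σ' ∧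
      ∃ c ∈ L i v, (∀ y ∈ L i v, c ≤ y) ∧ σ'.regs 17 = c.val := by
  obtain ⟨x₀, l₀, hv⟩ := List.exists_cons_of_ne_nil (mt (view_eq_nil (σ := σ)).1 hne)
  have hnd' : (σ.view L i v).Nodup := nodup_view.2 hnd
  have hlen : (σ.view L i v).length = (L i v).length := length_view
  refine wp_seq.2 (wp_seq.2 (wp_front ha hσ (by simp [hv]) fun p hp => ?_))
  rw [wp_read (i := i) (v := v) (x := x₀) (l := l₀) ⟨p, by simp, hp.1, by rw [hp.2, hv]⟩]
  simp only [wp_seq, wp_mov, wp_const]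
  refine wp_loop (fun m t σ' => Pure 17 0 σ σ' ∧ σ'.regs 19 = x₀.val ∧ ∃ c, σ'.regs 17 = c.val ∧
    ((σ'.regs 21 = 0 ∧ ∃ d x e, σ.view L i v = d ++ x :: e ∧ σ'.At L 5 i v (x :: (e ++ d)) ∧
      c ∈ d ++ [x] ∧ (∀ y ∈ d ++ [x], c ≤ y) ∧ m = e.length + 1 ∧ t ≤ 13 * d.length) ∨
    (σ'.regs 21 = 1 ∧ m = 0 ∧ c ∈ σ.view L i v ∧ (∀ y ∈ σ.view L i v, c ≤ y) ∧
      t ≤ 13 * (σ.view L i v).length))) (l₀.length + 1) ?_ ?_ ?_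
  · refine ⟨?_, by simp [val_mod hw], x₀, by simp [val_mod hw], Or.inl ⟨by simp, [], x₀, l₀, hv,
      ⟨p, by simp, hp.1, by rw [hp.2, hv]; simp⟩, by simp, by simp, rfl, by simp⟩⟩
    repeat (first | exact Pure.refl 17 0 σ | refine Pure.setReg ?_ | refine Pure.setCursor ?_)
  · rintro m t σ₁ ⟨hk, h19, c, h17, ⟨h21, d, x, e, hd, hat, hc, hcm, rfl, ht⟩ | ⟨h21, -⟩⟩ hn
    swap
    · exact absurd (h21.trans (hk.base hb).r4.symm) hn
    refine (wp_advance hw hw0 h19 (by decide) hat).seq ?_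
    rintro t₂ σ₂ ⟨ht₂, hk₂, -, h21₂, hat₂⟩
    have hk2 : Pure 17 0 σ σ₂ := hk.trans hk₂
    rw [hd] at hnd' hv
    have hh := head?_rotated_eq_iff (b := x₀) hnd' (by rw [hv]; rfl)
    simp only [hh] at h21₂
    have h17₂ : σ₂.regs 17 = c.val := (hk₂.regs 17 (by decide)).trans h17
    have h19₂ : σ₂.regs 19 = x₀.val := (hk₂.regs 19 (by decide)).trans h19
    obtain ⟨z, l', hz⟩ : ∃ z l', e ++ d ++ [x] = z :: l' := by
      cases h : e ++ d ++ [x] with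
      | nil => simp at h
      | cons z l' => exact ⟨z, l', rfl⟩
    rw [hz] at hat₂
    rw [wp_seq, wp_read hat₂]
    -- the new least vertex so far
    have key : ∀ (σ₃ : Store h n) t₃, Pure 17 0 σ σ₃ → σ₃.regs 19 = x₀.val →
        σ₃.regs 21 = σ₂.regs 21 → σ₃.cursors 5 = σ₂.cursors 5 → σ₃.regs 17 = (min c z).val →
        t₃ ≤ 11 →
        ∃ m' < e.length + 1, Pure 17 0 σ σ₃ ∧ σ₃.regs 19 = x₀.val ∧ ∃ c, σ₃.regs 17 = c.val ∧
          ((σ₃.regs 21 = 0 ∧ ∃ d x e, σ.view L i v = d ++ x :: e ∧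
            σ₃.At L 5 i v (x :: (e ++ d)) ∧ c ∈ d ++ [x] ∧ (∀ y ∈ d ++ [x], c ≤ y) ∧
            m' = e.length + 1 ∧ t + (1 + t₃ + 1) ≤ 13 * d.length) ∨
          (σ₃.regs 21 = 1 ∧ m' = 0 ∧ c ∈ σ.view L i v ∧ (∀ y ∈ σ.view L i v, c ≤ y) ∧
            t + (1 + t₃ + 1) ≤ 13 * (σ.view L i v).length)) := by
      intro σ₃ t₃ hk₃ h19₃ h21₃ hcu h17₃ ht₃
      cases e with
      | nil =>
        have hzx : z = x₀ := by
          simp only [List.nil_append] at hz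
          rw [hz] at hv
          exact (List.cons.inj hv).1
        have hz' : z ∈ d ++ [x] := by simp only [List.nil_append] at hz; rw [hz]; simp
        have hmin : min c z = c := min_eq_left (hcm z hz')
        exact ⟨0, by simp, hk₃, h19₃, c, by rw [h17₃, hmin], Or.inr ⟨by rw [h21₃, h21₂]; simp, rfl,
          by rw [hd]; exact hc, by rw [hd]; exact hcm, by rw [hd]; simp; omega⟩⟩
      | cons z' e =>
        obtain ⟨rfl, rfl⟩ : z' = z ∧ e ++ d ++ [x] = l' := by simpa using hz
        refine ⟨e.length + 1, by simp, hk₃, h19₃, _, h17₃, Or.inl ⟨by rw [h21₃, h21₂]; simp,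
          d ++ [x], z', e, by rw [hd]; simp, by simpa using hat₂.congr hcu, ?_, ?_, rfl,
          by simp; omega⟩⟩
        · rcases min_choice c z' with h | h <;> rw [h]
          · exact List.mem_append_left _ hc
          · simp
        · intro y hy
          rcases List.mem_append.1 hy with hy | hy
          · exact (min_le_left _ _).trans (hcm y hy)
          · rw [List.mem_singleton.1 hy]; exact min_le_right _ _
    have hlt : Test.holds (σ₂.setReg w 18 z) (.lt 18 17) ↔ z < c := by
      simp [Test.holds, h17₂, val_mod hw]
    rw [wp_ite, hlt, wp_mov, wp_skip]
    refine ⟨fun hlt => ?_, fun hlt => ?_⟩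
    · refine key _ _ hk2.setReg.setReg (by simpa using h19₂) (by simp) (by simp) ?_ (by omega)
      simp [val_mod hw, min_eq_right hlt.le]
    · refine key _ _ hk2.setReg (by simpa using h19₂) (by simp) (by simp) ?_ (by omega)
      simp [h17₂, min_eq_left (not_lt.1 hlt)]
  · rintro m t σ₁ ⟨hk, h19, c, h17, ⟨h21, -⟩ | ⟨h21, rfl, hc, hcm, ht⟩⟩ he
    · have : σ₁.regs 21 = σ₁.regs 4 := he
      rw [h21, (hk.base hb).r4] at this
      exact absurd this zero_ne_one
    · exact ⟨by omega, hk, c, mem_view.1 hc, fun y hy => hcm y (mem_view.2 hy), h17⟩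

theorem wp_leastToEnd (hw : n < 2 ^ w) (hw0 : 0 < w) (hb : Base s w σ) (hσ : σ.HeadsOk L)
    (h5 : σ.regs 5 = v.val) (hnd : (L i v).Nodup) :
    wp L w S (leastToEnd i) σ fun t σ' => t ≤ 20 * (L i v).length + 20 ∧ Keeps 17 0 σ σ' ∧
      σ'.HeadsOk L ∧ (∀ j u, ¬ (j = i ∧ u = v) → σ'.view L j u = σ.view L j u) ∧
      ∀ c ∈ (σ'.view L i v).getLast?, ∀ y ∈ σ'.view L i v, c ≤ y := by
  rw [leastToEnd, wp_seq]
  by_cases hne : L i v = []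
  · rw [wp_front_nil h5 (view_eq_nil.2 hne)]
    simp only [wp_ite, Test.holds, wp_skip, cursors_setCursor, if_true, true_imp_iff,
      not_true_eq_false, false_imp_iff, and_true]
    exact ⟨by omega, (Keeps.refl 17 0 σ).setCursor, hσ, fun _ _ _ => rfl,
      by simp [view_eq_nil.2 hne]⟩
  refine wp_front h5 hσ (mt view_eq_nil.1 hne) fun p hp => ?_
  simp only [wp_ite, Test.holds, cursors_setCursor, if_true, reduceCtorEq, false_imp_iff, true_and,
    not_false_eq_true, true_imp_iff]
  refine (wp_minOf (σ := σ.setCursor 5 (some (i, v, p))) (v := v) (s := s) hw hw0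
    ⟨hb.1, hb.2, hb.3, hb.4, hb.5⟩ hσ h5 hnd hne).seq ?_
  rintro t₁ σ₁ ⟨ht₁, hk₁, c, hc, hcm, h17⟩
  have hok₁ := hk₁.headsOk (L := L) hσ
  obtain ⟨l₁, l₂, hl⟩ := List.append_of_mem ((mem_view (σ := σ₁)).2 hc)
  have hnd₁ : (σ₁.view L i v).Nodup := nodup_view.2 hnd
  have hlen : (σ₁.view L i v).length = (L i v).length := length_view
  rw [hl] at hnd₁ hlen
  have hcl : c ∉ l₁ := fun hcl => (List.nodup_append.1 hnd₁).2.2 c hcl c (by simp) rfl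
  refine (wp_rotateUntil hw hok₁ ((hk₁.regs 5 (by decide)).trans h5) h17 (by decide) (by decide)
    hl hcl).seq ?_
  rintro t₂ σ₂ ⟨ht₂, hk₂, hok₂, hv₂, hoth₂⟩
  rw [wp_rotate (v := v) ((hk₂.regs 5 (by decide)).trans ((hk₁.regs 5 (by decide)).trans h5))]
  have hv₃ : (σ₂.rot L i v).view L i v = l₂ ++ l₁ ++ [c] := by
    rw [view_rot hok₂, hv₂]; simp
  have hk1 : Keeps 17 0 σ σ₁ := ⟨hk₁.regs, by simp, hk₁.mem, hk₁.out⟩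
  refine ⟨?_, (hk1.trans hk₂).rot, hok₂.rot, fun j u hju => ?_, ?_⟩
  · rw [List.length_append, List.length_cons] at hlen; omega
  · rw [view_rot hok₂, if_neg hju, hoth₂ j u hju, hk₁.view]; rfl
  · rw [hv₃]
    intro c' hc' y hy
    obtain rfl : c = c' := by simpa using hc'
    refine hcm y ((mem_view (σ := σ₁)).1 ?_)
    rw [hl]
    simp only [List.mem_append, List.mem_cons] at hy ⊢
    tauto

theorem wp_find (hw : n < 2 ^ w) (hw0 : 0 < w) (hb : Base s w σ) (hσ : σ.HeadsOk L)
    (h13 : σ.regs 13 = y.val) (h16 : σ.regs 16 = v.val) (hnd : (L i v).Nodup)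
    (hv : σ.view L i v = l ++ pre) (hc : c ∈ l.getLast?) (hcm : ∀ z ∈ L i v, c ≤ z) :
    wp L w S (find i) σ fun t σ' => t ≤ 30 * (L i v).length + 20 ∧ Pure 12 0 σ σ' ∧
      σ'.regs 12 = if y ∈ l then 1 else 0 := by
  have h1w : 1 % 2 ^ w = 1 := Nat.mod_eq_of_lt (Nat.one_lt_two_pow hw0.ne')
  obtain ⟨l, rfl⟩ := List.getLast?_eq_some_iff.1 hc
  have hcL : c ∈ L i v := (mem_view (σ := σ)).1 (by rw [hv]; simp)
  have hlen : (σ.view L i v).length = (L i v).length := length_view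
  have hnd' : (σ.view L i v).Nodup := nodup_view.2 hnd
  refine (wp_minOf (v := v) (s := s) hw hw0 hb hσ h16 hnd
    (List.ne_nil_of_mem hcL)).seq ?_
  rintro t₁ σ₁ ⟨ht₁, hk₁, c', hc', hcm', h17⟩
  obtain rfl : c' = c := le_antisymm (hcm' c hcL) (hcm c' hc')
  have hok₁ := hk₁.headsOk (L := L) hσ
  have hv₁ : σ₁.view L i v = l ++ [c'] ++ pre := by rw [hk₁.view, hv]
  obtain ⟨x₀, l₀, hx₀⟩ : ∃ z l', l ++ [c'] = z :: l' := by cases l <;> simp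
  refine wp_seq.2 (wp_seq.2 (wp_front (v := v) ((hk₁.regs 16 (by decide)).trans h16) hok₁
    (by simp [hv₁]) fun p hp => ?_))
  have hat : (σ₁.setCursor 5 (some (i, v, p))).At
      L 5 i v (x₀ :: (l₀ ++ pre)) := ⟨p, by simp, hp.1, by rw [hp.2, hv₁, hx₀]; rfl⟩
  rw [wp_read (i := i) (v := v) (x := x₀) (l := l₀ ++ pre) hat]
  simp only [wp_seq, wp_const]
  have hk1 : Pure 12 0 σ σ₁ := ⟨⟨fun r hr => hk₁.regs r (by omega), by simp, hk₁.mem, hk₁.out⟩, hk₁.heads⟩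
  rw [hv] at hnd' hlen
  have hcl : c' ∉ l := fun hcl =>
    (List.nodup_append.1 (List.nodup_append.1 hnd').1).2.2 c' hcl c' (by simp) rfl
  refine wp_loop (fun m t σ' => Pure 12 0 σ σ' ∧ σ'.regs 17 = c'.val ∧ σ'.regs 13 = y.val ∧
    ((σ'.regs 19 = 0 ∧ ∃ d x e, l ++ [c'] = d ++ x :: e ∧ σ'.At L 5 i v (x :: (e ++ pre ++ d)) ∧
      y ∉ d ∧ σ'.regs 18 = x.val ∧ σ'.regs 12 = 0 ∧ m = e.length + 1 ∧ t ≤ 10 * d.length) ∨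
    (σ'.regs 19 = 1 ∧ m = 0 ∧ t ≤ 10 * (l ++ [c']).length ∧
      σ'.regs 12 = if y ∈ l ++ [c'] then 1 else 0))) (l₀.length + 1) ?_ ?_ ?_
  · refine ⟨?_, ?_, ?_, Or.inl ⟨by simp, [], x₀, l₀, hx₀, ?_, by simp, by simp [val_mod hw],
      by simp, rfl, by simp⟩⟩
    · repeat (first | exact hk1 | refine Pure.setReg ?_ | refine Pure.setCursor ?_)
    · simpa using h17
    · simpa using (hk₁.regs 13 (by decide)).trans h13
    · simp only [List.append_nil]
      exact hat.congr rfl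
  · rintro m t σ' ⟨hk, h17', h13', ⟨h19, d, x, e, hd, hat', hyd, h18, h12, rfl, ht⟩ | ⟨h19, -⟩⟩ hn
    swap
    · exact absurd (h19.trans (hk.base hb).r4.symm) hn
    simp only [wp_ite, Test.holds, h18, h13', h17', Fin.val_inj, wp_seq, wp_const]
    have hl := congrArg List.length hd
    simp only [List.length_append, List.length_cons, List.length_nil] at hl
    refine ⟨fun hxy => ?_, fun hxy => ⟨fun hxc => ?_, fun hxc => ?_⟩⟩
    · subst hxy
      refine ⟨0, by omega, hk.setReg.setReg, by simpa using h17', by simpa using h13',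
        Or.inr ⟨by simp [h1w], rfl, by simp; omega, ?_⟩⟩
      rw [hd]; simp [h1w]
    · subst hxc
      have he : e = [] := by
        rcases List.eq_nil_or_concat e with rfl | ⟨e, z, rfl⟩
        · rfl
        · have h2 : l = d ++ x :: e := by
            have := congrArg List.dropLast hd
            rw [List.dropLast_concat, List.concat_eq_append, ← List.cons_append,
              ← List.append_assoc, List.dropLast_concat] at this
            exact this
          exact absurd (by rw [h2]; simp) hcl
      subst he
      refine ⟨0, by omega, hk.setReg, by simpa using h17', by simpa using h13',
        Or.inr ⟨by simp [h1w], rfl, by simp; omega, ?_⟩⟩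
      rw [hd, if_neg (by simp only [List.mem_append, List.mem_singleton]; rintro (h | h); exacts [hyd h, hxy h.symm])]
      simpa using h12
    · obtain ⟨z, e, rfl⟩ : ∃ z e', e = z :: e' := by
        cases e with
        | nil =>
          have := List.append_inj' hd rfl
          simp at this
          exact absurd this.2.symm hxc
        | cons z e => exact ⟨z, e, rfl⟩
      refine wp_next hat' fun p' hp' => ?_
      have hat2 : (σ'.setCursor 5 (some (i, v, p'))).At L 5 i v (z :: (e ++ pre ++ (d ++ [x]))) :=
        ⟨p', by simp, hp'.1, by rw [hp'.2]; simp⟩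
      rw [wp_read hat2]
      refine ⟨e.length + 1, by simp, hk.setCursor.setReg, by simpa using h17', by simpa using h13',
        Or.inl ⟨by simpa using h19, d ++ [x], z, e, by simpa using hd, hat2.congr rfl, ?_,
          by simp [val_mod hw], by simpa using h12, rfl, by simp; omega⟩⟩
      simp only [List.mem_append, List.mem_singleton]
      rintro (h | h)
      exacts [hyd h, hxy h.symm]
  · rintro m t σ' ⟨hk, -, -, ⟨h19, -⟩ | ⟨h19, rfl, ht, h12⟩⟩ he
    · have : σ'.regs 19 = σ'.regs 4 := he
      rw [h19, (hk.base hb).r4] at this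
      exact absurd this zero_ne_one
    · refine ⟨?_, hk, h12⟩
      rw [List.length_append (as := l ++ [c'])] at hlen
      omega

end Rotate

/-! ### Space-efficient DFS of directed graphs -/

namespace Rotate

open Store Dfs

variable {n : ℕ}

namespace Directed

/-- The body of the loop of `check`: follow the in-list head of `r13`; the number of steps is `r14`, the
flag `r15` is cleared at the end, and the answer is given in `r12`. -/
def checkStep : Cmd 2 :=
  .prim (.front 5 1 13) ;;
    .ite (.null 5) (.prim (.const 15 0))
      (.ite (.lt 7 14) (.prim (.const 15 0))
        (.prim (.read 16 5) ;; climb 0 16 ;;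
          .ite (.eq 22 4) (find 0 ;; .prim (.const 15 0))
            (mov 13 16 ;; .prim (.op .add 14 14 4))))

/-- Follow the heads of the in-lists from `r11` to the stack, by at most `r7` steps.  The vertex `r11` is
visited if and only if this leads to a vertex on the stack whose list has been scanned up to the last
vertex before it. -/
def check : Cmd 2 :=
  climb 0 11 ;;
  .ite (.eq 22 4) (.prim (.const 12 0))
    (mov 13 11 ;; .prim (.const 14 0) ;; .prim (.const 15 1) ;; .prim (.const 12 1) ;;
      .loop (.eq 15 3) checkStep)

/-- The list of a vertex on the stack ends with its least vertex. -/
def last : Cmd 2 :=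
  minOf 0 5 ;; .prim (.const 12 0) ;; .ite (.eq 11 17) (.prim (.const 12 1)) .skip

/-- Let the in-list of the new vertex `r11` start with the parent `r5`, and make `r11` the current
vertex. -/
def enter : Cmd 2 := rotateUntil 1 11 5 ;; mov 5 11 ;; leastToEnd 0

/-- The in-list of a vertex on the stack starts with its parent. -/
def leave : Cmd 2 := headOf 1 5 5 6

/-- The lists as seen from the heads `H`. -/
def viewOf (L : Lists 2 n) (H : Fin 2 → Fin n → ℕ) (j : Fin 2) (v : Fin n) : List (Fin n) :=
  (L j v).rotate (H j v)

/-- The head of the in-list of a vertex points to its parent in the DFS tree, and the order of the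
out-list is fixed by the rule that the least vertex is the last one.  The register `r10` is not used. -/
structure Inv (L : Lists 2 n) (H : Fin 2 → Fin n → ℕ) (D m : ℕ) (ρ : Fin n → List (Fin n))
    (T : List (Fin n × ℕ)) (F : List (Frame n)) : Prop where
  marker : m = 0
  depth_lt : D < n
  parents : ParentHeads (viewOf L H) F
  gated : Gated (viewOf L H 1) (fun _ _ => False) D T F
  least : ∀ v ∈ verts F, ∀ c ∈ (ρ v).getLast?, ∀ y ∈ ρ v, c ≤ y

variable {L : Lists 2 n} {r : Fin n → Fin n → Prop} {s u x y p c g : Fin n} {w S j : ℕ}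
  {σ σ' : Store 2 n} {ρ : Fin n → List (Fin n)} {T : List (Fin n × ℕ)} {F : List (Frame n)}
  {l l' pre : List (Fin n)}

/-- The unscanned part of the list of a vertex on the stack ends with the least vertex. -/
theorem frame (hc : LinkCore L 0 r s w σ ρ T u (x :: l) F) (h9 : σ.regs 9 = 0)
    (hadj : IsAdjacencyOrder r (L 0))
    (hX : Inv L σ.heads (maxDepth T) (σ.regs 10) ρ T ((u, x :: l) :: F))
    (hg : (g, l') ∈ (u, x :: l) :: F) :
    ∃ pre c, σ.view L 0 g = l' ++ pre ∧ c ∈ l'.getLast? ∧ (∀ z ∈ L 0 g, c ≤ z) ∧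
      (r g y → y ∉ visited T → y ∈ l') := by
  have h1 : ∃ pre, ρ g = pre ++ l' ∧ σ.view L 0 g = l' ++ pre := by
    rcases List.mem_cons.1 hg with h | h
    · obtain ⟨rfl, rfl⟩ := Prod.mk.inj h
      rcases hc.top with ⟨-, pre, h1, h2, -⟩ | ⟨h91, -⟩
      · exact ⟨pre, h1, h2⟩
      · exact absurd (h9.symm.trans h91) zero_ne_one
    · exact hc.below _ h
  have hne : l' ≠ [] := by
    have hch := hc.snap.chain
    rcases List.mem_cons.1 hg with h | h
    · obtain ⟨rfl, rfl⟩ := Prod.mk.inj h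
      simp
    · clear h1 hX hc hg
      generalize (u, x :: l) = f at hch
      induction F generalizing f with
      | nil => simp at h
      | cons f' F ih =>
        obtain ⟨⟨l'', h2⟩, h3⟩ := List.isChain_cons_cons.1 hch
        rcases List.mem_cons.1 h with rfl | h
        · simp only at h2; simp [h2]
        · exact ih h f' h3
  obtain ⟨pre, hρ, hv⟩ := h1
  refine ⟨pre, l'.getLast hne, hv, List.getLast?_eq_some_getLast hne, fun z hz => ?_,
    fun hgy hyT => ?_⟩
  · refine hX.least g (List.mem_map_of_mem (f := Prod.fst) hg) _ ?_ z
      (hc.snap.mem_iff.2 (((hadj g).2 z).1 hz))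
    rw [hρ, List.getLast?_append, List.getLast?_eq_some_getLast hne]; rfl
  · obtain ⟨pre', h1, h2⟩ := hc.snap.scanned _ hg
    have hy : y ∈ pre' ++ l' := h1 ▸ hc.snap.mem_iff.2 hgy
    rcases List.mem_append.1 hy with hy | hy
    · exact absurd (h2 y hy) hyT
    · exact hy

/-- `check` has followed `j` in-list heads from `x` to `y`. -/
structure Search (L : Lists 2 n) (T : List (Fin n × ℕ)) (F : List (Frame n)) (x : Fin n)
    (σ : Store 2 n) (j : ℕ) (y : Fin n) : Prop where
  r12 : σ.regs 12 = 1
  r13 : σ.regs 13 = y.val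
  r14 : σ.regs 14 = j
  r15 : σ.regs 15 = 1
  off : y ∉ verts F
  white : x ∉ visited T → y ∉ visited T
  gated : x ∈ visited T → y ∈ visited T ∧ ∃ k g π₁ π₂, Gate (σ.view L 1) T F k y g ∧
    verts F = π₁ ++ g :: π₂ ∧ j + k + π₂.length ≤ maxDepth T

/-- An unvisited vertex is never reached from a completed one by an edge, so that the search from an
unvisited vertex stays among unvisited vertices until it meets the stack, and there the last edge
has not been scanned. -/
theorem wp_checkStep (hw : n < 2 ^ w) (hw0 : 0 < w) (hadj : IsAdjacencyOrder r (L 0))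
    (hadj' : IsAdjacencyOrder (fun v u => r u v) (L 1))
    (hc : LinkCore L 0 r s w σ ρ T u (x :: l) F) (h9 : σ.regs 9 = 0)
    (hX : Inv L σ.heads (maxDepth T) (σ.regs 10) ρ T ((u, x :: l) :: F))
    (hs : Search L T ((u, x :: l) :: F) x σ j y) :
    wp L w S checkStep σ fun t σ' => Pure 12 0 σ σ' ∧
      ((∃ y', j ≤ maxDepth T ∧ Search L T ((u, x :: l) :: F) x σ' (j + 1) y' ∧
        t ≤ 10 * maxDepth T + 30) ∨
      (σ'.regs 15 = 0 ∧ t ≤ 10 * maxDepth T + 30 * n + 60 ∧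
        σ'.regs 12 = if x ∈ visited T then 0 else 1)) := by
  have hok := hc.ok
  have hDn := hX.depth_lt
  rw [checkStep, wp_seq]
  by_cases hy : L 1 y = []
  · rw [wp_front_nil hs.r13 (view_eq_nil.2 hy)]
    simp only [wp_ite, Test.holds, wp_const, cursors_setCursor, if_true, true_imp_iff,
      not_true_eq_false, false_imp_iff, and_true]
    refine ⟨(Pure.refl 12 0 σ).setCursor.setReg, Or.inr ⟨by simp, by omega, ?_⟩⟩
    rw [if_neg]
    · simpa using hs.r12
    intro hx
    obtain ⟨-, k, g, -, -, hg, -⟩ := hs.gated hx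
    cases hg with
    | base hx => simp [view_eq_nil.2 hy] at hx
    | step hx => simp [view_eq_nil.2 hy] at hx
  obtain ⟨z, lz, hz⟩ := List.exists_cons_of_ne_nil (mt (view_eq_nil (σ := σ)).1 hy)
  refine wp_front hs.r13 hok (by simp [hz]) fun q hq => ?_
  set σ₁ := σ.setCursor 5 (some (1, y, q)) with hσ₁
  have hk₁ : Pure 12 0 σ σ₁ := (Pure.refl 12 0 σ).setCursor
  simp only [wp_ite, Test.holds, show σ₁.cursors 5 = some (1, y, q) by simp [hσ₁], reduceCtorEq,
    false_imp_iff, true_and, not_false_eq_true, true_imp_iff,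
    show σ₁.regs 7 = maxDepth T from hc.r7, show σ₁.regs 14 = j from hs.r14]
  refine ⟨fun hj => ?_, fun hj => ?_⟩
  · -- links of completed vertices are not as long
    rw [wp_const]
    refine ⟨hk₁.setReg, Or.inr ⟨by simp, by omega, ?_⟩⟩
    rw [if_neg]
    · exact (by simp [hσ₁] : (σ₁.setReg w 15 0).regs 12 = σ.regs 12).trans hs.r12
    intro hx
    obtain ⟨-, k, g, π₁, π₂, -, -, h⟩ := hs.gated hx
    omega
  rw [wp_seq, wp_read (i := 1) (v := y) (x := z) (l := lz) ⟨q, by simp [hσ₁], hq.1, by rw [hq.2, hz]⟩]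
  set σ₂ := σ₁.setReg w 16 z with hσ₂
  have hk₂ : Pure 12 0 σ σ₂ := hk₁.setReg
  have h16 : σ₂.regs 16 = z.val := by simp [hσ₂, val_mod hw]
  have hc₂ := hc.of_pure hk₂
  have hrz : r z y := ((hadj' y).2 z).1 ((mem_view (σ := σ)).1 (by rw [hz]; simp))
  refine (wp_climb hw hw0 hc₂.ok hc₂.base.r1 hc₂.r5 ?_ h16 (by decide)
    hc₂.path).seq ?_
  · rw [hk₂.regs 10 (by decide), hX.marker]; positivity
  rintro t₃ σ₃ ⟨ht₃, hk₃', h22, -⟩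
  have hk₃ : Pure 12 0 σ σ₃ := hk₂.trans hk₃'
  have hlen : (verts F).length ≤ maxDepth T := by simpa using hc.depth_le
  have hc₃ := hc.of_pure hk₃
  have hreg : ∀ a : Reg, a.val < 20 → a ≠ 16 → σ₃.regs a = σ.regs a := fun a ha h16 => by
    rw [hk₃'.regs a ha]; simp [hσ₂, hσ₁, h16]
  have hv₃ : σ₃.view L = σ.view L := hk₃.view
  simp only [wp_ite, Test.holds, h22, hc₃.base.r4]
  refine ⟨fun hmem => ?_, fun hmem => ?_⟩
  · have hzF : z ∈ verts ((u, x :: l) :: F) := by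
      by_contra h
      exact absurd hmem (by rw [if_neg (show z ∉ u :: verts F from h)]; exact zero_ne_one)
    -- the frame in which `y` has to be found
    obtain ⟨l', hl', hyl⟩ : ∃ l', (z, l') ∈ (u, x :: l) :: F ∧ (y ∈ l' ↔ x ∉ visited T) := by
      by_cases hx : x ∈ visited T
      · obtain ⟨-, k, g, -, -, hg, -⟩ := hs.gated hx
        cases hg with
        | base hh hg hl =>
          obtain rfl : z = g := by simpa [hz] using hh
          exact ⟨_, hg, by simp [hl, hx]⟩
        | step hh _ hpF =>
          rw [hz] at hh
          obtain rfl := Option.some.inj hh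
          exact absurd hzF hpF
      · obtain ⟨⟨z', l'⟩, hf, rfl⟩ := List.mem_map.1 hzF
        obtain ⟨-, -, -, -, -, h⟩ := frame (y := y) hc h9 hadj hX hf
        exact ⟨l', hf, by simp [hx, h hrz (hs.white hx)]⟩
    obtain ⟨pre, c, hv, hcl, hcm, -⟩ := frame (y := y) hc h9 hadj hX hl'
    refine (wp_find (l := l') (pre := pre) (c := c) (y := y) (v := z) (s := s) hw hw0 hc₃.base
      hc₃.ok ?_ ?_ (hadj z).1 (by rw [hv₃, hv]) hcl hcm).seq ?_
    · rw [hreg 13 (by decide) (by decide), hs.r13]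
    · rw [hk₃'.regs 16 (by decide), h16]
    rintro t₄ σ₄ ⟨ht₄, hk₄, h12⟩
    rw [wp_const]
    have hn := length_le_of_nodup (hadj z).1
    refine ⟨(hk₃.trans hk₄).setReg, Or.inr ⟨by simp, by omega, ?_⟩⟩
    by_cases hx : x ∈ visited T <;> simp [h12, hyl, hx]
  · have hzF : z ∉ verts ((u, x :: l) :: F) := fun h => hmem (if_pos h)
    rw [wp_seq, wp_mov, wp_op]
    refine ⟨hk₃.setReg.setReg, Or.inl ⟨z, not_lt.1 hj, ?_, by omega⟩⟩
    constructor
    · simpa [hreg 12] using hs.r12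
    · simp [hk₃'.regs 16 (by decide), h16, val_mod hw]
    · simp [BinOp.eval, hreg 14, hs.r14, hc₃.base.r4, Nat.mod_eq_of_lt (show j + 1 < 2 ^ w by omega)]
    · simpa [hreg 15] using hs.r15
    · exact hzF
    · exact fun hx hzT => hs.white hx (hc.snap.closed z hzT hzF y hrz)
    · intro hx
      obtain ⟨hyT, k, g, π₁, π₂, hg, hπ, hk⟩ := hs.gated hx
      cases hg with
      | base hh hg hl =>
        rw [hz] at hh
        obtain rfl := Option.some.inj hh
        exact absurd (List.mem_map_of_mem (f := Prod.fst) hg) hzF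
      | step hh hpT hpF hg =>
        rw [hz] at hh
        obtain rfl := Option.some.inj hh
        exact ⟨hpT, _, g, π₁, π₂, by simpa [hv₃] using hg, hπ, by omega⟩

theorem wp_check (hw : n < 2 ^ w) (hw0 : 0 < w) (hadj : IsAdjacencyOrder r (L 0))
    (hadj' : IsAdjacencyOrder (fun v u => r u v) (L 1))
    (hc : LinkCore L 0 r s w σ ρ T u (x :: l) F) (h9 : σ.regs 9 = 0)
    (hX : Inv L σ.heads (maxDepth T) (σ.regs 10) ρ T ((u, x :: l) :: F)) (h11 : σ.regs 11 = x.val) :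
    wp L w S check σ fun t σ' => t ≤ (10 * maxDepth T + 32) * (maxDepth T + 3) + 30 * n + 80 ∧
      Pure 12 0 σ σ' ∧ σ'.regs 12 = if x ∈ visited T then 0 else 1 := by
  have h1w : 1 % 2 ^ w = 1 := Nat.mod_eq_of_lt (Nat.one_lt_two_pow hw0.ne')
  have hlen : (verts F).length ≤ maxDepth T := by simpa using hc.depth_le
  rw [check]
  refine (wp_climb hw hw0 hc.ok hc.base.r1 hc.r5 ?_ h11 (by decide) hc.path).seq ?_
  · rw [hX.marker]; positivity
  rintro t₁ σ₁ ⟨ht₁, hk₁', h22, -⟩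
  have hk₁ : Pure 12 0 σ σ₁ := (Pure.refl 12 0 σ).trans hk₁'
  simp only [wp_ite, Test.holds, h22, (hc.of_pure hk₁).base.r4]
  refine ⟨fun hmem => ?_, fun hmem => ?_⟩
  · have hxT : x ∈ visited T := by
      by_contra h
      exact absurd hmem (by
        rw [if_neg (show x ∉ u :: verts F from hc.snap.not_mem_stack h)]; exact zero_ne_one)
    rw [wp_const]
    exact ⟨by nlinarith, hk₁.setReg, by simp [hxT]⟩
  have hxF : x ∉ verts ((u, x :: l) :: F) := fun h => hmem (if_pos h)
  simp only [wp_seq, wp_mov, wp_const]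
  refine wp_loop (fun m t σ' => Pure 12 0 σ σ' ∧ ((∃ j y, Search L T ((u, x :: l) :: F) x σ' j y ∧
    j ≤ maxDepth T + 1 ∧ m = maxDepth T + 2 - j ∧ t ≤ (10 * maxDepth T + 32) * j) ∨
    (σ'.regs 15 = 0 ∧ m = 0 ∧ t ≤ (10 * maxDepth T + 32) * (maxDepth T + 2) + 30 * n + 60 ∧
      σ'.regs 12 = if x ∈ visited T then 0 else 1))) (maxDepth T + 2) ?_ ?_ ?_
  · refine ⟨hk₁.setReg.setReg.setReg.setReg, Or.inl ⟨0, x, ?_, by omega, rfl, by simp⟩⟩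
    refine ⟨by simp [h1w], ?_, by simp, by simp [h1w], hxF, id, fun hxT => ⟨hxT, ?_⟩⟩
    · simp [hk₁'.regs 11 (by decide), h11, val_mod hw]
    · obtain ⟨k, g, π₁, π₂, h1, h2, h3, -⟩ := hX.gated x hxT hxF
      exact ⟨k, g, π₁, π₂, by
        simp only [view_setReg, hk₁.view]; exact h1, h2, by omega⟩
  · rintro m t σ' ⟨hk, ⟨j, y, hs, hj, rfl, ht⟩ | ⟨h15, -⟩⟩ hn
    swap
    · exact absurd (h15.trans (hk.base hc.base).r3.symm) hn
    refine (wp_checkStep hw hw0 hadj hadj' (hc.of_pure hk) ((hk.regs 9 (by decide)).trans h9)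
      (by rw [hk.heads, hk.regs 10 (by decide)]; exact hX) hs).mono ?_
    rintro t' σ'' ⟨hk', ⟨y', hj', hs', ht'⟩ | ⟨h15, ht', h12⟩⟩
    · exact ⟨maxDepth T + 2 - (j + 1), by omega, hk.trans hk',
        Or.inl ⟨j + 1, y', hs', by omega, rfl, by rw [Nat.mul_succ]; omega⟩⟩
    · refine ⟨0, by omega, hk.trans hk', Or.inr ⟨h15, rfl, ?_, h12⟩⟩
      have := Nat.mul_le_mul_left (10 * maxDepth T + 32) hj
      rw [show maxDepth T + 2 = maxDepth T + 1 + 1 from rfl, Nat.mul_succ]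
      omega
  · rintro m t σ' ⟨hk, ⟨j, y, hs, hj, rfl, ht⟩ | ⟨h15, rfl, ht, h12⟩⟩ he
    · exact absurd (hs.r15.symm.trans (he.trans (hk.base hc.base).r3)) one_ne_zero
    · refine ⟨?_, hk, h12⟩
      rw [show maxDepth T + 3 = maxDepth T + 2 + 1 from rfl, Nat.mul_succ]
      omega

theorem wp_last (hw : n < 2 ^ w) (hw0 : 0 < w) (hadj : IsAdjacencyOrder r (L 0))
    (hc : LinkCore L 0 r s w σ ρ T u l F)
    (hX : Inv L σ.heads (maxDepth T) (σ.regs 10) ρ T ((u, l) :: F)) (hρ : ρ u = pre ++ c :: l)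
    (h11 : σ.regs 11 = c.val) :
    wp L w S last σ fun t σ' => t ≤ 13 * n + 20 ∧ Pure 12 0 σ σ' ∧
      σ'.regs 12 = if l = [] then 1 else 0 := by
  have h1w : 1 % 2 ^ w = 1 := Nat.mod_eq_of_lt (Nat.one_lt_two_pow hw0.ne')
  have hiff : ∀ z, z ∈ ρ u ↔ z ∈ L 0 u := fun z => hc.snap.mem_iff.trans ((hadj u).2 z).symm
  have hcL : c ∈ L 0 u := (hiff c).1 (by rw [hρ]; simp)
  refine (wp_minOf (v := u) hw hw0 hc.base hc.ok hc.r5 (hadj u).1 (List.ne_nil_of_mem hcL)).seq ?_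
  rintro t₁ σ₁ ⟨ht₁, hk₁', c', hc', hcm, h17⟩
  have hk₁ : Pure 12 0 σ σ₁ := (Pure.refl 12 0 σ).trans hk₁'
  have hlast : (ρ u).getLast? = some c' := by
    obtain ⟨d, hd⟩ : ∃ d, (ρ u).getLast? = some d :=
      ⟨_, List.getLast?_eq_some_getLast (by rw [hρ]; simp)⟩
    have h1 := hX.least u (by simp) d hd c' ((hiff c').2 hc')
    have h2 := hcm d ((hiff d).1 (List.mem_of_getLast? hd))
    rw [hd, le_antisymm h1 h2]
  have hnd : (c :: l).Nodup := by
    have := (hc.snap.order u).1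
    rw [hρ] at this
    exact (List.nodup_append.1 this).2.1
  have hcl := getLast?_append_cons_iff hnd (hρ ▸ hlast)
  have hn := length_le_of_nodup (hadj u).1
  have htest : Test.holds (σ₁.setReg w 12 0) (.eq 11 17) ↔ l = [] := by
    rw [← hcl]
    simp [Test.holds, h17, hk₁'.regs 11 (by decide), h11, Fin.val_inj]
  rw [wp_seq, wp_const, wp_ite, htest, wp_const, wp_skip]
  refine ⟨fun h => ⟨by omega, hk₁.setReg.setReg, by simp [h, h1w]⟩,
    fun h => ⟨by omega, hk₁.setReg, by simp [h]⟩⟩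

/-- Visiting a vertex takes time proportional to its degree. -/
def cost (L : Lists 2 n) (v : Fin n) (_ : Fin 2 → ℕ) (_ : List (Fin n)) : ℕ :=
  (L 0 v).length + (L 1 v).length + 1

theorem wp_enter (hw : n < 2 ^ w) (hw0 : 0 < w) (hadj : IsAdjacencyOrder r (L 0))
    (hadj' : IsAdjacencyOrder (fun v u => r u v) (L 1))
    (hc : LinkCore L 0 r s w σ ρ T u (x :: l) F)
    (hX : Inv L σ.heads (maxDepth T) (σ.regs 10) ρ T ((u, x :: l) :: F)) (h11 : σ.regs 11 = x.val)
    (hx : x ∉ visited T) :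
    wp L w S enter σ fun t σ' => (∀ r : Reg, r.val < 12 → r ≠ 5 → σ'.regs r = σ.regs r) ∧
      σ'.regs 5 = x.val ∧ σ'.out = σ.out ∧ σ'.HeadsOk L ∧
      (∀ v ∈ u :: verts F, σ'.view L 0 v = σ.view L 0 v) ∧
      Inv L σ'.heads (max (maxDepth T) (F.length + 1)) (σ.regs 10)
        (Function.update ρ x (σ'.view L 0 x)) (T ++ [(x, F.length + 1)])
        ((x, σ'.view L 0 x) :: (u, x :: l) :: F) ∧
      t ≤ 40 * ((L 0 x).length + (L 1 x).length + 1) := by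
  have hxF := hc.snap.not_mem_stack hx
  have hux : u ∈ L 1 x := by
    refine ((hadj' x).2 u).2 (hc.snap.mem_iff.1 ?_)
    obtain ⟨pre, h1, -⟩ := hc.snap.scanned _ List.mem_cons_self
    simp only at h1
    rw [h1]; simp
  obtain ⟨a, b, hab⟩ := List.append_of_mem ((mem_view (σ := σ)).2 hux)
  have hnd : (σ.view L 1 x).Nodup := nodup_view.2 (hadj' x).1
  have hlen : (σ.view L 1 x).length = (L 1 x).length := length_view
  rw [hab] at hnd hlen
  have hua : u ∉ a := fun hua => (List.nodup_append.1 hnd).2.2 u hua u (by simp) rfl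
  refine (wp_rotateUntil hw hc.ok h11 hc.r5 (by decide) (by decide) hab hua).seq ?_
  rintro t₁ σ₁ ⟨ht₁, hk₁, hok₁, hv₁, hoth₁⟩
  rw [wp_seq, wp_mov]
  have h5 : (σ₁.setReg w 5 (σ₁.regs 11)).regs 5 = x.val := by
    simp [hk₁.regs 11 (by decide), h11, val_mod hw]
  refine (wp_leastToEnd (v := x) hw hw0 ((base_setReg).2 (hk₁.base hc.base)) hok₁ h5 (hadj x).1).mono ?_
  rintro t₃ σ₃ ⟨ht₃, hk₃, hok₃, hoth₃, hlast⟩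
  have hv1 : σ₃.view L 1 x = u :: b ++ a := by rw [hoth₃ 1 x (by simp), view_setReg, hv₁]
  have hoth : ∀ j v, v ≠ x → σ₃.view L j v = σ.view L j v := fun j v hv => by
    rw [hoth₃ j v (by simp [hv]), view_setReg, hoth₁ j v (by simp [hv])]
  refine ⟨fun r hr hr5 => ?_, ?_, ?_, hok₃, fun v hv => hoth 0 v ?_, ?_, ?_⟩
  · rw [hk₃.regs r (by omega), regs_setReg, if_neg hr5, hk₁.regs r (by omega)]
  · rw [hk₃.regs 5 (by decide), h5]
  · rw [hk₃.out, out_setReg, hk₁.out]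
  · rintro rfl; exact hxF hv
  · constructor
    · exact hX.marker
    · have : F.length + 1 < n := by
        simpa using length_le_of_nodup (List.nodup_cons.2 ⟨hxF, hc.nodup⟩)
      have := hX.depth_lt
      omega
    · refine List.isChain_cons_cons.2 ⟨?_, hX.parents.congr fun v hv => ?_⟩
      · change (σ₃.view L 1 x).head? = some u
        rw [hv1]; rfl
      · exact congrArg List.head? (hoth 1 v (by rintro rfl; exact hxF hv))
    · exact hX.gated.push hx (le_max_left _ _) (by simp) fun v hv _ => hoth 1 v (by rintro rfl; exact hx hv)
    · intro v hv
      by_cases hvx : v = x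
      · subst hvx; simpa using hlast
      · rw [Function.update_of_ne hvx]
        exact hX.least v ((List.mem_cons.1 hv).resolve_left hvx)
  · simp only [List.length_append, List.length_cons] at hlen
    omega

theorem wp_leave (hw : n < 2 ^ w) (hc : LinkCore L 0 r s w σ ρ T u [] ((p, u :: l) :: F))
    (hX : Inv L σ.heads (maxDepth T) (σ.regs 10) ρ T ((u, []) :: (p, u :: l) :: F)) :
    wp L w S leave σ fun t σ' => t ≤ 2 ∧
      (∀ r : Reg, r.val < 12 → r ≠ 5 → σ'.regs r = σ.regs r) ∧
      σ'.regs 5 = p.val ∧ σ'.out = σ.out ∧ σ'.heads = σ.heads ∧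
      Inv L σ.heads (maxDepth T) (σ.regs 10) ρ T ((p, l) :: F) := by
  obtain ⟨hup, hpar⟩ := List.isChain_cons_cons.1 hX.parents
  obtain ⟨l', hl'⟩ := List.head?_eq_some_iff.1 hup
  refine wp_headOf hc.r5 hc.ok hl' fun q => ⟨le_rfl, fun r hr hr5 => by simp [hr5], ?_, rfl, rfl,
    hX.marker, hX.depth_lt, ParentHeads.top hpar, ?_, ?_⟩
  · simp [val_mod hw]
  · refine hX.gated.pop hc.mem hc.nodup ?_ hup (by simpa using hc.depth_le)
    obtain ⟨pre, h1, -⟩ := hc.snap.scanned (p, u :: l) (by simp)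
    have := (hc.snap.order p).1
    simp only at h1
    rw [h1] at this
    exact (List.nodup_cons.1 (List.nodup_append.1 this).2.1).1
  · exact fun v hv => hX.least v (List.mem_cons_of_mem _ hv)

/-- No vertex is completed at the beginning. -/
theorem wp_start (hw : n < 2 ^ w) (hw0 : 0 < w) (hadj : IsAdjacencyOrder r (L 0))
    (hb : Base s w σ) (h5 : σ.regs 5 = s.val) (hok : σ.HeadsOk L) :
    wp L w S (.prim (.const 10 0) ;; leastToEnd 0) σ fun t σ' =>
      (∀ r : Reg, r.val < 10 → σ'.regs r = σ.regs r) ∧ σ'.out = σ.out ∧ σ'.HeadsOk L ∧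
      Inv L σ'.heads 0 (σ'.regs 10) (Function.update (L 0) s (σ'.view L 0 s)) [(s, 0)]
        [(s, σ'.view L 0 s)] ∧ t ≤ 40 * ((L 0 s).length + (L 1 s).length + 1) := by
  rw [wp_seq, wp_const]
  refine (wp_leastToEnd (σ := σ.setReg w 10 0) (v := s) hw hw0 ((base_setReg).2 hb) hok
    (by simpa using h5) (hadj s).1).mono ?_
  rintro t₃ σ₃ ⟨ht₃, hk₃, hok₃, hoth₃, hlast⟩
  refine ⟨fun r hr => ?_, hk₃.out, hok₃, ⟨?_, s.pos, by simp [ParentHeads], ?_, ?_⟩, by omega⟩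
  · rw [hk₃.regs r (by omega), regs_setReg, if_neg]
    rintro rfl; revert hr; decide
  · rw [hk₃.regs 10 (by decide)]; simp
  · intro v hv hvF
    simp at hv hvF
    exact absurd hv hvF
  · intro v hv
    obtain rfl : v = s := by simpa using hv
    simpa using hlast

theorem linkSpec (hw : n < 2 ^ w) (hw0 : 0 < w) (hadj : IsAdjacencyOrder r (L 0))
    (hadj' : IsAdjacencyOrder (fun v u => r u v) (L 1)) :
    LinkSpec L 0 r s w S (.prim (.const 10 0) ;; leastToEnd 0) check last enter leave
      (Inv L) (fun D => 400 * (n + (D + 1) ^ 2)) (cost L) where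
  mono D D' h := by
    have := Nat.pow_le_pow_left (Nat.succ_le_succ h) 2
    simp only [Nat.succ_eq_add_one] at this ⊢
    exact Nat.mul_le_mul_left _ (by omega)
  le D := by nlinarith [Nat.zero_le n, Nat.zero_le D]
  rotate H H' D m ρ T u l F hX hH := by
    have h1 : viewOf L H' 1 = viewOf L H 1 := by
      funext v; rw [viewOf, viewOf, hH 1 v (by simp)]
    exact ⟨hX.marker, hX.depth_lt, hX.parents.congr fun v _ => by rw [h1], by rw [h1]; exact hX.gated,
      hX.least⟩
  skip H D m ρ T u x l F hX :=
    ⟨hX.marker, hX.depth_lt, hX.parents.top, hX.gated.skip, hX.least⟩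
  check σ ρ T u x l F hc hX h11 h9 := by
    refine (wp_check hw hw0 hadj hadj' hc h9 hX h11).mono fun t σ' h => ⟨h.1.trans ?_, h.2⟩
    nlinarith [Nat.zero_le n, Nat.zero_le (maxDepth T)]
  last σ ρ T u pre c l F hc hX hρ hv h11 := by
    refine (wp_last hw hw0 hadj hc hX hρ h11).mono fun t σ' h => ⟨h.1.trans ?_, h.2⟩
    nlinarith [Nat.zero_le n, Nat.zero_le (maxDepth T)]
  enter σ ρ T u x l F hc hX h11 _ hx := by
    refine (wp_enter hw hw0 hadj hadj' hc hX h11 hx).mono ?_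
    rintro t σ' ⟨h1, h2, h3, h4, h5, h6, h7⟩
    refine ⟨h1, h2, h3, h4, h5, h6, (L 0 x).length + (L 1 x).length + 1, ?_, ?_⟩
    · refine h7.trans (Nat.mul_le_mul_right _ ?_)
      nlinarith [Nat.zero_le n, Nat.zero_le (max (maxDepth T) (F.length + 1))]
    · have := sum_unvisited_push (fun v => (L 0 v).length + (L 1 v).length + 1) hx (F.length + 1)
      simp only [whitePotential, cost]
      omega
  leave σ ρ T u p l F hc hX _ := by
    refine (wp_leave hw hc hX).mono fun t σ' h => ⟨h.1.trans ?_, h.2⟩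
    nlinarith [Nat.zero_le n, Nat.zero_le (maxDepth T)]
  start σ hb h5 _ hok := by
    refine (wp_start hw hw0 hadj hb h5 hok).mono ?_
    rintro t σ' ⟨h1, h3, h4, h6, h7⟩
    refine ⟨h1, h3, h4, h6, (L 0 s).length + (L 1 s).length + 1, ?_, ?_⟩
    · exact h7.trans (Nat.mul_le_mul_right _ (by omega))
    · have := sum_unvisited_push (T := []) (x := s)
        (fun v => (L 0 v).length + (L 1 v).length + 1) (by simp) 0
      simp only [whitePotential, cost]
      simp only [List.nil_append] at this
      omega

end Directed

/-- If all vertices are reachable, then a DFS order of a directed graph is found with a constant number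
of words. -/
theorem outputs_link_directed {L : Lists 2 n} {r : Fin n → Fin n → Prop} (s : Fin n) {w : ℕ}
    (hw : n < 2 ^ w) (hw0 : 0 < w) (hadj : IsAdjacencyOrder r (L 0))
    (hadj' : IsAdjacencyOrder (fun v u => r u v) (L 1))
    (hreach : ∀ v, Relation.ReflTransGen r s v) :
    ∃ R t, IsAdjacencyOrder r R ∧
      Outputs (linkMain 0 (.prim (.const 10 0) ;; leastToEnd 0) Directed.check Directed.last
        Directed.enter Directed.leave).program L s w 0 t (dfsOrder R s) ∧
      t ≤ 400 * (n + (dfsDepth R s + 1) ^ 2) *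
        (7 * (∑ v, (L 0 v).length) + (∑ v, (L 1 v).length) + 10 * n + 1) := by
  obtain ⟨R, t, h1, h2, h3⟩ := outputs_linkMain hw hw0 hadj hreach
    (Directed.linkSpec (S := 0) hw hw0 hadj hadj')
  refine ⟨R, t, h1, h2, h3.trans (Nat.mul_le_mul_left _ ?_)⟩
  simp only [Directed.cost, Finset.sum_add_distrib, Finset.sum_const, Finset.card_univ,
    Fintype.card_fin, smul_eq_mul]
  omega

end Rotate

/-! ### Recognizing visited vertices of an undirected graph -/

namespace Rotate

open Store Dfs

variable {n : ℕ}

namespace Undirected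

/-- Follow the list heads from `r13` until the current vertex is reached, by at most `r7` steps. -/
def follow : Cmd 1 :=
  .prim (.const 14 0) ;; .prim (.const 12 1) ;; .prim (.const 15 1) ;;
  .loop (.eq 15 3)
    (.ite (.eq 13 5) (.prim (.const 12 0) ;; .prim (.const 15 0))
      (.ite (.lt 7 14) (.prim (.const 15 0)) (headOf 0 13 13 5 ;; .prim (.op .add 14 14 4))))

/-- If the neighbour `r11` of the current vertex is not on the stack, then it is completed if and only
if its list head does not point to the stack, but the list heads lead from there to the current
vertex. -/
def check : Cmd 1 :=
  climb 0 11 ;;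
  .ite (.eq 22 4) (.prim (.const 12 0))
    (headOf 0 13 11 5 ;; climb 0 13 ;; .ite (.eq 22 4) (.prim (.const 12 1)) follow)

/-- The list of a vertex on the stack ends with its parent, and the list of the source ends with `r10`.
-/
def last : Cmd 1 :=
  climb 0 11 ;; .prim (.const 12 0) ;; .ite (.eq 11 21) (.prim (.const 12 1)) .skip

/-- The list of a vertex on the stack ends with its parent. -/
def leave : Cmd 1 := mov 5 11

/-- The lists as seen from the heads `H`. -/
def viewOf (L : Lists 1 n) (H : Fin 1 → Fin n → ℕ) (v : Fin n) : List (Fin n) :=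
  (L 0 v).rotate (H 0 v)

/-- When the vertices in `V` are visited, the list of the unvisited vertex `y` may be rotated by `a`
nodes: this has brought it past visited vertices only, and it starts with an unvisited vertex if
possible. -/
structure Ready (L : Lists 1 n) (V : List (Fin n)) (a : ℕ) (y : Fin n) : Prop where
  passed : ∀ z ∈ (L 0 y).take a, z ∈ V
  blocked : ∀ z ∈ ((L 0 y).rotate a).head?, z ∈ V → ∀ z' ∈ L 0 y, z' ∈ V

/-- The list of a vertex on the stack ends with its parent, and the list of the source ends with `m`.
Every completed vertex `x` is linked to a vertex on the stack that is not below a neighbour of `x`. -/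
structure Inv (L : Lists 1 n) (r : Fin n → Fin n → Prop) (H : Fin 1 → Fin n → ℕ) (D m : ℕ)
    (ρ : Fin n → List (Fin n)) (T : List (Fin n × ℕ)) (F : List (Frame n)) : Prop where
  marker_lt : m < n
  depth_lt : D < n
  subset : ∀ v ∈ verts F, v ∈ visited T
  gated : Gated (viewOf L H) r D T F
  parents : (verts F).IsChain fun c p => (ρ c).getLast? = some p
  root : ∀ v ∈ (verts F).getLast?, ∀ c ∈ (ρ v).getLast?, c.val = m
  ready : ∀ y, y ∉ visited T → Ready L (visited T) (H 0 y) y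

variable {L : Lists 1 n} {r : Fin n → Fin n → Prop} {s u x y p c g : Fin n} {w S j : ℕ}
  {σ σ' : Store 1 n} {ρ : Fin n → List (Fin n)} {T : List (Fin n × ℕ)} {F : List (Frame n)}
  {l l' pre : List (Fin n)}

/-- After `j` steps, `follow` has come to `z`, on its way from the unvisited or completed neighbour `x`
of `u`. -/
def Following (L : Lists 1 n) (σ : Store 1 n) (T : List (Fin n × ℕ)) (F : List (Frame n)) (D : ℕ)
    (u x : Fin n) (j : ℕ) (z : Fin n) : Prop :=
  (x ∈ visited T ∧ (z = u ∨ ∃ k, Gate (σ.view L 0) T F k z u ∧ j + k ≤ D)) ∨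
    (x ∉ visited T ∧ z ∉ visited T ∧ L 0 z ≠ [] ∧
      ∀ v ∈ (σ.view L 0 z).head?, v ∉ visited T)

theorem Following.congr {D : ℕ} {z : Fin n} (hf : Following L σ T F D u x j z)
    (hh : σ'.heads = σ.heads) : Following L σ' T F D u x j z := by
  rw [Following, view_congr hh]; exact hf

/-- The list heads lead from an unvisited vertex that has an unvisited neighbour to unvisited vertices
only, by `Ready`, whereas they lead from a completed neighbour of `u` to `u`. -/
theorem wp_follow (hw : n < 2 ^ w) (hw0 : 0 < w) (hadj : IsAdjacencyOrder r (L 0))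
    (hsymm : ∀ u v, r u v → r v u) (hc : LinkCore L 0 r s w σ ρ T u l F)
    (hX : Inv L r σ.heads (maxDepth T) (σ.regs 10) ρ T ((u, l) :: F))
    (hz : Following L σ T ((u, l) :: F) (maxDepth T) u x 0 p) (h13 : σ.regs 13 = p.val) :
    wp L w S follow σ fun t σ' => t ≤ 9 * maxDepth T + 20 ∧ Pure 12 0 σ σ' ∧
      σ'.regs 12 = if x ∈ visited T then 0 else 1 := by
  have h1w : 1 % 2 ^ w = 1 := Nat.mod_eq_of_lt (Nat.one_lt_two_pow hw0.ne')
  have hDn := hX.depth_lt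
  have huT := hc.mem
  simp only [follow, wp_seq, wp_const]
  refine wp_loop (fun m t σ' => Pure 12 0 σ σ' ∧
    ((∃ j z, Following L σ' T ((u, l) :: F) (maxDepth T) u x j z ∧ σ'.regs 12 = 1 ∧
      σ'.regs 13 = z.val ∧ σ'.regs 14 = j ∧ σ'.regs 15 = 1 ∧
      j ≤ maxDepth T + 1 ∧ m = maxDepth T + 2 - j ∧ t ≤ 9 * j) ∨
    (σ'.regs 15 = 0 ∧ m = 0 ∧ t ≤ 9 * maxDepth T + 16 ∧
      σ'.regs 12 = if x ∈ visited T then 0 else 1))) (maxDepth T + 2) ?_ ?_ ?_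
  · exact ⟨(Pure.refl 12 0 σ).setReg.setReg.setReg, Or.inl ⟨0, p, hz.congr rfl, by simp [h1w],
      by simpa using h13, by simp, by simp [h1w], by omega, rfl, by simp⟩⟩
  · rintro m t σ' ⟨hk, ⟨j, z, hf, h12, h13, h14, h15, hj, rfl, ht⟩ | ⟨h15, -⟩⟩ hn
    swap
    · exact absurd (h15.trans (hk.base hc.base).r3.symm) hn
    have hc' := hc.of_pure hk
    simp only [wp_ite, Test.holds, h13, hc'.r5, hc'.r7, h14, Fin.val_inj]
    refine ⟨fun hzu => ?_, fun hzu => ⟨fun hD => ?_, fun hD => ?_⟩⟩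
    · simp only [wp_seq, wp_const]
      refine ⟨0, by omega, hk.setReg.setReg, Or.inr ⟨by simp, rfl, by omega, ?_⟩⟩
      rcases hf with ⟨hx, -⟩ | ⟨-, hzT, -⟩
      · simp [hx]
      · exact absurd (hzu ▸ huT) hzT
    · rw [wp_const]
      refine ⟨0, by omega, hk.setReg, Or.inr ⟨by simp, rfl, by omega, ?_⟩⟩
      rcases hf with ⟨hx, h | ⟨k, -, hk⟩⟩ | ⟨hx, -⟩
      · exact absurd h hzu
      · omega
      · simpa [hx] using h12
    · obtain ⟨v, lv, hv, hfv⟩ : ∃ v lv, σ'.view L 0 z = v :: lv ∧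
          Following L σ' T ((u, l) :: F) (maxDepth T) u x (j + 1) v := by
        rcases hf with ⟨hx, h | ⟨k, hk, hkj⟩⟩ | ⟨hx, hzT, hne, hv⟩
        · exact absurd h hzu
        · cases hk with
          | base hh hg hl =>
            obtain ⟨lv, hlv⟩ := List.head?_eq_some_iff.1 hh
            exact ⟨_, lv, hlv, Or.inl ⟨hx, Or.inl rfl⟩⟩
          | step hh hpT hpF hg =>
            obtain ⟨lv, hlv⟩ := List.head?_eq_some_iff.1 hh
            exact ⟨_, lv, hlv, Or.inl ⟨hx, Or.inr ⟨_, hg, by omega⟩⟩⟩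
        · obtain ⟨v, lv, hvl⟩ := List.exists_cons_of_ne_nil (mt (view_eq_nil (σ := σ')).1 hne)
          have hvT := hv v (by rw [hvl]; rfl)
          have hzv : z ∈ L 0 v := ((hadj v).2 z).2 (hsymm _ _ (((hadj z).2 v).1
            ((mem_view (σ := σ')).1 (by rw [hvl]; simp))))
          refine ⟨v, lv, hvl, Or.inr ⟨hx, hvT, List.ne_nil_of_mem hzv, fun v' hv' hvT' => hzT ?_⟩⟩
          refine (hX.ready v hvT).blocked v' ?_ hvT' z hzv
          have := hk.view (L := L)
          rw [this] at hv'
          exact hv'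
      refine wp_seq.2 (wp_headOf h13 hc'.ok hv fun q => ?_)
      rw [wp_op]
      refine ⟨maxDepth T + 2 - (j + 1), by omega, hk.setCursor.setReg.setReg, Or.inl ⟨j + 1, v,
        hfv.congr rfl, by simpa using h12, by simp [val_mod hw], ?_, by simpa using h15, by omega,
        rfl, by omega⟩⟩
      simp [BinOp.eval, h14, hc'.base.r4, Nat.mod_eq_of_lt (show j + 1 < 2 ^ w by omega)]
  · rintro m t σ' ⟨hk, ⟨j, z, -, -, -, -, h15, -⟩ | ⟨h15, rfl, ht, h12⟩⟩ he
    · exact absurd (h15.symm.trans (he.trans (hk.base hc.base).r3)) one_ne_zero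
    · exact ⟨by omega, hk, h12⟩

theorem wp_check (hw : n < 2 ^ w) (hw0 : 0 < w) (hadj : IsAdjacencyOrder r (L 0))
    (hsymm : ∀ u v, r u v → r v u) (hc : LinkCore L 0 r s w σ ρ T u (x :: l) F)
    (hX : Inv L r σ.heads (maxDepth T) (σ.regs 10) ρ T ((u, x :: l) :: F))
    (h11 : σ.regs 11 = x.val) :
    wp L w S check σ fun t σ' => t ≤ 29 * maxDepth T + 60 ∧ Pure 12 0 σ σ' ∧
      σ'.regs 12 = if x ∈ visited T then 0 else 1 := by
  have h1w : 1 % 2 ^ w = 1 := Nat.mod_eq_of_lt (Nat.one_lt_two_pow hw0.ne')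
  have hlen : (verts F).length ≤ maxDepth T := by simpa using hc.depth_le
  have hmw := hX.marker_lt.trans hw
  have hrux : r u x := by
    obtain ⟨pre, h1, -⟩ := hc.snap.scanned _ List.mem_cons_self
    simp only at h1
    exact hc.snap.mem_iff.1 (by rw [h1]; simp)
  have hux : u ∈ L 0 x := ((hadj x).2 u).2 (hsymm _ _ hrux)
  rw [check]
  refine (wp_climb hw hw0 hc.ok hc.base.r1 hc.r5 hmw h11 (by decide) hc.path).seq ?_
  rintro t₁ σ₁ ⟨ht₁, hk₁', h22, -⟩
  have hk₁ : Pure 12 0 σ σ₁ := (Pure.refl 12 0 σ).trans hk₁'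
  have hc₁ := hc.of_pure hk₁
  rw [wp_ite]
  simp only [Test.holds, h22, hc₁.base.r4]
  refine ⟨fun hmem => ?_, fun hmem => ?_⟩
  · have hxT : x ∈ visited T := by
      by_contra h
      exact absurd hmem (by
        rw [if_neg (show x ∉ u :: verts F from hc.snap.not_mem_stack h)]; exact zero_ne_one)
    rw [wp_const]
    exact ⟨by omega, hk₁.setReg, by simp [hxT]⟩
  have hxF : x ∉ verts ((u, x :: l) :: F) := fun h => hmem (if_pos h)
  obtain ⟨z, lz, hz⟩ := List.exists_cons_of_ne_nil
    (mt (view_eq_nil (σ := σ₁)).1 (List.ne_nil_of_mem hux))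
  refine wp_seq.2 (wp_headOf ((hk₁'.regs 11 (by decide)).trans h11) hc₁.ok hz fun q => ?_)
  set σ₂ := (σ₁.setCursor 5 q).setReg w 13 z with hσ₂
  have hk₂ : Pure 12 0 σ σ₂ := hk₁.setCursor.setReg
  have hc₂ := hc.of_pure hk₂
  have h13 : σ₂.regs 13 = z.val := by simp [hσ₂, val_mod hw]
  have hzσ : σ.view L 0 x = z :: lz := by rw [← hk₁.view]; exact hz
  refine (wp_climb hw hw0 hc₂.ok hc₂.base.r1 hc₂.r5 ?_ h13 (by decide) hc₂.path).seq ?_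
  · rwa [hk₂.regs 10 (by decide)]
  rintro t₃ σ₃ ⟨ht₃, hk₃', h22₃, -⟩
  have hk₃ : Pure 12 0 σ σ₃ := hk₂.trans hk₃'
  have hc₃ := hc.of_pure hk₃
  have hv₃ : σ₃.view L = σ.view L := hk₃.view
  rw [wp_ite]
  simp only [Test.holds, h22₃, hc₃.base.r4]
  -- a completed neighbour of `u` that has not been scanned is linked to `u` in at least two steps
  have hgate : x ∈ visited T → z ∉ verts ((u, x :: l) :: F) ∧ ∃ k,
      Gate (σ.view L 0) T ((u, x :: l) :: F) k z u ∧ k ≤ maxDepth T := by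
    intro hxT
    obtain ⟨k, g, π₁, π₂, hg, hπ, hkD, hq⟩ := hX.gated x hxT hxF
    obtain rfl : u = g := by
      cases π₁ with
      | nil => exact (List.cons.inj hπ).1
      | cons a π₁ =>
        obtain ⟨rfl, hπ'⟩ := List.cons.inj hπ
        have hnd := hc.nodup
        rw [show verts F = π₁ ++ g :: π₂ from hπ'] at hnd
        exact absurd (List.mem_append_right π₁ (hq u (by simp) (hsymm _ _ hrux)))
          (List.nodup_cons.1 hnd).1
    have hg' : Gate (σ.view L 0) T ((u, x :: l) :: F) k x u := hg
    cases hg' with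
    | base hh hg hl =>
      rcases List.mem_cons.1 hg with h | h
      · obtain ⟨-, rfl⟩ := Prod.mk.inj h
        exact absurd List.mem_cons_self hl
      · exact absurd (List.mem_map_of_mem (f := Prod.fst) h) (List.nodup_cons.1 hc.nodup).1
    | step hh hpT hpF hg =>
      rw [hzσ] at hh
      obtain rfl := Option.some.inj hh
      exact ⟨hpF, _, hg, by omega⟩
  refine ⟨fun hmem => ?_, fun hmem => ?_⟩
  · have hzF : z ∈ verts ((u, x :: l) :: F) := by
      by_contra h
      exact absurd hmem (by rw [if_neg (show z ∉ u :: verts F from h)]; exact zero_ne_one)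
    have hxT : x ∉ visited T := fun hxT => (hgate hxT).1 hzF
    rw [wp_const]
    exact ⟨by omega, hk₃.setReg, by simp [hxT, h1w]⟩
  · have hzF : z ∉ verts ((u, x :: l) :: F) := fun h => hmem (if_pos h)
    refine (wp_follow (x := x) (p := z) hw hw0 hadj hsymm hc₃ ?_ ?_ ?_).mono ?_
    · rw [hk₃.heads, hk₃.regs 10 (by decide)]; exact hX
    · rw [Following, hv₃]
      by_cases hxT : x ∈ visited T
      · obtain ⟨-, k, hk, hkD⟩ := hgate hxT
        exact Or.inl ⟨hxT, Or.inr ⟨k, hk, by omega⟩⟩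
      · have hxz : x ∈ L 0 z := ((hadj z).2 x).2 (hsymm _ _ (((hadj x).2 z).1
          ((mem_view (σ := σ)).1 (by rw [hzσ]; simp))))
        have hzT : z ∉ visited T := fun hzT =>
          hxT (hc.snap.closed z hzT hzF x (((hadj z).2 x).1 hxz))
        exact Or.inr ⟨hxT, hzT, List.ne_nil_of_mem hxz, fun v hv hvT =>
          hxT ((hX.ready z hzT).blocked v hv hvT x hxz)⟩
    · rw [hk₃'.regs 13 (by decide), h13]
    · rintro t₄ σ₄ ⟨ht₄, hk₄, h12⟩
      exact ⟨by omega, hk₃.trans hk₄, h12⟩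

theorem wp_last (hw : n < 2 ^ w) (hw0 : 0 < w) (hc : LinkCore L 0 r s w σ ρ T u l F)
    (hX : Inv L r σ.heads (maxDepth T) (σ.regs 10) ρ T ((u, l) :: F)) (hρ : ρ u = pre ++ c :: l)
    (h11 : σ.regs 11 = c.val) :
    wp L w S last σ fun t σ' => t ≤ 10 * maxDepth T + 20 ∧ Pure 12 0 σ σ' ∧
      σ'.regs 12 = if l = [] then 1 else 0 := by
  have h1w : 1 % 2 ^ w = 1 := Nat.mod_eq_of_lt (Nat.one_lt_two_pow hw0.ne')
  have hlen : (verts F).length ≤ maxDepth T := by simpa using hc.depth_le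
  rw [last]
  refine (wp_climb hw hw0 hc.ok hc.base.r1 hc.r5 (hX.marker_lt.trans hw) h11 (by decide)
    hc.path).seq ?_
  rintro t₁ σ₁ ⟨ht₁, hk₁', -, h21⟩
  have hk₁ : Pure 12 0 σ σ₁ := (Pure.refl 12 0 σ).trans hk₁'
  obtain ⟨c', hc', h21'⟩ : ∃ c', (ρ u).getLast? = some c' ∧ σ₁.regs 21 = c'.val := by
    cases F with
    | nil =>
      have hne : ρ u ≠ [] := by rw [hρ]; simp
      refine ⟨_, List.getLast?_eq_some_getLast hne, ?_⟩
      rw [h21, hX.root u (by simp) _ (List.getLast?_eq_some_getLast hne)]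
      rfl
    | cons f F => exact ⟨f.1, (List.isChain_cons_cons.1 hX.parents).1, by rw [h21]; rfl⟩
  have hnd : (c :: l).Nodup := by
    have := (hc.snap.order u).1
    rw [hρ] at this
    exact (List.nodup_append.1 this).2.1
  have hcl := getLast?_append_cons_iff hnd (hρ ▸ hc')
  have htest : Test.holds (σ₁.setReg w 12 0) (.eq 11 21) ↔ l = [] := by
    rw [← hcl]
    simp [Test.holds, h21', hk₁'.regs 11 (by decide), h11, Fin.val_inj]
  rw [wp_seq, wp_const, wp_ite, htest, wp_const, wp_skip]
  exact ⟨fun h => ⟨by omega, hk₁.setReg.setReg, by simp [h, h1w]⟩,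
    fun h => ⟨by omega, hk₁.setReg, by simp [h]⟩⟩

theorem wp_leave (hw : n < 2 ^ w) (hc : LinkCore L 0 r s w σ ρ T u [] ((p, u :: l) :: F))
    (hX : Inv L r σ.heads (maxDepth T) (σ.regs 10) ρ T ((u, []) :: (p, u :: l) :: F))
    (hend : σ.view L 0 u = [] ∨ ∃ c, c ∈ (ρ u).getLast? ∧ σ.regs 11 = c.val) :
    wp L w S leave σ fun t σ' => t ≤ 1 ∧
      (∀ r : Reg, r.val < 12 → r ≠ 5 → σ'.regs r = σ.regs r) ∧
      σ'.regs 5 = p.val ∧ σ'.out = σ.out ∧ σ'.heads = σ.heads ∧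
      Inv L r σ.heads (maxDepth T) (σ.regs 10) ρ T ((p, l) :: F) := by
  obtain ⟨hup, hpar⟩ := List.isChain_cons_cons.1 hX.parents
  have hpu : p ∈ ρ u := List.mem_of_getLast? hup
  -- the parent is the last vertex in the list, and this vertex has been scanned last
  have hhead : (σ.view L 0 u).head? = some p := by
    rcases hc.top with ⟨-, pre, h1, -, h2⟩ | ⟨-, pre, c, -, h1, h2⟩
    · rw [h1, h2 rfl] at hpu
      simp at hpu
    · rw [h1] at hup
      have : c = p := by simpa using hup
      rw [h2, this]; rfl
  have h11 : σ.regs 11 = p.val := by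
    rcases hend with h | ⟨c, hcl, h⟩
    · rw [h] at hhead; simp at hhead
    · have hup' : (ρ u).getLast? = some p := hup
      rw [hup'] at hcl
      rw [h, Option.some.inj hcl]
  rw [leave, wp_mov]
  refine ⟨le_rfl, fun r hr hr5 => by simp [hr5], by simp [h11, val_mod hw], rfl, rfl,
    hX.marker_lt, hX.depth_lt, fun v hv => hX.subset v (List.mem_cons_of_mem _ hv), ?_, hpar, ?_,
    hX.ready⟩
  · refine hX.gated.pop hc.mem hc.nodup ?_ hhead (by simpa using hc.depth_le)
    obtain ⟨pre, h1, -⟩ := hc.snap.scanned (p, u :: l) (by simp)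
    have := (hc.snap.order p).1
    simp only at h1
    rw [h1] at this
    exact (List.nodup_cons.1 (List.nodup_append.1 this).2.1).1
  · intro v hv
    refine hX.root v ?_
    simp only [verts, List.map_cons, List.getLast?_cons_cons] at hv ⊢
    exact hv

end Undirected
end Rotate

/-! ### Space-efficient DFS of undirected graphs -/

namespace Rotate

open Store Dfs

variable {n : ℕ}

theorem succPos_eq_mod {α : Type} {l : List α} {p : ℕ} (hp : p < l.length) :
    succPos l p = (p + 1) % l.length := by
  rw [succPos]
  split
  · rw [Nat.mod_eq_of_lt ‹_›]
  · rw [show p + 1 = l.length by omega, Nat.mod_self]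

/-- If the entries of a list are distinct, then its sequence as seen from the head determines the
head. -/
theorem Store.heads_eq_of_view {h : ℕ} {L : Lists h n} {σ σ' : Store h n} {i : Fin h} {v : Fin n}
    (hσ : σ.HeadsOk L) (hσ' : σ'.HeadsOk L) (hnd : (L i v).Nodup)
    (hv : σ'.view L i v = σ.view L i v) : σ'.heads i v = σ.heads i v := by
  rcases eq_or_ne (L i v) [] with h0 | h0
  · have h1 := hσ i v
    have h2 := hσ' i v
    simp [h0] at h1 h2
    rw [h1, h2]
  · have hpos := List.length_pos_of_ne_nil h0
    have h1 := hσ i v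
    have h2 := hσ' i v
    have := (hnd.rotate_congr_iff.1 hv).resolve_right h0
    rwa [Nat.mod_eq_of_lt (by omega), Nat.mod_eq_of_lt (by omega)] at this

theorem Path.congr {A A' : Fin n → List (Fin n)} {s : Fin n} {P : List (Fin n)} (hP : Path A s P)
    (hA : ∀ v ∈ P, A' v = A v) : Path A' s P where
  chain := by
    have hch := hP.chain
    clear hP
    induction P with
    | nil => simp
    | cons c P ih =>
      cases P with
      | nil => simp
      | cons p P =>
        rw [List.isChain_cons_cons] at hch ⊢
        exact ⟨by rw [hA p (by simp)]; exact hch.1, ih (fun v hv => hA v (List.mem_cons_of_mem _ hv))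
          hch.2⟩
  last := hP.last
  nodup := hP.nodup

/-- The list of a vertex on a path starts with the vertex before it. -/
theorem Path.head?_mem {A : Fin n → List (Fin n)} {s u v : Fin n} {P : List (Fin n)}
    (hP : Path A s (u :: P)) (hv : v ∈ P) : ∃ c ∈ u :: P, (A v).head? = some c := by
  have hch := hP.chain
  clear hP
  induction P generalizing u with
  | nil => simp at hv
  | cons p P ih =>
    obtain ⟨h1, h2⟩ := List.isChain_cons_cons.1 hch
    rcases List.mem_cons.1 hv with rfl | hv
    · exact ⟨u, by simp, h1⟩
    · obtain ⟨c, hc, h⟩ := ih hv h2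
      exact ⟨c, List.mem_cons_of_mem _ hc, h⟩

namespace Undirected

/-- Rotate the list of `r13` until its head is not on the stack, or is the current vertex again. -/
def turn : Cmd 1 :=
  .prim (.const 15 1) ;;
  .loop (.eq 15 3)
    (.prim (.rotate 0 13) ;; headOf 0 18 13 7 ;;
      .ite (.eq 18 5) (.prim (.const 15 0))
        (climb 0 18 ;; .ite (.eq 22 4) .skip (.prim (.const 15 0))))

/-- If the list of `r13` starts with the current vertex, then rotate it, unless `r13` is the parent
`r14`. -/
def settle : Cmd 1 :=
  .ite (.eq 13 14) .skip (headOf 0 18 13 7 ;; .ite (.eq 18 5) turn .skip)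

/-- Take account of the fact that the current vertex is now visited, in the lists of its neighbours. -/
def settleAll : Cmd 1 :=
  headOf 0 12 5 5 ;; .prim (.const 21 0) ;;
  .loop (.eq 21 4) (.prim (.read 13 5) ;; settle ;; advance 5 12)

/-- Rotate the list of the new vertex `r11` such that it ends with the parent `r5`, and make `r11` the
current vertex. -/
def enter : Cmd 1 :=
  mov 14 5 ;; rotateUntil 0 11 5 ;; mov 5 11 ;; .prim (.rotate 0 5) ;; settleAll

/-- Store in `r10` the vertex at the head of the list of the source, and move it to the end of the list.
The source has no parent; the value `n` of `r14` is no vertex. -/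
def start : Cmd 1 :=
  .prim (.const 10 0) ;; .prim (.front 5 0 5) ;;
  .ite (.null 5) .skip (.prim (.read 10 5) ;; .prim (.rotate 0 5) ;; mov 14 0 ;; settleAll)

/-- This potential pays for the rotations of the list of the unvisited vertex `y`, the head of which is
at position `a`.  The head moves forward, except that it makes a full turn once, when the last neighbour
of `y` is visited. -/
def potential (L : Lists 1 n) (V : List (Fin n)) (a : ℕ) (y : Fin n) : ℕ :=
  ((L 0 y).length - a) + if ∀ z ∈ L 0 y, z ∈ V then 0 else (L 0 y).length

section ready

variable {L : Lists 1 n} {V V' : List (Fin n)} {a k : ℕ} {x y : Fin n}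

theorem potential_mono (hV : ∀ v ∈ V, v ∈ V') : potential L V' a y ≤ potential L V a y := by
  rw [potential, potential]
  by_cases h : ∀ z ∈ L 0 y, z ∈ V
  · rw [if_pos h, if_pos fun z hz => hV z (h z hz)]
  · rw [if_neg h]
    split <;> omega

/-- The list of `y` need not be rotated unless it starts with the new vertex `x`. -/
theorem Ready.of_head?_ne (hr : Ready L V a y) (hV : ∀ v, v ∈ V' ↔ v ∈ V ∨ v = x)
    (hx : ((L 0 y).rotate a).head? ≠ some x) : Ready L V' a y where
  passed z hz := (hV z).2 (Or.inl (hr.passed z hz))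
  blocked z hz hzV z' hz' := by
    refine (hV z').2 (Or.inl (hr.blocked z hz (((hV z).1 hzV).resolve_right ?_) z' hz'))
    rintro rfl
    exact hx hz

/-- The list of `y` starts with the new vertex `x`, and is rotated past visited vertices, until it
starts with an unvisited vertex or has made a full turn. -/
theorem Ready.turn (hr : Ready L V a y) (hV : ∀ v, v ∈ V' ↔ v ∈ V ∨ v = x) (hxV : x ∉ V)
    (ha : a < (L 0 y).length) (hx : ((L 0 y).rotate a).head? = some x) (hk : 0 < k)
    (hkl : k ≤ (L 0 y).length) (hd : ∀ z ∈ ((L 0 y).rotate a).take k, z ∈ V')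
    (he : k < (L 0 y).length → ∀ z ∈ ((L 0 y).rotate a)[k]?, z ∉ V') :
    Ready L V' ((a + k) % (L 0 y).length) y ∧
      k + potential L V' ((a + k) % (L 0 y).length) y ≤ potential L V a y := by
  have hxL : x ∈ L 0 y := List.mem_rotate.1 (List.mem_of_mem_head? hx)
  have hnot : ¬ ∀ z ∈ L 0 y, z ∈ V := fun h => hxV (h x hxL)
  have hrot : (L 0 y).rotate a = (L 0 y).drop a ++ (L 0 y).take a :=
    List.rotate_eq_drop_append_take ha.le
  rcases hkl.lt_or_eq with hkl | rfl
  · obtain ⟨z, hz⟩ : ∃ z, ((L 0 y).rotate a)[k]? = some z :=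
      ⟨_, List.getElem?_eq_getElem (by simpa using hkl)⟩
    have hzV := he hkl z hz
    have hzL : z ∈ L 0 y := List.mem_rotate.1 (List.mem_of_getElem? hz)
    -- the head does not pass the end of the list, since the vertices before `a` are visited
    have hak : a + k < (L 0 y).length := by
      by_contra hak
      rw [hrot, List.getElem?_append_right (by simp; omega)] at hz
      exact hzV ((hV z).2 (Or.inl (hr.passed z (List.mem_of_getElem? hz))))
    rw [Nat.mod_eq_of_lt hak]
    refine ⟨⟨fun z' hz' => ?_, fun z' hz' hz'V => ?_⟩, ?_⟩
    · rw [List.take_add, List.mem_append] at hz'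
      rcases hz' with h | h
      · exact (hV z').2 (Or.inl (hr.passed z' h))
      · refine hd z' ?_
        rw [hrot, List.take_append_of_le_length (by simp; omega)]
        exact h
    · rw [← List.rotate_rotate, List.head?_rotate (by simpa using hkl), hz] at hz'
      exact absurd (Option.some.inj hz' ▸ hz'V) hzV
    · rw [potential, potential, if_neg hnot, if_neg fun h => hzV (h z hzL)]
      omega
  · have hall : ∀ z ∈ L 0 y, z ∈ V' := fun z hz => hd z (by
      rw [List.take_of_length_le (by simp)]; exact List.mem_rotate.2 hz)
    rw [Nat.add_mod_right, Nat.mod_eq_of_lt ha]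
    refine ⟨⟨fun z hz => hall z (List.mem_of_mem_take hz), fun _ _ _ => hall⟩, ?_⟩
    rw [potential, potential, if_neg hnot, if_pos hall]
    omega

end ready

variable {L : Lists 1 n} {r : Fin n → Fin n → Prop} {s u x y : Fin n} {w S : ℕ}
  {σ σ' : Store 1 n} {P V V' : List (Fin n)}

theorem wp_turn (hw : n < 2 ^ w) (hw0 : 0 < w) (hb : Base s w σ) (hσ : σ.HeadsOk L)
    (hnd : (L 0 y).Nodup) (h5 : σ.regs 5 = x.val) (h10 : σ.regs 10 < 2 ^ w)
    (h13 : σ.regs 13 = y.val) (hP : Path (σ.view L 0) s (x :: P)) (hy : y ∉ x :: P)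
    (hx : (σ.view L 0 y).head? = some x) :
    wp L w S turn σ fun t σ' => Keeps 15 6 σ σ' ∧ σ'.HeadsOk L ∧
      (∀ v, v ≠ y → σ'.heads 0 v = σ.heads 0 v) ∧ ∃ k, 0 < k ∧ k ≤ (L 0 y).length ∧
        t ≤ (10 * P.length + 30) * k + 2 ∧
        σ'.heads 0 y = (σ.heads 0 y + k) % (L 0 y).length ∧
        (∀ z ∈ (σ.view L 0 y).take k, z ∈ x :: P) ∧
        (k < (L 0 y).length → ∀ z ∈ (σ.view L 0 y)[k]?, z ∉ x :: P) := by
  have h1w : 1 % 2 ^ w = 1 := Nat.mod_eq_of_lt (Nat.one_lt_two_pow hw0.ne')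
  have hlen : (σ.view L 0 y).length = (L 0 y).length := length_view
  have hnd' : (σ.view L 0 y).Nodup := nodup_view.2 hnd
  obtain ⟨lx, hlx⟩ := List.head?_eq_some_iff.1 hx
  have hpos : 0 < (L 0 y).length := by rw [← hlen, hlx]; simp
  have ha : σ.heads 0 y < (L 0 y).length := by have := hσ 0 y; omega
  rw [turn, wp_seq, wp_const]
  refine wp_loop (fun m t σ' => Keeps 15 6 σ σ' ∧ σ'.HeadsOk L ∧
    (∀ v, v ≠ y → σ'.heads 0 v = σ.heads 0 v) ∧ ∃ k ≤ (L 0 y).length,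
      σ'.heads 0 y = (σ.heads 0 y + k) % (L 0 y).length ∧
      (∀ z ∈ (σ.view L 0 y).take k, z ∈ x :: P) ∧ t ≤ (10 * P.length + 30) * k ∧
      ((σ'.regs 15 = 1 ∧ m = (L 0 y).length - k ∧ k < (L 0 y).length ∧
        ∀ z ∈ (σ.view L 0 y)[k]?, z ∈ x :: P) ∨
      (σ'.regs 15 = 0 ∧ m = 0 ∧ 0 < k ∧
        (k < (L 0 y).length → ∀ z ∈ (σ.view L 0 y)[k]?, z ∉ x :: P)))) (L 0 y).length ?_ ?_ ?_
  · exact ⟨(Keeps.refl 15 6 σ).setReg, hσ, fun _ _ => rfl, 0, Nat.zero_le _,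
      by simp [Nat.mod_eq_of_lt ha], by simp, by simp,
      Or.inl ⟨by simp [h1w], rfl, hpos, by simp [hlx]⟩⟩
  · rintro m t σ₁ ⟨hk₁, hok₁, hoth, k, -, hh, hd, ht, ⟨h15, rfl, hkl, hin⟩ | ⟨h15, -⟩⟩ hn
    swap
    · exact absurd (h15.trans (hk₁.base hb).r3.symm) hn
    set σ₂ := σ₁.rot L 0 y with hσ₂
    have hk₂ : Keeps 15 6 σ σ₂ := hk₁.rot
    have hok₂ : σ₂.HeadsOk L := hok₁.rot
    have hh₂ : σ₂.heads 0 y = (σ.heads 0 y + (k + 1)) % (L 0 y).length := by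
      rw [hσ₂, heads_rot]
      simp only [Function.update_self]
      rw [succPos_eq_mod (by rw [hh]; exact Nat.mod_lt _ hpos), hh, Nat.mod_add_mod, add_assoc]
    have hoth₂ : ∀ v, v ≠ y → σ₂.heads 0 v = σ.heads 0 v := fun v hv => by
      rw [hσ₂, heads_rot]; simp [hv, hoth v hv]
    have hv₂ : σ₂.view L 0 y = (σ.view L 0 y).rotate (k + 1) := by
      rw [view, hh₂, List.rotate_mod, view, List.rotate_rotate]
    have hd₂ : ∀ z ∈ (σ.view L 0 y).take (k + 1), z ∈ x :: P := by
      intro z hz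
      rw [List.take_add_one, List.mem_append] at hz
      rcases hz with hz | hz
      · exact hd z hz
      · exact hin z (by simpa using hz)
    have h13₂ : σ₂.regs 13 = y.val := (hk₂.regs 13 (by decide)).trans h13
    have h5₂ : σ₂.regs 5 = x.val := (hk₂.regs 5 (by decide)).trans h5
    refine wp_seq.2 ((wp_rotate (v := y) ((hk₁.regs 13 (by decide)).trans h13)).2 ?_)
    obtain ⟨z, lz, hz⟩ := List.exists_cons_of_ne_nil
      (mt (view_eq_nil (σ := σ₂)).1 (List.ne_nil_of_length_pos hpos))
    refine wp_seq.2 (wp_headOf h13₂ hok₂ hz fun q => ?_)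
    have htest : Test.holds ((σ₂.setCursor 7 q).setReg w 18 z) (.eq 18 5) ↔ z = x := by
      simp [Test.holds, h5₂, val_mod hw, Fin.val_inj]
    have hk₃ : Keeps 15 6 σ ((σ₂.setCursor 7 q).setReg w 18 z) := hk₂.setCursor.setReg
    rw [wp_ite, htest]
    refine ⟨fun hzx => ?_, fun hzx => ?_⟩
    · -- a full turn
      have hkl' : k + 1 = (L 0 y).length := by
        by_contra hne
        have h1 : ((σ.view L 0 y).rotate (k + 1)).head? = some z := by rw [← hv₂, hz]; rfl
        rw [List.head?_rotate (by omega), hzx] at h1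
        have h0 : (σ.view L 0 y)[0]? = some x := by rw [hlx]; rfl
        have := (List.getElem?_inj (by omega) hnd').1 (h0.trans h1.symm)
        omega
      rw [wp_const]
      exact ⟨0, by omega, hk₃.setReg, hok₂, hoth₂, k + 1, by omega, hh₂, hd₂,
        by rw [Nat.mul_succ]; omega, Or.inr ⟨by simp, rfl, by omega, fun h => by omega⟩⟩
    · have hkl' : k + 1 < (L 0 y).length := by
        refine lt_of_le_of_ne hkl fun he => hzx ?_
        have h1 : ((σ.view L 0 y).rotate (k + 1)).head? = some z := by rw [← hv₂, hz]; rfl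
        rw [he, ← hlen, List.rotate_length, hx] at h1
        exact (Option.some.inj h1).symm
      have hzk : (σ.view L 0 y)[k + 1]? = some z := by
        rw [← List.head?_rotate (by omega), ← hv₂, hz]; rfl
      refine (wp_climb (σ := (σ₂.setCursor 7 q).setReg w 18 z) (y := z) (a := 18) hw hw0 hok₂
        ((hk₃.base hb).r1) (by simpa using h5₂) ?_
        (by simp [val_mod hw]) (by decide) (hP.congr fun v hv => ?_)).seq ?_
      · rw [hk₃.regs 10 (by decide)]; exact h10
      · have hvy : v ≠ y := by rintro rfl; exact hy hv
        rw [view_setReg, view_setCursor, view, view, hoth₂ v hvy]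
      rintro t₄ σ₄ ⟨ht₄, hk₄', h22, -⟩
      have hk₄ : Keeps 15 6 σ σ₄ := hk₃.trans hk₄'.toKeeps
      have hh₄ : σ₄.heads = σ₂.heads := hk₄'.heads
      have htest₄ : Test.holds σ₄ (.eq 22 4) ↔ z ∈ x :: P := by
        rw [Test.holds, h22, (hk₄.base hb).r4]
        split <;> simp_all
      rw [wp_ite, htest₄, wp_skip, wp_const]
      refine ⟨fun hmem => ?_, fun hmem => ?_⟩
      · refine ⟨(L 0 y).length - (k + 1), by omega, hk₄, hok₂.congr hh₄, fun v hv => by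
          rw [hh₄, hoth₂ v hv], k + 1, by omega, by rw [hh₄, hh₂], hd₂, by rw [Nat.mul_succ]; omega,
          Or.inl ⟨?_, rfl, hkl', ?_⟩⟩
        · rw [hk₄'.regs 15 (by decide)]; simpa [hσ₂] using h15
        · intro z' hz'
          rw [hzk] at hz'
          exact Option.some.inj hz' ▸ hmem
      · refine ⟨0, by omega, hk₄.setReg, hok₂.congr hh₄, fun v hv => by
          rw [heads_setReg, hh₄, hoth₂ v hv], k + 1, by omega, by rw [heads_setReg, hh₄, hh₂], hd₂,
          by rw [Nat.mul_succ]; omega, Or.inr ⟨by simp, rfl, by omega, fun _ z' hz' => ?_⟩⟩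
        rw [hzk] at hz'
        exact Option.some.inj hz' ▸ hmem
  · rintro m t σ₁ ⟨hk₁, hok₁, hoth, k, hkl, hh, hd, ht, ⟨h15, -⟩ | ⟨h15, rfl, hk, he⟩⟩ hex
    · exact absurd (h15.symm.trans (hex.trans (hk₁.base hb).r3)) one_ne_zero
    · exact ⟨hk₁, hok₁, hoth, k, hk, hkl, by omega, hh, hd, he⟩

/-- The vertices in `V'` are visited, the current vertex `x` being the last one; `P` is the rest of the
stack.  Only the lists of vertices on the stack that are neighbours of `x` may start with `x`. -/
structure Entered (L : Lists 1 n) (s : Fin n) (w : ℕ) (x : Fin n) (P V V' : List (Fin n))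
    (σ : Store 1 n) : Prop where
  base : Base s w σ
  r5 : σ.regs 5 = x.val
  r10 : σ.regs 10 < 2 ^ w
  nodup : ∀ v, (L 0 v).Nodup
  path : Path (σ.view L 0) s (x :: P)
  mem_iff : ∀ v, v ∈ V' ↔ v ∈ V ∨ v = x
  not_mem : x ∉ V
  subset : ∀ v ∈ x :: P, v ∈ V'
  gray : ∀ v, v ∉ V' → ∀ z ∈ L 0 v, z ∈ V' → z ∈ x :: P
  white : ∀ v ∈ L 0 x, v.val ≠ σ.regs 14 → (σ.view L 0 v).head? = some x → v ∉ V'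
  parent : ∀ v, v ∉ V' → v.val ≠ σ.regs 14
  symm : ∀ v, x ∈ L 0 v → v ∈ L 0 x

theorem Entered.congr (he : Entered L s w x P V V' σ) (hk : Keeps 15 0 σ σ')
    (hh : ∀ v ∈ V', σ'.heads 0 v = σ.heads 0 v) : Entered L s w x P V V' σ' where
  base := hk.base he.base
  r5 := (hk.regs 5 (by decide)).trans he.r5
  r10 := by rw [hk.regs 10 (by decide)]; exact he.r10
  nodup := he.nodup
  path := he.path.congr fun v hv => by rw [view, view, hh v (he.subset v hv)]
  mem_iff := he.mem_iff
  not_mem := he.not_mem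
  subset := he.subset
  gray := he.gray
  white v hv h14 hx hvV := by
    refine he.white v hv ?_ ?_ hvV
    · rwa [hk.regs 14 (by decide)] at h14
    · rwa [view, hh v hvV] at hx
  parent v hv := by rw [hk.regs 14 (by decide)]; exact he.parent v hv
  symm := he.symm

theorem wp_settle (hw : n < 2 ^ w) (hw0 : 0 < w) (he : Entered L s w x P V V' σ)
    (hσ : σ.HeadsOk L) (h13 : σ.regs 13 = y.val) (hyx : y ∈ L 0 x) (hxy : x ∈ L 0 y)
    (hr : y ∉ V' → Ready L V (σ.heads 0 y) y) :
    wp L w S settle σ fun t σ' => Keeps 15 6 σ σ' ∧ σ'.HeadsOk L ∧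
      (∀ v, v ≠ y ∨ y ∈ V' → σ'.heads 0 v = σ.heads 0 v) ∧
      (y ∉ V' → Ready L V' (σ'.heads 0 y) y) ∧ ∃ k, t ≤ (10 * P.length + 30) * k + 10 ∧
        (y ∈ V' → k = 0) ∧
        (y ∉ V' → k + potential L V' (σ'.heads 0 y) y ≤ potential L V (σ.heads 0 y) y) := by
  have hmono : ∀ v ∈ V, v ∈ V' := fun v hv => (he.mem_iff v).2 (Or.inl hv)
  obtain ⟨z, lz, hz⟩ := List.exists_cons_of_ne_nil
    (mt (view_eq_nil (σ := σ)).1 (List.ne_nil_of_mem hxy))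
  rw [settle, wp_ite, wp_skip]
  simp only [Test.holds, h13]
  refine ⟨fun h14 => ?_, fun h14 => ?_⟩
  · have hyV : y ∈ V' := by
      by_contra h
      exact he.parent y h h14
    exact ⟨Keeps.refl 15 6 σ, hσ, fun _ _ => trivial, fun h => absurd hyV h, 0, by omega,
      fun _ => rfl, fun h => absurd hyV h⟩
  refine wp_seq.2 (wp_headOf h13 hσ hz fun q => ?_)
  set σ₁ := (σ.setCursor 7 q).setReg w 18 z with hσ₁
  have hk₁ : Keeps 15 6 σ σ₁ := (Keeps.refl 15 6 σ).setCursor.setReg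
  have htest : Test.holds σ₁ (.eq 18 5) ↔ z = x := by
    simp [hσ₁, Test.holds, he.r5, val_mod hw, Fin.val_inj]
  rw [wp_ite, htest, wp_skip]
  refine ⟨fun hzx => ?_, fun hzx => ?_⟩
  · have hhead : (σ.view L 0 y).head? = some x := by rw [hz, hzx]; rfl
    have hyV : y ∉ V' := he.white y hyx h14 hhead
    have he₁ : Entered L s w x P V V' σ₁ := he.congr hk₁.mono fun _ _ => rfl
    refine (wp_turn hw hw0 he₁.base hσ (he.nodup y) he₁.r5 he₁.r10
      ((hk₁.regs 13 (by decide)).trans h13) he₁.path (fun h => hyV (he.subset y h)) hhead).mono ?_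
    rintro t σ₂ ⟨hk₂, hok₂, hoth, k, hk, hkl, ht, hh, hd, hex⟩
    have ha : σ.heads 0 y < (L 0 y).length := by
      have := hσ 0 y
      have := List.length_pos_of_mem hxy
      omega
    obtain ⟨h1, h2⟩ := (hr hyV).turn he.mem_iff he.not_mem ha hhead hk hkl
      (fun z hz => he.subset z (hd z hz)) fun hkl z hz hzV => hex hkl z hz
        (he.gray y hyV z (List.mem_rotate.1 (List.mem_of_getElem? hz)) hzV)
    refine ⟨hk₁.trans hk₂, hok₂, fun v hv => hoth v (hv.resolve_right hyV), fun _ => ?_, k,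
      by omega, fun h => absurd h hyV, fun _ => ?_⟩
    · rw [hh]; exact h1
    · rw [hh]; exact h2
  · have hne : (σ.view L 0 y).head? ≠ some x := by rw [hz]; simpa using hzx
    exact ⟨hk₁, hσ, fun _ _ => rfl, fun h => (hr h).of_head?_ne he.mem_iff hne, 0, by omega,
      fun _ => rfl, fun _ => by rw [Nat.zero_add]; exact potential_mono hmono⟩

/-- Changing one summand. -/
theorem sum_add_le {f g : Fin n → ℕ} {k : ℕ} (y : Fin n) (h : ∀ v, v ≠ y → f v ≤ g v)
    (hy : k + f y ≤ g y) : k + ∑ v, f v ≤ ∑ v, g v := by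
  rw [← Finset.add_sum_erase _ _ (Finset.mem_univ y), ← Finset.add_sum_erase _ _ (Finset.mem_univ y)]
  have := Finset.sum_le_sum (s := Finset.univ.erase y) fun v hv => h v (Finset.ne_of_mem_erase hv)
  omega

theorem wp_settleAll (hw : n < 2 ^ w) (hw0 : 0 < w) (he : Entered L s w x P V V' σ)
    (hσ : σ.HeadsOk L) (hsymm : ∀ v, v ∈ L 0 x → x ∈ L 0 v) (hne : L 0 x ≠ [])
    (hr : ∀ y, y ∉ V' → Ready L V (σ.heads 0 y) y) :
    wp L w S settleAll σ fun t σ' => Keeps 12 0 σ σ' ∧ σ'.HeadsOk L ∧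
      (∀ v ∈ V', σ'.heads 0 v = σ.heads 0 v) ∧
      (∀ y, y ∉ V' → Ready L V' (σ'.heads 0 y) y) ∧ ∃ b, t ≤ (10 * P.length + 30) * b + 4 ∧
        b + (∑ v, if v ∈ V' then 0 else potential L V' (σ'.heads 0 v) v) ≤
          (∑ v, if v ∈ V' then 0 else potential L V (σ.heads 0 v) v) + (L 0 x).length := by
  have hmono : ∀ v ∈ V, v ∈ V' := fun v hv => (he.mem_iff v).2 (Or.inl hv)
  have hlen : (σ.view L 0 x).length = (L 0 x).length := length_view
  have hnd : (σ.view L 0 x).Nodup := nodup_view.2 (he.nodup x)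
  obtain ⟨x₀, l₀, hx₀⟩ := List.exists_cons_of_ne_nil (mt (view_eq_nil (σ := σ)).1 hne)
  refine wp_seq.2 (wp_seq.2 (wp_front he.r5 hσ (by simp [hx₀]) fun p hp => ?_))
  have hat : (σ.setCursor 5 (some (0, x, p))).At L 5 0 x (x₀ :: l₀) :=
    ⟨p, by simp, hp.1, by rw [hp.2, hx₀]⟩
  rw [wp_read hat, wp_seq, wp_const]
  refine wp_loop (fun m t σ' => Keeps 12 0 σ σ' ∧ σ'.regs 14 = σ.regs 14 ∧ σ'.HeadsOk L ∧
    (∀ v ∈ V', σ'.heads 0 v = σ.heads 0 v) ∧ σ'.regs 12 = x₀.val ∧ ∃ d e b, σ.view L 0 x = d ++ e ∧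
      (∀ y, y ∉ V' → if y ∈ d then Ready L V' (σ'.heads 0 y) y else
        σ'.heads 0 y = σ.heads 0 y) ∧ t ≤ (10 * P.length + 30) * b ∧
      b + (∑ v, if v ∈ V' then 0 else
          if v ∈ d then potential L V' (σ'.heads 0 v) v else potential L V (σ.heads 0 v) v) ≤
        (∑ v, if v ∈ V' then 0 else potential L V (σ.heads 0 v) v) + d.length ∧ m = e.length ∧
      ((σ'.regs 21 = 0 ∧ e ≠ [] ∧ σ'.At L 5 0 x (e ++ d)) ∨ (σ'.regs 21 = 1 ∧ e = [])))
      (l₀.length + 1) ?_ ?_ ?_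
  · refine ⟨?_, by simp, hσ, fun _ _ => rfl, by simp [val_mod hw], [], x₀ :: l₀, 0, hx₀, by simp,
      by simp, by simp, rfl, Or.inl ⟨by simp, by simp, by
        rw [List.append_nil]; exact hat.congr rfl⟩⟩
    repeat (first | exact Keeps.refl 12 0 σ | refine Keeps.setReg ?_ | refine Keeps.setCursor ?_)
  · rintro m t σ₁ ⟨hk₁, h14, hok₁, hV₁, h12, d, e, b, hd, hst, ht, hb, rfl, ⟨h21, hen, hat₁⟩ |
      ⟨h21, -⟩⟩ hn
    swap
    · exact absurd (h21.trans (hk₁.base he.base).r4.symm) hn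
    obtain ⟨y, e, rfl⟩ := List.exists_cons_of_ne_nil hen
    have hyx : y ∈ L 0 x := (mem_view (σ := σ)).1 (by rw [hd]; simp)
    rw [hd] at hnd
    have hyd : y ∉ d := fun hyd => (List.nodup_append.1 hnd).2.2 y hyd y (by simp) rfl
    refine wp_seq.2 ((wp_read hat₁).2 ?_)
    set σ₂ := σ₁.setReg w 13 y with hσ₂
    have he₂ : Entered L s w x P V V' σ₂ := by
      refine ⟨?_, ?_, ?_, he.nodup, ?_, he.mem_iff, he.not_mem, he.subset, he.gray, ?_, ?_, he.symm⟩
      · exact (base_setReg).2 (hk₁.base he.base)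
      · simpa [hσ₂] using (hk₁.regs 5 (by decide)).trans he.r5
      · simpa [hσ₂, hk₁.regs 10 (by decide)] using he.r10
      · exact he.path.congr fun v hv => by rw [view, view, heads_setReg, hV₁ v (he.subset v hv)]
      · intro v hv hv14 hvx hvV
        refine he.white v hv ?_ ?_ hvV
        · simpa [hσ₂, h14] using hv14
        · rwa [view, heads_setReg, hV₁ v hvV] at hvx
      · intro v hv
        simpa [hσ₂, h14] using he.parent v hv
    refine (wp_settle (y := y) hw hw0 he₂ hok₁ (by simp [hσ₂, val_mod hw]) hyx (hsymm y hyx)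
      fun hyV => ?_).seq ?_
    · have := hst y hyV
      rw [if_neg hyd] at this
      rw [heads_setReg, this]
      exact hr y hyV
    rintro t₃ σ₃ ⟨hk₃, hok₃, hoth₃, hr₃, k, ht₃, hkV, hpot⟩
    have hat₃ : σ₃.At L 5 0 x (y :: (e ++ d)) := hat₁.congr (hk₃.cursors 5 (by decide))
    refine (wp_advance (y := x₀) hw hw0 ?_ (by decide) hat₃).mono ?_
    · rw [hk₃.regs 12 (by decide)]; simpa [hσ₂] using h12
    rintro t₄ σ₄ ⟨ht₄, hk₄, -, h21₄, hat₄⟩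
    have hh₄ : σ₄.heads = σ₃.heads := hk₄.heads
    have hoth₄ : ∀ v, v ≠ y ∨ y ∈ V' → σ₄.heads 0 v = σ₁.heads 0 v := fun v hv => by
      rw [hh₄]; exact hoth₃ v hv
    refine ⟨e.length, by simp, ?_, ?_, hok₃.congr hh₄, fun v hv => ?_, ?_, d ++ [y], e, b + (k + 1),
      by simpa using hd, fun v hv => ?_, ?_, ?_, rfl, ?_⟩
    · exact ((hk₁.setReg).trans hk₃).trans hk₄.toKeeps
    · rw [hk₄.regs 14 (by decide), hk₃.regs 14 (by decide)]; simpa [hσ₂] using h14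
    · rw [hoth₄ v, hV₁ v hv]
      by_cases hvy : v = y
      · right; exact hvy ▸ hv
      · left; exact hvy
    · rw [hk₄.regs 12 (by decide), hk₃.regs 12 (by decide)]; simpa [hσ₂] using h12
    · by_cases hvy : v = y
      · subst hvy
        rw [if_pos (by simp), hh₄]
        exact hr₃ hv
      · have := hst v hv
        rw [hoth₄ v (Or.inl hvy)]
        simpa [hvy] using this
    · rw [Nat.mul_add, Nat.mul_add (10 * P.length + 30) k 1]; omega
    · rw [List.length_append, List.length_singleton]
      refine le_trans ?_ (Nat.add_le_add_right hb 1)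
      rw [show b + (k + 1) = k + (b + 1) by omega, add_right_comm b, add_assoc, add_left_comm]
      refine Nat.add_le_add_left (sum_add_le y (fun v hv => ?_) ?_) _
      · rw [hoth₄ v (Or.inl hv)]; simp [hv]
      · by_cases hyV : y ∈ V'
        · simp [hyV, hkV hyV]
        · have := hst y hyV
          rw [if_neg hyd] at this
          have hp := hpot hyV
          rw [heads_setReg, this] at hp
          simp only [hyV, if_false, hyd, List.mem_append, List.mem_singleton, or_true, if_true, hh₄]
          exact hp
    · have hiff := head?_rotated_eq_iff hnd (by rw [← hd, hx₀]; rfl)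
      simp only [hiff] at h21₄
      by_cases hem : e = []
      · exact Or.inr ⟨by simpa [hem] using h21₄, hem⟩
      · exact Or.inl ⟨by simpa [hem] using h21₄, hem, by simpa using hat₄⟩
  · rintro m t σ₁ ⟨hk₁, h14, hok₁, hV₁, h12, d, e, b, hd, hst, ht, hb, rfl, ⟨h21, -⟩ | ⟨h21, rfl⟩⟩ hex
    · exact absurd (h21.symm.trans (hex.trans (hk₁.base he.base).r4)) zero_ne_one
    · rw [List.append_nil] at hd
      rw [hd] at hlen
      have hout : ∀ y, y ∉ d → (σ.view L 0 y).head? ≠ some x := by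
        intro y hyd hy
        apply hyd
        rw [← hd, mem_view]
        exact he.symm y (mem_view.1 (List.mem_of_mem_head? hy))
      refine ⟨hk₁, hok₁, hV₁, fun y hy => ?_, b, by omega, ?_⟩
      · have := hst y hy
        by_cases hyd : y ∈ d
        · rwa [if_pos hyd] at this
        · rw [if_neg hyd] at this
          rw [this]
          exact (hr y hy).of_head?_ne he.mem_iff (hout y hyd)
      · rw [← hlen]
        refine le_trans (Nat.add_le_add_left (Finset.sum_le_sum fun v _ => ?_) b) hb
        by_cases hv : v ∈ V'
        · simp [hv]
        · have := hst v hv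
          by_cases hvd : v ∈ d
          · simp [hv, hvd]
          · rw [if_neg hvd] at this
            simpa [hv, hvd, this] using potential_mono hmono

end Undirected
end Rotate

/-! ### Visiting the vertices of an undirected graph -/

namespace Rotate

open Store Dfs

variable {n : ℕ}

namespace Undirected

variable {L : Lists 1 n} {r : Fin n → Fin n → Prop} {s u x p c : Fin n} {w S b : ℕ}
  {σ σ' : Store 1 n} {ρ : Fin n → List (Fin n)} {T : List (Fin n × ℕ)} {F : List (Frame n)}
  {l : List (Fin n)}

/-- An unvisited vertex pays for the rotations of its list and for the visit. -/
def cost (L : Lists 1 n) (v : Fin n) (a : Fin 1 → ℕ) (V : List (Fin n)) : ℕ :=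
  potential L V (a 0) v + 2 * ((L 0 v).length + 1)

theorem whitePotential_push {H H₁ H' : Fin 1 → Fin n → ℕ} {d : ℕ} (hx : x ∉ visited T)
    (hH : ∀ v, v ≠ x → H₁ 0 v = H 0 v)
    (hb : b + (∑ v, if v ∈ visited (T ++ [(x, d)]) then 0 else
        potential L (visited (T ++ [(x, d)])) (H' 0 v) v) ≤
      (∑ v, if v ∈ visited (T ++ [(x, d)]) then 0 else potential L (visited T) (H₁ 0 v) v) +
        (L 0 x).length) :
    b + ((L 0 x).length + 1) + whitePotential (cost L) H' (T ++ [(x, d)]) ≤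
      whitePotential (cost L) H T := by
  have hsplit : ∀ f g : Fin n → ℕ, (∑ v, if v ∈ visited (T ++ [(x, d)]) then 0 else f v + g v) =
      (∑ v, if v ∈ visited (T ++ [(x, d)]) then 0 else f v) +
        ∑ v, if v ∈ visited (T ++ [(x, d)]) then 0 else g v := by
    intro f g
    rw [← Finset.sum_add_distrib]
    exact Finset.sum_congr rfl fun v _ => by split <;> simp
  have h1 := sum_unvisited_push
    (fun v => potential L (visited T) (H 0 v) v + 2 * ((L 0 v).length + 1)) hx d
  have h2 : (∑ v, if v ∈ visited (T ++ [(x, d)]) then 0 else potential L (visited T) (H₁ 0 v) v) =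
      ∑ v, if v ∈ visited (T ++ [(x, d)]) then 0 else potential L (visited T) (H 0 v) v := by
    refine Finset.sum_congr rfl fun v _ => ?_
    by_cases hv : v ∈ visited (T ++ [(x, d)])
    · rw [if_pos hv, if_pos hv]
    · rw [if_neg hv, if_neg hv, hH v fun h => hv (mem_visited_append.2 (Or.inr h))]
  rw [hsplit] at h1
  rw [h2] at hb
  simp only [whitePotential, cost]
  rw [hsplit]
  omega

theorem wp_enter (hw : n < 2 ^ w) (hw0 : 0 < w) (hadj : IsAdjacencyOrder r (L 0))
    (hsymm : ∀ u v, r u v → r v u) (hirr : ∀ v, ¬ r v v)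
    (hc : LinkCore L 0 r s w σ ρ T u (x :: l) F)
    (hX : Inv L r σ.heads (maxDepth T) (σ.regs 10) ρ T ((u, x :: l) :: F))
    (h11 : σ.regs 11 = x.val) (h9 : σ.regs 9 = 0) (hx : x ∉ visited T) :
    wp L w S enter σ fun t σ' => (∀ r : Reg, r.val < 12 → r ≠ 5 → σ'.regs r = σ.regs r) ∧
      σ'.regs 5 = x.val ∧ σ'.out = σ.out ∧ σ'.HeadsOk L ∧
      (∀ v ∈ u :: verts F, σ'.view L 0 v = σ.view L 0 v) ∧
      Inv L r σ'.heads (max (maxDepth T) (F.length + 1)) (σ.regs 10)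
        (Function.update ρ x (σ'.view L 0 x)) (T ++ [(x, F.length + 1)])
        ((x, σ'.view L 0 x) :: (u, x :: l) :: F) ∧
      ∃ b, t ≤ 100 * (max (maxDepth T) (F.length + 1) + 1) * b ∧
        b + whitePotential (cost L) σ'.heads (T ++ [(x, F.length + 1)]) ≤
          whitePotential (cost L) σ.heads T := by
  have hxF := hc.snap.not_mem_stack hx
  have hsym : ∀ a b, a ∈ L 0 b → b ∈ L 0 a := fun a b hab =>
    ((hadj a).2 b).2 (hsymm _ _ (((hadj b).2 a).1 hab))
  have hrux : r u x := by
    obtain ⟨pre, h1, -⟩ := hc.snap.scanned _ List.mem_cons_self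
    simp only at h1
    exact hc.snap.mem_iff.1 (by rw [h1]; simp)
  have hux : u ∈ L 0 x := ((hadj x).2 u).2 (hsymm _ _ hrux)
  obtain ⟨a, e, hab⟩ := List.append_of_mem ((mem_view (σ := σ)).2 hux)
  have hnd : (σ.view L 0 x).Nodup := nodup_view.2 (hadj x).1
  have hlen : (σ.view L 0 x).length = (L 0 x).length := length_view
  rw [hab] at hnd hlen
  have hua : u ∉ a := fun hua => (List.nodup_append.1 hnd).2.2 u hua u (by simp) rfl
  rw [enter, wp_seq, wp_mov]
  refine (wp_rotateUntil (σ := σ.setReg w 14 (σ.regs 5)) (v := x) (x := u) hw hc.ok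
    (by simpa using h11) (by simpa using hc.r5) (by decide) (by decide) hab hua).seq ?_
  rintro t₁ σ₁ ⟨ht₁, hk₁, hok₁, hv₁, hoth₁⟩
  have hregs : ∀ a : Reg, a.val < 14 → σ₁.regs a = σ.regs a := fun a ha => by
    rw [hk₁.regs a (by omega), regs_setReg, if_neg]
    rintro rfl; revert ha; decide
  have hh₁ : ∀ v, v ≠ x → σ₁.heads 0 v = σ.heads 0 v := fun v hv =>
    heads_eq_of_view hc.ok hok₁ (hadj v).1 (hoth₁ 0 v (by simp [hv]))
  have h11₁ : σ₁.regs 11 = x.val := (hregs 11 (by decide)).trans h11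
  rw [wp_seq, wp_mov, wp_seq, wp_rotate (v := x) (by simp [h11₁, val_mod hw])]
  set σ₂ := (σ₁.setReg w 5 (σ₁.regs 11)).rot L 0 x with hσ₂
  have hok₂ : σ₂.HeadsOk L := HeadsOk.rot (σ := σ₁.setReg w 5 (σ₁.regs 11)) hok₁
  have hv₂ : σ₂.view L 0 x = e ++ a ++ [u] := by
    rw [hσ₂, view_rot (σ := σ₁.setReg w 5 (σ₁.regs 11)) hok₁, if_pos ⟨rfl, rfl⟩, view_setReg, hv₁]
    simp
  have hh₂ : ∀ v, v ≠ x → σ₂.heads 0 v = σ.heads 0 v := fun v hv => by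
    rw [hσ₂, heads_rot]; simp [hv, hh₁ v hv]
  have hregs₂ : ∀ a : Reg, a.val < 14 → a ≠ 5 → σ₂.regs a = σ.regs a := fun a ha h5 => by
    rw [hσ₂, regs_rot, regs_setReg, if_neg h5, hregs a ha]
  have hview : ∀ v, v ≠ x → σ₂.view L 0 v = σ.view L 0 v := fun v hv => by
    rw [view, view, hh₂ v hv]
  have hvu : (σ.view L 0 u).head? = some x := by
    rcases hc.top with ⟨-, pre, -, h, -⟩ | ⟨h, -⟩
    · rw [h]; rfl
    · exact absurd (h9.symm.trans h) zero_ne_one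
  have h14 : σ₂.regs 14 = u.val := by
    rw [hσ₂, regs_rot, regs_setReg, if_neg (by decide), hk₁.regs 14 (by decide)]
    simp [hc.r5, val_mod hw]
  have hmem : ∀ v, v ∈ visited (T ++ [(x, F.length + 1)]) ↔ v ∈ visited T ∨ v = x :=
    fun v => mem_visited_append
  have hen : Entered L s w x (u :: verts F) (visited T) (visited (T ++ [(x, F.length + 1)])) σ₂ := by
    refine ⟨?_, ?_, ?_, fun v => (hadj v).1, ⟨?_, ?_, ?_⟩, hmem, hx, ?_, ?_, ?_, ?_, fun v => hsym x v⟩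
    · exact hc.base.congr (b := 5) fun a ha => hregs₂ a (by omega) (by rintro rfl; revert ha; decide)
    · simp [hσ₂, h11₁, val_mod hw]
    · rw [hregs₂ 10 (by decide) (by decide)]; exact hX.marker_lt.trans hw
    · have hux' : u ≠ x := by rintro rfl; exact hx hc.mem
      refine List.isChain_cons_cons.2 ⟨by rw [hview u hux']; exact hvu,
        (hc.path.congr fun v hv => ?_).chain⟩
      exact hview v (by rintro rfl; exact hxF hv)
    · intro v hv
      rw [List.getLast?_cons_cons] at hv
      exact hc.root v hv
    · exact List.nodup_cons.2 ⟨hxF, hc.nodup⟩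
    · intro v hv
      rcases List.mem_cons.1 hv with rfl | hv
      · exact (hmem _).2 (Or.inr rfl)
      · exact (hmem v).2 (Or.inl (hX.subset v hv))
    · intro v hv z hz hzT
      rcases (hmem z).1 hzT with hzT | rfl
      · by_contra hzF
        exact hv ((hmem v).2 (Or.inl (hc.snap.closed z hzT (fun h => hzF (List.mem_cons_of_mem _ h)) v
          (((hadj z).2 v).1 (hsym _ _ hz)))))
      · simp
    · intro v hv hv14 hvx hvT
      have hvu : v ≠ u := by rintro rfl; exact hv14 h14.symm
      rcases (hmem v).1 hvT with hvT' | rfl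
      · have hvx' : v ≠ x := by rintro rfl; exact hx hvT'
        rw [hview v hvx'] at hvx
        by_cases hvF : v ∈ verts F
        · -- the list of `v` starts with a vertex on the stack
          obtain ⟨f, hf, rfl⟩ := List.mem_map.1 hvF
          obtain ⟨c, hcs, hch⟩ := hc.path.head?_mem hvF
          rw [hvx] at hch
          exact hxF (by rw [Option.some.inj hch]; exact hcs)
        · have hvF' : v ∉ verts ((u, x :: l) :: F) := fun h => hvF ((List.mem_cons.1 h).resolve_left hvu)
          exact hx (hc.snap.closed v hvT' hvF' x (((hadj v).2 x).1 (hsym _ _ hv)))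
      · exact hirr v (((hadj v).2 v).1 hv)
    · intro v hv h
      rw [h14] at h
      exact hv ((hmem v).2 (Or.inl (Fin.ext h ▸ hc.mem)))
  refine (wp_settleAll hw hw0 hen hok₂ (fun v hv => hsym _ _ hv) (List.ne_nil_of_mem hux)
    fun y hy => ?_).mono ?_
  · rw [hh₂ y fun h => hy ((hmem y).2 (Or.inr h))]
    exact hX.ready y fun h => hy ((hmem y).2 (Or.inl h))
  rintro t₃ σ₃ ⟨hk₃, hok₃, hV₃, hr₃, b, ht₃, hb⟩
  have hT₃ : ∀ v ∈ visited T, σ₃.view L 0 v = σ.view L 0 v := fun v hv => by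
    rw [view, view, hV₃ v ((hmem v).2 (Or.inl hv)), hh₂ v (by rintro rfl; exact hx hv)]
  have hx₃ : σ₃.view L 0 x = e ++ a ++ [u] := by
    rw [view, hV₃ x ((hmem x).2 (Or.inr rfl))]; exact hv₂
  refine ⟨fun r' hr' hr5 => ?_, ?_, ?_, hok₃, fun v hv => hT₃ v (hX.subset v hv), ?_,
    b + ((L 0 x).length + 1), ?_, whitePotential_push hx hh₂ hb⟩
  · rw [hk₃.regs r' hr', hregs₂ r' (by omega) hr5]
  · rw [hk₃.regs 5 (by decide), hen.r5]
  · rw [hk₃.out, hσ₂, out_rot, out_setReg, hk₁.out, out_setReg]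
  · constructor
    · exact hX.marker_lt
    · have : F.length + 1 < n := by
        simpa using length_le_of_nodup (List.nodup_cons.2 ⟨hxF, hc.nodup⟩)
      have := hX.depth_lt
      omega
    · exact hen.subset
    · exact hX.gated.push hx (le_max_left _ _)
        (fun z hz hzF hzx => hx (hc.snap.closed z hz hzF x hzx)) fun v hv _ => hT₃ v hv
    · refine List.isChain_cons_cons.2 ⟨by simp [hx₃], ?_⟩
      refine List.IsChain.imp_of_mem_imp (fun v c hv hc' h => ?_) hX.parents
      rwa [Function.update_of_ne (by rintro rfl; exact hxF hv)]
    · intro v hv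
      simp only [verts, List.map_cons, List.getLast?_cons_cons] at hv
      have hvF : v ∈ verts ((u, x :: l) :: F) := List.mem_of_getLast? hv
      rw [Function.update_of_ne (by rintro rfl; exact hxF hvF)]
      exact hX.root v hv
    · exact hr₃
  · have h1 : (10 * (u :: verts F).length + 30) * b ≤
        100 * (max (maxDepth T) (F.length + 1) + 1) * b := by
      refine Nat.mul_le_mul_right _ ?_
      simp only [List.length_cons, verts, List.length_map]
      omega
    have h2 : 100 * ((L 0 x).length + 1) ≤
        100 * (max (maxDepth T) (F.length + 1) + 1) * ((L 0 x).length + 1) :=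
      Nat.mul_le_mul_right _ (by omega)
    simp only [List.length_append, List.length_cons] at hlen
    rw [Nat.mul_add]
    omega

theorem wp_start (hw : n < 2 ^ w) (hw0 : 0 < w) (hadj : IsAdjacencyOrder r (L 0))
    (hsymm : ∀ u v, r u v → r v u) (hirr : ∀ v, ¬ r v v) (hb : Base s w σ)
    (h5 : σ.regs 5 = s.val) (hv : σ.view L = L) (hok : σ.HeadsOk L) :
    wp L w S start σ fun t σ' => (∀ r : Reg, r.val < 10 → σ'.regs r = σ.regs r) ∧
      σ'.out = σ.out ∧ σ'.HeadsOk L ∧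
      Inv L r σ'.heads 0 (σ'.regs 10) (Function.update (L 0) s (σ'.view L 0 s)) [(s, 0)]
        [(s, σ'.view L 0 s)] ∧
      ∃ b, t ≤ 100 * b ∧
        b + whitePotential (cost L) σ'.heads [(s, 0)] ≤ whitePotential (cost L) σ.heads [] := by
  have hsym : ∀ a b, a ∈ L 0 b → b ∈ L 0 a := fun a b hab =>
    ((hadj a).2 b).2 (hsymm _ _ (((hadj b).2 a).1 hab))
  have hss : s ∉ L 0 s := fun h => hirr s (((hadj s).2 s).1 h)
  have hmem : ∀ v, v ∈ visited [(s, 0)] ↔ v ∈ visited ([] : List (Fin n × ℕ)) ∨ v = s := by simp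
  have hready : ∀ y, Ready L (visited []) (σ.heads 0 y) y := fun y => by
    have h0 : σ.heads 0 y = 0 := by
      refine (heads_eq_of_view (σ := σ) (σ' := { σ with heads := fun _ _ => 0 }) hok
        (fun _ _ => Or.inl rfl) (hadj y).1 ?_).symm
      rw [hv]
      exact List.rotate_zero _
    rw [h0]
    exact ⟨by simp, by simp⟩
  have hgated : ∀ σ' : Store 1 n, Gated (viewOf L σ'.heads) r 0 [(s, 0)] [(s, σ'.view L 0 s)] := by
    intro σ' v hv hvF
    simp at hv hvF
    exact absurd hv hvF
  rw [start, wp_seq, wp_const, wp_seq]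
  by_cases hne : L 0 s = []
  · rw [wp_front_nil (v := s) (by simpa using h5) (view_eq_nil.2 hne), wp_ite, wp_skip]
    refine ⟨fun _ => ?_, fun h => absurd (by simp [Test.holds]) h⟩
    refine ⟨fun r' hr' => ?_, rfl, hok, ⟨?_, s.pos, by simp, hgated _, by simp, ?_, fun y hy => ?_⟩,
      (L 0 s).length + 1, by omega, ?_⟩
    · rw [regs_setCursor, regs_setReg, if_neg]
      rintro rfl; revert hr'; decide
    · simpa using s.pos
    · intro v hv
      obtain rfl : v = s := by simpa using hv.symm
      simp [view_eq_nil.2 hne]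
    · refine (hready y).of_head?_ne hmem fun h => ?_
      have := hsym _ _ (List.mem_rotate.1 (List.mem_of_mem_head? h))
      rw [hne] at this
      simp at this
    · have := whitePotential_push (L := L) (b := 0) (T := []) (x := s) (d := 0) (H := σ.heads)
        (H₁ := σ.heads) (H' := σ.heads) (by simp) (fun _ _ => rfl) (by
          rw [Nat.zero_add]
          refine (Finset.sum_le_sum fun v _ => ?_).trans (Nat.le_add_right _ _)
          split
          · exact le_rfl
          · exact potential_mono (by simp))
      rw [Nat.zero_add] at this
      exact this
  refine wp_front (v := s) (by simpa using h5) hok (mt view_eq_nil.1 hne) fun q hq => ?_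
  obtain ⟨x₀, l₀, hl⟩ := List.exists_cons_of_ne_nil (mt (view_eq_nil (σ := σ)).1 hne)
  rw [wp_ite]
  refine ⟨fun h => absurd h (by simp [Test.holds]), fun _ => ?_⟩
  rw [wp_seq, wp_read (i := 0) (v := s) (x := x₀) (l := l₀)
    ⟨q, by simp, hq.1, by rw [hq.2, view_setReg, hl]⟩, wp_seq, wp_rotate (v := s) (by simpa using h5),
    wp_seq, wp_mov]
  set σ₁ := (((σ.setReg w 10 0).setCursor 5 (some (0, s, q))).setReg w 10 x₀) with hσ₁
  have hok₁ : σ₁.HeadsOk L := hok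
  set σ₂ := (σ₁.rot L 0 s).setReg w 14 ((σ₁.rot L 0 s).regs 0) with hσ₂
  have hok₂ : σ₂.HeadsOk L := hok₁.rot
  have hv₂ : σ₂.view L 0 s = l₀ ++ [x₀] := by
    rw [hσ₂, view_setReg, view_rot hok₁, if_pos ⟨rfl, rfl⟩]
    simp [hσ₁, hl]
  have hregs₂ : ∀ a : Reg, a ≠ 10 → a ≠ 14 → σ₂.regs a = σ.regs a := fun a h10 h14 => by
    simp [hσ₂, hσ₁, h10, h14]
  have hh₂ : ∀ v, v ≠ s → σ₂.heads 0 v = σ.heads 0 v := fun v hv => by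
    rw [hσ₂, heads_setReg, heads_rot]; simp [hv, hσ₁]
  have h10 : σ₂.regs 10 = x₀.val := by simp [hσ₂, hσ₁, val_mod hw]
  have h14 : σ₂.regs 14 = n := by
    simp [hσ₂, hσ₁, hb.r0, Nat.mod_eq_of_lt hw]
  have hen : Entered L s w s [] (visited []) (visited [(s, 0)]) σ₂ := by
    refine ⟨?_, ?_, ?_, fun v => (hadj v).1, ⟨by simp, by simp, by simp⟩, hmem, by simp, by simp, ?_,
      ?_, ?_, fun v => hsym s v⟩
    · exact hb.congr (b := 5) fun a ha => hregs₂ a (by rintro rfl; revert ha; decide)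
        (by rintro rfl; revert ha; decide)
    · rw [hregs₂ 5 (by decide) (by decide), h5]
    · rw [h10]; exact x₀.isLt.trans hw
    · simp
    · intro v hv _ _ hvs
      obtain rfl : v = s := by simpa using hvs
      exact hss hv
    · intro v _
      rw [h14]; exact v.isLt.ne
  refine (wp_settleAll hw hw0 hen hok₂ (fun v hv => hsym _ _ hv) hne fun y hy => ?_).mono ?_
  · rw [hh₂ y fun h => hy ((hmem y).2 (Or.inr h))]
    exact hready y
  rintro t₃ σ₃ ⟨hk₃, hok₃, hV₃, hr₃, b, ht₃, hb'⟩
  have hs₃ : σ₃.view L 0 s = l₀ ++ [x₀] := by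
    rw [view, hV₃ s (by simp)]; exact hv₂
  refine ⟨fun r' hr' => ?_, ?_, hok₃, ⟨?_, s.pos, by simp, hgated _, by simp, ?_, hr₃⟩,
    b + ((L 0 s).length + 1), ?_, whitePotential_push (T := []) (by simp) hh₂ hb'⟩
  · rw [hk₃.regs r' (by omega), hregs₂ r' (by rintro rfl; revert hr'; decide)
      (by rintro rfl; revert hr'; decide)]
  · rw [hk₃.out]; rfl
  · rw [hk₃.regs 10 (by decide), h10]; exact x₀.isLt
  · intro v hv c hcl
    obtain rfl : s = v := by simpa using hv
    rw [Function.update_self, hs₃] at hcl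
    obtain rfl : x₀ = c := by simpa using hcl
    rw [hk₃.regs 10 (by decide), h10]
  · simp only [List.length_nil, Nat.mul_zero, Nat.zero_add] at ht₃
    omega

theorem linkSpec (hw : n < 2 ^ w) (hw0 : 0 < w) (hadj : IsAdjacencyOrder r (L 0))
    (hsymm : ∀ u v, r u v → r v u) (hirr : ∀ v, ¬ r v v) :
    LinkSpec L 0 r s w S start check last enter leave (Inv L r) (fun D => 100 * (D + 1)) (cost L) where
  mono D D' h := Nat.mul_le_mul_left _ (Nat.succ_le_succ h)
  le D := by omega
  rotate H H' D m ρ T u l F hX hH := by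
    have h1 : ∀ v, v ≠ u → H' 0 v = H 0 v := fun v hv => hH 0 v (by simp [hv])
    refine ⟨hX.marker_lt, hX.depth_lt, hX.subset, hX.gated.congr fun v _ hv => ?_, hX.parents,
      hX.root, fun y hy => ?_⟩
    · rw [viewOf, viewOf, h1 v (by rintro rfl; simp at hv)]
    · rw [h1 y (by rintro rfl; exact hy (hX.subset _ (by simp)))]
      exact hX.ready y hy
  skip H D m ρ T u x l F hX :=
    ⟨hX.marker_lt, hX.depth_lt, hX.subset, hX.gated.skip, hX.parents, hX.root, hX.ready⟩
  check σ ρ T u x l F hc hX h11 _ :=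
    (wp_check hw hw0 hadj hsymm hc hX h11).mono fun t σ' h => ⟨by omega, h.2⟩
  last σ ρ T u pre c l F hc hX hρ hv h11 :=
    (wp_last hw hw0 hc hX hρ h11).mono fun t σ' h => ⟨by omega, h.2⟩
  enter σ ρ T u x l F hc hX h11 h9 hx := wp_enter hw hw0 hadj hsymm hirr hc hX h11 h9 hx
  leave σ ρ T u p l F hc hX hend :=
    (wp_leave hw hc hX hend).mono fun t σ' h => ⟨by omega, h.2⟩
  start σ hb h5 hv hok := wp_start hw hw0 hadj hsymm hirr hb h5 hv hok

end Undirected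

/-- If the graph is connected, then a DFS order of an undirected graph is found with a constant number
of words. -/
theorem outputs_link_undirected {L : Lists 1 n} {r : Fin n → Fin n → Prop} (s : Fin n) {w : ℕ}
    (hw : n < 2 ^ w) (hw0 : 0 < w) (hadj : IsAdjacencyOrder r (L 0))
    (hsymm : ∀ u v, r u v → r v u) (hirr : ∀ v, ¬ r v v)
    (hreach : ∀ v, Relation.ReflTransGen r s v) :
    ∃ R t, IsAdjacencyOrder r R ∧
      Outputs (linkMain 0 Undirected.start Undirected.check Undirected.last Undirected.enter
        Undirected.leave).program L s w 0 t (dfsOrder R s) ∧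
      t ≤ 100 * (dfsDepth R s + 1) * (10 * (∑ v, (L 0 v).length) + 11 * n + 1) := by
  obtain ⟨R, t, h1, h2, h3⟩ := outputs_linkMain hw hw0 hadj hreach
    (Undirected.linkSpec (S := 0) hw hw0 hadj hsymm hirr)
  refine ⟨R, t, h1, h2, h3.trans (Nat.mul_le_mul_left _ ?_)⟩
  have : ∀ v : Fin n, Undirected.cost L v (fun _ => 0) [] ≤ 4 * (L 0 v).length + 2 := fun v => by
    rw [Undirected.cost, Undirected.potential]
    split <;> omega
  have := Finset.sum_le_sum fun v (_ : v ∈ Finset.univ) => this v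
  simp only [Finset.sum_add_distrib, ← Finset.mul_sum, Finset.sum_const, Finset.card_univ,
    Fintype.card_fin, smul_eq_mul] at this
  omega

end Rotate

/-! ### Space and time bounds in terms of the graph -/

namespace Rotate

variable {n : ℕ}

/-- The program for the lex-DFS order of undirected graphs. -/
abbrev lexUndirected : Cmd 1 := lexMain 0 enterUndirected leaveUndirected

/-- The program for the lex-DFS order of directed graphs. -/
abbrev lexDirected : Cmd 2 := lexMain 0 enterDirected leaveDirected

/-- The program for a general-DFS order of undirected graphs that uses no work memory. -/
abbrev linkUndirected : Cmd 1 :=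
  linkMain 0 Undirected.start Undirected.check Undirected.last Undirected.enter Undirected.leave

/-- The program for a general-DFS order of directed graphs that uses no work memory. -/
abbrev linkDirected : Cmd 2 :=
  linkMain 0 (.prim (.const 10 0) ;; leastToEnd 0) Directed.check Directed.last Directed.enter
    Directed.leave

theorem natSize_le_two_mul_logb (hn : 2 ≤ n) : (Nat.size n : ℝ) ≤ 2 * Real.logb 2 n := by
  have h1 : 1 ≤ Real.logb 2 n := by
    rw [Real.le_logb_iff_rpow_le one_lt_two (by positivity)]
    simpa using (by exact_mod_cast hn : (2 : ℝ) ≤ n)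
  have h2 : Nat.size n ≤ Nat.log 2 n + 1 := Nat.size_le.2 (Nat.lt_pow_succ_log_self one_lt_two n)
  have h3 := Real.natLog_le_logb n 2
  have : (Nat.size n : ℝ) ≤ Nat.log 2 n + 1 := by exact_mod_cast h2
  push_cast at h3
  linarith

/-- There are at most `2 * n ^ 2` nodes, so that a cursor needs `O(lg n)` bits. -/
theorem extraBits_le {h κ w S : ℕ} (c : Cmd h) {L : Lists h n} (hh : h ≤ 2)
    (hL : ∀ i v, (L i v).Nodup) (hw : w ≤ κ * Nat.size n) (hn : 2 ≤ n) :
    extraBits c.program L w S ≤ (32 * κ + 24) * Nat.size n + S * w := by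
  have h1 : ∑ i, ∑ v, (L i v).length ≤ 2 * n ^ 2 :=
    calc ∑ i, ∑ v, (L i v).length ≤ ∑ _i : Fin h, ∑ _v : Fin n, n :=
          Finset.sum_le_sum fun i _ => Finset.sum_le_sum fun v _ => Dfs.length_le_of_nodup (hL i v)
      _ = h * n ^ 2 := by simp [sq]
      _ ≤ 2 * n ^ 2 := Nat.mul_le_mul_right _ hh
  have hN : n < 2 ^ Nat.size n := Nat.lt_size_self n
  have hN1 : 1 ≤ Nat.size n := Nat.size_pos.2 (by omega)
  have h2 : Nat.size (∑ i, ∑ v, (L i v).length) ≤ 3 * Nat.size n := by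
    refine (Nat.size_le.2 (h1.trans_lt ?_) : _ ≤ 2 * Nat.size n + 1).trans (by omega)
    rw [pow_succ 2 (2 * _), mul_comm 2, pow_mul']
    exact Nat.mul_lt_mul_of_pos_right (Nat.pow_lt_pow_left hN two_ne_zero) two_pos
  have : extraBits c.program L w S = 32 * w + 8 * Nat.size (∑ i, ∑ v, (L i v).length) + S * w :=
    rfl
  rw [this]
  nlinarith

theorem extraBits_le_logb {h κ w : ℕ} (c : Cmd h) {L : Lists h n} (hh : h ≤ 2)
    (hL : ∀ i v, (L i v).Nodup) (hw : w ≤ κ * Nat.size n) (hn : 2 ≤ n) :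
    (extraBits c.program L w 0 : ℝ) ≤ (64 * κ + 48 : ℕ) * Real.logb 2 n := by
  have h1 : (extraBits c.program L w 0 : ℝ) ≤ (32 * κ + 24 : ℕ) * Nat.size n := by
    exact_mod_cast by simpa using extraBits_le c (S := 0) hh hL hw hn
  have h2 := mul_le_mul_of_nonneg_left (natSize_le_two_mul_logb hn)
    (Nat.cast_nonneg (α := ℝ) (32 * κ + 24))
  push_cast at *
  linarith

/-- A bit vector on the vertices occupies `n / w + 1` words, at most `n + w` bits. -/
theorem extraBits_bitVector_le {h κ w : ℕ} (c : Cmd h) {L : Lists h n} (hh : h ≤ 2)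
    (hL : ∀ i v, (L i v).Nodup) (hw : w ≤ κ * Nat.size n) (hn : 2 ≤ n) :
    (extraBits c.program L w (n / w + 1) : ℝ) ≤ n + (66 * κ + 48 : ℕ) * Real.logb 2 n := by
  have h1 : extraBits c.program L w (n / w + 1) ≤ n + (33 * κ + 24) * Nat.size n := by
    have := extraBits_le c (S := n / w + 1) hh hL hw hn
    have := Nat.div_mul_le_self n w
    nlinarith
  have h1' : (extraBits c.program L w (n / w + 1) : ℝ) ≤ n + (33 * κ + 24 : ℕ) * Nat.size n := by
    exact_mod_cast h1
  have h2 := mul_le_mul_of_nonneg_left (natSize_le_two_mul_logb hn)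
    (Nat.cast_nonneg (α := ℝ) (33 * κ + 24))
  push_cast at *
  linarith

theorem one_le_logb (hn : 2 ≤ n) : 1 ≤ Real.logb 2 n := by
  rw [Real.le_logb_iff_rpow_le one_lt_two (by positivity)]
  simpa using (by exact_mod_cast hn : (2 : ℝ) ≤ n)

/-- One bit per vertex is less than the `lg 3` bits that a three-valued colour takes. -/
theorem add_mul_le_logb_three {D : ℕ} (hn : 2 ≤ n) :
    (n : ℝ) + D * Real.logb 2 n ≤ n * Real.logb 2 3 + D * Real.logb 2 n ^ 2 := by
  have h1 : (1 : ℝ) ≤ Real.logb 2 3 := one_le_logb (n := 3) (by omega)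
  have h2 := one_le_logb hn
  gcongr
  · exact le_mul_of_one_le_right (Nat.cast_nonneg n) h1
  · exact le_self_pow₀ h2 two_ne_zero

theorem sum_length_eq_ncard {r : Fin n → Fin n → Prop} {l : Fin n → List (Fin n)}
    (hl : IsAdjacencyOrder r l) : ∑ v, (l v).length = {p : Fin n × Fin n | r p.1 p.2}.ncard := by
  classical
  rw [Set.ncard_eq_toFinset_card', Set.toFinset_ofPred, Finset.card_filter,
    Fintype.sum_prod_type]
  refine Finset.sum_congr rfl fun v _ => ?_
  rw [← Finset.card_filter, ← List.toFinset_card_of_nodup (hl v).1]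
  congr 1
  ext u
  simp [(hl v).2]

theorem sum_length_eq_ncard_swap {r : Fin n → Fin n → Prop} {l : Fin n → List (Fin n)}
    (hl : IsAdjacencyOrder (fun v u => r u v) l) :
    ∑ v, (l v).length = {p : Fin n × Fin n | r p.1 p.2}.ncard := by
  rw [sum_length_eq_ncard hl]
  exact Set.ncard_congr (fun p _ => p.swap) (fun p hp => hp)
    (fun p q _ _ h => Prod.swap_injective h) fun p hp => ⟨p.swap, hp, p.swap_swap⟩

theorem sum_length_eq_two_mul_ncard {G : SimpleGraph (Fin n)} {l : Fin n → List (Fin n)}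
    (hl : IsAdjacencyOrder G.Adj l) : ∑ v, (l v).length = 2 * G.edgeSet.ncard := by
  classical
  rw [Set.ncard_eq_toFinset_card', ← SimpleGraph.edgeFinset,
    ← G.sum_degrees_eq_twice_card_edges]
  refine Finset.sum_congr rfl fun v _ => ?_
  rw [← G.card_neighborFinset_eq_degree, ← List.toFinset_card_of_nodup (hl v).1]
  congr 1
  ext u
  simp [(hl v).2]

theorem le_sum_length_add_one {r : Fin n → Fin n → Prop} {l : Fin n → List (Fin n)} {s : Fin n}
    (hl : IsAdjacencyOrder (fun v u => r u v) l) (hs : ∀ v, Relation.ReflTransGen r s v) :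
    n ≤ (∑ v, (l v).length) + 1 := by
  have h1 : ∀ v ∈ Finset.univ.erase s, 1 ≤ (l v).length := fun v hv => by
    rcases (hs v).cases_tail with h | ⟨u, -, hu⟩
    · exact absurd h (Finset.ne_of_mem_erase hv)
    · exact List.length_pos_of_mem (((hl v).2 u).2 hu)
  have h2 := Finset.card_nsmul_le_sum _ _ _ h1
  have h3 : ∑ v ∈ Finset.univ.erase s, (l v).length ≤ ∑ v, (l v).length :=
    Finset.sum_le_sum_of_subset (Finset.erase_subset _ _)
  simp at h2
  omega

theorem reflTransGen_of_reachable {G : SimpleGraph (Fin n)} {u v : Fin n} (h : G.Reachable u v) :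
    Relation.ReflTransGen G.Adj u v :=
  (SimpleGraph.reachable_iff_reflTransGen u v).1 h

theorem link_time_undirected {m l t : ℕ} (hn : 2 ≤ n) (hm : n ≤ 2 * m + 1)
    (ht : t ≤ 100 * (l + 1) * (10 * (2 * m) + 11 * n + 1)) :
    (t : ℝ) ≤ 16200 * ((m : ℝ) ^ 2 / n + m * l) := by
  have h1 : n ≤ 3 * m := by omega
  have h2 : t ≤ 5400 * (m * (l + 1)) :=
    ht.trans (by
      calc 100 * (l + 1) * (10 * (2 * m) + 11 * n + 1) ≤ 100 * (l + 1) * (54 * m) :=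
            Nat.mul_le_mul_left _ (by omega)
        _ = _ := by ring)
  have h3 : (t : ℝ) ≤ 5400 * (m * (l + 1)) := by exact_mod_cast h2
  have hn0 : (0 : ℝ) < n := by exact_mod_cast (by omega : 0 < n)
  have h4 : (m : ℝ) ≤ 3 * (m ^ 2 / n) := by
    rw [← mul_div_assoc, le_div_iff₀ hn0, sq]
    have : (n : ℝ) ≤ 3 * m := by exact_mod_cast h1
    nlinarith [Nat.cast_nonneg (α := ℝ) m]
  have h5 : (0 : ℝ) ≤ m * l := by positivity
  linarith

theorem link_time_directed {m l t : ℕ} (hn : 2 ≤ n) (hm : n ≤ m + 1)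
    (ht : t ≤ 400 * (n + (l + 1) ^ 2) * (7 * m + m + 10 * n + 1)) :
    (t : ℝ) ≤ 23200 * ((m : ℝ) * (n + (l : ℝ) ^ 2)) := by
  have h2 : t ≤ 23200 * (m * (n + l ^ 2)) :=
    ht.trans (by
      calc 400 * (n + (l + 1) ^ 2) * (7 * m + m + 10 * n + 1)
          ≤ 400 * (2 * (n + l ^ 2)) * (29 * m) :=
            Nat.mul_le_mul (Nat.mul_le_mul_left _ (by nlinarith [sq_nonneg ((l : ℤ) - 1)]))
              (by omega)
        _ = _ := by ring)
  exact_mod_cast h2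

theorem nodup_cons_lists {r₀ : Fin n → Fin n → Prop} {l₀ : Fin n → List (Fin n)}
    (h₀ : IsAdjacencyOrder r₀ l₀) (i : Fin 1) (v : Fin n) : ((![l₀] : Lists 1 n) i v).Nodup := by
  fin_cases i
  exact (h₀ v).1

theorem nodup_cons_cons_lists {r₀ r₁ : Fin n → Fin n → Prop} {l₀ l₁ : Fin n → List (Fin n)}
    (h₀ : IsAdjacencyOrder r₀ l₀) (h₁ : IsAdjacencyOrder r₁ l₁) (i : Fin 2) (v : Fin n) :
    ((![l₀, l₁] : Lists 2 n) i v).Nodup := by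
  fin_cases i
  · exact (h₀ v).1
  · exact (h₁ v).1

theorem lt_two_pow_of_size_le {w : ℕ} (hw : 1 * Nat.size n ≤ w) : n < 2 ^ w :=
  Nat.size_le.1 (by omega)

theorem pos_of_size_le {w : ℕ} (hn : 2 ≤ n) (hw : 1 * Nat.size n ≤ w) : 0 < w := by
  have : 0 < Nat.size n := Nat.size_pos.2 (by omega)
  omega

/-- The lex-DFS order of an undirected graph, in linear time and with one bit per vertex. -/
theorem lex_undirected_bounds {κ w : ℕ} (hn : 2 ≤ n) (hw : 1 * Nat.size n ≤ w)
    (hκ : w ≤ κ * Nat.size n) {G : SimpleGraph (Fin n)} {adj : Fin n → List (Fin n)} (s : Fin n)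
    (hadj : IsAdjacencyOrder G.Adj adj) :
    ∃ S t : ℕ, Outputs lexUndirected.program ![adj] s w S t (dfsOrder adj s) ∧
      (t : ℝ) ≤ 300 * ((G.edgeSet.ncard : ℝ) + n) ∧
      (extraBits lexUndirected.program ![adj] w S : ℝ) ≤
        n + (66 * κ + 48 : ℕ) * Real.logb 2 n := by
  obtain ⟨t, ho, ht⟩ := outputs_lex_undirected (L := ![adj]) s (lt_two_pow_of_size_le hw)
    (pos_of_size_le hn hw) hadj (fun _ _ => G.adj_symm) fun _ => G.loopless.irrefl _
  refine ⟨_, t, ho, ?_, extraBits_bitVector_le _ (by omega) (nodup_cons_lists hadj) hκ hn⟩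
  have h : t ≤ 300 * (G.edgeSet.ncard + n) := ht.trans (by
    have := sum_length_eq_two_mul_ncard hadj
    simp only [Matrix.cons_val_zero]
    omega)
  exact_mod_cast h

/-- The lex-DFS order of a directed graph, in linear time and with one bit per vertex. -/
theorem lex_directed_bounds {κ w : ℕ} (hn : 2 ≤ n) (hw : 1 * Nat.size n ≤ w)
    (hκ : w ≤ κ * Nat.size n) {G : Digraph (Fin n)} {out inn : Fin n → List (Fin n)} (s : Fin n)
    (hout : IsAdjacencyOrder G.Adj out) (hinn : IsAdjacencyOrder (fun v u => G.Adj u v) inn) :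
    ∃ S t : ℕ, Outputs lexDirected.program ![out, inn] s w S t (dfsOrder out s) ∧
      (t : ℝ) ≤ 300 * (({p : Fin n × Fin n | G.Adj p.1 p.2}.ncard : ℝ) + n) ∧
      (extraBits lexDirected.program ![out, inn] w S : ℝ) ≤
        n + (66 * κ + 48 : ℕ) * Real.logb 2 n := by
  obtain ⟨t, ho, ht⟩ := outputs_lex_directed (L := ![out, inn]) s (lt_two_pow_of_size_le hw)
    (pos_of_size_le hn hw) hout hinn
  refine ⟨_, t, ho, ?_, extraBits_bitVector_le _ le_rfl (nodup_cons_cons_lists hout hinn) hκ hn⟩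
  have h : t ≤ 300 * ({p : Fin n × Fin n | G.Adj p.1 p.2}.ncard + n) := ht.trans (by
    have h0 := sum_length_eq_ncard hout
    have h1 := sum_length_eq_ncard_swap hinn
    simp only [Matrix.cons_val_zero, Matrix.cons_val_one]
    omega)
  exact_mod_cast h

end Rotate

theorem theorem1 :
    -- lex-DFS, undirected graphs
    (∃ (P : Rotate.Program 1) (κ₀ : ℕ) (C : ℝ), ∀ κ : ℕ, ∃ D : ℝ,
      ∀ n w : ℕ, 2 ≤ n → κ₀ * Nat.size n ≤ w → w ≤ κ * Nat.size n →
        ∀ (G : SimpleGraph (Fin n)) (adj : Fin n → List (Fin n)) (s : Fin n),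
          IsAdjacencyOrder G.Adj adj →
          ∃ S t : ℕ,
            Rotate.Outputs P ![adj] s w S t (dfsOrder adj s) ∧
            (t : ℝ) ≤ C * ((G.edgeSet.ncard : ℝ) + n) ∧
            (Rotate.extraBits P ![adj] w S : ℝ) ≤ n * Real.logb 2 3 + D * (Real.logb 2 n) ^ 2) ∧
    -- lex-DFS, directed graphs
    (∃ (P : Rotate.Program 2) (κ₀ : ℕ) (C : ℝ), ∀ κ : ℕ, ∃ D : ℝ,
      ∀ n w : ℕ, 2 ≤ n → κ₀ * Nat.size n ≤ w → w ≤ κ * Nat.size n →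
        ∀ (G : Digraph (Fin n)) (out inn : Fin n → List (Fin n)) (s : Fin n),
          IsAdjacencyOrder G.Adj out → IsAdjacencyOrder (fun v u => G.Adj u v) inn →
          ∃ S t : ℕ,
            Rotate.Outputs P ![out, inn] s w S t (dfsOrder out s) ∧
            (t : ℝ) ≤ C * (({p : Fin n × Fin n | G.Adj p.1 p.2}.ncard : ℝ) + n) ∧
            (Rotate.extraBits P ![out, inn] w S : ℝ) ≤ n * Real.logb 2 3 + D * (Real.logb 2 n) ^ 2) ∧
    -- general-DFS, undirected graphs
    (∃ (P : Rotate.Program 1) (κ₀ : ℕ) (C : ℝ), ∀ κ : ℕ, ∃ D : ℝ,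
      ∀ n w : ℕ, 2 ≤ n → κ₀ * Nat.size n ≤ w → w ≤ κ * Nat.size n →
        ∀ (G : SimpleGraph (Fin n)) (adj : Fin n → List (Fin n)) (s : Fin n),
          IsAdjacencyOrder G.Adj adj →
          ∃ (R : Fin n → List (Fin n)) (S t : ℕ), IsAdjacencyOrder G.Adj R ∧
            Rotate.Outputs P ![adj] s w S t (dfsOrder R s) ∧
            (t : ℝ) ≤ C * ((G.edgeSet.ncard : ℝ) + n) ∧
            (Rotate.extraBits P ![adj] w S : ℝ) ≤ n + D * Real.logb 2 n) ∧
    -- general-DFS, directed graphs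
    (∃ (P : Rotate.Program 2) (κ₀ : ℕ) (C : ℝ), ∀ κ : ℕ, ∃ D : ℝ,
      ∀ n w : ℕ, 2 ≤ n → κ₀ * Nat.size n ≤ w → w ≤ κ * Nat.size n →
        ∀ (G : Digraph (Fin n)) (out inn : Fin n → List (Fin n)) (s : Fin n),
          IsAdjacencyOrder G.Adj out → IsAdjacencyOrder (fun v u => G.Adj u v) inn →
          ∃ (R : Fin n → List (Fin n)) (S t : ℕ), IsAdjacencyOrder G.Adj R ∧
            Rotate.Outputs P ![out, inn] s w S t (dfsOrder R s) ∧
            (t : ℝ) ≤ C * (({p : Fin n × Fin n | G.Adj p.1 p.2}.ncard : ℝ) + n) ∧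
            (Rotate.extraBits P ![out, inn] w S : ℝ) ≤ n + D * Real.logb 2 n) ∧
    -- general-DFS in logarithmic space, undirected graphs
    (∃ (P : Rotate.Program 1) (κ₀ : ℕ) (C : ℝ), ∀ κ : ℕ, ∃ D : ℝ,
      ∀ n w : ℕ, 2 ≤ n → κ₀ * Nat.size n ≤ w → w ≤ κ * Nat.size n →
        ∀ (G : SimpleGraph (Fin n)) (adj : Fin n → List (Fin n)) (s : Fin n),
          IsAdjacencyOrder G.Adj adj →
          (∀ v, G.Reachable s v) →
          ∃ (R : Fin n → List (Fin n)) (S t : ℕ), IsAdjacencyOrder G.Adj R ∧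
            Rotate.Outputs P ![adj] s w S t (dfsOrder R s) ∧
            (t : ℝ) ≤ C * ((G.edgeSet.ncard : ℝ) ^ 2 / n + (G.edgeSet.ncard : ℝ) * dfsDepth R s) ∧
            (Rotate.extraBits P ![adj] w S : ℝ) ≤ D * Real.logb 2 n) ∧
    -- general-DFS in logarithmic space, directed graphs
    (∃ (P : Rotate.Program 2) (κ₀ : ℕ) (C : ℝ), ∀ κ : ℕ, ∃ D : ℝ,
      ∀ n w : ℕ, 2 ≤ n → κ₀ * Nat.size n ≤ w → w ≤ κ * Nat.size n →
        ∀ (G : Digraph (Fin n)) (out inn : Fin n → List (Fin n)) (s : Fin n),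
          IsAdjacencyOrder G.Adj out → IsAdjacencyOrder (fun v u => G.Adj u v) inn →
          (∀ v, Relation.ReflTransGen G.Adj s v) →
          ∃ (R : Fin n → List (Fin n)) (S t : ℕ), IsAdjacencyOrder G.Adj R ∧
            Rotate.Outputs P ![out, inn] s w S t (dfsOrder R s) ∧
            (t : ℝ) ≤ C * (({p : Fin n × Fin n | G.Adj p.1 p.2}.ncard : ℝ) * (n + (dfsDepth R s : ℝ) ^ 2)) ∧
            (Rotate.extraBits P ![out, inn] w S : ℝ) ≤ D * Real.logb 2 n) := by
  open Rotate in
  -- words that hold the number `n` are long enough, so that `κ₀ = 1`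
  refine ⟨⟨lexUndirected.program, 1, 300, fun κ => ⟨(66 * κ + 48 : ℕ),
      fun n w hn hw hκ G adj s hadj => ?_⟩⟩,
    ⟨lexDirected.program, 1, 300, fun κ => ⟨(66 * κ + 48 : ℕ),
      fun n w hn hw hκ G out inn s hout hinn => ?_⟩⟩,
    ⟨lexUndirected.program, 1, 300, fun κ => ⟨(66 * κ + 48 : ℕ),
      fun n w hn hw hκ G adj s hadj => ?_⟩⟩,
    ⟨lexDirected.program, 1, 300, fun κ => ⟨(66 * κ + 48 : ℕ),
      fun n w hn hw hκ G out inn s hout hinn => ?_⟩⟩,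
    ⟨linkUndirected.program, 1, 16200, fun κ => ⟨(64 * κ + 48 : ℕ),
      fun n w hn hw hκ G adj s hadj hs => ?_⟩⟩,
    ⟨linkDirected.program, 1, 23200, fun κ => ⟨(64 * κ + 48 : ℕ),
      fun n w hn hw hκ G out inn s hout hinn hs => ?_⟩⟩⟩
  · obtain ⟨S, t, ho, ht, hb⟩ := lex_undirected_bounds hn hw hκ s hadj
    exact ⟨S, t, ho, ht, hb.trans (add_mul_le_logb_three hn)⟩
  · obtain ⟨S, t, ho, ht, hb⟩ := lex_directed_bounds hn hw hκ s hout hinn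
    exact ⟨S, t, ho, ht, hb.trans (add_mul_le_logb_three hn)⟩
  · -- the lex-DFS order is the general-DFS order for the input lists themselves
    obtain ⟨S, t, h⟩ := lex_undirected_bounds hn hw hκ s hadj
    exact ⟨adj, S, t, hadj, h⟩
  · obtain ⟨S, t, h⟩ := lex_directed_bounds hn hw hκ s hout hinn
    exact ⟨out, S, t, hout, h⟩
  · have hs' := fun v => reflTransGen_of_reachable (hs v)
    obtain ⟨R, t, hR, ho, ht⟩ := outputs_link_undirected (L := ![adj]) s (lt_two_pow_of_size_le hw)
      (pos_of_size_le hn hw) hadj (fun _ _ => G.adj_symm) (fun _ => G.loopless.irrefl _) hs'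
    refine ⟨R, 0, t, hR, ho, link_time_undirected hn ?_ ?_,
      extraBits_le_logb _ (by omega) (nodup_cons_lists hadj) hκ hn⟩
    · rw [← sum_length_eq_two_mul_ncard hadj]
      exact le_sum_length_add_one (fun v => ⟨(hadj v).1, fun u => ((hadj v).2 u).trans
        (G.adj_comm v u)⟩) hs'
    · rw [← sum_length_eq_two_mul_ncard hadj]
      exact ht
  · obtain ⟨R, t, hR, ho, ht⟩ := outputs_link_directed (L := ![out, inn]) s
      (lt_two_pow_of_size_le hw) (pos_of_size_le hn hw) hout hinn hs
    refine ⟨R, 0, t, hR, ho, link_time_directed hn ?_ ?_,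
      extraBits_le_logb _ le_rfl (nodup_cons_cons_lists hout hinn) hκ hn⟩
    · rw [← sum_length_eq_ncard_swap hinn]
      exact le_sum_length_add_one hinn hs
    · refine ht.trans (le_of_eq ?_)
      simp only [Matrix.cons_val_zero, Matrix.cons_val_one]
      rw [sum_length_eq_ncard hout, sum_length_eq_ncard_swap hinn]
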